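/- Let $n\ge 1$. A \emph{virtual diagram} is an oriented circle generically (smoothly) immersed in $\mathbb{R}^2$ (its only multiple points are transverse double points, the crossings), each crossing being marked as real or virtual. Two virtual diagrams are \emph{strictly equivalent} if they are related by a finite sequence of isotopies of $\mathbb{R}^2$ and detour moves (replacing a semiarc, i.e. an arc between consecutive passages through real crossings, by another immersed arc with the same ends that meets the rest of the diagram only in virtual crossings). A virtual diagram is \emph{minimal} if no crossing-reducing flat Reidemeister move $R_1$ or $R_2$ (removing a kink with one real crossing, or a bigon with two real crossings) can be applied to any diagram strictly equivalent to it. Let $\mathbf{Diagram}^{\min}_{\rm strict}(n)$ (resp. $\mathbf{Diagram}^{\min}_{\rm strict+rev}(n)$) be the set of minimal virtual diagrams with $n$ real crossings modulo strict equivalence (resp. modulo strict equivalence and reversal of the orientation). A \emph{Gauss code} on $n$ letters is a sequence $w=x_1\dots x_{2n}$ in which every element of $J=\{1,\dots,n\}\times\{L,R\}$ appears. A Gauss code of a diagram $D$ with $n$ real crossings is obtained by labeling the real crossings by $1,\dots,n$, moving along $D$ once from a base point that is not a real crossing, and recording, at each passage through a real crossing $j$, the letter $(j,L)$ if the other branch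 passes from the left to the right and $(j,R)$ otherwise. Put ${\rm rev}(w)=x_{2n}\dots x_1$. The code $w$ is \emph{left preferred} if $x_1=(1,L)$ and $(1,L)(2,L)\dots(n,L)$ is a subsequence of $w$. For a Gauss code $w$, let ${\rm proj}^{\rm LP}(w)$ be the left preferred code obtained by relabeling so that $(1,L)\dots(n,L)$ becomes a subsequence and then rotating cyclically so that $(1,L)$ comes first; let ${\rm shift}^{\rm LP}(w)={\rm proj}^{\rm LP}(x_2\dots x_{2n}x_1)$ for left preferred $w$. Order codes lexicographically with $(1,L)<(1,R)<(2,L)<\dots<(n,R)$. A left preferred code is \emph{left canonical} if it is the smallest element of its orbit under ${\rm shift}^{\rm LP}$; ${\rm proj}^{\rm LC}(w)$ is the smallest element of the ${\rm shift}^{\rm LP}$-orbit of ${\rm proj}^{\rm LP}(w)$, and ${\rm rev}^{\rm LC}(w)={\rm proj}^{\rm LC}({\rm rev}(w))$ for left canonical $w$. Call $xy$ consecutive in $w$ if $(x,y)=(x_i,x_{i+1})$ for some $i\in\{1,\dots,2n\}$, where $x_{2n+1}=x_1$. The code $w$ is \emph{$1$-reducible} if for some $j$ the letters $(j,L)(j,R)$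 or $(j,R)(j,L)$ are consecutive. It is \emph{$2$-reducible} if for some $j\ne k$ both members of one of the following pairs are consecutive: $(j,L)(k,R)$ and $(j,R)(k,L)$; or $(j,L)(k,R)$ and $(k,L)(j,R)$; or $(j,R)(k,L)$ and $(k,R)(j,L)$. It is \emph{minimal} if it is neither $1$- nor $2$-reducible. Let $\mathbf{Gauss}^{\rm min,LC}(n)$ be the set of minimal left canonical Gauss codes on $n$ letters, and $\mathbf{Gauss}^{\rm min,LC}_{\rm rev}(n)$ its quotient by the action of ${\rm rev}^{\rm LC}$. \textbf{Theorem.} Every virtual diagram with $n$ real crossings has a Gauss code, and a virtual diagram is minimal if and only if any one of its Gauss codes on $n$ letters is minimal. There are bijections $$\mathbf{Diagram}^{\min}_{\rm strict}(n)\longleftrightarrow\mathbf{Gauss}^{\rm min,LC}(n),\qquad \mathbf{Diagram}^{\min}_{\rm strict+rev}(n)\longleftrightarrow\mathbf{Gauss}^{\rm min,LC}_{\rm rev}(n),$$ the first sending the class of $D$ to ${\rm proj}^{\rm LC}(w)$, and the second sending the class of $D$ to the class of ${\rm proj}^{\rm LC}(w)$, for any Gauss code $w$ of $D$. -/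

import Mathlib

open scoped ContDiff

noncomputable section

/-! ## Virtual diagrams -/

/-- The plane `ℝ²`. Only its topology and smooth structure are used. -/
abbrev Plane : Type := ℝ × ℝ

/-- `det (v, u)`: negative exactly when `u` points to the right of `v`. -/
def planeDet (v u : Plane) : ℝ := v.1 * u.2 - v.2 * u.1

/-- Two parameters of a `1`-periodic curve give the same point of the source circle `ℝ / ℤ`. -/
def SameParam (s t : ℝ) : Prop := ∃ k : ℤ, s = t + k

/-- An oriented virtual diagram (of one component), given by a parametrization: a smooth immersion
of the circle `ℝ / ℤ` in the plane whose only multiple points are transverse double points (the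
crossings), together with the set of those crossings that are real; the other crossings are
virtual. The choice of the parametrization is divided out by `VirtualDiagram.Isotopic`. -/
structure VirtualDiagram where
  curve : ℝ → Plane
  smooth : ContDiff ℝ ∞ curve
  periodic : ∀ t, curve (t + 1) = curve t
  immersed : ∀ t, deriv curve t ≠ 0
  transverse : ∀ s t, curve s = curve t → ¬ SameParam s t →
    planeDet (deriv curve s) (deriv curve t) ≠ 0
  no_triple : ∀ s t u, curve s = curve t → curve t = curve u →
    SameParam s t ∨ SameParam t u ∨ SameParam s u
  /-- the set of real crossings -/
  real : Set Plane
  real_crossing : ∀ p ∈ real, ∃ s t, curve s = p ∧ curve t = p ∧ ¬ SameParam s t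

/-- A bijection of the plane is a diffeomorphism. -/
def IsPlaneDiffeo (F : Plane ≃ Plane) : Prop :=
  ContDiff ℝ ∞ F ∧ ContDiff ℝ ∞ F.symm

/-- `Φ` is a smooth ambient isotopy of the plane, starting at the identity. -/
def IsPlaneIsotopy (Φ : ℝ → Plane ≃ Plane) : Prop :=
  ContDiff ℝ ∞ (fun q : ℝ × Plane => Φ q.1 q.2) ∧
  ContDiff ℝ ∞ (fun q : ℝ × Plane => (Φ q.1).symm q.2) ∧
  Φ 0 = Equiv.refl Plane

/-- `h` induces an orientation preserving diffeomorphism of the circle `ℝ / ℤ`. -/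
def IsCircleReparam (h : ℝ → ℝ) : Prop :=
  ContDiff ℝ ∞ h ∧ (∀ t, 0 < deriv h t) ∧ ∀ t, h (t + 1) = h t + 1

/-- The open unit disc. -/
def unitDisc : Set Plane := {p | p.1 ^ 2 + p.2 ^ 2 < 1}

/-- The horizontal diameter of the open unit disc. -/
def unitDiameter : Set Plane := {p | p ∈ unitDisc ∧ p.2 = 0}

/-- The parameters `t` that lie in the interval `(a, b)` modulo `ℤ`. -/
def arcParams (a b : ℝ) : Set ℝ := {t | ∃ k : ℤ, t + k ∈ Set.Ioo a b}

namespace VirtualDiagram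

/-- `D'` is the image of `D` under an ambient isotopy of the plane (as an oriented curve, that is,
up to an orientation preserving change of the parameter). -/
def Isotopic (D D' : VirtualDiagram) : Prop :=
  ∃ (Φ : ℝ → Plane ≃ Plane) (h : ℝ → ℝ), IsPlaneIsotopy Φ ∧ IsCircleReparam h ∧
    (∀ t, D'.curve t = Φ 1 (D.curve (h t))) ∧ D'.real = Φ 1 '' D.real

/-- `D'` is obtained from `D` by a detour move: the two diagrams are identical, except for an arc
`[a, b]` of the source circle on which neither has a real crossing (so this arc is contained in a
semiarc of each). -/
def Detour (D D' : VirtualDiagram) : Prop :=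
  ∃ a b : ℝ, a < b ∧ b < a + 1 ∧ D'.real = D.real ∧
    (∀ t ∈ Set.Icc a b, D.curve t ∉ D.real) ∧
    (∀ t ∈ Set.Icc a b, D'.curve t ∉ D'.real) ∧
    ∀ t ∈ Set.Icc b (a + 1), D'.curve t = D.curve t

/-- Strict equivalence: the equivalence relation generated by detour moves and isotopies. -/
def StrictEquiv : VirtualDiagram → VirtualDiagram → Prop :=
  Relation.EqvGen fun D D' => Isotopic D D' ∨ Detour D D'

/-- `D'` is obtained from `D` by a move `R₁` that removes a real crossing. There is a disc `N` in
the plane outside which the two diagrams are identical; inside `N`, `D` is an arc with exactly one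
self-crossing, which is real, and `D'` is an arc without crossings. -/
def R1Move (D D' : VirtualDiagram) : Prop :=
  ∃ (F : Plane ≃ Plane) (a b s t : ℝ), IsPlaneDiffeo F ∧
    a < s ∧ s < t ∧ t < b ∧ b < a + 1 ∧
    (∀ x, D.curve x ∈ F '' unitDisc ↔ x ∈ arcParams a b) ∧
    (∀ x, D'.curve x ∈ F '' unitDisc ↔ x ∈ arcParams a b) ∧
    (∀ x, x ∉ arcParams a b → D'.curve x = D.curve x) ∧
    D.curve s = D.curve t ∧ D.curve s ∈ D.real ∧
    (∀ x ∈ Set.Ioo a b, ∀ y ∈ Set.Ioo a b, x < y → D.curve x = D.curve y → x = s ∧ y = t) ∧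
    Set.InjOn D'.curve (Set.Ioo a b) ∧
    D'.real = D.real \ {D.curve s}

/-- `D'` is obtained from `D` by a move `R₂` that removes two real crossings. There is a disc `N`
in the plane outside which the two diagrams are identical; inside `N`, each of them consists of
two arcs without self-crossings. The first arc, which is not moved, is a diameter of `N` (in
suitable smooth coordinates of the plane); the second arc of `D` meets it in exactly two points,
which are real crossings, and the second arc of `D'` does not meet it. -/
def R2Move (D D' : VirtualDiagram) : Prop :=
  ∃ (F : Plane ≃ Plane) (a b c d s₁ s₂ t₁ t₂ : ℝ), IsPlaneDiffeo F ∧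
    a < b ∧ b < c ∧ c < d ∧ d < a + 1 ∧
    (∀ x, D.curve x ∈ F '' unitDisc ↔ x ∈ arcParams a b ∪ arcParams c d) ∧
    (∀ x, D'.curve x ∈ F '' unitDisc ↔ x ∈ arcParams a b ∪ arcParams c d) ∧
    (∀ x, x ∉ arcParams c d → D'.curve x = D.curve x) ∧
    D.curve '' Set.Ioo a b = F '' unitDiameter ∧
    Set.InjOn D.curve (Set.Ioo a b) ∧
    Set.InjOn D.curve (Set.Ioo c d) ∧
    Set.InjOn D'.curve (Set.Ioo c d) ∧
    s₁ ∈ Set.Ioo a b ∧ s₂ ∈ Set.Ioo a b ∧ s₁ ≠ s₂ ∧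
    t₁ ∈ Set.Ioo c d ∧ t₂ ∈ Set.Ioo c d ∧
    D.curve s₁ = D.curve t₁ ∧ D.curve s₁ ∈ D.real ∧
    D.curve s₂ = D.curve t₂ ∧ D.curve s₂ ∈ D.real ∧
    (∀ x ∈ Set.Ioo a b, ∀ y ∈ Set.Ioo c d, D.curve x = D.curve y →
      (x = s₁ ∧ y = t₁) ∨ (x = s₂ ∧ y = t₂)) ∧
    (∀ x ∈ Set.Ioo a b, ∀ y ∈ Set.Ioo c d, D'.curve x ≠ D'.curve y) ∧
    D'.real = D.real \ {D.curve s₁, D.curve s₂}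

/-- A virtual diagram is minimal if no (crossing removing) move `R₁` or `R₂` can be applied to any
diagram strictly equivalent to it. -/
def IsMinimal (D : VirtualDiagram) : Prop :=
  ¬ ∃ D₁ D₂ : VirtualDiagram, StrictEquiv D D₁ ∧ (R1Move D₁ D₂ ∨ R2Move D₁ D₂)

/-- The diagram with the reversed orientation. -/
def rev (D : VirtualDiagram) : VirtualDiagram where
  curve t := D.curve (-t)
  smooth := D.smooth.comp contDiff_neg
  periodic t := by
    have h := D.periodic (-(t + 1))
    rw [← h]
    congr 1
    ring
  immersed t := by
    rw [deriv_comp_neg]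
    simpa using D.immersed (-t)
  transverse s t h hst := by
    have hst' : ¬ SameParam (-s) (-t) := by
      rintro ⟨k, hk⟩
      exact hst ⟨-k, by push_cast; linarith⟩
    have := D.transverse (-s) (-t) h hst'
    rw [deriv_comp_neg, deriv_comp_neg]
    simpa [planeDet] using this
  no_triple s t u h₁ h₂ := by
    have key : ∀ x y : ℝ, SameParam (-x) (-y) → SameParam x y := by
      rintro x y ⟨k, hk⟩
      exact ⟨-k, by push_cast; linarith⟩
    rcases D.no_triple (-s) (-t) (-u) h₁ h₂ with h | h | h
    · exact Or.inl (key _ _ h)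
    · exact Or.inr (Or.inl (key _ _ h))
    · exact Or.inr (Or.inr (key _ _ h))
  real := D.real
  real_crossing p hp := by
    obtain ⟨s, t, hs, ht, hst⟩ := D.real_crossing p hp
    refine ⟨-s, -t, by simpa using hs, by simpa using ht, ?_⟩
    rintro ⟨k, hk⟩
    exact hst ⟨-k, by push_cast; linarith⟩

end VirtualDiagram

/-! ## Gauss codes -/

/-- The second component of a letter, left or right, ordered by `L < R`. -/
abbrev Side : Type := Bool

/-- left -/
abbrev Side.L : Side := false

/-- right -/
abbrev Side.R : Side := true

/-- A Gauss code on `n` letters: a sequence of length `2n` in `{1, …, n} × {L, R}` in which all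
elements of this set appear. Letters and positions are numbered from `0`. -/
def GaussCode (n : ℕ) : Type :=
  {w : Fin (2 * n) → Fin n × Side // Function.Surjective w}

namespace GaussCode

variable {n : ℕ}

/-- The letter at a position. -/
def letter (w : GaussCode n) (i : Fin (2 * n)) : Fin n × Side := w.1 i

/-- The (unique) position of an element of `{1, …, n} × {L, R}`. -/
def pos (w : GaussCode n) (x : Fin n × Side) : Fin (2 * n) := Function.surjInv w.2 x

/-- The relabeling `π_*`. -/
def relabel (π : Equiv.Perm (Fin n)) (w : GaussCode n) : GaussCode n :=
  ⟨fun i => (π (w.letter i).1, (w.letter i).2), fun x => by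
    obtain ⟨i, hi⟩ := w.2 (π.symm x.1, x.2)
    exact ⟨i, by simp [letter, hi]⟩⟩

/-- The cyclic shift `x₁ … x₂ₙ ↦ xₘ₊₁ … x₂ₙ x₁ … xₘ`. -/
def shift (m : ℕ) (w : GaussCode n) : GaussCode n :=
  ⟨fun i => w.letter ((finRotate (2 * n) ^ m) i),
    w.2.comp (finRotate (2 * n) ^ m).surjective⟩

/-- The reversed sequence. -/
def rev (w : GaussCode n) : GaussCode n :=
  ⟨fun i => w.letter i.rev, w.2.comp Fin.rev_surjective⟩

/-- The lexicographic order, for the order `(1,L) < (1,R) < (2,L) < (2,R) < ⋯` of the letters. -/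
instance : LinearOrder (GaussCode n) :=
  LinearOrder.lift' (fun w => toLex fun i => toLex (w.letter i)) (by
    intro w w' h
    refine Subtype.ext (funext fun i => ?_)
    exact toLex.injective (congrFun (toLex.injective h) i))

/-- `(1,L) (2,L) … (n,L)` is a subsequence. -/
def IsWeaklyLeftPreferred (w : GaussCode n) : Prop :=
  ∀ p q, (w.letter p).2 = Side.L → (w.letter q).2 = Side.L →
    (w.letter p).1 < (w.letter q).1 → p < q

/-- Left preferred Gauss codes. -/
def IsLeftPreferred [NeZero n] (w : GaussCode n) : Prop :=
  w.IsWeaklyLeftPreferred ∧ w.letter 0 = (0, Side.L)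

/-- The permutation that sends `j₁, …, jₙ` to `1, …, n`, where `(j₁,L) … (jₙ,L)` is the
subsequence of the letters with second component `L`. -/
def leftPerm (w : GaussCode n) : Equiv.Perm (Fin n) :=
  (Tuple.sort fun j => w.pos (j, Side.L))⁻¹

/-- The projection to left preferred Gauss codes: relabel to a weakly left preferred code, then
shift the letter `(1,L)` to the front. -/
def projLP [NeZero n] (w : GaussCode n) : GaussCode n :=
  shift ((relabel w.leftPerm w).pos (0, Side.L)) (relabel w.leftPerm w)

/-- The shift of left preferred Gauss codes. -/
def shiftLP [NeZero n] (w : GaussCode n) : GaussCode n :=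
  projLP (shift 1 w)

/-- Left canonical Gauss codes: left preferred, and smallest in the orbit under `shiftLP`. -/
def IsLeftCanonical [NeZero n] (w : GaussCode n) : Prop :=
  w.IsLeftPreferred ∧ ∀ k : ℕ, w ≤ shiftLP^[k] w

/-- The left canonical representative: the smallest element of
`{v, shiftLP v, …, shiftLP ^ (n - 1) v}`, where `v = projLP w`. -/
def projLC [NeZero n] (w : GaussCode n) : GaussCode n :=
  ((Finset.range n).image fun k => shiftLP^[k] (projLP w)).min'
    ((Finset.nonempty_range_iff.mpr (NeZero.ne n)).image _)

/-- The reversal of left canonical Gauss codes. -/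
def revLC [NeZero n] (w : GaussCode n) : GaussCode n :=
  projLC (rev w)

/-- The position that follows `i` cyclically. -/
def next (i : Fin (2 * n)) : Fin (2 * n) := finRotate (2 * n) i

/-- The pair `x y` appears in `w` (cyclically) as two consecutive letters. -/
def Consecutive (w : GaussCode n) (x y : Fin n × Side) : Prop :=
  ∃ i, w.letter i = x ∧ w.letter (next i) = y

/-- `1`-reducible Gauss codes. -/
def IsOneReducible (w : GaussCode n) : Prop :=
  ∃ j, w.Consecutive (j, Side.L) (j, Side.R) ∨ w.Consecutive (j, Side.R) (j, Side.L)

/-- `2`-reducible Gauss codes. -/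
def IsTwoReducible (w : GaussCode n) : Prop :=
  ∃ j k, j ≠ k ∧
    ((w.Consecutive (j, Side.L) (k, Side.R) ∧ w.Consecutive (j, Side.R) (k, Side.L)) ∨
     (w.Consecutive (j, Side.L) (k, Side.R) ∧ w.Consecutive (k, Side.L) (j, Side.R)) ∨
     (w.Consecutive (j, Side.R) (k, Side.L) ∧ w.Consecutive (k, Side.R) (j, Side.L)))

/-- Minimal (irreducible) Gauss codes. -/
def IsMinimal (w : GaussCode n) : Prop :=
  ¬ w.IsOneReducible ∧ ¬ w.IsTwoReducible

end GaussCode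

/-- `w` is a Gauss code of `D`, for some base semiarc (the one that contains the point with
parameter `t₀`) and some labeling `c` of the real crossings: `τ` lists the parameters of the
branches at real crossings in the order in which they are met from `t₀` on; the `i`-th letter
is the label of the crossing on the `i`-th branch, with `L` if the other branch passes from the
left to the right, and `R` otherwise. -/
def VirtualDiagram.HasGaussCode {n : ℕ} (D : VirtualDiagram) (w : GaussCode n) : Prop :=
  ∃ (t₀ : ℝ) (τ : Fin (2 * n) → ℝ) (c : Fin n → Plane),
    D.curve t₀ ∉ D.real ∧
    Function.Injective c ∧ Set.range c = D.real ∧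
    StrictMono τ ∧ Set.range τ = {t | t ∈ Set.Ioo t₀ (t₀ + 1) ∧ D.curve t ∈ D.real} ∧
    ∀ i, D.curve (τ i) = c (w.letter i).1 ∧
      ∀ s, D.curve s = D.curve (τ i) → ¬ SameParam s (τ i) →
        ((w.letter i).2 = Side.L ↔ planeDet (deriv D.curve (τ i)) (deriv D.curve s) < 0)

/-! ## The sets in the correspondence -/

/-- Minimal virtual diagrams with `n` real crossings. -/
def MinDiagram (n : ℕ) : Type :=
  {D : VirtualDiagram // D.real.ncard = n ∧ D.IsMinimal}

/-- Minimal virtual diagrams with `n` real crossings modulo strict equivalence. -/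
def DiagramMinStrict (n : ℕ) : Type :=
  Quot fun D D' : MinDiagram n => VirtualDiagram.StrictEquiv D.1 D'.1

/-- Minimal virtual diagrams with `n` real crossings modulo strict equivalence and reversing
orientations. -/
def DiagramMinStrictRev (n : ℕ) : Type :=
  Quot fun D D' : MinDiagram n =>
    VirtualDiagram.StrictEquiv D.1 D'.1 ∨ VirtualDiagram.StrictEquiv D.1 D'.1.rev

/-- Minimal left canonical Gauss codes on `n` letters. -/
def GaussMinLC (n : ℕ) [NeZero n] : Type :=
  {w : GaussCode n // w.IsMinimal ∧ w.IsLeftCanonical}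

/-- The quotient of the minimal left canonical Gauss codes by the action of `revLC`. -/
def GaussMinLCRev (n : ℕ) [NeZero n] : Type :=
  Quot fun w w' : GaussMinLC n => w'.1 = GaussCode.revLC w.1

/-- The class of a minimal diagram modulo strict equivalence. -/
def MinDiagram.strictClass {n : ℕ} (D : MinDiagram n) : DiagramMinStrict n := Quot.mk _ D

/-- The class of a minimal diagram modulo strict equivalence and reversal. -/
def MinDiagram.strictRevClass {n : ℕ} (D : MinDiagram n) : DiagramMinStrictRev n := Quot.mk _ D

/-- The class of a minimal left canonical Gauss code modulo `revLC`. -/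
def GaussMinLC.revClass {n : ℕ} [NeZero n] (w : GaussMinLC n) : GaussMinLCRev n := Quot.mk _ w

end

/-! Up to relabeling and cyclic shift (`Related`), the Gauss code is a complete invariant of strict
equivalence, and every code is realized. Both bijections and the criterion for minimality follow
from this.

Invariance. The Jacobian determinant of an ambient isotopy never vanishes and is 1 at time 0, so it
stays positive and the side of a crossing branch is preserved. A detour changes nothing near a real
crossing. Hence `StrictEquiv.hasGaussCode_iff`. Two codes of one diagram differ only by base point
and labels (`HasGaussCode.related_of`).

Completeness (`HasGaussCode.strictEquiv`). Shears and reparametrizations bring a diagram into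
standard position, where the germs at the real crossings depend on the code only
(`HasGaussCode.exists_isStandard`). Two standard diagrams with the same code then differ only along
arcs without real crossings. Exchanging these arcs one after the other is a chain of detours,
provided that every intermediate curve is generic. To ensure this, both diagrams are moved to one
common perturbed curve: the arcs are perturbed by `β t • (v 0 + cos (2πt) • v 1 + sin (2πt) • v 2)`,
and for almost every `v` all intermediate curves are generic immersions that avoid the real
crossings (`ae_genericOn_trigPerturbed`, `IsStandard.strictEquiv`). The perturbation need not be
small, because a detour may create any virtual crossings. The exceptional `v` form a null set: they
lie in differentiable images of null sets or in sets of critical values.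

Realization (`exists_hasGaussCode`). Short pieces of curve are placed at the crossings, joined
arbitrarily high above the special pieces, and the joining arcs are made generic by the same
perturbation.

Minimality. A move `R₁` or `R₂` takes place in a disc that no other strand enters, so the passages
through the removed crossings are consecutive; for `R₂` the two crossings have opposite signs. So
the code is reducible. Conversely, a reducible code is realized by a diagram that contains an
explicit kink or bigon in an explicit disc (`exists_R1Move`, `exists_R2Move`). By completeness that
diagram is strictly equivalent to every diagram with this code, so none of them is minimal.

Canonical codes. Iterating `shiftLP` from a left preferred code reaches every left preferred code
related to it, within fewer than `n` steps. Hence `projLC` picks the least left preferred code of a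
class, and `projLC w = projLC w'` exactly when the codes are related. Reversing a diagram reverses
its code and keeps the sides, which gives the second bijection. -/

open MeasureTheory Topology

open scoped ContDiff
open MeasureTheory

/-! ### Null sets of parameters -/

/-- The curve `γ` perturbed by a linear combination of the functions `E k`. -/
noncomputable def perturbed (γ : ℝ → Plane) (E : Fin 3 → ℝ → ℝ) (v : Fin 3 → Plane) (t : ℝ) : Plane :=
  γ t + ∑ k, E k t • v k

lemma sum_update_eq (k : Fin 3) (a : Fin 3 → ℝ) (v : Fin 3 → Plane) (p : Plane) :
    ∑ l, a l • Function.update v k p l = a k • p + (∑ l, a l • v l - a k • v k) := by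
  have h1 := Finset.add_sum_erase Finset.univ (fun l => a l • Function.update v k p l)
    (Finset.mem_univ k)
  have h2 := Finset.add_sum_erase Finset.univ (fun l => a l • v l) (Finset.mem_univ k)
  have h3 : ∑ l ∈ Finset.univ.erase k, a l • Function.update v k p l
      = ∑ l ∈ Finset.univ.erase k, a l • v l := by
    refine Finset.sum_congr rfl fun l hl => ?_
    rw [Function.update_of_ne (Finset.ne_of_mem_erase hl)]
  rw [← h1, ← h2, h3]
  simp

lemma differentiableOn_update {A : Set (Fin 3 → Plane)} (k : Fin 3) {f : (Fin 3 → Plane) → Plane}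
    {g : (Fin 3 → Plane) → (Fin 3 → Plane)} (hg : DifferentiableOn ℝ g A)
    (hf : DifferentiableOn ℝ f A) :
    DifferentiableOn ℝ (fun v => Function.update (g v) k (f v)) A := by
  rw [differentiableOn_pi]
  intro l
  by_cases h : l = k
  · subst h; simpa using hf
  · simp only [Function.update_of_ne h]
    exact (differentiableOn_pi.1 hg) l

lemma volume_slice_eq_zero (k : Fin 3) :
    volume {v : Fin 3 → Plane | (v k).2 = 0} = 0 := by
  let L : (Fin 3 → Plane) →ₗ[ℝ] ℝ := (LinearMap.snd ℝ ℝ ℝ).comp (LinearMap.proj k)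
  have h := Measure.addHaar_submodule (volume : Measure (Fin 3 → Plane)) (LinearMap.ker L) (by
    intro h
    have : (fun _ => ((0 : ℝ), (1 : ℝ)) : Fin 3 → Plane) ∈ LinearMap.ker L := by rw [h]; trivial
    simp [L] at this)
  refine measure_mono_null ?_ h
  intro v hv
  simpa [L] using hv

/-- Where `a k t ≠ 0`, the equation determines `v k` from `t` and the other vectors. The solutions
thus depend on five real parameters and have measure zero in a space of dimension six. -/
lemma volume_solvable_eq_zero (a : Fin 3 → ℝ → ℝ) (b : ℝ → Plane)
    (ha : ∀ k, Differentiable ℝ (a k)) (hb : Differentiable ℝ b) :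
    volume {v : Fin 3 → Plane | ∃ t, (∃ k, a k t ≠ 0) ∧ b t + ∑ k, a k t • v k = 0} = 0 := by
  have key : ∀ k, volume {v : Fin 3 → Plane | ∃ t, a k t ≠ 0 ∧ b t + ∑ k, a k t • v k = 0} = 0 := by
    intro k
    -- The slot `k` is free, since `v k` is solved for. Its first coordinate stores `t` and its
    -- second one is kept at 0, which makes the domain null.
    let A : Set (Fin 3 → Plane) := {v | (v k).2 = 0 ∧ a k (v k).1 ≠ 0}
    let f : (Fin 3 → Plane) → Plane := fun v =>
      (a k (v k).1)⁻¹ • (a k (v k).1 • v k - b (v k).1 - ∑ l, a l (v k).1 • v l)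
    have hf : DifferentiableOn ℝ f A := by
      intro v hv
      have h0 : DifferentiableAt ℝ (fun v : Fin 3 → Plane => (v k).1) v := by fun_prop
      have h1 : ∀ l, DifferentiableAt ℝ (fun v : Fin 3 → Plane => a l (v k).1) v := fun l =>
        (ha l).differentiableAt.comp v h0
      have h2 : DifferentiableAt ℝ (fun v : Fin 3 → Plane => b (v k).1) v :=
        hb.differentiableAt.comp v h0
      have h3 : ∀ l, DifferentiableAt ℝ (fun v : Fin 3 → Plane => v l) v := by
        intro l; fun_prop
      exact (((h1 k).inv hv.2).smul ((((h1 k).smul (h3 k)).sub h2).sub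
        (DifferentiableAt.fun_sum fun l _ => (h1 l).smul (h3 l)))).differentiableWithinAt
    have hA : volume A = 0 := measure_mono_null (fun v hv => hv.1) (volume_slice_eq_zero k)
    refine measure_mono_null ?_ (addHaar_image_eq_zero_of_differentiableOn_of_addHaar_eq_zero volume
      (differentiableOn_update k differentiableOn_id hf) hA)
    rintro v ⟨t, ht, hv⟩
    refine ⟨Function.update v k (t, 0), ⟨by simp, by simpa using ht⟩, ?_⟩
    ext1 l
    by_cases h : l = k
    · subst h
      simp only [f, id, Function.update_self, sum_update_eq]
      have : ∑ l, a l t • v l = - b t := by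
        rw [eq_neg_iff_add_eq_zero, add_comm]; exact hv
      rw [this]
      rw [inv_smul_eq_iff₀ ht]
      module
    · simp [Function.update_of_ne h]
  refine measure_mono_null (t := ⋃ k, _) ?_ (measure_iUnion_null key)
  rintro v ⟨t, ⟨k, hk⟩, hv⟩
  exact Set.mem_iUnion.2 ⟨k, t, hk, hv⟩

lemma exists_smul_eq_smul_of_planeDet_eq_zero {a b : Plane} (h : planeDet a b = 0) :
    ∃ p : Plane, p ≠ 0 ∧ p.1 • a = p.2 • b := by
  unfold planeDet at h
  by_cases h1 : a.1 = 0
  · by_cases h2 : a.2 = 0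
    · exact ⟨(1, 0), by simp, by ext <;> simp [h1, h2]⟩
    · refine ⟨(b.2, a.2), fun h => h2 (congrArg Prod.snd h), ?_⟩
      ext <;> simp <;> linarith
  · refine ⟨(b.1, a.1), fun h => h1 (congrArg Prod.snd h), ?_⟩
    ext <;> simp <;> linarith

lemma hasDerivAt_perturbed {γ : ℝ → Plane} {E : Fin 3 → ℝ → ℝ} (hγ : Differentiable ℝ γ)
    (hE : ∀ k, Differentiable ℝ (E k)) (v : Fin 3 → Plane) (t : ℝ) :
    HasDerivAt (perturbed γ E v) (deriv γ t + ∑ k, deriv (E k) t • v k) t := by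
  refine (hγ t).hasDerivAt.add (HasDerivAt.fun_sum fun k _ => ?_)
  exact ((hE k) t).hasDerivAt.smul_const (v k)

/-- A Sard argument. Solving the double point equation for `v k`, with `(s, t)` stored in the freed
slot, gives a map `F` between spaces of equal dimension. Where the two branches are tangent to each
other, the derivative of `F` is singular, so the bad `v` are critical values. -/
lemma volume_nontransverse_eq_zero (γ : ℝ → Plane) (E : Fin 3 → ℝ → ℝ)
    (hγ : Differentiable ℝ γ) (hE : ∀ k, Differentiable ℝ (E k)) :
    volume {v : Fin 3 → Plane | ∃ s t, (∃ k, E k s ≠ E k t) ∧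
      perturbed γ E v s = perturbed γ E v t ∧
      planeDet (deriv (perturbed γ E v) s) (deriv (perturbed γ E v) t) = 0} = 0 := by
  have key : ∀ k, volume {v : Fin 3 → Plane | ∃ s t, E k s ≠ E k t ∧
      perturbed γ E v s = perturbed γ E v t ∧
      planeDet (deriv (perturbed γ E v) s) (deriv (perturbed γ E v) t) = 0} = 0 := by
    intro k
    let D : (Fin 3 → Plane) → ℝ := fun v => E k (v k).1 - E k (v k).2
    let f : (Fin 3 → Plane) → Plane := fun v => (D v)⁻¹ •
      (D v • v k + (perturbed γ E v (v k).2 - perturbed γ E v (v k).1))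
    let F : (Fin 3 → Plane) → (Fin 3 → Plane) := fun v => Function.update v k (f v)
    let A : Set (Fin 3 → Plane) := {v | D v ≠ 0 ∧
      planeDet (deriv (perturbed γ E (F v)) (v k).1) (deriv (perturbed γ E (F v)) (v k).2) = 0}
    have hs : ∀ v : Fin 3 → Plane, ∀ l, DifferentiableAt ℝ (fun v : Fin 3 → Plane => v l) v := by
      intro v l; fun_prop
    have h1 : ∀ v : Fin 3 → Plane, DifferentiableAt ℝ (fun v : Fin 3 → Plane => (v k).1) v := by
      intro v; fun_prop
    have h2 : ∀ v : Fin 3 → Plane, DifferentiableAt ℝ (fun v : Fin 3 → Plane => (v k).2) v := by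
      intro v; fun_prop
    have hE1 : ∀ v l, DifferentiableAt ℝ (fun v : Fin 3 → Plane => E l (v k).1) v := fun v l =>
      (hE l).differentiableAt.comp v (h1 v)
    have hE2 : ∀ v l, DifferentiableAt ℝ (fun v : Fin 3 → Plane => E l (v k).2) v := fun v l =>
      (hE l).differentiableAt.comp v (h2 v)
    have hDd : ∀ v, DifferentiableAt ℝ D v := fun v => (hE1 v k).sub (hE2 v k)
    have hF : ∀ v, D v ≠ 0 → DifferentiableAt ℝ F v := by
      intro v hv
      rw [← differentiableWithinAt_univ]
      have hfv : DifferentiableAt ℝ f v := by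
        refine ((hDd v).inv hv).smul (((hDd v).smul (hs v k)).add (DifferentiableAt.sub ?_ ?_))
        · exact (hγ.differentiableAt.comp v (h2 v)).add
            (DifferentiableAt.fun_sum fun l _ => (hE2 v l).smul (hs v l))
        · exact (hγ.differentiableAt.comp v (h1 v)).add
            (DifferentiableAt.fun_sum fun l _ => (hE1 v l).smul (hs v l))
      rw [differentiableWithinAt_univ, differentiableAt_pi]
      intro l
      by_cases h : l = k
      · subst h; simpa [F] using hfv
      · simpa [F, Function.update_of_ne h] using hs v l
    have hsolve : ∀ v, D v ≠ 0 →
        perturbed γ E (F v) (v k).1 = perturbed γ E (F v) (v k).2 := by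
      intro v hv
      simp only [perturbed, F, sum_update_eq]
      have h3 : (D v) • f v = D v • v k + (perturbed γ E v (v k).2 - perturbed γ E v (v k).1) :=
        smul_inv_smul₀ hv _
      simp only [D, perturbed] at h3
      rw [sub_smul, sub_smul] at h3
      rw [sub_eq_iff_eq_add] at h3
      rw [h3]
      abel
    have hdet : ∀ v ∈ A, (fderiv ℝ F v).det = 0 := by
      rintro v ⟨hv, hd⟩
      obtain ⟨p, hp, hpe⟩ := exists_smul_eq_smul_of_planeDet_eq_zero hd
      by_contra hne
      have hinj : Function.Injective (fderiv ℝ F v) := by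
        have : LinearMap.det ((fderiv ℝ F v : (Fin 3 → Plane) →L[ℝ] (Fin 3 → Plane)) :
          (Fin 3 → Plane) →ₗ[ℝ] (Fin 3 → Plane)) ≠ 0 := hne
        exact (LinearEquiv.ofIsUnitDet (v := Module.finBasis ℝ (Fin 3 → Plane)) (v' := Module.finBasis ℝ (Fin 3 → Plane))
          (f := ((fderiv ℝ F v : (Fin 3 → Plane) →L[ℝ] (Fin 3 → Plane)) :
          (Fin 3 → Plane) →ₗ[ℝ] (Fin 3 → Plane))) (by
            rw [LinearMap.det_toMatrix]; exact isUnit_iff_ne_zero.2 this)).injective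
      -- The kernel vector: moving `(s, t)` in the direction `p` moves both branch points by the
      -- same amount to first order, because `p.1` and `p.2` balance the parallel tangents.
      let w : Fin 3 → Plane := Function.update 0 k p
      have hw : w ≠ 0 := by
        intro h; apply hp; simpa [w] using congrFun h k
      apply hw
      apply hinj
      rw [map_zero]
      let c : ℝ → Fin 3 → Plane := fun r => v + r • w
      have hc : HasDerivAt c w 0 := by
        have h := ((hasDerivAt_id (0:ℝ)).smul_const w).const_add v
        rw [one_smul] at h
        exact h
      have hc0 : c 0 = v := by simp [c]
      have hg : HasDerivAt (fun r => F (c r)) (fderiv ℝ F v w) 0 := by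
        have := (hF v hv).hasFDerivAt
        rw [← hc0] at this
        have := this.comp_hasDerivAt 0 hc
        rwa [hc0] at this
      have hgl := hasDerivAt_pi.1 hg
      have hck : ∀ r, c r k = v k + r • p := by intro r; simp [c, w]
      have hcl : ∀ l, l ≠ k → ∀ r, c r l = v l := by
        intro l hl r; simp [c, w, Function.update_of_ne hl]
      have hzero : ∀ l, l ≠ k → fderiv ℝ F v w l = 0 := by
        intro l hl
        have : (fun r => F (c r) l) = fun _ => v l := by
          funext r; simp [F, Function.update_of_ne hl, hcl l hl]
        have h5 := hgl l
        rw [this] at h5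
        exact h5.unique (hasDerivAt_const _ _)
      have hside : ∀ (x y : ℝ), HasDerivAt (fun r => perturbed γ E (F (c r)) (x + r * y))
          (y • deriv (perturbed γ E (F v)) x + E k x • fderiv ℝ F v w k) 0 := by
        intro x y
        have hx : HasDerivAt (fun r : ℝ => x + r * y) y 0 := by
          simpa using ((hasDerivAt_id (0:ℝ)).mul_const y).const_add x
        have hx0 : x + (0:ℝ) * y = x := by ring
        have e1 : HasDerivAt (fun r : ℝ => γ (x + r * y)) (y • deriv γ x) 0 := by
          have h6 : HasDerivAt γ (deriv γ x) (x + 0 * y) := by rw [hx0]; exact (hγ x).hasDerivAt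
          exact h6.scomp 0 hx
        have e2 : ∀ l, HasDerivAt (fun r : ℝ => E l (x + r * y) • F (c r) l)
            (E l x • fderiv ℝ F v w l + (deriv (E l) x * y) • F v l) 0 := by
          intro l
          have h6 : HasDerivAt (E l) (deriv (E l) x) (x + 0 * y) := by
            rw [hx0]; exact (hE l x).hasDerivAt
          have h6' : HasDerivAt (fun r : ℝ => E l (x + r * y)) (deriv (E l) x * y) 0 :=
            h6.comp (0:ℝ) hx
          have h7 := h6'.fun_smul (hgl l)
          simp only [hx0, hc0] at h7
          exact h7
        have h8 := e1.add (HasDerivAt.fun_sum fun l (_ : l ∈ Finset.univ) => e2 l)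
        refine h8.congr_deriv ?_
        rw [(hasDerivAt_perturbed hγ hE (F v) x).deriv, Finset.sum_add_distrib]
        have h9 : ∑ l, E l x • fderiv ℝ F v w l = E k x • fderiv ℝ F v w k := by
          refine Finset.sum_eq_single k (fun l _ hl => ?_) (by simp)
          rw [hzero l hl, smul_zero]
        rw [h9, smul_add, Finset.smul_sum]
        have h10 : ∀ l, (deriv (E l) x * y) • F v l = y • deriv (E l) x • F v l := by
          intro l; rw [smul_smul, mul_comm]
        simp only [h10]
        abel
      have hs1 := hside (v k).1 p.1
      have hs2 := hside (v k).2 p.2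
      -- The double point persists along the line `c`. Differentiating both sides at 0, the
      -- tangential terms cancel by the choice of `p`, and what remains is `D v` times the `k`-th
      -- component of the derivative.
      have hev : (fun r => perturbed γ E (F (c r)) ((v k).1 + r * p.1)) =ᶠ[nhds 0]
          fun r => perturbed γ E (F (c r)) ((v k).2 + r * p.2) := by
        have hcont : ContinuousAt (fun r => D (c r)) 0 := by
          have : ContinuousAt D (c 0) := by rw [hc0]; exact (hDd v).continuousAt
          exact this.comp hc.continuousAt
        have : ∀ᶠ r in nhds (0:ℝ), D (c r) ≠ 0 :=
          hcont.eventually_ne (by rw [hc0]; exact hv)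
        filter_upwards [this] with r hr
        have := hsolve (c r) hr
        simpa [hck] using this
      have heq := (hs1.congr_of_eventuallyEq hev.symm).unique hs2
      rw [hpe] at heq
      have h11 : D v • fderiv ℝ F v w k = 0 := by
        have := add_left_cancel heq
        simp only [D, sub_smul, this, sub_self]
      ext1 l
      by_cases h : l = k
      · subst h; exact (smul_eq_zero.1 h11).resolve_left hv
      · exact hzero l h
    refine measure_mono_null ?_ (addHaar_image_eq_zero_of_det_fderivWithin_eq_zero volume
      (s := A) (f := F) (f' := fun v => fderiv ℝ F v)
      (fun v hv => (hF v hv.1).hasFDerivAt.hasFDerivWithinAt) hdet)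
    rintro v ⟨s, t, hst, he, hd⟩
    have hD : D (Function.update v k (s, t)) ≠ 0 := by
      simpa [D, sub_eq_zero] using hst
    have hFv : F (Function.update v k (s, t)) = v := by
      have hfv : f (Function.update v k (s, t)) = v k := by
        simp only [f]
        rw [inv_smul_eq_iff₀ hD]
        simp only [perturbed] at he
        simp only [D, perturbed, sum_update_eq, Function.update_self]
        have : γ s - γ t + (∑ l, E l s • v l - ∑ l, E l t • v l) = 0 := by
          rw [← sub_eq_zero] at he; rw [← he]; abel
        rw [← sub_eq_zero]
        rw [← neg_eq_zero] at this
        rw [← this]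
        module
      simp only [F, hfv]
      simp
    refine ⟨Function.update v k (s, t), ⟨hD, ?_⟩, hFv⟩
    rw [hFv]
    simpa using hd
  refine measure_mono_null (t := ⋃ k, _) ?_ (measure_iUnion_null key)
  rintro v ⟨s, t, ⟨k, hk⟩, hv⟩
  exact Set.mem_iUnion.2 ⟨k, s, t, hk, hv⟩

/-- A triple point is a linear system for `v k` and `v l`, solvable where the minor does not vanish.
The three parameters `s`, `t`, `u` fit into the two freed slots and leave one coordinate over; it is
set to 0, so the domain is null. -/
lemma volume_triple_eq_zero (γ : ℝ → Plane) (E : Fin 3 → ℝ → ℝ)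
    (hγ : Differentiable ℝ γ) (hE : ∀ k, Differentiable ℝ (E k)) :
    volume {v : Fin 3 → Plane | ∃ s t u,
      (∃ k l, k ≠ l ∧ (E k s - E k u) * (E l t - E l u) - (E l s - E l u) * (E k t - E k u) ≠ 0) ∧
      perturbed γ E v s = perturbed γ E v u ∧ perturbed γ E v t = perturbed γ E v u} = 0 := by
  have key : ∀ k l, volume {v : Fin 3 → Plane | ∃ s t u,
      (k ≠ l ∧ (E k s - E k u) * (E l t - E l u) - (E l s - E l u) * (E k t - E k u) ≠ 0) ∧
      perturbed γ E v s = perturbed γ E v u ∧ perturbed γ E v t = perturbed γ E v u} = 0 := by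
    intro k l
    by_cases hkl : k = l
    · simp [hkl]
    let M : ℝ → ℝ → ℝ → ℝ := fun s t u =>
      (E k s - E k u) * (E l t - E l u) - (E l s - E l u) * (E k t - E k u)
    let r : (Fin 3 → Plane) → ℝ → ℝ → Plane := fun v x y => perturbed γ E v x - perturbed γ E v y
    let s : (Fin 3 → Plane) → ℝ := fun v => (v k).1
    let t : (Fin 3 → Plane) → ℝ := fun v => (v k).2
    let u : (Fin 3 → Plane) → ℝ := fun v => (v l).1
    let z : (Fin 3 → Plane) → (Fin 3 → Plane) := fun v =>
      Function.update (Function.update v k 0) l 0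
    -- Cramer's rule for the unknowns `v k` and `v l`; `z` clears the slots in which the parameters
    -- are stored.
    let f : (Fin 3 → Plane) → Plane := fun v => (M (s v) (t v) (u v))⁻¹ •
      (-(E l (t v) - E l (u v)) • r (z v) (s v) (u v) + (E l (s v) - E l (u v)) • r (z v) (t v) (u v))
    let g : (Fin 3 → Plane) → Plane := fun v => (M (s v) (t v) (u v))⁻¹ •
      ((E k (t v) - E k (u v)) • r (z v) (s v) (u v) - (E k (s v) - E k (u v)) • r (z v) (t v) (u v))
    let F : (Fin 3 → Plane) → (Fin 3 → Plane) := fun v =>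
      Function.update (Function.update v k (f v)) l (g v)
    let A : Set (Fin 3 → Plane) := {v | (v l).2 = 0 ∧ M (s v) (t v) (u v) ≠ 0}
    have hA : volume A = 0 := measure_mono_null (fun v hv => hv.1) (volume_slice_eq_zero l)
    have hs : DifferentiableOn ℝ s A := by simp only [s]; fun_prop
    have ht : DifferentiableOn ℝ t A := by simp only [t]; fun_prop
    have hu : DifferentiableOn ℝ u A := by simp only [u]; fun_prop
    have hz : DifferentiableOn ℝ z A :=
      differentiableOn_update l (differentiableOn_update k differentiableOn_id
        (differentiableOn_const _)) (differentiableOn_const _)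
    have hEc : ∀ (i : Fin 3) (x : (Fin 3 → Plane) → ℝ), DifferentiableOn ℝ x A →
        DifferentiableOn ℝ (fun v => E i (x v)) A := fun i x hx => (hE i).comp_differentiableOn hx
    have hP : ∀ (x : (Fin 3 → Plane) → ℝ), DifferentiableOn ℝ x A →
        DifferentiableOn ℝ (fun v => perturbed γ E (z v) (x v)) A := by
      intro x hx
      refine (hγ.comp_differentiableOn hx).add (DifferentiableOn.fun_sum fun i _ => ?_)
      exact (hEc i x hx).smul (differentiableOn_pi.1 hz i)
    have hM : DifferentiableOn ℝ (fun v => M (s v) (t v) (u v)) A :=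
      (((hEc k s hs).sub (hEc k u hu)).mul ((hEc l t ht).sub (hEc l u hu))).sub
        (((hEc l s hs).sub (hEc l u hu)).mul ((hEc k t ht).sub (hEc k u hu)))
    have hMi : DifferentiableOn ℝ (fun v => (M (s v) (t v) (u v))⁻¹) A := hM.inv fun v hv => hv.2
    have hf : DifferentiableOn ℝ f A :=
      hMi.smul ((((hEc l t ht).sub (hEc l u hu)).neg.smul ((hP s hs).sub (hP u hu))).add
        (((hEc l s hs).sub (hEc l u hu)).smul ((hP t ht).sub (hP u hu))))
    have hg : DifferentiableOn ℝ g A :=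
      hMi.smul ((((hEc k t ht).sub (hEc k u hu)).smul ((hP s hs).sub (hP u hu))).sub
        (((hEc k s hs).sub (hEc k u hu)).smul ((hP t ht).sub (hP u hu))))
    refine measure_mono_null ?_ (addHaar_image_eq_zero_of_differentiableOn_of_addHaar_eq_zero volume
      (differentiableOn_update l (differentiableOn_update k differentiableOn_id hf) hg) hA)
    rintro v ⟨s₀, t₀, u₀, ⟨-, hne⟩, h1, h2⟩
    let v' : Fin 3 → Plane := Function.update (Function.update v k (s₀, t₀)) l (u₀, 0)
    have hs0 : s v' = s₀ := by simp [s, v', Function.update_of_ne hkl]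
    have ht0 : t v' = t₀ := by simp [t, v', Function.update_of_ne hkl]
    have hu0 : u v' = u₀ := by simp [u, v']
    have hz0 : z v' = Function.update (Function.update v k 0) l 0 := by
      funext i
      by_cases hil : i = l
      · subst hil; simp [z]
      · by_cases hik : i = k
        · subst hik; simp [z, Function.update_of_ne hil]
        · simp [z, v', Function.update_of_ne hil, Function.update_of_ne hik]
    have hMne : M s₀ t₀ u₀ ≠ 0 := hne
    refine ⟨v', ⟨by simp [v'], by rw [hs0, ht0, hu0]; exact hne⟩, ?_⟩
    have hpz : ∀ x, perturbed γ E (z v') x = perturbed γ E v x - E k x • v k - E l x • v l := by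
      intro x
      simp only [hz0, perturbed, sum_update_eq (a := fun i => E i x),
        Function.update_of_ne (Ne.symm hkl)]
      simp only [smul_zero]
      abel
    have hr : ∀ x, perturbed γ E v x = perturbed γ E v u₀ →
        r (z v') x u₀ = -((E k x - E k u₀) • v k) - (E l x - E l u₀) • v l := by
      intro x hx
      simp only [r, hpz, hx]
      module
    have hfv : f v' = v k := by
      simp only [f]
      rw [hs0, ht0, hu0, inv_smul_eq_iff₀ hMne, hr _ h1, hr _ h2]
      simp only [M]
      module
    have hgv : g v' = v l := by
      simp only [g]
      rw [hs0, ht0, hu0, inv_smul_eq_iff₀ hMne, hr _ h1, hr _ h2]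
      simp only [M]
      module
    funext i
    by_cases hil : i = l
    · subst hil; simp [hgv]
    · by_cases hik : i = k
      · subst hik; simp [Function.update_of_ne hil, hfv]
      · simp [v', Function.update_of_ne hil, Function.update_of_ne hik]
  refine measure_mono_null (t := ⋃ k, ⋃ l, _) ?_
    (measure_iUnion_null fun k => measure_iUnion_null fun l => key k l)
  rintro v ⟨s, t, u, ⟨k, l, hkl⟩, hv⟩
  exact Set.mem_iUnion.2 ⟨k, Set.mem_iUnion.2 ⟨l, s, t, u, hkl, hv⟩⟩

/-! ### Generic curves -/

lemma SameParam.refl (s : ℝ) : SameParam s s := ⟨0, by simp⟩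

lemma SameParam.symm {s t : ℝ} (h : SameParam s t) : SameParam t s := by
  obtain ⟨k, hk⟩ := h
  exact ⟨-k, by push_cast; linarith⟩

lemma SameParam.trans {s t u : ℝ} (h : SameParam s t) (h' : SameParam t u) : SameParam s u := by
  obtain ⟨k, hk⟩ := h
  obtain ⟨l, hl⟩ := h'
  exact ⟨k + l, by push_cast; linarith⟩

lemma SameParam.add_int (s : ℝ) (k : ℤ) : SameParam (s + k) s := ⟨k, rfl⟩

lemma SameParam.apply_eq {α : Type*} {f : ℝ → α} (hf : ∀ t, f (t + 1) = f t) {s t : ℝ}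
    (h : SameParam s t) : f s = f t := by
  obtain ⟨k, rfl⟩ := h
  have h1 : Function.Periodic f 1 := hf
  simpa using h1.int_mul k t

lemma deriv_periodic {F : Type*} [NormedAddCommGroup F] [NormedSpace ℝ F] {f : ℝ → F}
    (hf : ∀ t, f (t + 1) = f t) (t : ℝ) : deriv f (t + 1) = deriv f t := by
  rw [← deriv_comp_add_const]
  simp only [hf]

/-- The curve `γ` is a generic immersion on the set `K` of parameters. -/
structure GenericOn (γ : ℝ → Plane) (K : Set ℝ) : Prop where
  immersed : ∀ t ∈ K, deriv γ t ≠ 0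
  transverse : ∀ s ∈ K, ∀ t ∈ K, γ s = γ t → ¬ SameParam s t →
    planeDet (deriv γ s) (deriv γ t) ≠ 0
  no_triple : ∀ s ∈ K, ∀ t ∈ K, ∀ u ∈ K, γ s = γ t → γ t = γ u →
    SameParam s t ∨ SameParam t u ∨ SameParam s u

/-- At a transverse pair the derivative of `(s, t) ↦ γ s - γ t` is injective, so the pair is
isolated among the zeros. A discrete subset of the plane is countable. -/
lemma countable_transverse_pairs {γ : ℝ → Plane} (hγ : Differentiable ℝ γ) :
    {p : ℝ × ℝ | γ p.1 = γ p.2 ∧ planeDet (deriv γ p.1) (deriv γ p.2) ≠ 0}.Countable := by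
  refine (HereditarilyLindelofSpace.isLindelof _).countable ?_
  rw [← isDiscrete_iff_discreteTopology, isDiscrete_iff_nhdsNE]
  rintro ⟨s, t⟩ ⟨h, hd⟩
  let G : ℝ × ℝ → Plane := fun p => γ p.1 - γ p.2
  let G' : ℝ × ℝ →L[ℝ] Plane := (ContinuousLinearMap.fst ℝ ℝ ℝ).smulRight (deriv γ s) -
    (ContinuousLinearMap.snd ℝ ℝ ℝ).smulRight (deriv γ t)
  have hG : HasFDerivAt G G' (s, t) := by
    have h1 : HasFDerivAt (fun p : ℝ × ℝ => γ p.1)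
        ((ContinuousLinearMap.fst ℝ ℝ ℝ).smulRight (deriv γ s)) (s, t) := by
      have := (hγ s).hasDerivAt.hasFDerivAt.comp (s, t) (f := Prod.fst) hasFDerivAt_fst
      exact this
    have h2 : HasFDerivAt (fun p : ℝ × ℝ => γ p.2)
        ((ContinuousLinearMap.snd ℝ ℝ ℝ).smulRight (deriv γ t)) (s, t) := by
      have := (hγ t).hasDerivAt.hasFDerivAt.comp (s, t) (f := Prod.snd) hasFDerivAt_snd
      exact this
    exact h1.sub h2
  have hinj : LinearMap.ker (G' : ℝ × ℝ →ₗ[ℝ] Plane) = ⊥ := by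
    rw [LinearMap.ker_eq_bot']
    rintro ⟨x, y⟩ hxy
    have hxy' : x • deriv γ s - y • deriv γ t = 0 := hxy
    have e1 := congrArg Prod.fst hxy'
    have e2 := congrArg Prod.snd hxy'
    simp only [Prod.fst_sub, Prod.snd_sub, Prod.smul_fst, Prod.smul_snd, smul_eq_mul, Prod.fst_zero,
      Prod.snd_zero] at e1 e2
    have hx : x * planeDet (deriv γ s) (deriv γ t) = 0 := by
      unfold planeDet
      linear_combination (deriv γ t).2 * e1 - (deriv γ t).1 * e2
    have hy : y * planeDet (deriv γ s) (deriv γ t) = 0 := by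
      unfold planeDet
      linear_combination (deriv γ s).2 * e1 - (deriv γ s).1 * e2
    have := (mul_eq_zero.1 hx).resolve_right hd
    have := (mul_eq_zero.1 hy).resolve_right hd
    simp_all
  obtain ⟨C, -, hC⟩ := LinearMap.exists_antilipschitzWith _ hinj
  have hev := hG.eventually_ne (c := 0) ⟨C, hC⟩
  rw [Filter.inf_principal_eq_bot]
  filter_upwards [hev] with p hp hmem
  exact hp (sub_eq_zero.2 hmem.1)

/-- The trigonometric functions `1`, `cos 2πt`, `sin 2πt`. -/
noncomputable def trigFun : Fin 3 → ℝ → ℝ :=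
  ![fun _ => 1, fun t => Real.cos (2 * Real.pi * t), fun t => Real.sin (2 * Real.pi * t)]

lemma trigFun_contDiff (k : Fin 3) : ContDiff ℝ ∞ (trigFun k) := by
  fin_cases k
  · exact contDiff_const
  · exact Real.contDiff_cos.comp (contDiff_const.mul contDiff_id)
  · exact Real.contDiff_sin.comp (contDiff_const.mul contDiff_id)

lemma trigFun_periodic (k : Fin 3) (t : ℝ) : trigFun k (t + 1) = trigFun k t := by
  fin_cases k
  · rfl
  · change Real.cos (2 * Real.pi * (t + 1)) = Real.cos (2 * Real.pi * t)
    rw [mul_add, mul_one, Real.cos_add_two_pi]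
  · change Real.sin (2 * Real.pi * (t + 1)) = Real.sin (2 * Real.pi * t)
    rw [mul_add, mul_one, Real.sin_add_two_pi]

lemma trigFun_sq (t : ℝ) : trigFun 1 t ^ 2 + trigFun 2 t ^ 2 = 1 :=
  Real.cos_sq_add_sin_sq _

lemma sameParam_of_trigFun_eq {s t : ℝ} (h1 : trigFun 1 s = trigFun 1 t)
    (h2 : trigFun 2 s = trigFun 2 t) : SameParam s t := by
  have h := Real.Angle.cos_sin_inj h1 h2
  obtain ⟨k, hk⟩ := Real.Angle.angle_eq_iff_two_pi_dvd_sub.1 h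
  refine ⟨k, ?_⟩
  have hpi : (2 * Real.pi) ≠ 0 := by positivity
  have : (2 * Real.pi) * s = (2 * Real.pi) * (t + k) := by linarith
  exact mul_left_cancel₀ hpi this

lemma circle_not_collinear {a₁ b₁ a₂ b₂ a₃ b₃ : ℝ} (h₁ : a₁ ^ 2 + b₁ ^ 2 = 1)
    (h₂ : a₂ ^ 2 + b₂ ^ 2 = 1) (h₃ : a₃ ^ 2 + b₃ ^ 2 = 1)
    (h : (a₁ - a₃) * (b₂ - b₃) - (b₁ - b₃) * (a₂ - a₃) = 0) :
    (a₁ = a₂ ∧ b₁ = b₂) ∨ (a₂ = a₃ ∧ b₂ = b₃) ∨ (a₁ = a₃ ∧ b₁ = b₃) := by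
  by_cases hp : a₁ = a₃ ∧ b₁ = b₃
  · exact Or.inr (Or.inr hp)
  by_cases hr : a₂ = a₃ ∧ b₂ = b₃
  · exact Or.inr (Or.inl hr)
  left
  obtain ⟨p, rfl⟩ : ∃ p, a₁ = a₃ + p := ⟨a₁ - a₃, by ring⟩
  obtain ⟨q, rfl⟩ : ∃ q, b₁ = b₃ + q := ⟨b₁ - b₃, by ring⟩
  obtain ⟨r, rfl⟩ : ∃ r, a₂ = a₃ + r := ⟨a₂ - a₃, by ring⟩
  obtain ⟨s, rfl⟩ : ∃ s, b₂ = b₃ + s := ⟨b₂ - b₃, by ring⟩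
  have hd : p * s = q * r := by linarith
  have e1 : p ^ 2 + q ^ 2 = -2 * (a₃ * p + b₃ * q) := by linarith
  have e2 : r ^ 2 + s ^ 2 = -2 * (a₃ * r + b₃ * s) := by linarith
  have k1 : r * (p * (r - p) + q * (s - q)) = 0 := by
    linear_combination p * e2 - r * e1 + (-s - 2 * b₃) * hd
  have k2 : s * (p * (r - p) + q * (s - q)) = 0 := by
    linear_combination q * e2 - s * e1 + (r + 2 * a₃) * hd
  have k3 : p * (r * (p - r) + s * (q - s)) = 0 := by
    linear_combination r * e1 - p * e2 + (q + 2 * b₃) * hd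
  have k4 : q * (r * (p - r) + s * (q - s)) = 0 := by
    linear_combination s * e1 - q * e2 + (-p - 2 * a₃) * hd
  -- With chord vectors `P = (p, q)` and `R = (r, s)` from the third point, `m1` and `m2` say `P·(R
  -- - P) = 0` and `R·(P - R) = 0`. Their sum is `-|P - R|²`, so the chords coincide.
  have m1 : p * (r - p) + q * (s - q) = 0 := by
    by_contra hne
    exact hr ⟨by simpa using (mul_eq_zero.1 k1).resolve_right hne,
      by simpa using (mul_eq_zero.1 k2).resolve_right hne⟩
  have m2 : r * (p - r) + s * (q - s) = 0 := by
    by_contra hne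
    exact hp ⟨by simpa using (mul_eq_zero.1 k3).resolve_right hne,
      by simpa using (mul_eq_zero.1 k4).resolve_right hne⟩
  have m3 : (p - r) ^ 2 + (q - s) ^ 2 = 0 := by linear_combination -m1 - m2
  have m4 : p - r = 0 := by nlinarith [sq_nonneg (p - r), sq_nonneg (q - s)]
  have m5 : q - s = 0 := by nlinarith [sq_nonneg (p - r), sq_nonneg (q - s)]
  constructor <;> linarith

/-- The reason for choosing `1, cos, sin`: three distinct points of a circle are not collinear, so
the vectors `(1, cos, sin)` at distinct parameters are independent. If `β u = 0`, two vectors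
remain, and those are not parallel. Two nonzero weights therefore suffice. -/
lemma exists_trig_minor_ne_zero {β : ℝ → ℝ} {s t u : ℝ} (hs : β s ≠ 0) (ht : β t ≠ 0)
    (hst : ¬ SameParam s t) (htu : ¬ SameParam t u) (hsu : ¬ SameParam s u) :
    ∃ k l, k ≠ l ∧ (β s * trigFun k s - β u * trigFun k u) * (β t * trigFun l t - β u * trigFun l u)
      - (β s * trigFun l s - β u * trigFun l u) * (β t * trigFun k t - β u * trigFun k u) ≠ 0 := by
  by_contra! hc
  have h01 := hc 0 1 (by decide)
  have h02 := hc 0 2 (by decide)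
  have h12 := hc 1 2 (by decide)
  have h0 : ∀ x, trigFun 0 x = 1 := fun _ => rfl
  simp only [h0, mul_one] at h01 h02 h12
  by_cases hu : β u = 0
  · simp only [hu, zero_mul, sub_zero] at h01 h02
    have hm : β s * β t ≠ 0 := mul_ne_zero hs ht
    have h1 : β s * β t * (trigFun 1 t - trigFun 1 s) = 0 := by linarith
    have h2 : β s * β t * (trigFun 2 t - trigFun 2 s) = 0 := by linarith
    have h1' := (mul_eq_zero.1 h1).resolve_left hm
    have h2' := (mul_eq_zero.1 h2).resolve_left hm
    exact hst (sameParam_of_trigFun_eq (by linarith) (by linarith))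
  · have hm : β s * β t * β u ≠ 0 := mul_ne_zero (mul_ne_zero hs ht) hu
    have h3 : β s * β t * β u * ((trigFun 1 s - trigFun 1 u) * (trigFun 2 t - trigFun 2 u) -
        (trigFun 2 s - trigFun 2 u) * (trigFun 1 t - trigFun 1 u)) = 0 := by
      linear_combination β u * h12 - (β u * trigFun 1 u) * h02 + (β u * trigFun 2 u) * h01
    have h3' := (mul_eq_zero.1 h3).resolve_left hm
    rcases circle_not_collinear (trigFun_sq s) (trigFun_sq t) (trigFun_sq u) h3' with h | h | h
    · exact hst (sameParam_of_trigFun_eq h.1 h.2)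
    · exact htu (sameParam_of_trigFun_eq h.1 h.2)
    · exact hsu (sameParam_of_trigFun_eq h.1 h.2)

/-- The perturbation of `γ` on the support of the weight `β` with the parameter `v`. -/
noncomputable def trigPerturbed (γ : ℝ → Plane) (β : ℝ → ℝ) (v : Fin 3 → Plane) : ℝ → Plane :=
  perturbed γ (fun k t => β t * trigFun k t) v

lemma trigPerturbed_of_eq_zero {γ : ℝ → Plane} {β : ℝ → ℝ} {v : Fin 3 → Plane} {t : ℝ}
    (h : β t = 0) : trigPerturbed γ β v t = γ t := by
  simp [trigPerturbed, perturbed, h]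

lemma trigPerturbed_contDiff {γ : ℝ → Plane} {β : ℝ → ℝ} (hγ : ContDiff ℝ ∞ γ)
    (hβ : ContDiff ℝ ∞ β) (v : Fin 3 → Plane) : ContDiff ℝ ∞ (trigPerturbed γ β v) :=
  hγ.add (ContDiff.sum fun k _ => (hβ.mul (trigFun_contDiff k)).smul contDiff_const)

lemma trigPerturbed_periodic {γ : ℝ → Plane} {β : ℝ → ℝ} (hγ : ∀ t, γ (t + 1) = γ t)
    (hβ : ∀ t, β (t + 1) = β t) (v : Fin 3 → Plane) (t : ℝ) :
    trigPerturbed γ β v (t + 1) = trigPerturbed γ β v t := by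
  simp [trigPerturbed, perturbed, hγ, hβ, trigFun_periodic]

/-- A zero of a nonnegative weight is a minimum. Hence a perturbation with such a weight keeps both
the curve and its tangents on the zero set. -/
lemma deriv_eq_zero_of_nonneg {β : ℝ → ℝ} (hβ : ∀ t, 0 ≤ β t) {t : ℝ} (h : β t = 0) :
    deriv β t = 0 :=
  IsLocalMin.deriv_eq_zero (Filter.Eventually.of_forall fun s => by rw [h]; exact hβ s)

lemma deriv_trigPerturbed_of_eq_zero {γ : ℝ → Plane} {β : ℝ → ℝ} (hγ : ContDiff ℝ ∞ γ)
    (hβ : ContDiff ℝ ∞ β) (hβ0 : ∀ t, 0 ≤ β t) (v : Fin 3 → Plane) {t : ℝ} (h : β t = 0) :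
    deriv (trigPerturbed γ β v) t = deriv γ t := by
  have hd : ∀ k, Differentiable ℝ (fun t => β t * trigFun k t) := fun k =>
    (hβ.mul (trigFun_contDiff k)).differentiable (by simp)
  refine (hasDerivAt_perturbed (hγ.differentiable (by simp)) hd v t).deriv.trans ?_
  have : ∀ k, deriv (fun t => β t * trigFun k t) t = 0 := by
    intro k
    rw [deriv_fun_mul (hβ.differentiable (by simp) t)
      ((trigFun_contDiff k).differentiable (by simp) t), h, deriv_eq_zero_of_nonneg hβ0 h]
    simp
  simp [this]

/-- Genericity is needed only on the fixed part `β = 0`. Coincidences are sorted by the number of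
moving parameters: triple points with at least two moving ones are excluded by the minors, those
with one moving parameter by avoiding the countably many fixed double points, and those with none by
hypothesis. -/
theorem ae_genericOn_trigPerturbed {γ : ℝ → Plane} {β : ℝ → ℝ} (hγ : ContDiff ℝ ∞ γ)
    (hγp : ∀ t, γ (t + 1) = γ t) (hβ : ContDiff ℝ ∞ β) (hβp : ∀ t, β (t + 1) = β t)
    (hβ0 : ∀ t, 0 ≤ β t) (hK : GenericOn γ {t | β t = 0}) {Q : Set Plane} (hQ : Q.Countable) :
    ∀ᵐ v : Fin 3 → Plane, GenericOn (trigPerturbed γ β v) Set.univ ∧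
      ∀ t, β t ≠ 0 → trigPerturbed γ β v t ∉ Q := by
  set E : Fin 3 → ℝ → ℝ := fun k t => β t * trigFun k t with hE
  have hEc : ∀ k, ContDiff ℝ ∞ (E k) := fun k => hβ.mul (trigFun_contDiff k)
  have hEd : ∀ k, Differentiable ℝ (E k) := fun k => (hEc k).differentiable (by simp)
  have hγd : Differentiable ℝ γ := hγ.differentiable (by simp)
  have hEd' : ∀ k, Differentiable ℝ (deriv (E k)) := fun k =>
    ((contDiff_infty_iff_deriv.1 (hEc k)).2).differentiable (by simp)
  have hγd' : Differentiable ℝ (deriv γ) :=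
    ((contDiff_infty_iff_deriv.1 hγ).2).differentiable (by simp)
  have hE0 : ∀ t, E 0 t = β t := fun t => mul_one _
  let Z := {p : ℝ × ℝ | γ p.1 = γ p.2 ∧ planeDet (deriv γ p.1) (deriv γ p.2) ≠ 0}
  -- The moving part must avoid the transverse double points of `γ` in addition to `Q`; otherwise it
  -- could pass through a crossing of the fixed part.
  let Q' : Set Plane := Q ∪ (fun p : ℝ × ℝ => γ p.1) '' Z
  have hQ' : Q'.Countable := hQ.union ((countable_transverse_pairs hγd).image _)
  have a1 := measure_eq_zero_iff_ae_notMem.1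
    (volume_solvable_eq_zero (fun k => deriv (E k)) (deriv γ) hEd' hγd')
  have a2 := measure_eq_zero_iff_ae_notMem.1 (volume_nontransverse_eq_zero γ E hγd hEd)
  have a3 := measure_eq_zero_iff_ae_notMem.1 (volume_triple_eq_zero γ E hγd hEd)
  have a4 : ∀ᵐ v : Fin 3 → Plane, ∀ q ∈ Q', v ∉ {v : Fin 3 → Plane |
      ∃ t, (∃ k, E k t ≠ 0) ∧ (γ t - q) + ∑ k, E k t • v k = 0} := by
    rw [ae_ball_iff hQ']
    intro q _
    exact measure_eq_zero_iff_ae_notMem.1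
      (volume_solvable_eq_zero E (fun t => γ t - q) hEd (hγd.sub_const q))
  filter_upwards [a1, a2, a3, a4] with v b1 b2 b3 b4
  have hv : trigPerturbed γ β v = perturbed γ E v := rfl
  have hper := trigPerturbed_periodic hγp hβp v
  have hon : ∀ {t}, β t = 0 → perturbed γ E v t = γ t := fun h => trigPerturbed_of_eq_zero h
  have hon' : ∀ {t}, β t = 0 → deriv (perturbed γ E v) t = deriv γ t := fun h =>
    deriv_trigPerturbed_of_eq_zero hγ hβ hβ0 v h
  have hsep : ∀ {s t}, β s ≠ 0 → ¬ SameParam s t → ∃ k, E k s ≠ E k t := by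
    intro s t hs hst
    by_contra! hc
    have h0 := hc 0
    rw [hE0, hE0] at h0
    have h1 := hc 1
    have h2 := hc 2
    simp only [hE, h0] at h1 h2
    rw [h0] at hs
    exact hst (sameParam_of_trigFun_eq (mul_left_cancel₀ hs h1) (mul_left_cancel₀ hs h2))
  have avoid : ∀ t, β t ≠ 0 → perturbed γ E v t ∉ Q' := by
    intro t ht hq
    refine b4 _ hq ⟨t, ⟨0, by rwa [hE0]⟩, ?_⟩
    simp only [perturbed]
    abel
  rw [hv] at hper ⊢
  have himm : ∀ t, deriv (perturbed γ E v) t ≠ 0 := by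
    intro t
    by_cases ht : β t = 0
    · rw [hon' ht]; exact hK.immersed t ht
    · intro h
      rw [(hasDerivAt_perturbed hγd hEd v t).deriv] at h
      refine b1 ⟨t, ?_, h⟩
      -- The constant function forces `deriv β t = 0`; the other two components then make `sin` and
      -- `cos` vanish at the same parameter.
      by_contra! hc
      have hmul : ∀ k, deriv (E k) t = deriv β t * trigFun k t + β t * deriv (trigFun k) t :=
        fun k => deriv_fun_mul (hβ.differentiable (by simp) t)
          ((trigFun_contDiff k).differentiable (by simp) t)
      have h0 := hc 0
      rw [hmul] at h0
      have e0 : deriv (trigFun 0) t = 0 := deriv_const t 1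
      rw [e0, mul_zero, add_zero] at h0
      have hβ' : deriv β t = 0 := by simpa [trigFun] using h0
      have h1 := hc 1
      have h2 := hc 2
      rw [hmul, hβ', zero_mul, zero_add] at h1 h2
      have e1 : HasDerivAt (trigFun 1) (-Real.sin (2 * Real.pi * t) * (2 * Real.pi)) t := by
        have hl : HasDerivAt (fun t : ℝ => 2 * Real.pi * t) (2 * Real.pi) t := by
          simpa using (hasDerivAt_id t).const_mul (2 * Real.pi)
        exact hl.cos
      have e2 : HasDerivAt (trigFun 2) (Real.cos (2 * Real.pi * t) * (2 * Real.pi)) t := by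
        have hl : HasDerivAt (fun t : ℝ => 2 * Real.pi * t) (2 * Real.pi) t := by
          simpa using (hasDerivAt_id t).const_mul (2 * Real.pi)
        exact hl.sin
      rw [e1.deriv] at h1
      rw [e2.deriv] at h2
      have hpi : (2 * Real.pi) ≠ 0 := by positivity
      have s1 : Real.sin (2 * Real.pi * t) = 0 := by simpa [ht, Real.pi_ne_zero] using h1
      have s2 : Real.cos (2 * Real.pi * t) = 0 := by simpa [ht, Real.pi_ne_zero] using h2
      have := Real.cos_sq_add_sin_sq (2 * Real.pi * t)
      rw [s1, s2] at this
      norm_num at this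
  have htr : ∀ s t, perturbed γ E v s = perturbed γ E v t → ¬ SameParam s t →
      planeDet (deriv (perturbed γ E v) s) (deriv (perturbed γ E v) t) ≠ 0 := by
    intro s t hst hne
    by_cases hs : β s = 0
    · by_cases ht : β t = 0
      · rw [hon' hs, hon' ht]
        rw [hon hs, hon ht] at hst
        exact hK.transverse s hs t ht hst hne
      · intro h
        obtain ⟨k, hk⟩ := hsep ht fun h => hne h.symm
        exact b2 ⟨s, t, ⟨k, hk.symm⟩, hst, h⟩
    · intro h
      exact b2 ⟨s, t, hsep hs hne, hst, h⟩
  have hKQ : ∀ s t, β s = 0 → β t = 0 → ¬ SameParam s t → γ s = γ t → γ s ∈ Q' := by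
    intro s t hs ht hne h
    exact Or.inr ⟨(s, t), ⟨h, hK.transverse s hs t ht h hne⟩, rfl⟩
  have two : ∀ s t u, β s ≠ 0 → β t ≠ 0 → perturbed γ E v s = perturbed γ E v u →
      perturbed γ E v t = perturbed γ E v u → ¬ SameParam s t → ¬ SameParam t u →
      ¬ SameParam s u → False := by
    intro s t u hs ht h1 h2 n1 n2 n3
    exact b3 ⟨s, t, u, exists_trig_minor_ne_zero hs ht n1 n2 n3, h1, h2⟩
  have one : ∀ s t u, β s = 0 → β t = 0 → perturbed γ E v s = perturbed γ E v t →
      perturbed γ E v u = perturbed γ E v s → ¬ SameParam s t → β u ≠ 0 → False := by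
    intro s t u hs ht h1 h2 n1 hu
    refine avoid u hu ?_
    rw [h2, hon hs]
    rw [hon hs, hon ht] at h1
    exact hKQ s t hs ht n1 h1
  refine ⟨⟨fun t _ => himm t, fun s _ t _ => htr s t, ?_⟩, fun t ht hq => avoid t ht (Or.inl hq)⟩
  intro s _ t _ u _ h1 h2
  by_contra! hc
  obtain ⟨n1, n2, n3⟩ := hc
  by_cases hs : β s = 0 <;> by_cases ht : β t = 0 <;> by_cases hu : β u = 0
  · rw [hon hs, hon ht] at h1
    rw [hon ht, hon hu] at h2
    rcases hK.no_triple s hs t ht u hu h1 h2 with h | h | h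
    exacts [n1 h, n2 h, n3 h]
  · exact one s t u hs ht h1 (h1.trans h2).symm n1 hu
  · exact one s u t hs hu (h1.trans h2) h1.symm n3 ht
  · exact two t u s ht hu h1.symm (h1.trans h2).symm n2 (fun h => n3 h.symm) (fun h => n1 h.symm)
  · exact one t u s ht hu h2 h1 n2 hs
  · exact two s u t hs hu h1 h2.symm n3 (fun h => n2 h.symm) n1
  · exact two s t u hs ht (h1.trans h2) h2 n1 n2 n3
  · exact two s t u hs ht (h1.trans h2) h2 n1 n2 n3

/-! ### Diffeomorphisms, reparametrizations and Gauss codes -/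

/-- The Jacobian determinant of a linear map of the plane. -/
def jac (A : Plane →L[ℝ] Plane) : ℝ := planeDet (A (1, 0)) (A (0, 1))

lemma planeDet_map (A : Plane →L[ℝ] Plane) (v u : Plane) :
    planeDet (A v) (A u) = jac A * planeDet v u := by
  have h : ∀ x : Plane, A x = x.1 • A (1, 0) + x.2 • A (0, 1) := by
    intro x
    rw [← map_smul, ← map_smul, ← map_add]
    congr 1
    ext <;> simp
  rw [h v, h u]
  simp only [jac, planeDet, Prod.fst_add, Prod.snd_add, Prod.smul_fst, Prod.smul_snd, smul_eq_mul]
  ring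

lemma planeDet_smul_smul (a b : ℝ) (v u : Plane) :
    planeDet (a • v) (b • u) = a * b * planeDet v u := by
  simp only [planeDet, Prod.smul_fst, Prod.smul_snd, smul_eq_mul]
  ring

lemma planeDet_swap (v u : Plane) : planeDet u v = -planeDet v u := by
  unfold planeDet; ring

lemma IsPlaneDiffeo.fderiv_symm_comp {F : Plane ≃ Plane} (hF : IsPlaneDiffeo F) (p : Plane) :
    (fderiv ℝ F.symm (F p)).comp (fderiv ℝ F p) = ContinuousLinearMap.id ℝ Plane := by
  have h1 : HasFDerivAt F (fderiv ℝ F p) p := (hF.1.differentiable (by simp) p).hasFDerivAt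
  have h2 : HasFDerivAt F.symm (fderiv ℝ F.symm (F p)) (F p) :=
    (hF.2.differentiable (by simp) (F p)).hasFDerivAt
  have h3 := h2.comp p h1
  have h4 : (F.symm ∘ F : Plane → Plane) = id := by funext x; simp
  rw [h4] at h3
  exact h3.unique (hasFDerivAt_id p)

lemma IsPlaneDiffeo.jac_ne_zero {F : Plane ≃ Plane} (hF : IsPlaneDiffeo F) (p : Plane) :
    jac (fderiv ℝ F p) ≠ 0 := by
  intro h
  have h1 := planeDet_map (fderiv ℝ F.symm (F p)) (fderiv ℝ F p (1, 0)) (fderiv ℝ F p (0, 1))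
  have h2 : ∀ x, fderiv ℝ F.symm (F p) (fderiv ℝ F p x) = x := fun x => by
    have := congrArg (fun A : Plane →L[ℝ] Plane => A x) (hF.fderiv_symm_comp p)
    simpa using this
  rw [h2, h2] at h1
  unfold jac at h
  rw [h] at h1
  simp [planeDet] at h1

lemma IsPlaneDiffeo.symm {F : Plane ≃ Plane} (hF : IsPlaneDiffeo F) : IsPlaneDiffeo F.symm :=
  ⟨hF.2, by simpa using hF.1⟩

lemma IsPlaneDiffeo.hasDerivAt {F : Plane ≃ Plane} (hF : IsPlaneDiffeo F) {γ : ℝ → Plane} {t : ℝ}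
    (hγ : DifferentiableAt ℝ γ t) :
    HasDerivAt (fun t => F (γ t)) (fderiv ℝ F (γ t) (deriv γ t)) t :=
  (hF.1.differentiable (by simp) (γ t)).hasFDerivAt.comp_hasDerivAt t hγ.hasDerivAt

lemma IsPlaneDiffeo.fderiv_injective {F : Plane ≃ Plane} (hF : IsPlaneDiffeo F) (p : Plane) :
    Function.Injective (fderiv ℝ F p) := by
  intro x y h
  have h2 : ∀ x, fderiv ℝ F.symm (F p) (fderiv ℝ F p x) = x := fun x => by
    have := congrArg (fun A : Plane →L[ℝ] Plane => A x) (hF.fderiv_symm_comp p)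
    simpa using this
  rw [← h2 x, h, h2]

lemma IsPlaneIsotopy.isPlaneDiffeo {Φ : ℝ → Plane ≃ Plane} (h : IsPlaneIsotopy Φ) (s : ℝ) :
    IsPlaneDiffeo (Φ s) :=
  ⟨h.1.comp (contDiff_const.prodMk contDiff_id), h.2.1.comp (contDiff_const.prodMk contDiff_id)⟩

/-- The determinant at `p` is continuous in time, equals 1 at time 0 and never vanishes. -/
lemma IsPlaneIsotopy.jac_pos {Φ : ℝ → Plane ≃ Plane} (h : IsPlaneIsotopy Φ) (p : Plane) :
    0 < jac (fderiv ℝ (Φ 1) p) := by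
  have hform : ∀ s w, fderiv ℝ (Φ s) p w =
      fderiv ℝ (fun q : ℝ × Plane => Φ q.1 q.2) (s, p) (0, w) := by
    intro s w
    have h1 : HasFDerivAt (fun q : ℝ × Plane => Φ q.1 q.2)
      (fderiv ℝ (fun q : ℝ × Plane => Φ q.1 q.2) (s, p)) (s, p) :=
      (h.1.differentiable (by simp) _).hasFDerivAt
    have h2 : HasFDerivAt (fun x : Plane => ((s, x) : ℝ × Plane))
        (ContinuousLinearMap.inr ℝ ℝ Plane) p := hasFDerivAt_prodMk_right s p
    have h3 := (h1.comp p h2).fderiv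
    have h4 : ((fun q : ℝ × Plane => Φ q.1 q.2) ∘ fun x : Plane => ((s, x) : ℝ × Plane)) = Φ s := by
      funext x; rfl
    rw [h4] at h3
    rw [h3]
    simp
  have hcont : Continuous fun s => jac (fderiv ℝ (Φ s) p) := by
    have hc : Continuous (fderiv ℝ (fun q : ℝ × Plane => Φ q.1 q.2)) :=
      h.1.continuous_fderiv (by simp)
    have hc' : Continuous fun s : ℝ => fderiv ℝ (fun q : ℝ × Plane => Φ q.1 q.2) (s, p) :=
      hc.comp (by fun_prop)
    have hw : ∀ w : Plane, Continuous fun s => fderiv ℝ (Φ s) p w := by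
      intro w
      simp only [hform]
      exact hc'.clm_apply continuous_const
    unfold jac planeDet
    have := hw (1, 0)
    have := hw (0, 1)
    fun_prop
  by_contra hneg
  have h0 : jac (fderiv ℝ (Φ 0) p) = 1 := by
    have h5 : (Φ 0 : Plane → Plane) = id := by rw [h.2.2]; rfl
    rw [h5, fderiv_id]
    simp [jac, planeDet]
  have hle : jac (fderiv ℝ (Φ 1) p) ≤ 0 := not_lt.1 hneg
  have := intermediate_value_Icc' (zero_le_one' ℝ) hcont.continuousOn
  obtain ⟨s, -, hs⟩ := this ⟨hle, by rw [h0]; exact zero_le_one⟩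
  exact (h.isPlaneDiffeo s).jac_ne_zero p hs

/-! ### Orientation preserving reparametrizations of the circle -/

lemma IsCircleReparam.strictMono {h : ℝ → ℝ} (hh : IsCircleReparam h) : StrictMono h :=
  strictMono_of_deriv_pos hh.2.1

lemma IsCircleReparam.add_int {h : ℝ → ℝ} (hh : IsCircleReparam h) (t : ℝ) (k : ℤ) :
    h (t + k) = h t + k := by
  have hp : Function.Periodic (fun t => h t - t) 1 := by
    intro t
    simp only [hh.2.2 t]
    ring
  have := hp.int_mul k t
  simp only [mul_one] at this
  linarith

lemma IsCircleReparam.surjective {h : ℝ → ℝ} (hh : IsCircleReparam h) : Function.Surjective h := by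
  intro y
  have hc : Continuous h := hh.1.continuous
  have h1 : h ((⌊y - h 0⌋ : ℤ) : ℝ) ≤ y := by
    have := hh.add_int 0 ⌊y - h 0⌋
    rw [zero_add] at this
    rw [this]
    linarith [Int.floor_le (y - h 0)]
  have h2 : y ≤ h ((⌊y - h 0⌋ + 1 : ℤ) : ℝ) := by
    have := hh.add_int 0 (⌊y - h 0⌋ + 1)
    rw [zero_add] at this
    rw [this]
    push_cast
    linarith [Int.lt_floor_add_one (y - h 0)]
  obtain ⟨x, -, hx⟩ := intermediate_value_Icc (by push_cast; linarith) hc.continuousOn ⟨h1, h2⟩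
  exact ⟨x, hx⟩

/-- A reparametrization of the circle, as an order isomorphism of the line. -/
noncomputable def IsCircleReparam.orderIso {h : ℝ → ℝ} (hh : IsCircleReparam h) : ℝ ≃o ℝ :=
  hh.strictMono.orderIsoOfSurjective h hh.surjective

@[simp] lemma IsCircleReparam.orderIso_apply {h : ℝ → ℝ} (hh : IsCircleReparam h) (t : ℝ) :
    hh.orderIso t = h t := rfl

lemma IsCircleReparam.sameParam_iff {h : ℝ → ℝ} (hh : IsCircleReparam h) {s t : ℝ} :
    SameParam (h s) (h t) ↔ SameParam s t := by
  constructor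
  · rintro ⟨k, hk⟩
    exact ⟨k, hh.strictMono.injective (by rw [hk, hh.add_int])⟩
  · rintro ⟨k, rfl⟩
    exact ⟨k, hh.add_int t k⟩

lemma IsCircleReparam.hasDerivAt {F : Type*} [NormedAddCommGroup F] [NormedSpace ℝ F] {h : ℝ → ℝ}
    (hh : IsCircleReparam h) {γ : ℝ → F} {t : ℝ} (hγ : DifferentiableAt ℝ γ (h t)) :
    HasDerivAt (fun t => γ (h t)) (deriv h t • deriv γ (h t)) t :=
  hγ.hasDerivAt.scomp t (hh.1.differentiable (by simp) t).hasDerivAt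

lemma isCircleReparam_add_const (a : ℝ) : IsCircleReparam (fun t => t + a) := by
  refine ⟨contDiff_id.add contDiff_const, fun t => ?_, fun t => by ring⟩
  have : deriv (fun t : ℝ => t + a) t = 1 := by simp
  rw [this]; exact one_pos

lemma isCircleReparam_id : IsCircleReparam (fun t => t) := by
  simpa using isCircleReparam_add_const 0

lemma IsCircleReparam.symm {h : ℝ → ℝ} (hh : IsCircleReparam h) :
    IsCircleReparam hh.orderIso.symm := by
  have hd : ∀ t, HasDerivAt hh.orderIso.symm (deriv h (hh.orderIso.symm t))⁻¹ t := by
    intro t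
    refine HasDerivAt.of_local_left_inverse hh.orderIso.symm.continuous.continuousAt
      (hh.1.differentiable (by simp) _).hasDerivAt (hh.2.1 _).ne' ?_
    exact Filter.Eventually.of_forall fun y => hh.orderIso.apply_symm_apply y
  refine ⟨?_, fun t => ?_, fun t => ?_⟩
  · rw [contDiff_iff_contDiffAt]
    intro t
    let Ho : Homeomorph ℝ ℝ := hh.orderIso.toHomeomorph
    have h1 : HasDerivAt Ho (deriv h (Ho.symm t)) (Ho.symm t) :=
      (hh.1.differentiable (by simp) _).hasDerivAt
    exact (Ho.toOpenPartialHomeomorph.contDiffAt_symm_deriv (hh.2.1 _).ne'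
      (Set.mem_univ t) h1 hh.1.contDiffAt)
  · rw [(hd t).deriv]; exact inv_pos.2 (hh.2.1 _)
  · apply hh.orderIso.injective
    rw [OrderIso.apply_symm_apply, hh.orderIso_apply, hh.2.2, ← hh.orderIso_apply,
      OrderIso.apply_symm_apply]

/-! ### Images of diagrams and invariance of Gauss codes under strict equivalence -/

namespace VirtualDiagram

lemma differentiable (D : VirtualDiagram) : Differentiable ℝ D.curve :=
  D.smooth.differentiable (by simp)

@[ext] lemma ext' {D D' : VirtualDiagram} (h : D.curve = D'.curve) (h' : D.real = D'.real) :
    D = D' := by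
  cases D; cases D'; cases h; cases h'; rfl

/-- The diagram with a generic curve and a given set of real crossings. -/
def ofGeneric (γ : ℝ → Plane) (hγ : ContDiff ℝ ∞ γ) (hp : ∀ t, γ (t + 1) = γ t)
    (hg : GenericOn γ Set.univ) (R : Set Plane)
    (hR : ∀ p ∈ R, ∃ s t, γ s = p ∧ γ t = p ∧ ¬ SameParam s t) : VirtualDiagram where
  curve := γ
  smooth := hγ
  periodic := hp
  immersed t := hg.immersed t trivial
  transverse s t := hg.transverse s trivial t trivial
  no_triple s t u := hg.no_triple s trivial t trivial u trivial
  real := R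
  real_crossing := hR

/-- The image of a diagram under a diffeomorphism of the plane and a reparametrization. -/
def transport (D : VirtualDiagram) (F : Plane ≃ Plane) (hF : IsPlaneDiffeo F) (h : ℝ → ℝ)
    (hh : IsCircleReparam h) : VirtualDiagram where
  curve t := F (D.curve (h t))
  smooth := hF.1.comp (D.smooth.comp hh.1)
  periodic t := by rw [hh.2.2, D.periodic]
  immersed t := by
    have h1 := hh.hasDerivAt (D.differentiable (h t))
    rw [(hF.hasDerivAt h1.differentiableAt).deriv, h1.deriv]
    intro h0
    have := hF.fderiv_injective _ (h0.trans (map_zero _).symm)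
    exact (smul_ne_zero (hh.2.1 t).ne' (D.immersed _)) this
  transverse s t hst hne := by
    have h1 := hh.hasDerivAt (D.differentiable (h t))
    have h2 := hh.hasDerivAt (D.differentiable (h s))
    rw [(hF.hasDerivAt h1.differentiableAt).deriv, h1.deriv,
      (hF.hasDerivAt h2.differentiableAt).deriv, h2.deriv]
    have hst' := F.injective hst
    rw [hst', planeDet_map, planeDet_smul_smul]
    exact mul_ne_zero (hF.jac_ne_zero _) (mul_ne_zero (mul_ne_zero (hh.2.1 _).ne' (hh.2.1 _).ne')
      (D.transverse _ _ hst' fun h0 => hne (hh.sameParam_iff.1 h0)))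
  no_triple s t u h1 h2 := by
    have := D.no_triple _ _ _ (F.injective h1) (F.injective h2)
    simpa only [hh.sameParam_iff] using this
  real := F '' D.real
  real_crossing := by
    rintro _ ⟨p, hp, rfl⟩
    obtain ⟨s, t, hs, ht, hst⟩ := D.real_crossing p hp
    obtain ⟨s, rfl⟩ := hh.surjective s
    obtain ⟨t, rfl⟩ := hh.surjective t
    exact ⟨s, t, by rw [hs], by rw [ht], fun h0 => hst (hh.sameParam_iff.2 h0)⟩

/-- The image of a diagram under a diffeomorphism of the plane. -/
def map (D : VirtualDiagram) (F : Plane ≃ Plane) (hF : IsPlaneDiffeo F) : VirtualDiagram :=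
  D.transport F hF _ isCircleReparam_id

lemma isPlaneDiffeo_refl : IsPlaneDiffeo (Equiv.refl Plane) := ⟨contDiff_id, contDiff_id⟩

/-- The reparametrization of a diagram. -/
def reparam (D : VirtualDiagram) (h : ℝ → ℝ) (hh : IsCircleReparam h) : VirtualDiagram :=
  D.transport (Equiv.refl _) isPlaneDiffeo_refl h hh

@[simp] lemma map_curve (D : VirtualDiagram) (F : Plane ≃ Plane) (hF : IsPlaneDiffeo F) (t : ℝ) :
    (D.map F hF).curve t = F (D.curve t) := rfl

@[simp] lemma reparam_curve (D : VirtualDiagram) (h : ℝ → ℝ) (hh : IsCircleReparam h) (t : ℝ) :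
    (D.reparam h hh).curve t = D.curve (h t) := rfl

lemma StrictEquiv.refl (D : VirtualDiagram) : StrictEquiv D D := Relation.EqvGen.refl _

lemma StrictEquiv.symm {D D' : VirtualDiagram} (h : StrictEquiv D D') : StrictEquiv D' D :=
  Relation.EqvGen.symm _ _ h

lemma StrictEquiv.trans {D D' D'' : VirtualDiagram} (h : StrictEquiv D D')
    (h' : StrictEquiv D' D'') : StrictEquiv D D'' := Relation.EqvGen.trans _ _ _ h h'

lemma Detour.strictEquiv {D D' : VirtualDiagram} (h : Detour D D') : StrictEquiv D D' :=
  Relation.EqvGen.rel _ _ (Or.inr h)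

lemma strictEquiv_map (D : VirtualDiagram) {Φ : ℝ → Plane ≃ Plane} (hΦ : IsPlaneIsotopy Φ) :
    StrictEquiv D (D.map (Φ 1) (hΦ.isPlaneDiffeo 1)) :=
  Relation.EqvGen.rel _ _ (Or.inl ⟨Φ, _, hΦ, isCircleReparam_id, fun _ => rfl, rfl⟩)

lemma strictEquiv_reparam (D : VirtualDiagram) {h : ℝ → ℝ} (hh : IsCircleReparam h) :
    StrictEquiv D (D.reparam h hh) :=
  Relation.EqvGen.rel _ _ (Or.inl ⟨fun _ => Equiv.refl _, h,
    ⟨contDiff_snd, contDiff_snd, rfl⟩, hh, fun _ => rfl, rfl⟩)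

/-- The base parameter `t₀`, the parameters `τ` and the labeling `c` exhibit the Gauss code `w`. -/
def HasCodeAt {n : ℕ} (D : VirtualDiagram) (w : GaussCode n) (t₀ : ℝ) (τ : Fin (2 * n) → ℝ)
    (c : Fin n → Plane) : Prop :=
  D.curve t₀ ∉ D.real ∧ Function.Injective c ∧ Set.range c = D.real ∧
    StrictMono τ ∧ Set.range τ = {t | t ∈ Set.Ioo t₀ (t₀ + 1) ∧ D.curve t ∈ D.real} ∧
    ∀ i, D.curve (τ i) = c (w.letter i).1 ∧
      ∀ s, D.curve s = D.curve (τ i) → ¬ SameParam s (τ i) →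
        ((w.letter i).2 = Side.L ↔ planeDet (deriv D.curve (τ i)) (deriv D.curve s) < 0)

variable {n : ℕ} {D D' : VirtualDiagram} {w : GaussCode n} {t₀ : ℝ} {τ : Fin (2 * n) → ℝ}
  {c : Fin n → Plane}

lemma HasCodeAt.hasGaussCode (h : D.HasCodeAt w t₀ τ c) : D.HasGaussCode w := ⟨t₀, τ, c, h⟩

/-- A code records only the cyclic order, the coincidences and the signs at double points. So no
smoothness of `e` or `F` is asked for, and the same lemma serves both directions of an isotopy. -/
lemma HasCodeAt.transport (h : D.HasCodeAt w t₀ τ c) (e : ℝ ≃o ℝ) (he : ∀ t, e (t + 1) = e t + 1)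
    (F : Plane ≃ Plane) (hc : ∀ t, D'.curve t = F (D.curve (e t))) (hr : D'.real = F '' D.real)
    (hs : ∀ s t, D.curve (e s) = D.curve (e t) →
      (planeDet (deriv D'.curve s) (deriv D'.curve t) < 0 ↔
        planeDet (deriv D.curve (e s)) (deriv D.curve (e t)) < 0)) :
    D'.HasCodeAt w (e.symm t₀) (e.symm ∘ τ) (F ∘ c) := by
  obtain ⟨h1, h2, h3, h4, h5, h6⟩ := h
  have hmem : ∀ t, D'.curve t ∈ D'.real ↔ D.curve (e t) ∈ D.real := by
    intro t
    rw [hc, hr, F.injective.mem_set_image]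
  have he' : ∀ t, e.symm (t + 1) = e.symm t + 1 := by
    intro t
    rw [OrderIso.symm_apply_eq, he, OrderIso.apply_symm_apply]
  have hadd : ∀ t (k : ℤ), e (t + k) = e t + k := by
    intro t k
    have hp : Function.Periodic (fun t => e t - t) 1 := by
      intro t
      simp only [he t]
      ring
    have := hp.int_mul k t
    simp only [mul_one] at this
    linarith
  refine ⟨by rw [hmem, e.apply_symm_apply]; exact h1, F.injective.comp h2, ?_,
    e.symm.strictMono.comp h4, ?_, fun i => ⟨?_, ?_⟩⟩
  · rw [Set.range_comp, h3, hr]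
  · rw [Set.range_comp, h5]
    ext t
    simp only [Set.mem_image, Set.mem_ofPred_eq, Set.mem_Ioo, hmem]
    constructor
    · rintro ⟨x, ⟨⟨hx1, hx2⟩, hx3⟩, rfl⟩
      refine ⟨⟨e.symm.strictMono hx1, ?_⟩, by simpa using hx3⟩
      rw [← he']
      exact e.symm.strictMono hx2
    · rintro ⟨⟨hx1, hx2⟩, hx3⟩
      refine ⟨e t, ⟨⟨?_, ?_⟩, hx3⟩, e.symm_apply_apply t⟩
      · rwa [← e.symm_apply_lt]
      · rwa [← e.lt_symm_apply, he']
  · simp only [Function.comp_apply, hc, e.apply_symm_apply, (h6 i).1]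
  · intro s hs1 hs2
    simp only [Function.comp_apply, hc, e.apply_symm_apply] at hs1 hs2 ⊢
    have hs1' := F.injective hs1
    rw [(h6 i).2 (e s) hs1' ?_, hs, e.apply_symm_apply]
    · rw [hs1', e.apply_symm_apply]
    · rintro ⟨k, hk⟩
      refine hs2 ⟨k, ?_⟩
      apply e.injective
      rw [hadd, e.apply_symm_apply, hk]

lemma HasCodeAt.congr (h : D.HasCodeAt w t₀ τ c) (hr : D'.real = D.real)
    (h1 : ∀ t, D'.curve t ∈ D'.real → D.curve t ∈ D.real)
    (h2 : ∀ t, D.curve t ∈ D.real → D'.curve t = D.curve t ∧ deriv D'.curve t = deriv D.curve t) :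
    D'.HasCodeAt w t₀ τ c := by
  obtain ⟨a1, a2, a3, a4, a5, a6⟩ := h
  have hmem : ∀ t, D'.curve t ∈ D'.real ↔ D.curve t ∈ D.real := fun t =>
    ⟨h1 t, fun ht => by rw [(h2 t ht).1, hr]; exact ht⟩
  have hτ : ∀ i, D.curve (τ i) ∈ D.real := fun i => (a5 ▸ Set.mem_range_self i :
    τ i ∈ {t | t ∈ Set.Ioo t₀ (t₀ + 1) ∧ D.curve t ∈ D.real}).2
  refine ⟨by rwa [hmem], a2, a3.trans hr.symm, a4, by simp only [hmem]; exact a5, fun i => ?_⟩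
  rw [(h2 _ (hτ i)).1, (h2 _ (hτ i)).2]
  refine ⟨(a6 i).1, fun s hs1 hs2 => ?_⟩
  have hs3 : D.curve s ∈ D.real := by
    rw [← hmem, hs1, hr]; exact hτ i
  rw [(h2 _ hs3).1] at hs1
  rw [(h2 _ hs3).2]
  exact (a6 i).2 s hs1 hs2

lemma Detour.symm (h : Detour D D') : Detour D' D := by
  obtain ⟨a, b, h1, h2, h3, h4, h5, h6⟩ := h
  exact ⟨a, b, h1, h2, h3.symm, h5, h4, fun t ht => (h6 t ht).symm⟩

lemma exists_int_add_mem_Ico (a t : ℝ) : ∃ k : ℤ, t + k ∈ Set.Ico a (a + 1) := by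
  refine ⟨-⌊t - a⌋, ?_, ?_⟩ <;> push_cast
  · linarith [Int.floor_le (t - a)]
  · linarith [Int.lt_floor_add_one (t - a)]

lemma curve_add_int (D : VirtualDiagram) (t : ℝ) (k : ℤ) : D.curve (t + k) = D.curve t :=
  SameParam.apply_eq D.periodic (SameParam.add_int t k)

lemma deriv_curve_add_int (D : VirtualDiagram) (t : ℝ) (k : ℤ) :
    deriv D.curve (t + k) = deriv D.curve t :=
  SameParam.apply_eq (deriv_periodic D.periodic) (SameParam.add_int t k)

/-- A passage through a real crossing lies, modulo 1, in the open interval `(b, a + 1)`, where the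
two curves agree on a neighbourhood. Hence their derivatives agree too. -/
lemma Detour.congr (h : Detour D D') (t : ℝ) (ht : D.curve t ∈ D.real) :
    D'.curve t = D.curve t ∧ deriv D'.curve t = deriv D.curve t := by
  obtain ⟨a, b, h1, h2, h3, h4, h5, h6⟩ := h
  obtain ⟨k, hk⟩ := exists_int_add_mem_Ico a t
  rw [← D.curve_add_int t k] at ht
  rw [← D.curve_add_int t k, ← D'.curve_add_int t k, ← D.deriv_curve_add_int t k,
    ← D'.deriv_curve_add_int t k]
  have hb : b < t + k := by
    by_contra hle
    exact h4 _ ⟨hk.1, not_lt.1 hle⟩ ht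
  refine ⟨h6 _ ⟨hb.le, hk.2.le⟩, Filter.EventuallyEq.deriv_eq ?_⟩
  filter_upwards [Ioo_mem_nhds hb hk.2] with x hx
  exact h6 x ⟨hx.1.le, hx.2.le⟩

lemma Detour.hasCodeAt (h : Detour D D') (hw : D.HasCodeAt w t₀ τ c) : D'.HasCodeAt w t₀ τ c := by
  have hr : D'.real = D.real := by
    obtain ⟨a, b, h1, h2, h3, -⟩ := h
    exact h3
  refine hw.congr hr (fun t ht => ?_) h.congr
  rw [← (h.symm.congr t ht).1] at ht
  rwa [hr] at ht

lemma planeDet_transport_neg_iff {F : Plane ≃ Plane} {h : ℝ → ℝ} (hF : IsPlaneDiffeo F)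
    (hj : ∀ p, 0 < jac (fderiv ℝ F p)) (hh : IsCircleReparam h) (D : VirtualDiagram)
    (hc : ∀ t, D'.curve t = F (D.curve (h t))) (s t : ℝ) (hst : D.curve (h s) = D.curve (h t)) :
    planeDet (deriv D'.curve s) (deriv D'.curve t) < 0 ↔
      planeDet (deriv D.curve (h s)) (deriv D.curve (h t)) < 0 := by
  have hD : D'.curve = fun t => F (D.curve (h t)) := funext hc
  have h1 := hh.hasDerivAt (D.differentiable (h t))
  have h2 := hh.hasDerivAt (D.differentiable (h s))
  rw [hD, (hF.hasDerivAt h1.differentiableAt).deriv, h1.deriv,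
    (hF.hasDerivAt h2.differentiableAt).deriv, h2.deriv, hst, planeDet_map, planeDet_smul_smul,
    ← mul_assoc]
  have : 0 < jac (fderiv ℝ F (D.curve (h t))) * (deriv h s * deriv h t) :=
    mul_pos (hj _) (mul_pos (hh.2.1 _) (hh.2.1 _))
  exact ⟨fun h => by nlinarith, fun h => mul_neg_of_pos_of_neg this h⟩

lemma Isotopic.hasGaussCode_iff (h : Isotopic D D') : D.HasGaussCode w ↔ D'.HasGaussCode w := by
  obtain ⟨Φ, h, hΦ, hh, hc, hr⟩ := h
  have hsgn := planeDet_transport_neg_iff (hΦ.isPlaneDiffeo 1) hΦ.jac_pos hh D hc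
  constructor
  · rintro ⟨t₀, τ, c, hw⟩
    exact (HasCodeAt.transport hw hh.orderIso hh.2.2 (Φ 1) hc hr hsgn).hasGaussCode
  · rintro ⟨t₀, τ, c, hw⟩
    refine (HasCodeAt.transport (D' := D) hw hh.orderIso.symm hh.symm.2.2 (Φ 1).symm
      (fun t => ?_) ?_ fun s t hst => ?_).hasGaussCode
    · rw [hc, ← hh.orderIso_apply, OrderIso.apply_symm_apply, Equiv.symm_apply_apply]
    · rw [hr, Equiv.symm_image_image]
    · rw [hc, hc] at hst
      rw [hsgn _ _ ((Φ 1).injective hst), ← hh.orderIso_apply, ← hh.orderIso_apply,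
        OrderIso.apply_symm_apply, OrderIso.apply_symm_apply]

theorem StrictEquiv.hasGaussCode_iff (h : StrictEquiv D D') :
    D.HasGaussCode w ↔ D'.HasGaussCode w := by
  induction h with
  | rel D D' h =>
    rcases h with h | h
    · exact h.hasGaussCode_iff
    · exact ⟨fun ⟨t₀, τ, c, hw⟩ => ⟨t₀, τ, c, h.hasCodeAt hw⟩,
        fun ⟨t₀, τ, c, hw⟩ => ⟨t₀, τ, c, h.symm.hasCodeAt hw⟩⟩
  | refl => exact Iff.rfl
  | symm _ _ _ ih => exact ih.symm
  | trans _ _ _ _ _ ih1 ih2 => exact ih1.trans ih2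

lemma HasCodeAt.map (hw : D.HasCodeAt w t₀ τ c) {Φ : ℝ → Plane ≃ Plane} (hΦ : IsPlaneIsotopy Φ) :
    (D.map (Φ 1) (hΦ.isPlaneDiffeo 1)).HasCodeAt w t₀ τ (Φ 1 ∘ c) := by
  have := hw.transport (D' := D.map (Φ 1) (hΦ.isPlaneDiffeo 1)) (OrderIso.refl ℝ) (fun _ => rfl)
    (Φ 1) (fun _ => rfl) rfl
    (planeDet_transport_neg_iff (hΦ.isPlaneDiffeo 1) hΦ.jac_pos isCircleReparam_id D fun _ => rfl)
  exact this

lemma HasCodeAt.reparam (hw : D.HasCodeAt w t₀ τ c) {h : ℝ → ℝ} (hh : IsCircleReparam h) :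
    (D.reparam h hh).HasCodeAt w (hh.orderIso.symm t₀) (hh.orderIso.symm ∘ τ) c := by
  have := hw.transport (D' := D.reparam h hh) hh.orderIso hh.2.2 (Equiv.refl _) (fun _ => rfl)
    rfl
    (planeDet_transport_neg_iff isPlaneDiffeo_refl (fun p => by
      have : (⇑(Equiv.refl Plane)) = id := rfl
      rw [this, fderiv_id]; simp [jac, planeDet]) hh D fun _ => rfl)
  exact this

end VirtualDiagram

/-! ### Shears -/

/-- The shear `(x, y) ↦ (x, y + p x)`. -/
def shearY (p : ℝ → ℝ) : Plane ≃ Plane where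
  toFun z := (z.1, z.2 + p z.1)
  invFun z := (z.1, z.2 - p z.1)
  left_inv z := by simp
  right_inv z := by simp

/-- The shear `(x, y) ↦ (x + q y, y)`. -/
def shearX (q : ℝ → ℝ) : Plane ≃ Plane where
  toFun z := (z.1 + q z.2, z.2)
  invFun z := (z.1 - q z.2, z.2)
  left_inv z := by simp
  right_inv z := by simp

lemma shearY_isotopy {p : ℝ → ℝ} (hp : ContDiff ℝ ∞ p) :
    IsPlaneIsotopy fun s => shearY fun x => s * p x := by
  refine ⟨?_, ?_, ?_⟩
  · change ContDiff ℝ ∞ fun q : ℝ × Plane => (q.2.1, q.2.2 + q.1 * p q.2.1)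
    fun_prop
  · change ContDiff ℝ ∞ fun q : ℝ × Plane => (q.2.1, q.2.2 - q.1 * p q.2.1)
    fun_prop
  · ext z <;> simp [shearY]

lemma shearX_isotopy {q : ℝ → ℝ} (hq : ContDiff ℝ ∞ q) :
    IsPlaneIsotopy fun s => shearX fun y => s * q y := by
  refine ⟨?_, ?_, ?_⟩
  · change ContDiff ℝ ∞ fun r : ℝ × Plane => (r.2.1 + r.1 * q r.2.2, r.2.2)
    fun_prop
  · change ContDiff ℝ ∞ fun r : ℝ × Plane => (r.2.1 - r.1 * q r.2.2, r.2.2)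
    fun_prop
  · ext z <;> simp [shearX]

namespace VirtualDiagram

variable {n : ℕ} {D : VirtualDiagram} {w : GaussCode n} {t₀ : ℝ} {τ : Fin (2 * n) → ℝ}
  {c : Fin n → Plane}

lemma HasCodeAt.exists_shearY (hw : D.HasCodeAt w t₀ τ c) {p : ℝ → ℝ} (hp : ContDiff ℝ ∞ p) :
    ∃ D' : VirtualDiagram, StrictEquiv D D' ∧
      (∀ t, D'.curve t = ((D.curve t).1, (D.curve t).2 + p (D.curve t).1)) ∧
      D'.HasCodeAt w t₀ τ (fun j => ((c j).1, (c j).2 + p (c j).1)) := by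
  refine ⟨_, D.strictEquiv_map (shearY_isotopy hp), fun t => ?_, ?_⟩
  · simp [shearY]
  · have := hw.map (shearY_isotopy hp)
    simpa [shearY, Function.comp_def] using this

lemma HasCodeAt.exists_shearX (hw : D.HasCodeAt w t₀ τ c) {q : ℝ → ℝ} (hq : ContDiff ℝ ∞ q) :
    ∃ D' : VirtualDiagram, StrictEquiv D D' ∧
      (∀ t, D'.curve t = ((D.curve t).1 + q (D.curve t).2, (D.curve t).2)) ∧
      D'.HasCodeAt w t₀ τ (fun j => ((c j).1 + q (c j).2, (c j).2)) := by
  refine ⟨_, D.strictEquiv_map (shearX_isotopy hq), fun t => ?_, ?_⟩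
  · simp [shearX]
  · have := hw.map (shearX_isotopy hq)
    simpa [shearX, Function.comp_def] using this

end VirtualDiagram

/-! ### Periodic extensions and reparametrizations with prescribed germs -/

/-- The `1`-periodic function that agrees with `f` on `[0, 1)`. -/
noncomputable def periodize {α : Type*} (f : ℝ → α) (t : ℝ) : α := f (Int.fract t)

lemma periodize_add_one {α : Type*} (f : ℝ → α) (t : ℝ) : periodize f (t + 1) = periodize f t := by
  simp [periodize]

lemma periodize_of_mem {α : Type*} (f : ℝ → α) {t : ℝ} (ht : t ∈ Set.Ico (0 : ℝ) 1) :
    periodize f t = f t := by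
  simp [periodize, Int.fract_eq_self.2 ht]

lemma periodize_eventuallyEq {α : Type*} (f : ℝ → α) {t : ℝ} (ht : t ∈ Set.Ioo (0 : ℝ) 1) :
    periodize f =ᶠ[𝓝 t] f := by
  filter_upwards [Ioo_mem_nhds ht.1 ht.2] with x hx
  exact periodize_of_mem f ⟨hx.1.le, hx.2⟩

lemma contDiff_of_periodic {F : Type*} [NormedAddCommGroup F] [NormedSpace ℝ F] {f : ℝ → F}
    (hf : ∀ t, f (t + 1) = f t) (h : ∀ t ∈ Set.Ico (0 : ℝ) 1, ContDiffAt ℝ ∞ f t) :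
    ContDiff ℝ ∞ f := by
  rw [contDiff_iff_contDiffAt]
  intro t
  have hp : f = fun x => f (x + (-⌊t⌋ : ℤ)) := by
    funext x
    exact (SameParam.apply_eq hf (SameParam.add_int x _)).symm
  rw [hp]
  have : ContDiffAt ℝ ∞ f (t + (-⌊t⌋ : ℤ)) := by
    apply h
    push_cast
    exact ⟨by linarith [Int.floor_le t], by linarith [Int.lt_floor_add_one t]⟩
  exact this.comp (g := f) t (f := fun x : ℝ => x + (-⌊t⌋ : ℤ))
    (contDiffAt_id.add contDiffAt_const)

lemma contDiff_periodize {F : Type*} [NormedAddCommGroup F] [NormedSpace ℝ F] {f : ℝ → F}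
    (hf : ContDiff ℝ ∞ f) {a b : ℝ} (ha : 0 < a) (hb : b < 1) (h : ∀ t, f t ≠ 0 → t ∈ Set.Icc a b) :
    ContDiff ℝ ∞ (periodize f) := by
  refine contDiff_of_periodic (periodize_add_one f) fun t ht => ?_
  rcases ht.1.eq_or_lt with h0 | h0
  · subst h0
    have : periodize f =ᶠ[𝓝 0] fun _ => 0 := by
      filter_upwards [Ioo_mem_nhds (show -(1 - b) < 0 by linarith) ha,
        Ioo_mem_nhds (show (-1 : ℝ) < 0 by norm_num) (zero_lt_one)] with x hx hx'
      by_contra hne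
      have h1 := h _ hne
      rcases lt_or_ge x 0 with hneg | hpos
      · have : Int.fract x = x + 1 := by
          rw [Int.fract_eq_iff]
          exact ⟨by linarith [hx'.1], by linarith, -1, by push_cast; ring⟩
        rw [this] at h1
        linarith [h1.2, hx.1]
      · rw [Int.fract_eq_self.2 ⟨hpos, hx'.2⟩] at h1
        linarith [h1.1, hx.2]
    exact contDiffAt_const.congr_of_eventuallyEq this
  · exact hf.contDiffAt.congr_of_eventuallyEq (periodize_eventuallyEq f ⟨h0, ht.2⟩)

lemma exists_pos_le_sub {N : ℕ} {T : ℕ → ℝ} (hT : ∀ j < N, T j < T (j + 1)) :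
    ∃ e > 0, ∀ j < N, e ≤ T (j + 1) - T j := by
  rcases N.eq_zero_or_pos with rfl | hN
  · exact ⟨1, one_pos, by simp⟩
  obtain ⟨i, hi, hmin⟩ := Finset.exists_min_image (Finset.range N) (fun j => T (j + 1) - T j)
    ⟨0, Finset.mem_range.2 hN⟩
  exact ⟨T (i + 1) - T i, sub_pos.2 (hT i (Finset.mem_range.1 hi)),
    fun j hj => hmin j (Finset.mem_range.2 hj)⟩

/-- `H` is the integral of a positive periodic density. Near `T j` the density is `deriv (g j)`;
elsewhere it is a small constant `s` plus a bump `θ j` in the middle of each gap, whose mass `c j`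
adjusts the integral over the gap to `S (j + 1) - S j`. In between, the density is a convex
combination of `s` and `deriv (g j)`, plus the bumps, and so is positive. -/
lemma exists_circleReparam_of_nat {N : ℕ} {T S : ℕ → ℝ} (hN : 0 < N) (hT : ∀ j < N, T j < T (j + 1))
    (hS : ∀ j < N, S j < S (j + 1)) (hT0 : T 0 = 0) (hT1 : T N = 1) (hS0 : S 0 = 0) (hS1 : S N = 1)
    {g : ℕ → ℝ → ℝ} (hg : ∀ j, ContDiff ℝ ∞ (g j))
    (hgT : ∀ j ∈ Finset.Ioo 0 N, g j (T j) = S j)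
    (hg' : ∀ j ∈ Finset.Ioo 0 N, 0 < deriv (g j) (T j)) :
    ∃ H, IsCircleReparam H ∧ H 0 = 0 ∧ ∀ j ∈ Finset.Ioo 0 N, H =ᶠ[𝓝 (T j)] g j := by
  obtain ⟨e, he, heT⟩ := exists_pos_le_sub hT
  obtain ⟨d, hd, hdS⟩ := exists_pos_le_sub hS
  have hmono : ∀ i j, i < j → j ≤ N → T i + e ≤ T j := by
    intro i j hij
    induction j, hij using Nat.le_induction with
    | base => intro h; linarith [heT i (by omega)]
    | succ j hj ih => intro h; linarith [heT j (by omega), ih (by omega)]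
  have hmono' : ∀ i j, i ≤ j → j ≤ N → T i ≤ T j := by
    intro i j hij hj
    rcases hij.eq_or_lt with rfl | h
    · exact le_rfl
    · linarith [hmono i j h hj]
  have hgc : ∀ j, Continuous (deriv (g j)) := fun j => (hg j).continuous_deriv (by simp)
  let M : ℝ := ∑ j ∈ Finset.Ioo 0 N, (deriv (g j) (T j) + 1)
  have hM : ∀ j ∈ Finset.Ioo 0 N, deriv (g j) (T j) + 1 ≤ M := by
    intro j hj
    exact Finset.single_le_sum (f := fun j => deriv (g j) (T j) + 1)
      (fun i hi => by linarith [hg' i hi]) hj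
  have hM0 : 0 ≤ M := Finset.sum_nonneg fun i hi => by linarith [hg' i hi]
  obtain ⟨ε₀, hε₀, hball⟩ : ∃ ε > 0, ∀ j ∈ Finset.Ioo 0 N, ∀ t, |t - T j| < ε →
      0 < deriv (g j) t ∧ deriv (g j) t ≤ M := by
    have h1 : ∀ j ∈ Finset.Ioo 0 N, ∀ᶠ x in 𝓝 (0 : ℝ),
        0 < deriv (g j) (x + T j) ∧ deriv (g j) (x + T j) ≤ M := by
      intro j hj
      have hc : ContinuousAt (fun x => deriv (g j) (x + T j)) 0 := by
        have := hgc j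
        fun_prop
      have h2 := hc.eventually (lt_mem_nhds (a := 0) (by simpa using hg' j hj))
      have h3 := hc.eventually (gt_mem_nhds
        (show deriv (g j) (0 + T j) < deriv (g j) (T j) + 1 by rw [zero_add]; linarith))
      filter_upwards [h2, h3] with x hx1 hx2
      exact ⟨hx1, hx2.le.trans (hM j hj)⟩
    rw [← Filter.eventually_all_finset] at h1
    obtain ⟨ε, hε, h4⟩ := Metric.eventually_nhds_iff.1 h1
    refine ⟨ε, hε, fun j hj t ht => ?_⟩
    have := h4 (y := t - T j) (by simpa [Real.dist_eq] using ht) j hj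
    simpa using this
  -- The three bounds keep the derivatives of the germs in `(0, M]`, separate the bumps at the `T j`
  -- from those in the middle of the gaps, and limit the total mass near the `T j` to `d / 4`.
  obtain ⟨ε, hε, hεε₀, hεe, hεd⟩ : ∃ ε > 0, ε ≤ ε₀ ∧ ε ≤ e / 4 ∧ N * (M * (2 * ε)) ≤ d / 4 := by
    refine ⟨min (min ε₀ (e / 4)) (d / (8 * (N * M + 1))), ?_, ?_, ?_, ?_⟩
    · have : 0 < (N : ℝ) * M + 1 := by positivity
      positivity
    · exact (min_le_left _ _).trans (min_le_left _ _)
    · exact (min_le_left _ _).trans (min_le_right _ _)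
    · have h1 : 0 < (N : ℝ) * M + 1 := by positivity
      have h2 := min_le_right (min ε₀ (e / 4)) (d / (8 * (N * M + 1)))
      have h3 : (N : ℝ) * M ≤ N * M + 1 := by linarith
      set x := min (min ε₀ (e / 4)) (d / (8 * (N * M + 1)))
      have h4 : x * (8 * (N * M + 1)) ≤ d := (le_div_iff₀ (by positivity)).1 h2
      have hx : 0 ≤ x := by positivity
      nlinarith [mul_le_mul_of_nonneg_left h3 hx]
  let ρ : (j : ℕ) → ContDiffBump (T j) := fun j => ⟨ε / 2, ε, by positivity, by linarith⟩
  let θ : (j : ℕ) → ContDiffBump ((T j + T (j + 1)) / 2) := fun j =>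
    ⟨e / 8, e / 4, by positivity, by linarith⟩
  let θn : ℕ → ℝ → ℝ := fun j => (θ j).normed volume
  let s : ℝ := d / 4
  have hs : 0 < s := by positivity
  have hρ0 : ∀ j t, ρ j t ≠ 0 → |t - T j| < ε := by
    intro j t ht
    have : t ∈ Function.support (ρ j) := ht
    rw [(ρ j).support_eq] at this
    simpa [Real.dist_eq] using this
  have hθ0 : ∀ j t, θn j t ≠ 0 → |t - (T j + T (j + 1)) / 2| < e / 4 := by
    intro j t ht
    have : t ∈ Function.support ((θ j).normed volume) := ht
    rw [(θ j).support_normed_eq] at this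
    simpa [Real.dist_eq] using this
  have hθpos : ∀ j t, 0 ≤ θn j t := fun j t => (θ j).nonneg_normed t
  let k₀ : ℝ → ℝ := fun t => ∑ j ∈ Finset.Ioo 0 N, ρ j t * (deriv (g j) t - s)
  have hk₀ : ContDiff ℝ ∞ k₀ := ContDiff.sum fun j _ =>
    (ρ j).contDiff.mul (((contDiff_infty_iff_deriv.1 (hg j)).2).sub contDiff_const)
  let I : ℕ → ℝ := fun j => ∫ t in T j..T (j + 1), (s + k₀ t)
  let c : ℕ → ℝ := fun j => S (j + 1) - S j - I j
  have hI : ∀ j < N, I j ≤ d / 2 := by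
    intro j hj
    have h1 : I j ≤ ∫ t in T j..T (j + 1), (s + ∑ i ∈ Finset.Ioo 0 N, M * ρ i t) := by
      refine intervalIntegral.integral_mono_on (hT j hj).le
        ((continuous_const.add hk₀.continuous).intervalIntegrable _ _)
        (Continuous.intervalIntegrable ?_ _ _) fun t _ => ?_
      · exact continuous_const.add (continuous_finsetSum _ fun i _ =>
          continuous_const.mul (ρ i).continuous)
      · refine add_le_add_right (Finset.sum_le_sum fun i hi => ?_) _
        by_cases h0 : ρ i t = 0
        · simp [h0]
        · have := (hball i hi t ((hρ0 i t h0).trans_le hεε₀)).2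
          rw [mul_comm]
          exact mul_le_mul_of_nonneg_right (by linarith) (ρ i).nonneg
    refine h1.trans ?_
    have hρi : ∀ i, IntervalIntegrable (fun t => M * ρ i t) volume (T j) (T (j + 1)) := fun i =>
      (continuous_const.mul (ρ i).continuous).intervalIntegrable _ _
    have hρs : IntervalIntegrable (fun t => ∑ i ∈ Finset.Ioo 0 N, M * ρ i t) volume (T j)
        (T (j + 1)) := (continuous_finsetSum _ fun i _ =>
      continuous_const.mul (ρ i).continuous).intervalIntegrable _ _
    rw [intervalIntegral.integral_add intervalIntegrable_const hρs,
      intervalIntegral.integral_finsetSum (fun i _ => hρi i)]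
    have h2 : ∀ i ∈ Finset.Ioo 0 N, ∫ t in T j..T (j + 1), M * ρ i t ≤ M * (2 * ε) := by
      intro i _
      rw [intervalIntegral.integral_const_mul]
      refine mul_le_mul_of_nonneg_left ?_ hM0
      rw [intervalIntegral.integral_of_le (hT j hj).le]
      refine (setIntegral_le_integral (ρ i).integrable
        (Filter.Eventually.of_forall fun t => (ρ i).nonneg)).trans ?_
      refine ((ρ i).integral_le_measure_closedBall volume).trans ?_
      rw [Real.volume_real_closedBall hε.le]
    have h3 := Finset.sum_le_card_nsmul _ _ _ h2
    rw [nsmul_eq_mul] at h3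
    have h4 : (((Finset.Ioo 0 N).card : ℕ) : ℝ) * (M * (2 * ε)) ≤ N * (M * (2 * ε)) := by
      refine mul_le_mul_of_nonneg_right ?_ (by positivity)
      rw [Nat.card_Ioo]
      exact_mod_cast (by omega : N - 0 - 1 ≤ N)
    have h5 : T (j + 1) - T j ≤ 1 := by
      linarith [hmono' 0 j (by omega) hj.le, hmono' (j + 1) N (by omega) le_rfl]
    have h6 : (∫ _ in T j..T (j + 1), s) ≤ d / 4 := by
      rw [intervalIntegral.integral_const, smul_eq_mul]
      exact mul_le_of_le_one_left hs.le h5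
    linarith
  have hc : ∀ j < N, 0 ≤ c j := fun j hj => by
    simp only [c]; linarith [hI j hj, hdS j hj]
  let κ : ℝ → ℝ := fun t => k₀ t + ∑ j ∈ Finset.range N, c j * θn j t
  have hκ : ContDiff ℝ ∞ κ := hk₀.add (ContDiff.sum fun j _ =>
    contDiff_const.mul (θ j).contDiff_normed)
  let k : ℝ → ℝ := fun t => s + periodize κ t
  have hks : ContDiff ℝ ∞ k := by
    refine contDiff_const.add (contDiff_periodize hκ (a := e / 4) (b := 1 - e / 4) (by positivity)
      (by linarith) fun t ht => ?_)
    by_contra hmem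
    apply ht
    simp only [κ, k₀]
    rw [Finset.sum_eq_zero, Finset.sum_eq_zero, add_zero]
    · intro j hj
      have hj := Finset.mem_range.1 hj
      by_contra h0
      have h1 := abs_lt.1 (hθ0 j t (right_ne_zero_of_mul h0))
      have h2 := hmono j (j + 1) (by omega) (by omega)
      have h3 := hmono' 0 j (by omega) (by omega)
      have h4 := hmono' (j + 1) N (by omega) (by omega)
      exact hmem ⟨by linarith, by linarith⟩
    · intro j hj
      have hj := Finset.mem_Ioo.1 hj
      by_contra h0
      have h1 := abs_lt.1 (hρ0 j t (left_ne_zero_of_mul h0))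
      have h3 := hmono 0 j (by omega) (by omega)
      have h4 := hmono j N (by omega) (by omega)
      exact hmem ⟨by linarith, by linarith⟩
  have hkp : ∀ t, k (t + 1) = k t := fun t => by simp only [k, periodize_add_one]
  have hk01 : ∀ t ∈ Set.Ico (0 : ℝ) 1, k t = s + κ t := fun t ht => by
    simp only [k, periodize_of_mem κ ht]
  have hsep : ∀ i ≤ N, ∀ j ≤ N, ∀ t, |t - T i| < ε → |t - T j| < ε → i = j := by
    intro i hi j hj t h1 h2
    have h1 := abs_lt.1 h1
    have h2 := abs_lt.1 h2
    by_contra hne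
    rcases Nat.lt_or_gt_of_ne hne with h | h
    · linarith [hmono i j h hj]
    · linarith [hmono j i h hi]
  have hk₀' : ∀ i ∈ Finset.Ioo 0 N, ∀ t, |t - T i| < ε →
      k₀ t = ρ i t * (deriv (g i) t - s) := by
    intro i hi t ht
    refine Finset.sum_eq_single i (fun j hj hji => ?_) (fun h => absurd hi h)
    by_contra h0
    exact hji (hsep j (Finset.mem_Ioo.1 hj).2.le i (Finset.mem_Ioo.1 hi).2.le t
      (hρ0 j t (left_ne_zero_of_mul h0)) ht)
  have hk₀pos : ∀ t, 0 < s + k₀ t := by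
    intro t
    by_cases hex : ∃ i ∈ Finset.Ioo 0 N, |t - T i| < ε
    · obtain ⟨i, hi, ht⟩ := hex
      rw [hk₀' i hi t ht]
      have h1 := (hball i hi t (ht.trans_le hεε₀)).1
      have h2 : 0 ≤ ρ i t := (ρ i).nonneg
      have h3 : ρ i t ≤ 1 := (ρ i).le_one
      rcases h3.eq_or_lt with h4 | h4
      · rw [h4]; linarith
      · nlinarith [mul_nonneg h2 h1.le]
    · have : k₀ t = 0 := by
        refine Finset.sum_eq_zero fun j hj => ?_
        by_contra h0
        exact hex ⟨j, hj, hρ0 j t (left_ne_zero_of_mul h0)⟩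
      rw [this]; linarith
  have hkpos : ∀ t, 0 < k t := by
    intro t
    have h1 : 0 ≤ ∑ j ∈ Finset.range N, c j * θn j (Int.fract t) :=
      Finset.sum_nonneg fun j hj => mul_nonneg (hc j (Finset.mem_range.1 hj)) (hθpos j _)
    have h2 := hk₀pos (Int.fract t)
    simp only [k, periodize, κ]
    linarith
  let H : ℝ → ℝ := fun t => ∫ x in (0 : ℝ)..t, k x
  have hHd : ∀ t, HasDerivAt H (k t) t := fun t =>
    intervalIntegral.integral_hasDerivAt_right (hks.continuous.intervalIntegrable _ _)
      (hks.continuous.stronglyMeasurableAtFilter _ _) hks.continuous.continuousAt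
  have hHderiv : deriv H = k := funext fun t => (hHd t).deriv
  have hgap : ∀ j < N, ∫ x in T j..T (j + 1), k x = S (j + 1) - S j := by
    intro j hj
    have h1 : ∫ x in T j..T (j + 1), k x =
        ∫ x in T j..T (j + 1), ((s + k₀ x) + c j * θn j x) := by
      refine intervalIntegral.integral_congr_ae ?_
      have hne : ∀ᵐ x : ℝ, x ≠ 1 := by simp [ae_iff]
      filter_upwards [hne] with x hx1 hx
      rw [Set.uIoc_of_le (hT j hj).le] at hx
      rw [hk01 x ⟨?_, ?_⟩]
      · simp only [κ]
        rw [Finset.sum_eq_single j, add_assoc]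
        · intro i hi hij
          have hi := Finset.mem_range.1 hi
          by_contra h0
          have h2 := abs_lt.1 (hθ0 i x (right_ne_zero_of_mul h0))
          have h3 := heT i hi
          rcases Nat.lt_or_gt_of_ne hij with h | h
          · linarith [hmono' (i + 1) j (by omega) (by omega), hx.1]
          · linarith [hmono' (j + 1) i (by omega) (by omega), hx.2]
        · intro h; exact absurd (Finset.mem_range.2 hj) h
      · linarith [hmono' 0 j (by omega) hj.le, hx.1]
      · exact lt_of_le_of_ne (by linarith [hmono' (j + 1) N (by omega) le_rfl, hx.2]) hx1
    have i1 : IntervalIntegrable (fun x => s + k₀ x) volume (T j) (T (j + 1)) :=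
      (continuous_const.add hk₀.continuous).intervalIntegrable _ _
    have i2 : IntervalIntegrable (fun x => c j * θn j x) volume (T j) (T (j + 1)) :=
      (continuous_const.mul (θ j).continuous_normed).intervalIntegrable _ _
    have i3 : ∫ x in T j..T (j + 1), θn j x = 1 := by
      rw [intervalIntegral.integral_eq_integral_of_support_subset, (θ j).integral_normed]
      intro x hx
      have h2 := abs_lt.1 (hθ0 j x hx)
      have h3 := heT j hj
      exact ⟨by linarith, by linarith⟩
    rw [h1, intervalIntegral.integral_add i1 i2,
      intervalIntegral.integral_const_mul, i3]
    simp only [c, I]; ring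
  have hHT : ∀ j ≤ N, H (T j) = S j := by
    intro j
    induction j with
    | zero => intro _; simp [H, hT0, hS0]
    | succ j ih =>
      intro hj
      have h1 := intervalIntegral.integral_add_adjacent_intervals
        (hks.continuous.intervalIntegrable (μ := volume) 0 (T j))
        (hks.continuous.intervalIntegrable (T j) (T (j + 1)))
      rw [hgap j (by omega)] at h1
      have h2 := ih (by omega)
      simp only [H] at h2 ⊢
      linarith
  refine ⟨H, ⟨contDiff_infty_iff_deriv.2 ⟨fun t => (hHd t).differentiableAt, by rwa [hHderiv]⟩,
    fun t => by rw [hHderiv]; exact hkpos t, fun t => ?_⟩, intervalIntegral.integral_same,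
    fun j hj => ?_⟩
  · have h1 := intervalIntegral.integral_add_adjacent_intervals
        (hks.continuous.intervalIntegrable (μ := volume) 0 t)
        (hks.continuous.intervalIntegrable t (t + 1))
    have h2 := Function.Periodic.intervalIntegral_add_eq (f := k) (T := 1) hkp t 0
    rw [zero_add] at h2
    have h3 := hHT N le_rfl
    rw [hT1, hS1] at h3
    simp only [H] at h3 ⊢
    linarith
  · have hj' := Finset.mem_Ioo.1 hj
    have hkg : ∀ t ∈ Metric.ball (T j) (ε / 2), k t = deriv (g j) t := by
      intro t ht
      rw [Metric.mem_ball, Real.dist_eq] at ht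
      have h1 := abs_lt.1 ht
      have h2 := hmono 0 j hj'.1 hj'.2.le
      have h3 := hmono j N hj'.2 le_rfl
      rw [hk01 t ⟨by linarith, by linarith⟩]
      simp only [κ]
      rw [hk₀' j hj t (by linarith), Finset.sum_eq_zero]
      · have : ρ j t = 1 := (ρ j).one_of_mem_closedBall (by
          rw [Metric.mem_closedBall, Real.dist_eq]; exact ht.le)
        rw [this]; ring
      · intro i hi
        have hi := Finset.mem_range.1 hi
        by_contra h0
        have h4 := abs_lt.1 (hθ0 i t (right_ne_zero_of_mul h0))
        have h5 := heT i hi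
        rcases Nat.lt_or_ge i j with h | h
        · linarith [hmono' (i + 1) j (by omega) (by omega)]
        · linarith [hmono' j i (by omega) (by omega)]
    filter_upwards [Metric.ball_mem_nhds (T j) (half_pos hε)] with t ht
    have := IsOpen.eqOn_of_deriv_eq (f := H) (g := g j) Metric.isOpen_ball
      (convex_ball (T j) (ε / 2)).isPreconnected
      (fun x _ => (hHd x).differentiableAt.differentiableWithinAt)
      (((hg j).differentiable (by simp)).differentiableOn)
      (fun x hx => by rw [hHderiv]; exact hkg x hx) (Metric.mem_ball_self (half_pos hε))
      (by rw [hHT j hj'.2.le, hgT j hj])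
    exact this ht

theorem exists_circleReparam {m : ℕ} {τ σ : Fin m → ℝ} (hτ : StrictMono τ) (hσ : StrictMono σ)
    (hτ01 : ∀ i, τ i ∈ Set.Ioo (0 : ℝ) 1) (hσ01 : ∀ i, σ i ∈ Set.Ioo (0 : ℝ) 1)
    {g : Fin m → ℝ → ℝ} (hg : ∀ i, ContDiff ℝ ∞ (g i)) (hgτ : ∀ i, g i (τ i) = σ i)
    (hg' : ∀ i, 0 < deriv (g i) (τ i)) :
    ∃ H, IsCircleReparam H ∧ H 0 = 0 ∧ ∀ i, H =ᶠ[𝓝 (τ i)] g i := by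
  -- The points are shifted by one index, with 0 put in front and 1 at the end.
  let ext : (Fin m → ℝ) → ℕ → ℝ := fun τ j =>
    if j = 0 then 0 else if h : j - 1 < m then τ ⟨j - 1, h⟩ else 1
  have hext : ∀ τ : Fin m → ℝ, StrictMono τ → (∀ i, τ i ∈ Set.Ioo (0 : ℝ) 1) →
      ∀ j < m + 1, ext τ j < ext τ (j + 1) := by
    intro τ hτ h01 j hj
    rcases j with _ | j
    · simp only [ext]
      by_cases hm : 0 < m
      · simpa [hm] using (h01 ⟨0, hm⟩).1
      · simp [hm]
    · simp only [ext]
      have h1 : j < m := by omega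
      by_cases h2 : j + 1 < m
      · simpa [h1, h2] using hτ (show (⟨j, h1⟩ : Fin m) < ⟨j + 1, h2⟩ by simp)
      · simpa [h1, h2] using (h01 ⟨j, h1⟩).2
  let G : ℕ → ℝ → ℝ := fun j => if h : j - 1 < m then g ⟨j - 1, h⟩ else fun _ => 0
  obtain ⟨H, hH, hH0, hHg⟩ := exists_circleReparam_of_nat (N := m + 1) (T := ext τ) (S := ext σ) (g := G)
    (by omega) (hext τ hτ hτ01) (hext σ hσ hσ01) (by simp [ext]) (by simp [ext]) (by simp [ext])
    (by simp [ext]) (fun j => by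
      by_cases h : j - 1 < m
      · simp only [G, h, dite_true]; exact hg _
      · simp only [G, h, dite_false]; exact contDiff_const)
    (fun j hj => by
      have := Finset.mem_Ioo.1 hj
      have h1 : j - 1 < m := by omega
      have h2 : j ≠ 0 := by omega
      simp only [G, ext, h1, h2, dite_true, if_false, hgτ])
    (fun j hj => by
      have := Finset.mem_Ioo.1 hj
      have h1 : j - 1 < m := by omega
      have h2 : j ≠ 0 := by omega
      simp only [G, ext, h1, h2, dite_true, if_false, hg'])
  refine ⟨H, hH, hH0, fun i => ?_⟩
  have := hHg (i + 1) (Finset.mem_Ioo.2 ⟨by omega, by omega⟩)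
  simpa [ext, G] using this

/-! ### Standard position -/

lemma exists_contDiff_eventuallyEq {n : ℕ} {x : Fin n → ℝ} (hx : Function.Injective x)
    {f : Fin n → ℝ → ℝ} (hf : ∀ j, ContDiff ℝ ∞ (f j)) :
    ∃ p : ℝ → ℝ, ContDiff ℝ ∞ p ∧ ∀ j, p =ᶠ[𝓝 (x j)] f j := by
  obtain ⟨r, hr, hsep⟩ : ∃ r > 0, ∀ i j, i ≠ j → r ≤ |x i - x j| := by
    have h1 : ∀ i j, ∀ᶠ r in 𝓝 (0 : ℝ), i ≠ j → r < |x i - x j| := by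
      intro i j
      by_cases hij : i = j
      · simp [hij]
      · filter_upwards [gt_mem_nhds (abs_pos.2 (sub_ne_zero.2 (hx.ne hij)))] with r hr _
        exact hr
    have h2 : ∀ᶠ r in 𝓝[>] (0 : ℝ), ∀ i j, i ≠ j → r < |x i - x j| :=
      nhdsWithin_le_nhds (Filter.eventually_all.2 fun i => Filter.eventually_all.2 (h1 i))
    obtain ⟨r, hr, hr0⟩ := (h2.and self_mem_nhdsWithin).exists
    exact ⟨r, hr0, fun i j hij => (hr i j hij).le⟩
  let ρ : (j : Fin n) → ContDiffBump (x j) := fun j =>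
    ⟨r / 4, r / 2, by positivity, by linarith⟩
  refine ⟨fun t => ∑ j, ρ j t * f j t, ContDiff.sum fun j _ => (ρ j).contDiff.mul (hf j),
    fun j => ?_⟩
  filter_upwards [Metric.ball_mem_nhds (x j) (show 0 < r / 4 by positivity)] with t ht
  rw [Finset.sum_eq_single j]
  · rw [(ρ j).one_of_mem_closedBall (Metric.ball_subset_closedBall ht), one_mul]
  · intro i _ hij
    rw [(ρ i).zero_of_le_dist, zero_mul]
    rw [Metric.mem_ball, Real.dist_eq] at ht
    rw [Real.dist_eq]
    have h1 := hsep i j hij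
    have h2 := abs_sub_abs_le_abs_sub (x i - x j) (t - x j)
    have h3 : |(x i - x j) - (t - x j)| = |t - x i| := by
      rw [← abs_neg]; congr 1; ring
    rw [h3] at h2
    change r / 2 ≤ |t - x i|
    linarith
  · simp

namespace GaussCode

variable {n : ℕ} (w : GaussCode n)

lemma letter_bijective : Function.Bijective w.letter := by
  rw [Fintype.bijective_iff_surjective_and_card]
  refine ⟨w.2, ?_⟩
  simp [mul_comm]

lemma letter_injective : Function.Injective w.letter := w.letter_bijective.1

@[simp] lemma letter_pos (x : Fin n × Side) : w.letter (w.pos x) = x :=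
  Function.surjInv_eq w.2 x

@[simp] lemma pos_letter (i : Fin (2 * n)) : w.pos (w.letter i) = i :=
  w.letter_injective (by simp)

end GaussCode

namespace VirtualDiagram

variable {n : ℕ} {D : VirtualDiagram} {w : GaussCode n} {t₀ : ℝ} {τ : Fin (2 * n) → ℝ}
  {c : Fin n → Plane}

lemma HasCodeAt.curve_eq (h : D.HasCodeAt w t₀ τ c) (i : Fin (2 * n)) :
    D.curve (τ i) = c (w.letter i).1 := (h.2.2.2.2.2 i).1

lemma HasCodeAt.mem_Ioo (h : D.HasCodeAt w t₀ τ c) (i : Fin (2 * n)) :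
    τ i ∈ Set.Ioo t₀ (t₀ + 1) :=
  (h.2.2.2.2.1 ▸ Set.mem_range_self i :
    τ i ∈ {t | t ∈ Set.Ioo t₀ (t₀ + 1) ∧ D.curve t ∈ D.real}).1

lemma HasCodeAt.curve_mem (h : D.HasCodeAt w t₀ τ c) (i : Fin (2 * n)) :
    D.curve (τ i) ∈ D.real :=
  (h.2.2.2.2.1 ▸ Set.mem_range_self i :
    τ i ∈ {t | t ∈ Set.Ioo t₀ (t₀ + 1) ∧ D.curve t ∈ D.real}).2

lemma HasCodeAt.exists_eq (h : D.HasCodeAt w t₀ τ c) {t : ℝ} (ht : t ∈ Set.Ioo t₀ (t₀ + 1))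
    (hr : D.curve t ∈ D.real) : ∃ i, τ i = t := by
  have : t ∈ Set.range τ := by rw [h.2.2.2.2.1]; exact ⟨ht, hr⟩
  exact this

lemma HasCodeAt.strictMono (h : D.HasCodeAt w t₀ τ c) : StrictMono τ := h.2.2.2.1

lemma HasCodeAt.not_sameParam (h : D.HasCodeAt w t₀ τ c) {i j : Fin (2 * n)} (hij : i ≠ j) :
    ¬ SameParam (τ i) (τ j) := by
  rintro ⟨k, hk⟩
  have h1 := h.mem_Ioo i
  have h2 := h.mem_Ioo j
  have h3 : (k : ℝ) < 1 := by linarith [h1.2, h2.1]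
  have h4 : (-1 : ℝ) < k := by linarith [h1.1, h2.2]
  have h5 : k < 1 := by exact_mod_cast h3
  have h6 : -1 < k := by exact_mod_cast h4
  have h7 : k = 0 := by omega
  rw [h7] at hk
  exact hij (h.strictMono.injective (by simpa using hk))

lemma HasCodeAt.planeDet_neg (h : D.HasCodeAt w t₀ τ c) (j : Fin n) :
    planeDet (deriv D.curve (τ (w.pos (j, Side.L)))) (deriv D.curve (τ (w.pos (j, Side.R)))) < 0 := by
  have hne : w.pos (j, Side.R) ≠ w.pos (j, Side.L) := by
    intro he
    have := congrArg w.letter he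
    simp at this
  refine ((h.2.2.2.2.2 (w.pos (j, Side.L))).2 _ ?_ (h.not_sameParam hne)).1 (by simp)
  rw [h.curve_eq, h.curve_eq]
  simp

lemma HasCodeAt.exists_shift_zero (h : D.HasCodeAt w t₀ τ c) :
    ∃ D' : VirtualDiagram, ∃ τ', StrictEquiv D D' ∧ D'.HasCodeAt w 0 τ' c := by
  have hh := isCircleReparam_add_const t₀
  refine ⟨_, hh.orderIso.symm ∘ τ, D.strictEquiv_reparam hh, ?_⟩
  have h0 : hh.orderIso.symm t₀ = 0 := by
    rw [OrderIso.symm_apply_eq]; simp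
  have := h.reparam hh
  rwa [h0] at this

/-- The diagram is reparametrized by the inverse of a map with the germs `g i`. The last clause
expresses that the new curve at `g i t` is the old one at `t`, in a form that transfers any local
property to the new parameter. -/
lemma HasCodeAt.exists_reparam (h : D.HasCodeAt w 0 τ c) {σ : Fin (2 * n) → ℝ} (hσ : StrictMono σ)
    (hσ01 : ∀ i, σ i ∈ Set.Ioo (0 : ℝ) 1) {g : Fin (2 * n) → ℝ → ℝ}
    (hg : ∀ i, ContDiff ℝ ∞ (g i)) (hgτ : ∀ i, g i (τ i) = σ i)
    (hg' : ∀ i, 0 < deriv (g i) (τ i)) :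
    ∃ D' : VirtualDiagram, StrictEquiv D D' ∧ D'.HasCodeAt w 0 σ c ∧
      ∀ i (P : ℝ → Plane → Prop), (∀ᶠ t in 𝓝 (τ i), P (g i t) (D.curve t)) →
        ∀ᶠ u in 𝓝 (σ i), P u (D'.curve u) := by
  obtain ⟨H, hH, hH0, hHg⟩ := exists_circleReparam h.strictMono hσ
    (fun i => by simpa using h.mem_Ioo i) hσ01 hg hgτ hg'
  have hsymm : ∀ t, hH.symm.orderIso.symm t = H t := by
    intro t
    rw [OrderIso.symm_apply_eq, IsCircleReparam.orderIso_apply, ← hH.orderIso_apply,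
      OrderIso.symm_apply_apply]
  refine ⟨D.reparam _ hH.symm, D.strictEquiv_reparam hH.symm, ?_, fun i P hP => ?_⟩
  · have h1 := h.reparam hH.symm
    have h2 : (hH.symm.orderIso.symm ∘ τ) = σ := by
      funext i
      rw [Function.comp_apply, hsymm, (hHg i).eq_of_nhds, hgτ]
    rwa [h2, hsymm, hH0] at h1
  · have hmap : Filter.map (g i) (𝓝 (τ i)) = 𝓝 (σ i) := by
      have hs : HasStrictDerivAt (g i) (deriv (g i) (τ i)) (τ i) :=
        (hg i).contDiffAt.hasStrictDerivAt (by simp)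
      rw [hs.map_nhds_eq (hg' i).ne', hgτ]
    rw [← hmap, Filter.eventually_map]
    filter_upwards [hP, hHg i] with t ht hgt
    rw [reparam_curve, ← hgt, ← hH.orderIso_apply, OrderIso.symm_apply_apply]
    rwa [hH.orderIso_apply, hgt]

end VirtualDiagram

/-- The parameters of the branches at the real crossings in standard position. -/
noncomputable def stdParam (n : ℕ) (i : Fin (2 * n)) : ℝ := ((i : ℝ) + 1) / (2 * n + 1)

/-- The real crossings in standard position. -/
def stdPoint {n : ℕ} (j : Fin n) : Plane := ((j : ℝ), (j : ℝ))

/-- The germ of the branch with a given letter in standard position. -/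
def stdGerm {n : ℕ} (x : Fin n × Side) (s : ℝ) : Plane :=
  if x.2 = Side.L then ((x.1 : ℝ) + s, (x.1 : ℝ)) else ((x.1 : ℝ), (x.1 : ℝ) - s)

lemma stdParam_strictMono (n : ℕ) : StrictMono (stdParam n) := by
  intro i j hij
  have h : (i : ℝ) < j := by exact_mod_cast hij
  unfold stdParam
  gcongr

lemma stdParam_mem (n : ℕ) (i : Fin (2 * n)) : stdParam n i ∈ Set.Ioo (0 : ℝ) 1 := by
  have h : ((i : ℕ) : ℝ) < 2 * n := by exact_mod_cast i.2
  unfold stdParam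
  constructor
  · positivity
  · rw [div_lt_one (by positivity)]; linarith

/-- A diagram is in standard position for the Gauss code `w`. -/
structure VirtualDiagram.IsStandard {n : ℕ} (D : VirtualDiagram) (w : GaussCode n) : Prop where
  code : D.HasCodeAt w 0 (stdParam n) stdPoint
  germ : ∀ i, D.curve =ᶠ[𝓝 (stdParam n i)] fun t => stdGerm (w.letter i) (t - stdParam n i)

namespace VirtualDiagram

variable {n : ℕ} {D : VirtualDiagram} {w : GaussCode n} {t₀ : ℝ} {τ : Fin (2 * n) → ℝ}
  {c : Fin n → Plane}

lemma hasDerivAt_fst (D : VirtualDiagram) (t : ℝ) :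
    HasDerivAt (fun t => (D.curve t).1) (deriv D.curve t).1 t :=
  (D.differentiable t).hasDerivAt.fst

lemma hasDerivAt_snd (D : VirtualDiagram) (t : ℝ) :
    HasDerivAt (fun t => (D.curve t).2) (deriv D.curve t).2 t :=
  (D.differentiable t).hasDerivAt.snd

/-- Two distinct points get the same first coordinate under `(x, y) ↦ (x + ε y, y)` for at most one
`ε`, so only finitely many `ε` are bad. -/
lemma HasCodeAt.exists_injective_fst (h : D.HasCodeAt w t₀ τ c) :
    ∃ D' : VirtualDiagram, ∃ c' : Fin n → Plane, StrictEquiv D D' ∧ D'.HasCodeAt w t₀ τ c' ∧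
      Function.Injective fun j => (c' j).1 := by
  obtain ⟨ε, hε⟩ : ∃ ε : ℝ, ∀ i j, (c i).1 + ε * (c i).2 = (c j).1 + ε * (c j).2 → i = j := by
    have hfin : (⋃ i, ⋃ j, {ε : ℝ | i ≠ j ∧
        (c i).1 + ε * (c i).2 = (c j).1 + ε * (c j).2}).Finite := by
      refine Set.finite_iUnion fun i => Set.finite_iUnion fun j => Set.Subsingleton.finite ?_
      rintro x ⟨hij, hx⟩ y ⟨-, hy⟩
      by_contra hxy
      have h1 : (x - y) * ((c i).2 - (c j).2) = 0 := by linarith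
      have h2 := (mul_eq_zero.1 h1).resolve_left (sub_ne_zero.2 hxy)
      have h3 : (c i).2 = (c j).2 := by linarith
      rw [h3] at hx
      exact hij (h.2.1 (Prod.ext (by linarith) h3))
    obtain ⟨ε, hε⟩ := hfin.infinite_compl.nonempty
    refine ⟨ε, fun i j hij => ?_⟩
    by_contra hne
    exact hε (Set.mem_iUnion.2 ⟨i, Set.mem_iUnion.2 ⟨j, hne, hij⟩⟩)
  obtain ⟨D', h1, h2, h3⟩ := h.exists_shearX (q := fun y => ε * y) (contDiff_const.mul contDiff_id)
  exact ⟨D', _, h1, h3, fun i j hij => hε i j hij⟩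

lemma deriv_shearY {D' : VirtualDiagram} {p : ℝ → ℝ} (hp : ContDiff ℝ ∞ p)
    (h : ∀ t, D'.curve t = ((D.curve t).1, (D.curve t).2 + p (D.curve t).1)) (t : ℝ) :
    deriv D'.curve t = ((deriv D.curve t).1,
      (deriv D.curve t).2 + deriv p (D.curve t).1 * (deriv D.curve t).1) := by
  have h1 : D'.curve = fun t => ((D.curve t).1, (D.curve t).2 + p (D.curve t).1) := funext h
  rw [h1]
  have h2 := (hp.differentiable (by simp) (D.curve t).1).hasDerivAt.comp t (D.hasDerivAt_fst t)
  exact ((D.hasDerivAt_fst t).prodMk ((D.hasDerivAt_snd t).add h2)).deriv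

lemma deriv_shearX {D' : VirtualDiagram} {q : ℝ → ℝ} (hq : ContDiff ℝ ∞ q)
    (h : ∀ t, D'.curve t = ((D.curve t).1 + q (D.curve t).2, (D.curve t).2)) (t : ℝ) :
    deriv D'.curve t = ((deriv D.curve t).1 + deriv q (D.curve t).2 * (deriv D.curve t).2,
      (deriv D.curve t).2) := by
  have h1 : D'.curve = fun t => ((D.curve t).1 + q (D.curve t).2, (D.curve t).2) := funext h
  rw [h1]
  have h2 := (hq.differentiable (by simp) (D.curve t).2).hasDerivAt.comp t (D.hasDerivAt_snd t)
  exact (((D.hasDerivAt_fst t).add h2).prodMk (D.hasDerivAt_snd t)).deriv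

lemma eventuallyEq_affine {p : ℝ → ℝ} {x a m : ℝ} (h : p =ᶠ[𝓝 x] fun t => a + m * (t - x)) :
    p x = a ∧ deriv p x = m := by
  refine ⟨by simpa using h.eq_of_nhds, ?_⟩
  rw [h.deriv_eq]
  have : HasDerivAt (fun t => a + m * (t - x)) m x := by
    simpa using (((hasDerivAt_id x).sub_const x).const_mul m).const_add a
  exact this.deriv

lemma natCast_fin_injective (n : ℕ) : Function.Injective fun j : Fin n => ((j : ℕ) : ℝ) :=
  fun _ _ hij => Fin.ext (Nat.cast_injective hij)

/-- A vertical shear moves the crossings to distinct heights `j` and makes the tangents of the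
branches `L` non-horizontal. A horizontal shear can then prescribe, at each height separately, both
the first coordinate and its speed on the branch `L`. -/
lemma HasCodeAt.exists_stdPoint (h : D.HasCodeAt w t₀ τ c) :
    ∃ D' : VirtualDiagram, StrictEquiv D D' ∧ D'.HasCodeAt w t₀ τ stdPoint ∧
      ∀ j, (deriv D'.curve (τ (w.pos (j, Side.L)))).1 = 1 := by
  obtain ⟨D₁, c₁, e₁, h₁, hinj⟩ := h.exists_injective_fst
  let u : Fin n → Plane := fun j => deriv D₁.curve (τ (w.pos (j, Side.L)))
  have hu : ∀ j, u j ≠ 0 := fun j => D₁.immersed _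
  -- If `(u j).1 = 0`, division by zero gives slope 0. This is harmless: then `(u j).2 ≠ 0` already,
  -- as the curve is immersed.
  let m : Fin n → ℝ := fun j => (1 - (u j).2) / (u j).1
  obtain ⟨p, hp, hpj⟩ := exists_contDiff_eventuallyEq hinj
    (f := fun j x => ((j : ℝ) - (c₁ j).2) + m j * (x - (c₁ j).1)) (fun j => by fun_prop)
  obtain ⟨D₂, e₂, hc₂, h₂⟩ := h₁.exists_shearY hp
  have hcj : ∀ j, D₁.curve (τ (w.pos (j, Side.L))) = c₁ j := fun j => by
    rw [h₁.curve_eq]; simp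
  let v : Fin n → Plane := fun j => deriv D₂.curve (τ (w.pos (j, Side.L)))
  have hv : ∀ j, (v j).2 ≠ 0 := by
    intro j
    simp only [v]
    rw [deriv_shearY hp hc₂, hcj, (eventuallyEq_affine (hpj j)).2]
    change (u j).2 + m j * (u j).1 ≠ 0
    by_cases h0 : (u j).1 = 0
    · rw [h0, mul_zero, add_zero]
      intro h1
      exact hu j (Prod.ext h0 h1)
    · simp only [m]
      rw [div_mul_cancel₀ _ h0]
      norm_num
  let m' : Fin n → ℝ := fun j => (1 - (v j).1) / (v j).2
  obtain ⟨q, hq, hqj⟩ := exists_contDiff_eventuallyEq (natCast_fin_injective n)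
    (f := fun j y => ((j : ℝ) - (c₁ j).1) + m' j * (y - (j : ℝ))) (fun j => by fun_prop)
  obtain ⟨D₃, e₃, hc₃, h₃⟩ := h₂.exists_shearX hq
  have hc₂j : ∀ j, (D₂.curve (τ (w.pos (j, Side.L)))).2 = (j : ℝ) := by
    intro j
    rw [hc₂, hcj, (eventuallyEq_affine (hpj j)).1]
    ring
  refine ⟨D₃, (e₁.trans e₂).trans e₃, ?_, fun j => ?_⟩
  · convert h₃ using 1
    funext j
    simp only [(eventuallyEq_affine (hpj j)).1, stdPoint, add_sub_cancel,
      (eventuallyEq_affine (hqj j)).1]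
  · rw [deriv_shearX hq hc₃, hc₂j, (eventuallyEq_affine (hqj j)).2]
    change (v j).1 + m' j * (v j).2 = 1
    simp only [m']
    rw [div_mul_cancel₀ _ (hv j)]
    ring

/-- A choice, for every position, according to the side of the letter. -/
lemma forall_pos {P : Fin (2 * n) → Prop} (hL : ∀ j, P (w.pos (j, Side.L)))
    (hR : ∀ j, P (w.pos (j, Side.R))) (i : Fin (2 * n)) : P i := by
  rw [← w.pos_letter i]
  rcases h : w.letter i with ⟨j, s⟩
  cases s
  · exact hL j
  · exact hR j

/-- The branches `L` are straightened first and the branches `R` afterwards. The second round does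
not disturb the first: the reparametrization is the identity near the branches `L`, and the
horizontal shear has `q j = 0` at the constant height `j` of such a branch. The sign convention
makes the branches `R` point downwards. -/
theorem HasGaussCode.exists_isStandard (h : D.HasGaussCode w) :
    ∃ D' : VirtualDiagram, StrictEquiv D D' ∧ D'.IsStandard w := by
  obtain ⟨t₀, τ₀, c₀, h⟩ := h
  obtain ⟨D₀, τ, e₀, h₀⟩ := HasCodeAt.exists_shift_zero h
  obtain ⟨D₁, e₁, h₁, hu⟩ := h₀.exists_stdPoint
  set σ := stdParam n with hσ
  have hσm := stdParam_strictMono n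
  have hσ01 := stdParam_mem n
  have hstd : ∀ (E : VirtualDiagram) (θ : Fin (2 * n) → ℝ), E.HasCodeAt w 0 θ stdPoint → ∀ i,
      E.curve (θ i) = (((w.letter i).1 : ℝ), ((w.letter i).1 : ℝ)) := fun E θ hE i => hE.curve_eq i
  -- unit speed of the first coordinate on the branches `L`
  obtain ⟨D₂, e₂, h₂, hg₂⟩ := h₁.exists_reparam hσm hσ01
    (g := fun i t => if (w.letter i).2 = Side.L then (D₁.curve t).1 - (w.letter i).1 + σ i
      else t - τ i + σ i)
    (fun i => by
      split_ifs
      · exact (D₁.smooth.fst.sub contDiff_const).add contDiff_const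
      · exact (contDiff_id.sub contDiff_const).add contDiff_const)
    (fun i => by
      split_ifs
      · rw [hstd _ _ h₁]; ring
      · ring)
    (forall_pos (w := w) (fun j => by
        simp only [GaussCode.letter_pos, if_true]
        have := ((D₁.hasDerivAt_fst (τ (w.pos (j, Side.L)))).sub_const (j : ℝ)).add_const
          (σ (w.pos (j, Side.L)))
        rw [this.deriv, hu]
        exact one_pos) (fun j => by
        simp only [GaussCode.letter_pos, Bool.true_eq_false, if_false]
        have := ((hasDerivAt_id (τ (w.pos (j, Side.R)))).sub_const (τ (w.pos (j, Side.R)))).add_const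
          (σ (w.pos (j, Side.R)))
        erw [this.deriv]
        exact one_pos))
  have hX₂ : ∀ j : Fin n, ∀ᶠ t in 𝓝 (σ (w.pos (j, Side.L))),
      (D₂.curve t).1 = (j : ℝ) + (t - σ (w.pos (j, Side.L))) := by
    intro j
    refine hg₂ (w.pos (j, Side.L)) (fun t p => p.1 = (j : ℝ) + (t - σ (w.pos (j, Side.L))))
      (Filter.Eventually.of_forall fun t => ?_)
    simp
  -- the branches `L` become horizontal
  obtain ⟨p, hp, hpj⟩ := exists_contDiff_eventuallyEq (natCast_fin_injective n)
    (f := fun j x => (j : ℝ) - (D₂.curve (σ (w.pos (j, Side.L)) + (x - j))).2)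
    (fun j => contDiff_const.sub (D₂.smooth.snd.comp
      (contDiff_const.add (contDiff_id.sub contDiff_const))))
  obtain ⟨D₃, e₃, hc₃, h₃⟩ := h₂.exists_shearY hp
  have hp0 : ∀ j : Fin n, p j = 0 := by
    intro j
    rw [(hpj j).eq_of_nhds, sub_self, add_zero, hstd _ _ h₂]
    simp
  have h₃' : D₃.HasCodeAt w 0 σ stdPoint := by
    convert h₃ using 1
    funext j
    simp [stdPoint, hp0]
  have hL₃ : ∀ j : Fin n, ∀ᶠ t in 𝓝 (σ (w.pos (j, Side.L))),
      D₃.curve t = ((j : ℝ) + (t - σ (w.pos (j, Side.L))), (j : ℝ)) := by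
    intro j
    have hcont : Filter.Tendsto (fun t => (j : ℝ) + (t - σ (w.pos (j, Side.L))))
        (𝓝 (σ (w.pos (j, Side.L)))) (𝓝 (j : ℝ)) := by
      have : ContinuousAt (fun t => (j : ℝ) + (t - σ (w.pos (j, Side.L))))
        (σ (w.pos (j, Side.L))) := by fun_prop
      simpa [ContinuousAt] using this
    filter_upwards [hX₂ j, hcont.eventually (hpj j)] with t h1 h2
    rw [hc₃, h1, h2]
    ext
    · rfl
    · simp
  have hdL₃ : ∀ j : Fin n, deriv D₃.curve (σ (w.pos (j, Side.L))) = (1, 0) := by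
    intro j
    rw [Filter.EventuallyEq.deriv_eq (hL₃ j)]
    have : HasDerivAt (fun t => (((j : ℝ) + (t - σ (w.pos (j, Side.L))), (j : ℝ)) : Plane)) (1, 0)
        (σ (w.pos (j, Side.L))) :=
      (((hasDerivAt_id _).sub_const _).const_add _).prodMk (hasDerivAt_const _ _)
    exact this.deriv
  have hdR₃ : ∀ j : Fin n, (deriv D₃.curve (σ (w.pos (j, Side.R)))).2 < 0 := by
    intro j
    have := h₃'.planeDet_neg j
    rw [hdL₃] at this
    simpa [planeDet] using this
  -- unit speed of the second coordinate on the branches `R`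
  obtain ⟨D₄, e₄, h₄, hg₄⟩ := h₃'.exists_reparam hσm hσ01
    (g := fun i t => if (w.letter i).2 = Side.L then t else
      (w.letter i).1 - (D₃.curve t).2 + σ i)
    (fun i => by
      split_ifs
      · exact contDiff_id
      · exact (contDiff_const.sub D₃.smooth.snd).add contDiff_const)
    (fun i => by
      split_ifs
      · rfl
      · rw [hstd _ _ h₃']; ring)
    (forall_pos (w := w) (fun j => by
        simp only [GaussCode.letter_pos, if_true]
        rw [deriv_id'']
        exact one_pos) (fun j => by
        simp only [GaussCode.letter_pos, Bool.true_eq_false, if_false]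
        have := ((D₃.hasDerivAt_snd (σ (w.pos (j, Side.R)))).const_sub (j : ℝ)).add_const
          (σ (w.pos (j, Side.R)))
        rw [this.deriv]
        linarith [hdR₃ j]))
  have hL₄ : ∀ j : Fin n, ∀ᶠ t in 𝓝 (σ (w.pos (j, Side.L))),
      D₄.curve t = ((j : ℝ) + (t - σ (w.pos (j, Side.L))), (j : ℝ)) := by
    intro j
    refine hg₄ (w.pos (j, Side.L))
      (fun t p => p = ((j : ℝ) + (t - σ (w.pos (j, Side.L))), (j : ℝ))) ?_
    filter_upwards [hL₃ j] with t ht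
    simpa using ht
  have hY₄ : ∀ j : Fin n, ∀ᶠ t in 𝓝 (σ (w.pos (j, Side.R))),
      (D₄.curve t).2 = (j : ℝ) - (t - σ (w.pos (j, Side.R))) := by
    intro j
    refine hg₄ (w.pos (j, Side.R)) (fun t p => p.2 = (j : ℝ) - (t - σ (w.pos (j, Side.R))))
      (Filter.Eventually.of_forall fun t => ?_)
    simp
  -- the branches `R` become vertical
  obtain ⟨q, hq, hqj⟩ := exists_contDiff_eventuallyEq (natCast_fin_injective n)
    (f := fun j y => (j : ℝ) - (D₄.curve (σ (w.pos (j, Side.R)) + (j - y))).1)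
    (fun j => contDiff_const.sub (D₄.smooth.fst.comp
      (contDiff_const.add (contDiff_const.sub contDiff_id))))
  obtain ⟨D₅, e₅, hc₅, h₅⟩ := h₄.exists_shearX hq
  have hq0 : ∀ j : Fin n, q j = 0 := by
    intro j
    rw [(hqj j).eq_of_nhds, sub_self, add_zero, hstd _ _ h₄]
    simp
  refine ⟨D₅, ((((e₀.trans e₁).trans e₂).trans e₃).trans e₄).trans e₅, ⟨?_, ?_⟩⟩
  · convert h₅ using 1
    funext j
    simp [stdPoint, hq0]
  · refine forall_pos (w := w) (fun j => ?_) (fun j => ?_)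
    · filter_upwards [hL₄ j] with t ht
      rw [hc₅, ht, hq0]
      simp [stdGerm, hσ]
    · have hcont : Filter.Tendsto (fun t => (j : ℝ) - (t - σ (w.pos (j, Side.R))))
          (𝓝 (σ (w.pos (j, Side.R)))) (𝓝 (j : ℝ)) := by
        have : ContinuousAt (fun t => (j : ℝ) - (t - σ (w.pos (j, Side.R))))
          (σ (w.pos (j, Side.R))) := by fun_prop
        simpa [ContinuousAt] using this
      filter_upwards [hY₄ j, hcont.eventually (hqj j)] with t h1 h2
      rw [hc₅, h1, h2]
      simp only [GaussCode.letter_pos, stdGerm, Bool.true_eq_false, if_false]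
      ext
      · simp
      · rfl

end VirtualDiagram

/-! ### Consecutive passages through real crossings -/

lemma finRotate_val {N : ℕ} (i : Fin N) : (finRotate N i : ℕ) = (i + 1) % N := by
  obtain ⟨m, rfl⟩ : ∃ m, N = m + 1 := ⟨N - 1, by have := i.2; omega⟩
  rw [finRotate_apply, Fin.val_add, Fin.val_one']
  simp

lemma finRotate_pow_val {N : ℕ} (m : ℕ) (i : Fin N) :
    ((finRotate N ^ m) i : ℕ) = (i + m) % N := by
  induction m with
  | zero => simp [Nat.mod_eq_of_lt i.2]
  | succ m ih =>
    rw [pow_succ', Equiv.Perm.mul_apply, finRotate_val, ih, Nat.mod_add_mod, add_assoc]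

/-- The parameter of the passage that follows the `i`-th one. -/
noncomputable def nextParam {N : ℕ} (τ : Fin N → ℝ) (i : Fin N) : ℝ :=
  if h : (i : ℕ) + 1 < N then τ ⟨i + 1, h⟩ else τ ⟨0, i.pos⟩ + 1

lemma nextParam_eq {N : ℕ} (τ : Fin N → ℝ) (i : Fin N) :
    SameParam (nextParam τ i) (τ (finRotate N i)) := by
  unfold nextParam
  split_ifs with h
  · have : finRotate N i = ⟨i + 1, h⟩ := Fin.ext (by
      rw [finRotate_val, Nat.mod_eq_of_lt h])
    rw [this]
    exact SameParam.refl _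
  · have : finRotate N i = ⟨0, i.pos⟩ := Fin.ext (by
      have h1 := i.2
      have h2 : (i : ℕ) + 1 = N := by omega
      rw [finRotate_val, h2, Nat.mod_self])
    rw [this]
    exact ⟨1, by simp⟩

lemma lt_nextParam {N : ℕ} {τ : Fin N → ℝ} (hτ : StrictMono τ) {a : ℝ}
    (ha : ∀ i, τ i ∈ Set.Ioo a (a + 1)) (i : Fin N) : τ i < nextParam τ i := by
  unfold nextParam
  split_ifs with h
  · exact hτ (Fin.mk_lt_mk.2 (Nat.lt_succ_self _) : i < ⟨i + 1, h⟩)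
  · linarith [(ha i).2, (ha ⟨0, i.pos⟩).1]

lemma exists_mem_Ico_nextParam {N : ℕ} {τ : Fin N → ℝ} (hN : 0 < N) (t : ℝ) :
    ∃ (i : Fin N) (k : ℤ), t + k ∈ Set.Ico (τ i) (nextParam τ i) := by
  obtain ⟨k, hk⟩ := VirtualDiagram.exists_int_add_mem_Ico (τ ⟨0, hN⟩) t
  by_contra! hc
  have key : ∀ i : ℕ, ∀ h : i < N, τ ⟨i, h⟩ ≤ t + k := by
    intro i
    induction i with
    | zero => intro _; exact hk.1
    | succ i ih =>
      intro h
      have h1 := ih (by omega)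
      by_contra hlt
      refine hc ⟨i, by omega⟩ k ⟨h1, ?_⟩
      simp only [nextParam, h, dite_true]
      exact not_le.1 hlt
  refine hc ⟨N - 1, by omega⟩ k ⟨key _ _, ?_⟩
  have : ¬ (N - 1 + 1 < N) := by omega
  simp only [nextParam, this, dite_false]
  exact hk.2

namespace VirtualDiagram

variable {n : ℕ} {D : VirtualDiagram} {w : GaussCode n} {t₀ : ℝ} {τ : Fin (2 * n) → ℝ}
  {c : Fin n → Plane}

/-- The `τ i` list all passages in one period, so none lies strictly between neighbours. -/
lemma HasCodeAt.notMem_real (h : D.HasCodeAt w t₀ τ c) (i : Fin (2 * n)) {t : ℝ}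
    (ht : t ∈ Set.Ioo (τ i) (nextParam τ i)) : D.curve t ∉ D.real := by
  intro hr
  have hi := h.mem_Ioo i
  rcases lt_trichotomy t (t₀ + 1) with hlt | heq | hgt
  · obtain ⟨j, rfl⟩ := h.exists_eq ⟨hi.1.trans ht.1, hlt⟩ hr
    have hij : i < j := h.strictMono.lt_iff_lt.1 ht.1
    have h1 : (i : ℕ) + 1 < 2 * n := by
      have := j.2; have : (i : ℕ) < j := hij; omega
    have h2 := ht.2
    simp only [nextParam, h1, dite_true] at h2
    have h3 := h.strictMono.lt_iff_lt.1 h2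
    have h4 : (j : ℕ) < i + 1 := h3
    have h5 : (i : ℕ) < j := hij
    omega
  · rw [heq, D.periodic] at hr
    exact h.1 hr
  -- Beyond `t₀ + 1` only the interval after the last passage is left; `t - 1` would be a passage
  -- before the first one.
  · have h2 := ht.2
    unfold nextParam at h2
    split_ifs at h2 with h3
    · linarith [(h.mem_Ioo ⟨i + 1, h3⟩).2]
    · have h4 := h.mem_Ioo ⟨0, i.pos⟩
      have h5 : D.curve (t - 1) ∈ D.real := by
        rw [← D.periodic, sub_add_cancel]; exact hr
      obtain ⟨j, hj⟩ := h.exists_eq ⟨by linarith, by linarith [h4.2]⟩ h5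
      have h6 : τ ⟨0, i.pos⟩ ≤ τ j := h.strictMono.monotone (Fin.mk_le_of_le_val (Nat.zero_le _))
      linarith

end VirtualDiagram

/-! ### Diagrams with the same germs at the real crossings -/

/-- A periodized product of two smooth steps. The last clause, that the value 1 is taken only on the
inner arc, is used to identify the zero set of the weight that fixes prescribed pieces. -/
lemma exists_arc_bump {a a' b' b : ℝ} (ha : a < a') (hb : b' < b) (hab : b < a + 1) :
    ∃ ψ : ℝ → ℝ, ContDiff ℝ ∞ ψ ∧ (∀ t, ψ (t + 1) = ψ t) ∧ (∀ t, 0 ≤ ψ t) ∧ (∀ t, ψ t ≤ 1) ∧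
      (∀ t, ψ t ≠ 0 → ∃ k : ℤ, t + k ∈ Set.Ioo a b) ∧ (∀ t ∈ Set.Icc a' b', ψ t = 1) ∧
      ∀ t, ψ t = 1 → ∃ k : ℤ, t + k ∈ Set.Icc a' b' := by
  -- This shift centres `(a, b)` in a fundamental interval `[m, m + 1]`.
  let m : ℝ := (a + b - 1) / 2
  let f : ℝ → ℝ := fun s => Real.smoothTransition ((s + m - a) / (a' - a)) *
    Real.smoothTransition ((b - (s + m)) / (b - b'))
  have ha' : 0 < a' - a := sub_pos.2 ha
  have hb' : 0 < b - b' := sub_pos.2 hb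
  have hf : ContDiff ℝ ∞ f :=
    (Real.smoothTransition.contDiff.comp (by fun_prop)).mul
      (Real.smoothTransition.contDiff.comp (by fun_prop))
  have hf0 : ∀ s, f s ≠ 0 → s + m ∈ Set.Ioo a b := by
    intro s hs
    constructor
    · by_contra hle
      exact left_ne_zero_of_mul hs (Real.smoothTransition.zero_of_nonpos
        (div_nonpos_of_nonpos_of_nonneg (by linarith) ha'.le))
    · by_contra hle
      exact right_ne_zero_of_mul hs (Real.smoothTransition.zero_of_nonpos
        (div_nonpos_of_nonpos_of_nonneg (by linarith) hb'.le))
  have hfc : ContDiff ℝ ∞ (periodize f) := by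
    refine contDiff_periodize hf (a := a - m) (b := b - m) ?_ ?_ fun t ht => ?_
    · simp only [m]; linarith
    · simp only [m]; linarith
    · have := hf0 t ht
      exact ⟨by linarith [this.1], by linarith [this.2]⟩
  refine ⟨fun t => periodize f (t - m), hfc.comp (contDiff_id.sub contDiff_const), fun t => ?_,
    fun t => ?_, fun t => ?_, fun t ht => ?_, fun t ht => ?_, fun t ht => ?_⟩
  · beta_reduce
    rw [show t + 1 - m = t - m + 1 by ring, periodize_add_one]
  · exact mul_nonneg (Real.smoothTransition.nonneg _) (Real.smoothTransition.nonneg _)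
  · exact mul_le_one₀ (Real.smoothTransition.le_one _) (Real.smoothTransition.nonneg _)
      (Real.smoothTransition.le_one _)
  · refine ⟨-⌊t - m⌋, ?_⟩
    have := hf0 _ ht
    rw [Int.fract] at this
    push_cast
    convert this using 1
    ring
  · have hm : t - m ∈ Set.Ico (0 : ℝ) 1 := by
      simp only [m]
      exact ⟨by linarith [ht.1], by linarith [ht.2]⟩
    simp only [periodize_of_mem f hm, f, sub_add_cancel]
    rw [Real.smoothTransition.one_of_one_le, Real.smoothTransition.one_of_one_le, one_mul]
    · rw [one_le_div hb']; linarith [ht.2]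
    · rw [one_le_div ha']; linarith [ht.1]
  · refine ⟨-⌊t - m⌋, ?_⟩
    have h1 : f (Int.fract (t - m)) = 1 := ht
    have h2 := Real.smoothTransition.le_one ((Int.fract (t - m) + m - a) / (a' - a))
    have h3 := Real.smoothTransition.le_one ((b - (Int.fract (t - m) + m)) / (b - b'))
    have h4 := Real.smoothTransition.nonneg ((Int.fract (t - m) + m - a) / (a' - a))
    have h5 := Real.smoothTransition.nonneg ((b - (Int.fract (t - m) + m)) / (b - b'))
    have h6 : t + ((-⌊t - m⌋ : ℤ) : ℝ) = Int.fract (t - m) + m := by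
      rw [Int.fract]; push_cast; ring
    rw [h6]
    simp only [f] at h1
    constructor
    · by_contra hlt
      have := Real.smoothTransition.lt_one_of_lt_one (x := (Int.fract (t - m) + m - a) / (a' - a))
        (by rw [div_lt_one ha']; linarith)
      nlinarith
    · by_contra hlt
      have := Real.smoothTransition.lt_one_of_lt_one (x := (b - (Int.fract (t - m) + m)) / (b - b'))
        (by rw [div_lt_one hb']; linarith)
      nlinarith

/-- The complement of the product of the complements of the first `k` weights. -/
noncomputable def unionWeight {N : ℕ} (ψ : Fin N → ℝ → ℝ) (k : ℕ) (t : ℝ) : ℝ :=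
  1 - ∏ i with i.val < k, (1 - ψ i t)

section unionWeight

variable {N : ℕ} {ψ : Fin N → ℝ → ℝ}

lemma unionWeight_contDiff (hψ : ∀ i, ContDiff ℝ ∞ (ψ i)) (k : ℕ) :
    ContDiff ℝ ∞ (unionWeight ψ k) :=
  contDiff_const.sub (contDiff_prod fun i _ => contDiff_const.sub (hψ i))

lemma unionWeight_periodic (hψ : ∀ i t, ψ i (t + 1) = ψ i t) (k : ℕ) (t : ℝ) :
    unionWeight ψ k (t + 1) = unionWeight ψ k t := by
  simp [unionWeight, hψ]

lemma unionWeight_nonneg (h0 : ∀ i t, 0 ≤ ψ i t) (h1 : ∀ i t, ψ i t ≤ 1) (k : ℕ) (t : ℝ) :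
    0 ≤ unionWeight ψ k t :=
  sub_nonneg.2 (Finset.prod_le_one (fun i _ => sub_nonneg.2 (h1 i t))
    fun i _ => by linarith [h0 i t])

lemma unionWeight_zero (t : ℝ) : unionWeight ψ 0 t = 0 := by simp [unionWeight]

lemma exists_of_unionWeight_ne_zero {k : ℕ} {t : ℝ} (h : unionWeight ψ k t ≠ 0) :
    ∃ i, ψ i t ≠ 0 := by
  by_contra! hc
  exact h (by simp [unionWeight, hc])

lemma unionWeight_succ {k : ℕ} (hk : k < N) {t : ℝ} (h : ψ ⟨k, hk⟩ t = 0) :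
    unionWeight ψ (k + 1) t = unionWeight ψ k t := by
  unfold unionWeight
  have : (Finset.univ.filter fun i : Fin N => i.val < k + 1) =
      insert ⟨k, hk⟩ (Finset.univ.filter fun i : Fin N => i.val < k) := by
    ext i
    simp only [Finset.mem_filter, Finset.mem_univ, true_and, Finset.mem_insert, Fin.ext_iff]
    omega
  rw [this, Finset.prod_insert (by simp), h, sub_zero, one_mul]

lemma unionWeight_eq_one {i : Fin N} {t : ℝ} (h : ψ i t = 1) : unionWeight ψ N t = 1 := by
  unfold unionWeight
  rw [Finset.prod_eq_zero (i := i) (by simp) (by simp [h]), sub_zero]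

end unionWeight

namespace VirtualDiagram

/-- The arcs are changed one at a time: the curves with weights `unionWeight ψ k` and `unionWeight ψ
(k + 1)` differ only on the `k`-th arc, so the step is a detour. Almost every `v` makes all these
curves generic at once. The summand `e` allows an arbitrary large displacement before the
perturbation. -/
theorem ae_strictEquiv_trigPerturbed (D : VirtualDiagram) (hreal : D.real.Countable) {N : ℕ}
    {ψ : Fin N → ℝ → ℝ} (hψ : ∀ i, ContDiff ℝ ∞ (ψ i)) (hψp : ∀ i t, ψ i (t + 1) = ψ i t)
    (h0 : ∀ i t, 0 ≤ ψ i t) (h1 : ∀ i t, ψ i t ≤ 1) {a b : Fin N → ℝ} (hab : ∀ i, a i < b i)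
    (hab1 : ∀ i, b i < a i + 1)
    (hsupp : ∀ i t, ψ i t ≠ 0 → ∃ k : ℤ, t + k ∈ Set.Ioo (a i) (b i))
    (hD : ∀ i, ∀ t ∈ Set.Icc (a i) (b i), D.curve t ∉ D.real) {e : ℝ → Plane}
    (he : ContDiff ℝ ∞ e) (hep : ∀ t, e (t + 1) = e t) :
    ∀ᵐ v : Fin 3 → Plane, ∃ D' : VirtualDiagram, StrictEquiv D D' ∧ D'.real = D.real ∧
      D'.curve = trigPerturbed (fun t => D.curve t + unionWeight ψ N t • e t)
        (unionWeight ψ N) v := by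
  let γ : ℕ → ℝ → Plane := fun k t => D.curve t + unionWeight ψ k t • e t
  have hβ := unionWeight_contDiff hψ
  have hβp := unionWeight_periodic hψp
  have hβ0 := unionWeight_nonneg h0 h1
  have hγ : ∀ k, ContDiff ℝ ∞ (γ k) := fun k => D.smooth.add ((hβ k).smul he)
  have hγp : ∀ k t, γ k (t + 1) = γ k t := fun k t => by
    simp only [γ, D.periodic, hβp, hep]
  have hγe : ∀ {k t}, unionWeight ψ k t = 0 → γ k t = D.curve t := fun {k t} h => by
    simp only [γ, h, zero_smul, add_zero]
  have hγd : ∀ {k t}, unionWeight ψ k t = 0 → deriv (γ k) t = deriv D.curve t := by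
    intro k t h
    have hd := ((hβ k).differentiable (by simp) t).hasDerivAt.fun_smul
      (he.differentiable (by simp) t).hasDerivAt
    rw [h, deriv_eq_zero_of_nonneg (hβ0 k) h, zero_smul, zero_smul, add_zero] at hd
    have := ((D.differentiable t).hasDerivAt.add hd).deriv
    rwa [add_zero] at this
  have hgen : ∀ k, GenericOn (γ k) {t | unionWeight ψ k t = 0} := by
    intro k
    refine ⟨fun t ht => ?_, fun s hs t ht => ?_, fun s hs t ht u hu => ?_⟩
    · rw [hγd ht]; exact D.immersed t
    · rw [hγd hs, hγd ht, hγe hs, hγe ht]; exact D.transverse s t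
    · rw [hγe hs, hγe ht, hγe hu]; exact D.no_triple s t u
  have hae : ∀ᵐ v : Fin 3 → Plane, ∀ k, GenericOn (trigPerturbed (γ k) (unionWeight ψ k) v) Set.univ ∧
      ∀ t, unionWeight ψ k t ≠ 0 → trigPerturbed (γ k) (unionWeight ψ k) v t ∉ D.real :=
    ae_all_iff.2 fun k => ae_genericOn_trigPerturbed (hγ k) (hγp k) (hβ k) (hβp k) (hβ0 k) (hgen k)
      hreal
  filter_upwards [hae] with v hv
  let C : ℕ → ℝ → Plane := fun k => trigPerturbed (γ k) (unionWeight ψ k) v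
  have hCe : ∀ {k t}, unionWeight ψ k t = 0 → C k t = D.curve t := fun h => by
    rw [← hγe h]; exact trigPerturbed_of_eq_zero h
  have hDk : ∀ k t, D.curve t ∈ D.real → unionWeight ψ k t = 0 := by
    intro k t ht
    by_contra hne
    obtain ⟨i, hi⟩ := exists_of_unionWeight_ne_zero hne
    obtain ⟨l, hl⟩ := hsupp i t hi
    rw [← D.curve_add_int t l] at ht
    exact hD i _ (Set.Ioo_subset_Icc_self hl) ht
  let E : ℕ → VirtualDiagram := fun k => ofGeneric (C k) (trigPerturbed_contDiff (hγ k) (hβ k) v)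
    (trigPerturbed_periodic (hγp k) (hβp k) v) (hv k).1 D.real (fun p hp => by
      obtain ⟨s, t, hs, ht, hst⟩ := D.real_crossing p hp
      exact ⟨s, t, by rw [hCe (hDk k s (by rw [hs]; exact hp)), hs],
        by rw [hCe (hDk k t (by rw [ht]; exact hp)), ht], hst⟩)
  have hEreal : ∀ k i, ∀ t ∈ Set.Icc (a i) (b i), (E k).curve t ∉ (E k).real := by
    intro k i t ht
    change C k t ∉ D.real
    by_cases hz : unionWeight ψ k t = 0
    · rw [hCe hz]; exact hD i t ht
    · exact (hv k).2 t hz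
  have hchain : ∀ k ≤ N, StrictEquiv D (E k) := by
    intro k
    induction k with
    | zero =>
      intro _
      have : D = E 0 := ext' (funext fun t => (hCe (unionWeight_zero t)).symm) rfl
      rw [← this]
      exact StrictEquiv.refl D
    | succ k ih =>
      intro hk
      refine (ih (by omega)).trans (Detour.strictEquiv ?_)
      refine ⟨a ⟨k, hk⟩, b ⟨k, hk⟩, hab _, hab1 _, rfl, hEreal k _, hEreal (k + 1) _, fun t ht => ?_⟩
      -- The interval from `b k` to `a k + 1` is the complementary arc, where the `k`-th weight
      -- vanishes.
      have hz : ψ ⟨k, hk⟩ t = 0 := by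
        by_contra hne
        obtain ⟨l, hl1, hl2⟩ := hsupp _ t hne
        have h3 : (l : ℝ) < 0 := by linarith [ht.1]
        have h4 : (-1 : ℝ) < l := by linarith [ht.2]
        have h5 : l < 0 := by exact_mod_cast h3
        have h6 : -1 < l := by exact_mod_cast h4
        omega
      change C (k + 1) t = C k t
      simp only [C, γ, trigPerturbed, perturbed, unionWeight_succ hk hz]
  exact ⟨E N, hchain N le_rfl, rfl, rfl⟩

variable {n : ℕ} {w : GaussCode n}

/-- Let `β` be the union of the weights. The displacements are 0 for `D` and `β • (D.curve -
D'.curve)` for `D'`. Since `β = 1` wherever the curves differ, both diagrams are displaced to the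
curve of `D`, and a common perturbation makes them equal. -/
theorem IsStandard.strictEquiv (hn : 0 < n) {D D' : VirtualDiagram} (hD : D.IsStandard w)
    (hD' : D'.IsStandard w) : StrictEquiv D D' := by
  set σ := stdParam n with hσ
  have hlt : ∀ i, σ i < nextParam σ i := lt_nextParam (stdParam_strictMono n) (a := 0)
    (by simpa using stdParam_mem n)
  obtain ⟨δ, hδ, hgap, hagree⟩ : ∃ δ > 0, (∀ i, 4 * δ < nextParam σ i - σ i) ∧
      ∀ i t, |t - σ i| < 2 * δ → D.curve t = D'.curve t := by
    have h1 : ∀ᶠ δ in 𝓝 (0 : ℝ), ∀ i, 4 * δ < nextParam σ i - σ i := by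
      refine Filter.eventually_all.2 fun i => ?_
      have hc : ContinuousAt (fun δ : ℝ => 4 * δ) 0 := by fun_prop
      exact hc.eventually (gt_mem_nhds (by simpa using hlt i))
    have h2 : ∀ᶠ x in 𝓝 (0 : ℝ), ∀ i, D.curve (x + σ i) = D'.curve (x + σ i) := by
      refine Filter.eventually_all.2 fun i => ?_
      have hc : Filter.Tendsto (fun x : ℝ => x + σ i) (𝓝 0) (𝓝 (σ i)) := by
        have : ContinuousAt (fun x : ℝ => x + σ i) 0 := by fun_prop
        simpa [ContinuousAt] using this
      exact hc.eventually ((hD.germ i).trans (hD'.germ i).symm)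
    obtain ⟨ε₁, hε₁, h3⟩ := Metric.eventually_nhds_iff.1 h1
    obtain ⟨ε₂, hε₂, h4⟩ := Metric.eventually_nhds_iff.1 h2
    refine ⟨min (ε₁ / 2) (ε₂ / 2), by positivity, h3 ?_, fun i t ht => ?_⟩
    · rw [Real.dist_eq, sub_zero, abs_of_pos (by positivity)]
      linarith [min_le_left (ε₁ / 2) (ε₂ / 2)]
    · have := h4 (y := t - σ i) (by
        rw [Real.dist_eq, sub_zero]; linarith [min_le_right (ε₁ / 2) (ε₂ / 2)]) i
      simpa using this
  have hnext1 : ∀ i, nextParam σ i ≤ σ i + 1 := by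
    intro i
    unfold nextParam
    split_ifs with h
    · linarith [(stdParam_mem n i).1, (stdParam_mem n ⟨i + 1, h⟩).2]
    · have : σ ⟨0, i.pos⟩ ≤ σ i := (stdParam_strictMono n).monotone
        (Fin.mk_le_of_le_val (Nat.zero_le _))
      linarith
  let a : Fin (2 * n) → ℝ := fun i => σ i + δ
  let b : Fin (2 * n) → ℝ := fun i => nextParam σ i - δ
  have hbump := fun i => exists_arc_bump (a := a i) (a' := σ i + 2 * δ)
    (b' := nextParam σ i - 2 * δ) (b := b i) (by simp only [a]; linarith) (by simp only [b]; linarith)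
    (by simp only [a, b]; linarith [hnext1 i])
  choose ψ hψ hψp h0 h1 hsupp hone _ using hbump
  have hab : ∀ i, a i < b i := fun i => by simp only [a, b]; linarith [hgap i]
  have hab1 : ∀ i, b i < a i + 1 := fun i => by simp only [a, b]; linarith [hnext1 i]
  have hreal : ∀ {D : VirtualDiagram}, D.IsStandard w → D.real.Countable := fun hD => by
    rw [← hD.code.2.2.1]; exact Set.countable_range _
  have hfree : ∀ {D : VirtualDiagram}, D.IsStandard w → ∀ i, ∀ t ∈ Set.Icc (a i) (b i),
      D.curve t ∉ D.real := fun hD i t ht =>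
    hD.code.notMem_real i ⟨by simp only [a] at ht; linarith [ht.1],
      by simp only [b] at ht; linarith [ht.2]⟩
  have hA := D.ae_strictEquiv_trigPerturbed (hreal hD) hψ hψp h0 h1 hab hab1 hsupp (hfree hD)
    (e := fun _ => 0) contDiff_const fun _ => rfl
  have hB := D'.ae_strictEquiv_trigPerturbed (hreal hD') hψ hψp h0 h1 hab hab1 hsupp (hfree hD')
    (e := fun t => D.curve t - D'.curve t) (D.smooth.sub D'.smooth) fun t => by
      rw [D.periodic, D'.periodic]
  -- The same `v` has to be admissible for both chains of detours; this is why almost every `v` is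
  -- needed and not merely one.
  obtain ⟨v, ⟨E, hE1, hE2, hE3⟩, ⟨E', hE1', hE2', hE3'⟩⟩ := (hA.and hB).exists
  have : E = E' := by
    refine ext' ?_ ?_
    · rw [hE3, hE3']
      congr 1
      funext t
      rw [smul_zero, add_zero]
      by_cases hz : D.curve t = D'.curve t
      · simp [hz]
      · have h1 : unionWeight ψ (2 * n) t = 1 := by
          obtain ⟨i, k, hk1, hk2⟩ := exists_mem_Ico_nextParam (τ := σ) (by omega) t
          have hz' : D.curve (t + k) ≠ D'.curve (t + k) := by
            rwa [D.curve_add_int, D'.curve_add_int]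
          refine unionWeight_eq_one (i := i) ?_
          have hψk : ψ i t = ψ i (t + k) :=
            (SameParam.apply_eq (hψp i) (SameParam.add_int t k)).symm
          rw [hψk]
          refine hone i _ ⟨?_, ?_⟩
          · by_contra hlt
            exact hz' (hagree i _ (by rw [abs_lt]; constructor <;> linarith))
          · by_contra hlt
            obtain ⟨l, hl⟩ := nextParam_eq σ i
            have := hagree (finRotate _ i) (t + k - l) (by
              rw [abs_lt]; constructor <;> linarith)
            rw [show t + (k : ℝ) - l = t + ((k - l : ℤ) : ℝ) by push_cast; ring, D.curve_add_int,
              D'.curve_add_int] at this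
            exact hz this
        rw [h1, one_smul, add_sub_cancel]
    · rw [hE2, hE2', ← hD.code.2.2.1, ← hD'.code.2.2.1]
  rw [this] at hE1
  exact hE1.trans hE1'.symm

/-- Diagrams with a common Gauss code are strictly equivalent. -/
theorem HasGaussCode.strictEquiv (hn : 0 < n) {D D' : VirtualDiagram} (hD : D.HasGaussCode w)
    (hD' : D'.HasGaussCode w) : StrictEquiv D D' := by
  obtain ⟨E, h1, h2⟩ := hD.exists_isStandard
  obtain ⟨E', h1', h2'⟩ := hD'.exists_isStandard
  exact (h1.trans (h2.strictEquiv hn h2')).trans h1'.symm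

end VirtualDiagram

/-! ### Construction of diagrams from pieces -/

/-- Smooth pieces over pairwise disjoint windows of the parameter circle can be completed to a
generic closed curve; outside the windows the curve stays in a half plane and avoids a given
countable set. -/
theorem exists_generic_curve_of_pieces {κ : Type*} [Fintype κ] {m : κ → ℝ} {a b c₀ c₁ : ℝ}
    (ha : 0 < a) (hab : a < b) (hm0 : ∀ k, b < m k) (hm1 : ∀ k, m k + b < 1)
    (hsep : ∀ k l, k ≠ l → 2 * b ≤ |m k - m l|) {p : κ → ℝ → Plane}
    (hp : ∀ k, ContDiff ℝ ∞ (p k)) (hc : c₀ < c₁)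
    (hheight : ∀ k t, a ≤ |t - m k| → |t - m k| ≤ b → c₁ ≤ (p k t).2)
    (himm : ∀ k t, |t - m k| ≤ a → deriv (p k) t ≠ 0)
    (htr : ∀ k s l t, |s - m k| ≤ a → |t - m l| ≤ a → p k s = p l t → s ≠ t →
      planeDet (deriv (p k) s) (deriv (p l) t) ≠ 0)
    (htriple : ∀ k s l t i u, |s - m k| ≤ a → |t - m l| ≤ a → |u - m i| ≤ a →
      p k s = p l t → p l t = p i u → s = t ∨ t = u ∨ s = u) {Q : Set Plane} (hQ : Q.Countable) :
    ∃ γ : ℝ → Plane, ContDiff ℝ ∞ γ ∧ (∀ t, γ (t + 1) = γ t) ∧ GenericOn γ Set.univ ∧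
      (∀ k t, |t - m k| ≤ a → γ t = p k t ∧ deriv γ t = deriv (p k) t) ∧
      ∀ t ∈ Set.Icc (0 : ℝ) 1, (∀ k, a < |t - m k|) → c₀ < (γ t).2 ∧ γ t ∉ Q := by
  classical
  let a₁ : ℝ := (a + b) / 2
  have ha₁ : a < a₁ := by simp only [a₁]; linarith
  have hb₁ : a₁ < b := by simp only [a₁]; linarith
  let χ : (k : κ) → ContDiffBump (m k) := fun k => ⟨a₁, b, by linarith, hb₁⟩
  -- Between the windows the curve rests at `q`, at height `c₁`; in the collars it is a convex
  -- combination of `q` and a piece, both of height at least `c₁`.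
  let q : Plane := (0, c₁)
  let f : ℝ → Plane := fun t => ∑ k, χ k t • (p k t - q)
  have hf : ContDiff ℝ ∞ f := ContDiff.sum fun k _ => (χ k).contDiff.smul ((hp k).sub contDiff_const)
  have hχ0 : ∀ k t, χ k t ≠ 0 → |t - m k| < b := by
    intro k t ht
    have : t ∈ Function.support (χ k) := ht
    rw [(χ k).support_eq] at this
    simpa [Real.dist_eq] using this
  have hf_eq : ∀ k t, |t - m k| ≤ b → f t = χ k t • (p k t - q) := by
    intro k t ht
    refine Finset.sum_eq_single k (fun l _ hlk => ?_) (by simp)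
    have : χ l t = 0 := by
      by_contra hne
      have h1 := abs_lt.1 (hχ0 l t hne)
      have h2 := abs_le.1 ht
      have h3 := hsep l k hlk
      have h4 : |m l - m k| < 2 * b := by rw [abs_lt]; constructor <;> linarith
      linarith
    rw [this, zero_smul]
  have hf_zero : ∀ t, (∀ k, b ≤ |t - m k|) → f t = 0 := by
    intro t ht
    refine Finset.sum_eq_zero fun k _ => ?_
    have : χ k t = 0 := by
      by_contra hne
      exact absurd (hχ0 k t hne) (not_lt.2 (ht k))
    rw [this, zero_smul]
  have hper : ContDiff ℝ ∞ (periodize f) := by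
    obtain ⟨lo, hi, hlo, hhi, hlohi⟩ : ∃ lo hi : ℝ, 0 < lo ∧ hi < 1 ∧
        ∀ k, lo ≤ m k - b ∧ m k + b ≤ hi := by
      have h1 : ∀ᶠ x in 𝓝 (0 : ℝ), ∀ k, x < m k - b ∧ m k + b < 1 - x := by
        refine Filter.eventually_all.2 fun k => ?_
        have e1 : ∀ᶠ x in 𝓝 (0 : ℝ), x < m k - b := gt_mem_nhds (by linarith [hm0 k])
        have e2 : ∀ᶠ x in 𝓝 (0 : ℝ), x < 1 - (m k + b) := gt_mem_nhds (by linarith [hm1 k])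
        filter_upwards [e1, e2] with x h1 h2
        exact ⟨h1, by linarith⟩
      have h2 : ∀ᶠ x in 𝓝[>] (0 : ℝ), ∀ k, x < m k - b ∧ m k + b < 1 - x := nhdsWithin_le_nhds h1
      obtain ⟨x, hx, hx0⟩ := (h2.and self_mem_nhdsWithin).exists
      exact ⟨x, 1 - x, hx0, by linarith [hx0], fun k => ⟨(hx k).1.le, (hx k).2.le⟩⟩
    refine contDiff_periodize hf hlo hhi fun t ht => ?_
    obtain ⟨k, hk⟩ : ∃ k, |t - m k| < b := by
      by_contra! hcon
      exact ht (hf_zero t hcon)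
    have := abs_lt.1 hk
    exact ⟨by linarith [(hlohi k).1], by linarith [(hlohi k).2]⟩
  let γ₀ : ℝ → Plane := fun t => q + periodize f t
  have hγ₀ : ContDiff ℝ ∞ γ₀ := contDiff_const.add hper
  have hγ₀p : ∀ t, γ₀ (t + 1) = γ₀ t := fun t => by simp only [γ₀, periodize_add_one]
  have hIoo : ∀ k t, |t - m k| ≤ b → t ∈ Set.Ioo (0 : ℝ) 1 := by
    intro k t ht
    have := abs_le.1 ht
    exact ⟨by linarith [hm0 k], by linarith [hm1 k]⟩
  have hγ₀_eq : ∀ k t, |t - m k| ≤ a₁ → γ₀ t = p k t := by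
    intro k t ht
    have h1 : |t - m k| ≤ b := by linarith
    have h2 := hIoo k t h1
    simp only [γ₀]
    rw [periodize_of_mem f ⟨h2.1.le, h2.2⟩, hf_eq k t h1, (χ k).one_of_mem_closedBall (by
      rw [Metric.mem_closedBall, Real.dist_eq]; exact ht), one_smul, add_sub_cancel]
  have hγ₀_deriv : ∀ k t, |t - m k| ≤ a → deriv γ₀ t = deriv (p k) t := by
    intro k t ht
    refine Filter.EventuallyEq.deriv_eq ?_
    have h1 : ∀ᶠ x in 𝓝 t, |x - m k| < a₁ := by
      have hcont : ContinuousAt (fun x => |x - m k|) t := by fun_prop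
      exact hcont.eventually (gt_mem_nhds (by linarith))
    filter_upwards [h1] with x hx using hγ₀_eq k x hx.le
  have hγ₀_height : ∀ t ∈ Set.Ico (0 : ℝ) 1, (∀ k, a < |t - m k|) → c₁ ≤ (γ₀ t).2 := by
    intro t ht hk
    simp only [γ₀]
    rw [periodize_of_mem f ht]
    by_cases hex : ∃ k, |t - m k| ≤ b
    · obtain ⟨k, hkb⟩ := hex
      rw [hf_eq k t hkb]
      have h1 := hheight k t (hk k).le hkb
      have h2 : 0 ≤ χ k t := (χ k).nonneg
      simp only [q, Prod.snd_add, Prod.smul_snd, Prod.snd_sub, smul_eq_mul]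
      nlinarith [mul_nonneg h2 (sub_nonneg.2 h1)]
    · push Not at hex
      rw [hf_zero t fun k => (hex k).le, add_zero]
  have hbump := fun k => exists_arc_bump (a := m k - a₁) (a' := m k - a) (b' := m k + a)
    (b := m k + a₁) (by linarith) (by linarith) (by linarith [hm0 k, hm1 k])
  choose ζ hζ hζp hζ0 hζ1 _ hζone hζone' using hbump
  -- The weight vanishes exactly on the windows of radius `a`, modulo 1. Only there is `γ₀` known to
  -- be generic; between the windows it is even constant.
  let β : ℝ → ℝ := fun t => ∏ k, (1 - ζ k t)
  have hβ : ContDiff ℝ ∞ β := contDiff_prod fun k _ => contDiff_const.sub (hζ k)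
  have hβp : ∀ t, β (t + 1) = β t := fun t => by simp only [β, hζp]
  have hβ0 : ∀ t, 0 ≤ β t := fun t => Finset.prod_nonneg fun k _ => sub_nonneg.2 (hζ1 k t)
  have hβ1 : ∀ t, β t ≤ 1 := fun t => Finset.prod_le_one (fun k _ => sub_nonneg.2 (hζ1 k t))
    fun k _ => by linarith [hζ0 k t]
  have hβz : ∀ t, β t = 0 → ∃ k, ∃ i : ℤ, |t + i - m k| ≤ a := by
    intro t ht
    obtain ⟨k, -, hk⟩ := Finset.prod_eq_zero_iff.1 ht
    obtain ⟨i, hi⟩ := hζone' k t (by linarith)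
    exact ⟨k, i, by rw [abs_le]; constructor <;> linarith [hi.1, hi.2]⟩
  have hβz' : ∀ k t, |t - m k| ≤ a → β t = 0 := by
    intro k t ht
    have := abs_le.1 ht
    refine Finset.prod_eq_zero (Finset.mem_univ k) ?_
    rw [hζone k t ⟨by linarith, by linarith⟩, sub_self]
  have hsh : ∀ t (i : ℤ), γ₀ (t + i) = γ₀ t := fun t i =>
    SameParam.apply_eq hγ₀p (SameParam.add_int t i)
  have hsh' : ∀ t (i : ℤ), deriv γ₀ (t + i) = deriv γ₀ t := fun t i =>
    SameParam.apply_eq (deriv_periodic hγ₀p) (SameParam.add_int t i)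
  have hsame : ∀ {s t : ℝ} {i j : ℤ}, s + i = t + j → SameParam s t := fun {s t i j} h =>
    ⟨j - i, by push_cast; linarith⟩
  have hgen : GenericOn γ₀ {t | β t = 0} := by
    refine ⟨fun t ht => ?_, fun s hs t ht h hne => ?_, fun s hs t ht u hu h1 h2 => ?_⟩
    · obtain ⟨k, i, hk⟩ := hβz t ht
      rw [← hsh' t i, hγ₀_deriv k _ hk]
      exact himm k _ hk
    · obtain ⟨k, i, hk⟩ := hβz s hs
      obtain ⟨l, j, hl⟩ := hβz t ht
      rw [← hsh s i, ← hsh t j, hγ₀_eq k _ (by linarith), hγ₀_eq l _ (by linarith)] at h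
      rw [← hsh' s i, ← hsh' t j, hγ₀_deriv k _ hk, hγ₀_deriv l _ hl]
      exact htr k _ l _ hk hl h fun he => hne (hsame he)
    · obtain ⟨k, i, hk⟩ := hβz s hs
      obtain ⟨l, j, hl⟩ := hβz t ht
      obtain ⟨k', i', hk'⟩ := hβz u hu
      rw [← hsh s i, ← hsh t j, hγ₀_eq k _ (by linarith), hγ₀_eq l _ (by linarith)] at h1
      rw [← hsh u i', ← hsh t j, hγ₀_eq l _ (by linarith), hγ₀_eq k' _ (by linarith)] at h2
      rcases htriple k _ l _ k' _ hk hl hk' h1 h2 with h | h | h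
      · exact Or.inl (hsame h)
      · exact Or.inr (Or.inl (hsame h))
      · exact Or.inr (Or.inr (hsame h))
  have hae := ae_genericOn_trigPerturbed hγ₀ hγ₀p hβ hβp hβ0 hgen hQ
  -- Here `v` must be small: the perturbation lowers the height by at most `3 * ‖v‖ < c₁ - c₀`. A
  -- set of full measure is dense and so meets the ball.
  obtain ⟨v, hvball, hv1, hv2⟩ := (Measure.dense_of_ae hae).inter_open_nonempty
    (Metric.ball 0 ((c₁ - c₀) / 3)) Metric.isOpen_ball
    ⟨0, Metric.mem_ball_self (by linarith)⟩
  have hpc := trigPerturbed_contDiff hγ₀ hβ v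
  have hpp := trigPerturbed_periodic hγ₀p hβp v
  have hlow : ∀ t ∈ Set.Ico (0 : ℝ) 1, (∀ k, a < |t - m k|) →
      c₀ < (trigPerturbed γ₀ β v t).2 ∧ trigPerturbed γ₀ β v t ∉ Q := by
    intro t ht hk
    constructor
    · have h1 := hγ₀_height t ht hk
      have h2 : |∑ k, ((β t * trigFun k t) • v k).2| ≤ ∑ k, ‖v k‖ := by
        refine (Finset.abs_sum_le_sum_abs _ _).trans (Finset.sum_le_sum fun k _ => ?_)
        rw [Prod.smul_snd, smul_eq_mul, abs_mul]
        have h3 : |(v k).2| ≤ ‖v k‖ := norm_snd_le (v k)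
        have h4 : |trigFun k t| ≤ 1 := by
          have hsq := trigFun_sq t
          fin_cases k
          · exact abs_one.le
          · exact Real.abs_cos_le_one _
          · exact Real.abs_sin_le_one _
        have h5 : |β t * trigFun k t| ≤ 1 := by
          rw [abs_mul, abs_of_nonneg (hβ0 t)]
          exact mul_le_one₀ (hβ1 t) (abs_nonneg _) h4
        calc |β t * trigFun k t| * |(v k).2| ≤ 1 * ‖v k‖ :=
              mul_le_mul h5 h3 (abs_nonneg _) zero_le_one
          _ = ‖v k‖ := one_mul _
      have h6 : ∀ k, ‖v k‖ ≤ ‖v‖ := norm_le_pi_norm v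
      have h7 : ∑ k, ‖v k‖ ≤ 3 * ‖v‖ := by
        rw [Fin.sum_univ_three]; linarith [h6 0, h6 1, h6 2]
      have h8 : ‖v‖ < (c₁ - c₀) / 3 := by simpa using hvball
      have h9 := neg_le_of_abs_le (h2.trans h7)
      have h10 : (trigPerturbed γ₀ β v t).2 = (γ₀ t).2 + ∑ k, ((β t * trigFun k t) • v k).2 := by
        simp [trigPerturbed, perturbed, Prod.snd_sum]
      rw [h10]
      linarith
    · refine hv2 t fun hz => ?_
      obtain ⟨k, i, hki⟩ := hβz t hz
      have h1 := hIoo k _ (by linarith : |t + i - m k| ≤ b)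
      have h3 : (i : ℝ) < 1 := by linarith [h1.2, ht.1]
      have h4 : (-1 : ℝ) < i := by linarith [h1.1, ht.2]
      have h5 : i < 1 := by exact_mod_cast h3
      have h6 : -1 < i := by exact_mod_cast h4
      have h7 : i = 0 := by omega
      rw [h7, Int.cast_zero, add_zero] at hki
      exact absurd hki (not_le.2 (hk k))
  refine ⟨trigPerturbed γ₀ β v, hpc, hpp, hv1, fun k t ht => ?_, fun t ht hk => ?_⟩
  · have hz := hβz' k t ht
    rw [trigPerturbed_of_eq_zero hz, deriv_trigPerturbed_of_eq_zero hγ₀ hβ hβ0 v hz]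
    exact ⟨hγ₀_eq k t (by linarith), hγ₀_deriv k t ht⟩
  · rcases ht.2.lt_or_eq with h | h
    · exact hlow t ⟨ht.1, h⟩ hk
    · have h0 : trigPerturbed γ₀ β v t = trigPerturbed γ₀ β v 0 := by
        rw [h, ← hpp 0, zero_add]
      rw [h0]
      refine hlow 0 ⟨le_rfl, zero_lt_one⟩ fun k => ?_
      rw [zero_sub, abs_neg]
      have h1 := hm0 k
      exact lt_of_lt_of_le (by linarith) (le_abs_self _)

/-- Completion of pieces to a diagram with a prescribed Gauss code. -/
theorem exists_diagram_of_pieces {n : ℕ} {κ : Type*} [Fintype κ] {m : κ → ℝ} {a b c₀ c₁ : ℝ}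
    (ha : 0 < a) (hab : a < b) (hm0 : ∀ k, b < m k) (hm1 : ∀ k, m k + b < 1)
    (hsep : ∀ k l, k ≠ l → 2 * b ≤ |m k - m l|) {p : κ → ℝ → Plane}
    (hp : ∀ k, ContDiff ℝ ∞ (p k)) (hc : c₀ < c₁)
    (hheight : ∀ k t, a ≤ |t - m k| → |t - m k| ≤ b → c₁ ≤ (p k t).2)
    (himm : ∀ k t, |t - m k| ≤ a → deriv (p k) t ≠ 0)
    (htr : ∀ k s l t, |s - m k| ≤ a → |t - m l| ≤ a → p k s = p l t → s ≠ t →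
      planeDet (deriv (p k) s) (deriv (p l) t) ≠ 0)
    (htriple : ∀ k s l t i u, |s - m k| ≤ a → |t - m l| ≤ a → |u - m i| ≤ a →
      p k s = p l t → p l t = p i u → s = t ∨ t = u ∨ s = u)
    {w : GaussCode n} {σ : Fin (2 * n) → ℝ} {c : Fin n → Plane} (hσ : StrictMono σ)
    (hcinj : Function.Injective c) (win : Fin (2 * n) → κ)
    (hwin : ∀ i, |σ i - m (win i)| ≤ a) (hwc : ∀ i, p (win i) (σ i) = c (w.letter i).1)
    (hreal : ∀ k t, |t - m k| ≤ a → p k t ∈ Set.range c → ∃ i, σ i = t)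
    (hside : ∀ i j, i ≠ j → (w.letter i).1 = (w.letter j).1 → ((w.letter i).2 = Side.L ↔
      planeDet (deriv (p (win i)) (σ i)) (deriv (p (win j)) (σ j)) < 0)) :
    ∃ D : VirtualDiagram, D.HasCodeAt w 0 σ c ∧
      (∀ k t, |t - m k| ≤ a → D.curve t = p k t) ∧
      ∀ t ∈ Set.Icc (0 : ℝ) 1, (∀ k, a < |t - m k|) → c₀ < (D.curve t).2 := by
  obtain ⟨γ, hγ, hγp, hgen, hon, hoff⟩ := exists_generic_curve_of_pieces ha hab hm0 hm1 hsep hp hc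
    hheight himm htr htriple (Set.countable_range c)
  have hγσ : ∀ i, γ (σ i) = c (w.letter i).1 := fun i => by rw [(hon _ _ (hwin i)).1, hwc]
  have hIoo : ∀ k t, |t - m k| ≤ a → t ∈ Set.Ioo (0 : ℝ) 1 := by
    intro k t ht
    have := abs_le.1 ht
    exact ⟨by linarith [hm0 k], by linarith [hm1 k]⟩
  have hσ01 : ∀ i, σ i ∈ Set.Ioo (0 : ℝ) 1 := fun i => hIoo _ _ (hwin i)
  have hmem : ∀ t ∈ Set.Icc (0 : ℝ) 1, γ t ∈ Set.range c → ∃ i, σ i = t := by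
    intro t ht hr
    by_cases hk : ∀ k, a < |t - m k|
    · exact absurd hr (hoff t ht hk).2
    · push Not at hk
      obtain ⟨k, hk⟩ := hk
      refine hreal k t hk ?_
      rwa [← (hon k t hk).1]
  have hns : ∀ i j, i ≠ j → ¬ SameParam (σ i) (σ j) := by
    rintro i j hij ⟨k, hk⟩
    have h3 : (k : ℝ) < 1 := by linarith [(hσ01 i).2, (hσ01 j).1]
    have h4 : (-1 : ℝ) < k := by linarith [(hσ01 i).1, (hσ01 j).2]
    have h5 : k < 1 := by exact_mod_cast h3
    have h6 : -1 < k := by exact_mod_cast h4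
    have h7 : k = 0 := by omega
    rw [h7, Int.cast_zero, add_zero] at hk
    exact hij (hσ.injective hk)
  let D := VirtualDiagram.ofGeneric γ hγ hγp hgen (Set.range c) (by
    rintro _ ⟨j, rfl⟩
    refine ⟨σ (w.pos (j, Side.L)), σ (w.pos (j, Side.R)), by rw [hγσ]; simp, by rw [hγσ]; simp,
      hns _ _ fun h => ?_⟩
    have := congrArg w.letter h
    simp at this)
  refine ⟨D, ⟨?_, hcinj, rfl, hσ, ?_, fun i => ⟨hγσ i, fun s hs hne => ?_⟩⟩,
    fun k t ht => (hon k t ht).1, fun t ht hk => (hoff t ht hk).1⟩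
  · intro hr
    obtain ⟨i, hi⟩ := hmem 0 ⟨le_rfl, zero_le_one⟩ hr
    exact absurd hi (hσ01 i).1.ne'
  · ext t
    constructor
    · rintro ⟨i, rfl⟩
      refine ⟨by simpa using hσ01 i, ?_⟩
      change γ (σ i) ∈ Set.range c
      rw [hγσ]; exact Set.mem_range_self _
    · rintro ⟨ht, hr⟩
      exact hmem t ⟨ht.1.le, by linarith [ht.2]⟩ hr
  · obtain ⟨k, hk⟩ := VirtualDiagram.exists_int_add_mem_Ico 0 s
    have hs' : D.curve (s + k) = D.curve (σ i) := by rw [D.curve_add_int, hs]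
    have hr : γ (s + k) ∈ Set.range c := by
      change D.curve (s + k) ∈ Set.range c
      rw [hs']
      change γ (σ i) ∈ Set.range c
      rw [hγσ]; exact Set.mem_range_self _
    obtain ⟨j, hj⟩ := hmem (s + k) ⟨hk.1, by linarith [hk.2]⟩ hr
    have hij : i ≠ j := by
      rintro rfl
      exact hne ⟨-k, by push_cast; linarith⟩
    have hl : (w.letter i).1 = (w.letter j).1 := by
      apply hcinj
      rw [← hγσ, ← hγσ, hj]
      exact hs'.symm
    rw [hside i j hij hl, ← (hon _ _ (hwin i)).2, ← (hon _ _ (hwin j)).2, hj]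
    have : deriv γ (s + k) = deriv γ s := D.deriv_curve_add_int s k
    rw [this]
    rfl

/-! ### Standard pieces and diagrams with prescribed special pieces -/

/-- The piece at a regular crossing, with the given letter. -/
noncomputable def regPiece {n : ℕ} (x : Fin n × Side) (T : ℝ) : Plane :=
  if x.2 = Side.L then (100 + (x.1 : ℝ) + T / 10, 100) else (100 + (x.1 : ℝ), 100 - T / 10)

section regPiece

variable {n : ℕ}

lemma regPiece_contDiff (x : Fin n × Side) : ContDiff ℝ ∞ (regPiece x) := by
  unfold regPiece
  split_ifs <;> fun_prop

lemma deriv_regPiece (x : Fin n × Side) (T : ℝ) :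
    deriv (regPiece x) T = if x.2 = Side.L then (1 / 10, 0) else (0, -1 / 10) := by
  unfold regPiece
  split_ifs
  · exact ((((hasDerivAt_id T).div_const 10).const_add _).prodMk (hasDerivAt_const T _)).deriv
  · have := ((hasDerivAt_const T (100 + (x.1 : ℝ))).prodMk
      (((hasDerivAt_id T).div_const 10).const_sub 100)).deriv
    rw [neg_div]
    exact this

lemma regPiece_zero (x : Fin n × Side) : regPiece x 0 = (100 + (x.1 : ℝ), 100) := by
  unfold regPiece
  split_ifs <;> simp

/-- The horizontal deviation is below `1 / 2`, so pieces with different labels are disjoint, and all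
of them stay to the right of the special pieces, whose first coordinate is below 50. -/
lemma regPiece_bounds (x : Fin n × Side) {T : ℝ} (hT : |T| ≤ 4) :
    |(regPiece x T).1 - (100 + (x.1 : ℝ))| ≤ 4 / 10 ∧ 99 ≤ (regPiece x T).2 := by
  have := abs_le.1 hT
  unfold regPiece
  split_ifs
  · exact ⟨by rw [abs_le]; constructor <;> simp <;> linarith, by norm_num⟩
  · exact ⟨by simp; norm_num, by simp; linarith⟩

lemma regPiece_fst_eq {x y : Fin n × Side} {S T : ℝ} (hS : |S| ≤ 4) (hT : |T| ≤ 4)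
    (h : (regPiece x S).1 = (regPiece y T).1) : x.1 = y.1 := by
  have h1 := abs_le.1 (regPiece_bounds x hS).1
  have h2 := abs_le.1 (regPiece_bounds y hT).1
  have h3 : ((x.1 : ℕ) : ℝ) < (y.1 : ℕ) + 1 := by linarith
  have h4 : ((y.1 : ℕ) : ℝ) < (x.1 : ℕ) + 1 := by linarith
  have h5 : (x.1 : ℕ) < y.1 + 1 := by exact_mod_cast h3
  have h6 : (y.1 : ℕ) < x.1 + 1 := by exact_mod_cast h4
  exact Fin.ext (by omega)

lemma regPiece_injective (x : Fin n × Side) : Function.Injective (regPiece x) := by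
  intro S T h
  unfold regPiece at h
  split_ifs at h
  · have := congrArg Prod.fst h; simp at this; linarith
  · have := congrArg Prod.snd h; simp at this; linarith

lemma regPiece_eq {x y : Fin n × Side} {S T : ℝ} (hS : |S| ≤ 4) (hT : |T| ≤ 4)
    (h : regPiece x S = regPiece y T) : x.1 = y.1 ∧ (x = y ∧ S = T ∨ x.2 ≠ y.2) := by
  have h1 := regPiece_fst_eq hS hT (congrArg Prod.fst h)
  refine ⟨h1, ?_⟩
  by_cases h2 : x.2 = y.2
  · left
    have hxy : x = y := Prod.ext h1 h2
    subst hxy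
    exact ⟨rfl, regPiece_injective x h⟩
  · exact Or.inr h2

lemma eq_zero_of_regPiece_eq {x : Fin n × Side} {j : Fin n} {T : ℝ} (hT : |T| ≤ 4)
    (h : regPiece x T = (100 + (j : ℝ), 100)) : x.1 = j ∧ T = 0 := by
  have h0 : regPiece x T = regPiece (j, x.2) 0 := by rw [h, regPiece_zero]
  obtain ⟨h1, h2⟩ := regPiece_eq hT (by simp) h0
  rcases h2 with h2 | h2
  · exact ⟨h1, h2.2⟩
  · exact absurd rfl h2

lemma planeDet_deriv_regPiece {x y : Fin n × Side} (h : x.2 ≠ y.2) (S T : ℝ) :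
    (x.2 = Side.L ↔ planeDet (deriv (regPiece x) S) (deriv (regPiece y) T) < 0) ∧
      planeDet (deriv (regPiece x) S) (deriv (regPiece y) T) ≠ 0 := by
  rw [deriv_regPiece, deriv_regPiece]
  rcases x with ⟨i, s⟩
  rcases y with ⟨j, t⟩
  cases s <;> cases t <;> first | exact absurd rfl h | (constructor <;> norm_num [planeDet])

end regPiece

/-- Existence of a diagram with a given Gauss code that contains prescribed pieces around some of
the crossings. The regular positions get standard pieces; the passages at the other positions lie
on the special pieces `A k`, whose window has the place of the position `slot k`. -/
theorem exists_diagram_of_special {n : ℕ} (w : GaussCode n) {κ : Type*} [Fintype κ]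
    {slot : κ → Fin (2 * n)} (hslot : Function.Injective slot) {reg : Fin (2 * n) → Prop}
    (hreg : ∀ k, ¬ reg (slot k))
    (hlab : ∀ i j, (w.letter i).1 = (w.letter j).1 → reg i → reg j)
    {A : κ → ℝ → Plane} (hA : ∀ k, ContDiff ℝ ∞ (A k)) {c₀ c₁ : ℝ} (hc : c₀ < c₁) (hc₁ : c₁ ≤ 99)
    (hheight : ∀ k T, 3 ≤ |T| → |T| ≤ 4 → c₁ ≤ (A k T).2)
    (hx : ∀ k T, |T| ≤ 3 → (A k T).1 < 50)
    (himm : ∀ k T, deriv (A k) T ≠ 0)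
    (htr : ∀ k S l T, |S| ≤ 3 → |T| ≤ 3 → A k S = A l T → ¬ (k = l ∧ S = T) →
      planeDet (deriv (A k) S) (deriv (A l) T) ≠ 0)
    (htriple : ∀ k S l T i U, |S| ≤ 3 → |T| ≤ 3 → |U| ≤ 3 → A k S = A l T → A l T = A i U →
      (k = l ∧ S = T) ∨ (l = i ∧ T = U) ∨ (k = i ∧ S = U))
    {off : Fin (2 * n) → ℝ} (hoff : ∀ i, off i ∈ Set.Icc (-9 : ℝ) 0) (hoff0 : ∀ i, reg i → off i = 0)
    {win : ∀ i, ¬ reg i → κ} {loc : Fin (2 * n) → ℝ}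
    (hloc : ∀ (i : Fin (2 * n)) h, 10 * ((i : ℝ) - slot (win i h)) + off i = loc i)
    (hloc3 : ∀ i, ¬ reg i → |loc i| ≤ 3) {cs : Fin n → Plane}
    (hcs : ∀ i h, A (win i h) (loc i) = cs (w.letter i).1)
    (hcsinj : ∀ i j, ¬ reg i → ¬ reg j → cs (w.letter i).1 = cs (w.letter j).1 →
      (w.letter i).1 = (w.letter j).1)
    (hreal : ∀ k T, |T| ≤ 3 → ∀ i, ¬ reg i → A k T = cs (w.letter i).1 →
      ∃ j h, win j h = k ∧ loc j = T)
    (hside : ∀ i j hi hj, i ≠ j → (w.letter i).1 = (w.letter j).1 →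
      ((w.letter i).2 = Side.L ↔
        planeDet (deriv (A (win i hi)) (loc i)) (deriv (A (win j hj)) (loc j)) < 0)) :
    ∃ D : VirtualDiagram, D.HasGaussCode w ∧
      (∀ k t, |10 * (2 * n + 1) * t - 10 * ((slot k : ℝ) + 1)| ≤ 3 →
        D.curve t = A k (10 * (2 * n + 1) * t - 10 * ((slot k : ℝ) + 1))) ∧
      (∀ i, ¬ reg i → cs (w.letter i).1 ∈ D.real) ∧
      ∀ t ∈ Set.Icc (0 : ℝ) 1,
        (∀ k, 3 < |10 * (2 * n + 1) * t - 10 * ((slot k : ℝ) + 1)|) → c₀ < (D.curve t).2 := by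
  classical
  -- The local parameter `M * t - 10 * (i + 1)` gives every position a slot of length 10. The
  -- windows have radius 3 and their collars reach to radius 4, so they remain disjoint.
  set M : ℝ := 10 * (2 * n + 1) with hM
  have hM0 : 0 < M := by positivity
  let K := {i : Fin (2 * n) // reg i} ⊕ κ
  let s : K → Fin (2 * n) := Sum.elim Subtype.val slot
  have hs : Function.Injective s := by
    rintro (⟨i, hi⟩ | k) (⟨j, hj⟩ | l) h
    · exact congrArg Sum.inl (Subtype.ext h)
    · exact absurd (show reg (slot l) from (show i = slot l from h) ▸ hi) (hreg l)
    · exact absurd (show reg (slot k) from (show slot k = j from h) ▸ hj) (hreg k)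
    · exact congrArg Sum.inr (hslot h)
  let B : K → ℝ → Plane := Sum.elim (fun i => regPiece (w.letter i.1)) A
  have hB : ∀ k, ContDiff ℝ ∞ (B k) := by
    rintro (i | k)
    · exact regPiece_contDiff _
    · exact hA k
  let m : K → ℝ := fun k => 10 * ((s k : ℝ) + 1) / M
  let T : K → ℝ → ℝ := fun k t => M * t - 10 * ((s k : ℝ) + 1)
  let p : K → ℝ → Plane := fun k t => B k (T k t)
  have habs : ∀ k t, |t - m k| = |T k t| / M := by
    intro k t
    have : t - m k = T k t / M := by
      simp only [m, T]
      field_simp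
    rw [this, abs_div, abs_of_pos hM0]
  have hle : ∀ k t (r : ℝ), |t - m k| ≤ r / M ↔ |T k t| ≤ r := fun k t r => by
    rw [habs, div_le_div_iff_of_pos_right hM0]
  have hle' : ∀ k t (r : ℝ), r / M ≤ |t - m k| ↔ r ≤ |T k t| := fun k t r => by
    rw [habs, div_le_div_iff_of_pos_right hM0]
  have hlt' : ∀ k t (r : ℝ), r / M < |t - m k| ↔ r < |T k t| := fun k t r => by
    rw [habs, div_lt_div_iff_of_pos_right hM0]
  have hTd : ∀ k t, HasDerivAt (T k) M t := fun k t => by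
    have h := ((hasDerivAt_id t).const_mul M).sub_const (10 * ((s k : ℝ) + 1))
    rw [mul_one] at h
    exact h
  have hpd : ∀ k t, deriv (p k) t = M • deriv (B k) (T k t) := fun k t =>
    (((hB k).differentiable (by simp) (T k t)).hasDerivAt.scomp t (hTd k t)).deriv
  have hdet : ∀ k t l u, planeDet (deriv (p k) t) (deriv (p l) u) =
      M * M * planeDet (deriv (B k) (T k t)) (deriv (B l) (T l u)) := fun k t l u => by
    rw [hpd, hpd, planeDet_smul_smul]
  have hTinj : ∀ k t u, T k t = T k u → t = u := by
    intro k t u h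
    simp only [T] at h
    exact mul_left_cancel₀ hM0.ne' (by linarith)
  have hs2 : ∀ k, ((s k : ℕ) : ℝ) + 1 ≤ 2 * n := fun k => by exact_mod_cast (s k).2
  -- regular and special pieces are disjoint
  have hdisj : ∀ (i : {i : Fin (2 * n) // reg i}) (k : κ) (S U : ℝ), |S| ≤ 3 → |U| ≤ 3 →
      B (Sum.inl i) S ≠ B (Sum.inr k) U := by
    intro i k S U hS hU h
    have h1 := abs_le.1 (regPiece_bounds (w.letter i.1) (by linarith : |S| ≤ 4)).1
    have h2 := hx k U hU
    have h3 : (regPiece (w.letter i.1) S).1 = (A k U).1 := congrArg Prod.fst h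
    have h4 : (0 : ℝ) ≤ ((w.letter i.1).1 : ℕ) := Nat.cast_nonneg _
    linarith
  have hinl : ∀ (i j : {i : Fin (2 * n) // reg i}) (S U : ℝ), |S| ≤ 3 → |U| ≤ 3 →
      B (Sum.inl i) S = B (Sum.inl j) U → (w.letter i.1).1 = (w.letter j.1).1 ∧
        (i = j ∧ S = U ∨ (w.letter i.1).2 ≠ (w.letter j.1).2) := by
    intro i j S U hS hU h
    obtain ⟨h1, h2⟩ := regPiece_eq (by linarith) (by linarith) h
    exact ⟨h1, h2.imp_left fun h => ⟨Subtype.ext (w.letter_injective h.1), h.2⟩⟩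
  -- Both passages with a given label are of the same kind by `hlab`, so testing the letter `L`
  -- decides whether the crossing is regular.
  let c : Fin n → Plane := fun j =>
    if reg (w.pos (j, Side.L)) then (100 + (j : ℝ), 100) else cs j
  have hregpos : ∀ i, reg (w.pos ((w.letter i).1, Side.L)) ↔ reg i := fun i =>
    ⟨hlab _ _ (by simp), hlab _ _ (by simp)⟩
  have hcreg : ∀ i, reg i → c (w.letter i).1 = (100 + ((w.letter i).1 : ℝ), 100) := fun i hi =>
    if_pos ((hregpos i).2 hi)
  have hcspec : ∀ i, ¬ reg i → c (w.letter i).1 = cs (w.letter i).1 := fun i hi =>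
    if_neg fun h => hi ((hregpos i).1 h)
  have hclt : ∀ i, ¬ reg i → (c (w.letter i).1).1 < 50 := fun i hi => by
    rw [hcspec i hi, ← hcs i hi]; exact hx _ _ (hloc3 i hi)
  have hcgt : ∀ i, reg i → 100 ≤ (c (w.letter i).1).1 := fun i hi => by
    rw [hcreg i hi]
    simp
  have hcinj' : ∀ i j, c (w.letter i).1 = c (w.letter j).1 → (w.letter i).1 = (w.letter j).1 := by
    intro i j h
    by_cases hi : reg i <;> by_cases hj : reg j
    · rw [hcreg i hi, hcreg j hj] at h
      have := congrArg Prod.fst h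
      exact VirtualDiagram.natCast_fin_injective n (by simpa using this)
    · linarith [hcgt i hi, hclt j hj, congrArg Prod.fst h]
    · linarith [hcgt j hj, hclt i hi, congrArg Prod.fst h]
    · rw [hcspec i hi, hcspec j hj] at h
      exact hcsinj i j hi hj h
  have hcinj : Function.Injective c := by
    intro i j h
    have := hcinj' (w.pos (i, Side.L)) (w.pos (j, Side.L)) (by simpa using h)
    simpa using this
  -- Offsets in `[-9, 0]` preserve the order, and they allow a passage to be moved from its own slot
  -- into the window of the preceding slot.
  let σ : Fin (2 * n) → ℝ := fun i => (10 * ((i : ℝ) + 1) + off i) / M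
  have hσ : StrictMono σ := by
    intro i j hij
    have h1 : ((i : ℕ) : ℝ) + 1 ≤ (j : ℕ) := by exact_mod_cast (show (i : ℕ) < j from hij)
    have h2 := (hoff i).2
    have h3 := (hoff j).1
    simp only [σ]
    rw [div_lt_div_iff_of_pos_right hM0]
    linarith
  let W : Fin (2 * n) → K := fun i => if h : reg i then Sum.inl ⟨i, h⟩ else Sum.inr (win i h)
  have hMσ : ∀ i, M * σ i = 10 * ((i : ℝ) + 1) + off i := fun i => by
    simp only [σ]; field_simp
  have hTreg : ∀ i (h : reg i), T (Sum.inl ⟨i, h⟩) (σ i) = 0 := fun i h => by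
    simp only [T, hMσ, hoff0 i h]
    simp [s]
  have hTspec : ∀ i h, T (Sum.inr (win i h)) (σ i) = loc i := fun i h => by
    simp only [T, hMσ, ← hloc i h]
    simp only [s, Sum.elim_inr]
    ring
  have hσeq : ∀ i k t, T k (σ i) = T k t → σ i = t := fun i k t h => hTinj k _ _ h
  obtain ⟨D, hD1, hD2, hD3⟩ := exists_diagram_of_pieces (m := m) (a := 3 / M) (b := 4 / M)
    (c₀ := c₀) (c₁ := c₁) (p := p) (w := w) (σ := σ) (c := c) (by positivity)
    (by gcongr; norm_num)
    (fun k => by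
      simp only [m]
      have : (0 : ℝ) ≤ (s k : ℕ) := Nat.cast_nonneg _
      gcongr
      linarith)
    (fun k => by
      simp only [m]
      rw [← add_div, div_lt_one hM0]
      linarith [hs2 k])
    (fun k l hkl => by
      have hne : ((s k : ℕ) : ℤ) ≠ (s l : ℕ) := fun h => hkl (hs (Fin.ext (by exact_mod_cast h)))
      have h1 : (1 : ℤ) ≤ |((s k : ℕ) : ℤ) - (s l : ℕ)| := Int.one_le_abs (sub_ne_zero.2 hne)
      have h2 : (1 : ℝ) ≤ |((s k : ℕ) : ℝ) - (s l : ℕ)| := by exact_mod_cast h1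
      have h3 : m k - m l = 10 * (((s k : ℕ) : ℝ) - (s l : ℕ)) / M := by
        simp only [m]; ring
      rw [h3, abs_div, abs_of_pos hM0, abs_mul, ← mul_div_assoc, div_le_div_iff_of_pos_right hM0,
        abs_of_pos (by norm_num : (0 : ℝ) < 10)]
      linarith)
    (fun k => (hB k).comp ((contDiff_const.mul contDiff_id).sub contDiff_const)) hc
    (fun k t h1 h2 => by
      rw [hle'] at h1
      rw [hle] at h2
      rcases k with i | k
      · exact hc₁.trans (regPiece_bounds _ h2).2
      · exact hheight k _ h1 h2)
    (fun k t _ => by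
      rw [hpd]
      refine smul_ne_zero hM0.ne' ?_
      rcases k with i | k
      · simp only [B, Sum.elim_inl, deriv_regPiece]
        split_ifs <;> simp
      · exact himm k _)
    (fun k t l u h1 h2 h3 hne => by
      rw [hle] at h1 h2
      rw [hdet]
      refine mul_ne_zero (mul_ne_zero hM0.ne' hM0.ne') ?_
      rcases k with i | k <;> rcases l with j | l
      · obtain ⟨-, h5 | h5⟩ := hinl i j _ _ h1 h2 h3
        · obtain ⟨rfl, h6⟩ := h5
          exact absurd (hTinj _ _ _ h6) hne
        · exact (planeDet_deriv_regPiece h5 _ _).2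
      · exact absurd h3 (hdisj i l _ _ h1 h2)
      · exact absurd h3.symm (hdisj j k _ _ h2 h1)
      · refine htr k _ l _ h1 h2 h3 ?_
        rintro ⟨rfl, h6⟩
        exact hne (hTinj _ _ _ h6))
    (fun k t l u i x h1 h2 h3 e1 e2 => by
      rw [hle] at h1 h2 h3
      rcases k with k | k <;> rcases l with l | l <;> rcases i with i | i
      · obtain ⟨-, f1 | f1⟩ := hinl k l _ _ h1 h2 e1
        · obtain ⟨rfl, h6⟩ := f1
          exact Or.inl (hTinj _ _ _ h6)
        obtain ⟨-, f2 | f2⟩ := hinl l i _ _ h2 h3 e2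
        · obtain ⟨rfl, h6⟩ := f2
          exact Or.inr (Or.inl (hTinj _ _ _ h6))
        obtain ⟨-, f3 | f3⟩ := hinl k i _ _ h1 h3 (e1.trans e2)
        · obtain ⟨rfl, h6⟩ := f3
          exact Or.inr (Or.inr (hTinj _ _ _ h6))
        -- Three pairwise different sides do not exist.
        exfalso
        revert f1 f2 f3
        generalize (w.letter k.1).2 = b1
        generalize (w.letter l.1).2 = b2
        generalize (w.letter i.1).2 = b3
        revert b1 b2 b3
        decide
      · exact absurd e2 (hdisj _ _ _ _ h2 h3)
      · exact absurd e1 (hdisj _ _ _ _ h1 h2)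
      · exact absurd e1 (hdisj _ _ _ _ h1 h2)
      · exact absurd e1.symm (hdisj _ _ _ _ h2 h1)
      · exact absurd e1.symm (hdisj _ _ _ _ h2 h1)
      · exact absurd e2.symm (hdisj _ _ _ _ h3 h2)
      · rcases htriple k _ l _ i _ h1 h2 h3 e1 e2 with f | f | f
        · obtain ⟨rfl, h6⟩ := f
          exact Or.inl (hTinj _ _ _ h6)
        · obtain ⟨rfl, h6⟩ := f
          exact Or.inr (Or.inl (hTinj _ _ _ h6))
        · obtain ⟨rfl, h6⟩ := f
          exact Or.inr (Or.inr (hTinj _ _ _ h6)))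
    hσ hcinj W
    (fun i => by
      rw [hle]
      by_cases h : reg i
      · simp only [W, h, dite_true, hTreg i h]; norm_num
      · simp only [W, h, dite_false, hTspec i h]; exact hloc3 i h)
    (fun i => by
      by_cases h : reg i
      · simp only [W, h, dite_true, p, hTreg i h, hcreg i h]
        exact regPiece_zero _
      · simp only [W, h, dite_false, p, hTspec i h, hcspec i h]
        exact hcs i h)
    (fun k t ht hr => by
      rw [hle] at ht
      obtain ⟨j, hj⟩ := hr
      obtain ⟨i, rfl⟩ : ∃ i, (w.letter i).1 = j := ⟨w.pos (j, Side.L), by simp⟩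
      rcases k with k | k
      · have hi : reg i := by
          by_contra hi
          have h1 := hclt i hi
          have h2 := abs_le.1 (regPiece_bounds (w.letter k.1) (by linarith : |T (Sum.inl k) t| ≤ 4)).1
          have h3 : (c (w.letter i).1).1 = (regPiece (w.letter k.1) (T (Sum.inl k) t)).1 :=
            congrArg Prod.fst hj
          have h4 : (0 : ℝ) ≤ ((w.letter k.1).1 : ℕ) := Nat.cast_nonneg _
          linarith
        rw [hcreg i hi] at hj
        obtain ⟨-, h5⟩ := eq_zero_of_regPiece_eq (by linarith : |T (Sum.inl k) t| ≤ 4) hj.symm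
        exact ⟨k.1, hσeq _ (Sum.inl k) _ ((hTreg k.1 k.2).trans h5.symm)⟩
      · have hi : ¬ reg i := by
          intro hi
          have h1 := hcgt i hi
          have h2 := hx k _ ht
          have h3 : (c (w.letter i).1).1 = (A k (T (Sum.inr k) t)).1 := congrArg Prod.fst hj
          linarith
        rw [hcspec i hi] at hj
        obtain ⟨j, hj1, rfl, hj3⟩ := hreal k _ ht i hi hj.symm
        exact ⟨j, hσeq _ (Sum.inr (win j hj1)) _ ((hTspec j hj1).trans hj3)⟩)
    (fun i j hij hl => by
      rw [hdet]
      have hpos : 0 < M * M := by positivity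
      by_cases h : reg i
      · have h' : reg j := hlab i j hl h
        simp only [W, h, h', dite_true]
        have hsd : (w.letter i).2 ≠ (w.letter j).2 := fun hsd =>
          hij (w.letter_injective (Prod.ext hl hsd))
        rw [(planeDet_deriv_regPiece hsd (T (Sum.inl ⟨i, h⟩) (σ i)) (T (Sum.inl ⟨j, h'⟩) (σ j))).1]
        exact ⟨fun h => mul_neg_of_pos_of_neg hpos h, fun h => neg_of_mul_neg_right h hpos.le⟩
      · have h' : ¬ reg j := fun hj => h (hlab j i hl.symm hj)
        simp only [W, h, h', dite_false, hTspec i h, hTspec j h']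
        rw [hside i j h h' hij hl]
        exact ⟨fun h => mul_neg_of_pos_of_neg hpos h, fun h => neg_of_mul_neg_right h hpos.le⟩)
  refine ⟨D, hD1.hasGaussCode, fun k t ht => ?_, fun i hi => ?_, fun t ht hk => ?_⟩
  · exact hD2 (Sum.inr k) t ((hle _ _ _).2 ht)
  · rw [← hcspec i hi, ← hD1.2.2.1]
    exact Set.mem_range_self _
  · by_cases hex : ∃ i : {i : Fin (2 * n) // reg i}, |T (Sum.inl i) t| ≤ 3
    · obtain ⟨i, hi⟩ := hex
      rw [hD2 (Sum.inl i) t ((hle _ _ _).2 hi)]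
      have := (regPiece_bounds (w.letter i.1) (by linarith : |T (Sum.inl i) t| ≤ 4)).2
      exact lt_of_lt_of_le (by linarith) this
    · push Not at hex
      refine hD3 t ht fun k => ?_
      rw [hlt']
      rcases k with i | k
      · exact hex i
      · exact hk k

/-- Every Gauss code is realized. -/
theorem exists_hasGaussCode {n : ℕ} (w : GaussCode n) : ∃ D : VirtualDiagram, D.HasGaussCode w := by
  -- All positions are regular, and there are no special pieces.
  obtain ⟨D, hD, -⟩ := exists_diagram_of_special w (κ := Empty) (slot := fun k => k.elim)
    (fun k => k.elim) (reg := fun _ => True) (fun k => k.elim) (fun _ _ _ h => h)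
    (A := fun k => k.elim) (fun k => k.elim) zero_lt_one (by norm_num) (fun k => k.elim)
    (fun k => k.elim) (fun k => k.elim) (fun k => k.elim) (fun k => k.elim) (off := fun _ => 0)
    (fun _ => by norm_num) (fun _ _ => rfl) (win := fun i h => (h trivial).elim)
    (loc := fun _ => 0) (fun i h => (h trivial).elim) (fun i h => (h trivial).elim)
    (cs := fun _ => 0) (fun i h => (h trivial).elim) (fun i _ h => (h trivial).elim)
    (fun k => k.elim) (fun i _ h => (h trivial).elim)
  exact ⟨D, hD⟩

/-! ### Combinatorics of Gauss codes -/

namespace GaussCode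

variable {n : ℕ} {w w' w'' : GaussCode n}

lemma ext_letter (h : ∀ i, w.letter i = w'.letter i) : w = w' := Subtype.ext (funext h)

lemma letter_relabel (π : Equiv.Perm (Fin n)) (w : GaussCode n) (i : Fin (2 * n)) :
    (relabel π w).letter i = (π (w.letter i).1, (w.letter i).2) := rfl

lemma letter_shift (m : ℕ) (w : GaussCode n) (i : Fin (2 * n)) :
    (shift m w).letter i = w.letter ((finRotate (2 * n) ^ m) i) := rfl

lemma letter_rev (w : GaussCode n) (i : Fin (2 * n)) : w.rev.letter i = w.letter i.rev := rfl

lemma relabel_one (w : GaussCode n) : relabel 1 w = w := ext_letter fun _ => rfl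

lemma relabel_relabel (π ρ : Equiv.Perm (Fin n)) (w : GaussCode n) :
    relabel π (relabel ρ w) = relabel (π * ρ) w := ext_letter fun _ => rfl

lemma shift_relabel (m : ℕ) (π : Equiv.Perm (Fin n)) (w : GaussCode n) :
    shift m (relabel π w) = relabel π (shift m w) := ext_letter fun _ => rfl

lemma shift_zero (w : GaussCode n) : shift 0 w = w := ext_letter fun _ => rfl

lemma shift_shift (m k : ℕ) (w : GaussCode n) : shift m (shift k w) = shift (k + m) w :=
  ext_letter fun i => by
    rw [letter_shift, letter_shift, letter_shift, pow_add, Equiv.Perm.mul_apply]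

lemma shift_eq_of_mod_eq {m k : ℕ} (h : m % (2 * n) = k % (2 * n)) (w : GaussCode n) :
    shift m w = shift k w :=
  ext_letter fun i => by
    rw [letter_shift, letter_shift]
    congr 1
    refine Fin.ext ?_
    rw [finRotate_pow_val, finRotate_pow_val, Nat.add_mod, h, ← Nat.add_mod]

lemma exists_shift_eq (m : ℕ) (hn : 0 < n) (w : GaussCode n) :
    ∃ k < 2 * n, shift m w = shift k w :=
  ⟨m % (2 * n), Nat.mod_lt _ (by omega), shift_eq_of_mod_eq (by simp) w⟩

/-- Gauss codes are related if they agree up to relabeling and cyclic shift. -/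
def Related (w w' : GaussCode n) : Prop := ∃ π m, w' = relabel π (shift m w)

lemma Related.refl (w : GaussCode n) : Related w w := ⟨1, 0, by rw [shift_zero, relabel_one]⟩

lemma Related.trans (h : Related w w') (h' : Related w' w'') : Related w w'' := by
  obtain ⟨π, m, rfl⟩ := h
  obtain ⟨ρ, k, rfl⟩ := h'
  exact ⟨ρ * π, m + k, by rw [shift_relabel, relabel_relabel, shift_shift]⟩

lemma Related.symm (h : Related w w') : Related w' w := by
  obtain ⟨π, m, rfl⟩ := h
  -- This shift complements `m` to a multiple of the length `2 * n`.
  refine ⟨π⁻¹, 2 * n * m - m, ?_⟩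
  rw [shift_relabel, relabel_relabel, inv_mul_cancel, relabel_one, shift_shift]
  conv_lhs => rw [← shift_zero w]
  refine ext_letter fun i => ?_
  rw [shift_eq_of_mod_eq]
  rcases Nat.eq_zero_or_pos n with rfl | hn
  · exact absurd i.2 (by simp)
  · have : m ≤ 2 * n * m := Nat.le_mul_of_pos_left m (by omega)
    rw [Nat.add_sub_cancel' this]
    simp

lemma related_shift (m : ℕ) (w : GaussCode n) : Related w (shift m w) :=
  ⟨1, m, by rw [relabel_one]⟩

/-! #### Reducibility -/

lemma Consecutive.relabel {x y : Fin n × Side} (h : w.Consecutive x y) (π : Equiv.Perm (Fin n)) :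
    (relabel π w).Consecutive (π x.1, x.2) (π y.1, y.2) := by
  obtain ⟨i, rfl, rfl⟩ := h
  exact ⟨i, rfl, rfl⟩

lemma Consecutive.shift {x y : Fin n × Side} (h : w.Consecutive x y) (m : ℕ) :
    (shift m w).Consecutive x y := by
  obtain ⟨i, rfl, rfl⟩ := h
  refine ⟨(finRotate (2 * n) ^ m).symm i, ?_, ?_⟩
  · rw [letter_shift, Equiv.apply_symm_apply]
  · rw [letter_shift, next, next]
    congr 1
    rw [← Equiv.Perm.mul_apply, ← pow_succ, pow_succ', Equiv.Perm.mul_apply,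
      Equiv.apply_symm_apply]

/-- Reducibility is expressed by consecutive pairs and by equality of labels alone, so a relabeling
that respects these transports it. -/
lemma IsMinimal.of_consecutive {σ : Equiv.Perm (Fin n)}
    (h : ∀ i s j t, w'.Consecutive (i, s) (j, t) → w.Consecutive (σ i, s) (σ j, t))
    (hw : w.IsMinimal) : w'.IsMinimal := by
  refine ⟨?_, ?_⟩
  · rintro ⟨j, hj⟩
    exact hw.1 ⟨σ j, hj.imp (h _ _ _ _) (h _ _ _ _)⟩
  · rintro ⟨j, k, hjk, hj⟩
    exact hw.2 ⟨σ j, σ k, σ.injective.ne hjk, hj.imp (And.imp (h _ _ _ _) (h _ _ _ _))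
      (Or.imp (And.imp (h _ _ _ _) (h _ _ _ _)) (And.imp (h _ _ _ _) (h _ _ _ _)))⟩

lemma IsMinimal.related (hw : w.IsMinimal) (h : Related w w') : w'.IsMinimal := by
  obtain ⟨π, m, rfl⟩ := h.symm
  exact hw.of_consecutive (σ := π) fun i s j t hc => (hc.shift m).relabel π

/-! #### Left preferred and left canonical codes -/

lemma pos_eq_iff {x : Fin n × Side} {i : Fin (2 * n)} : w.pos x = i ↔ w.letter i = x :=
  ⟨fun h => by rw [← h, letter_pos], fun h => by rw [← h, pos_letter]⟩

lemma IsWeaklyLeftPreferred.strictMono_pos (h : w.IsWeaklyLeftPreferred) :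
    StrictMono fun j => w.pos (j, Side.L) := fun i j hij =>
  h _ _ (by simp) (by simp) (by simpa using hij)

/-- Both codes list the letters `L` in increasing order of their labels, so `π` is increasing and
hence the identity. The labels of a weakly left preferred code are thus rigid. -/
lemma eq_relabel_of_isWeaklyLeftPreferred {π : Equiv.Perm (Fin n)}
    (h : w.IsWeaklyLeftPreferred) (h' : (relabel π w).IsWeaklyLeftPreferred) :
    relabel π w = w := by
  have h1 : ∀ j, (relabel π w).pos (π j, Side.L) = w.pos (j, Side.L) := fun j => by
    rw [pos_eq_iff, letter_relabel, letter_pos]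
  have h2 : StrictMono π := fun i j hij => by
    have := h.strictMono_pos hij
    simp only [← h1] at this
    exact h'.strictMono_pos.lt_iff_lt.1 this
  have h3 : π = 1 := by
    ext j
    have := Subsingleton.elim (h2.orderIsoOfSurjective _ π.surjective) (OrderIso.refl (Fin n))
    have := congrArg (fun e : Fin n ≃o Fin n => e j) this
    simpa using congrArg Fin.val this
  rw [h3, relabel_one]

lemma isWeaklyLeftPreferred_relabel_leftPerm (w : GaussCode n) :
    (relabel w.leftPerm w).IsWeaklyLeftPreferred := by
  intro p q hp hq hlt
  rw [letter_relabel] at hp hq hlt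
  rw [letter_relabel] at hlt
  set f : Fin n → Fin (2 * n) := fun j => w.pos (j, Side.L) with hf
  have h1 : Monotone (f ∘ Tuple.sort f) := Tuple.monotone_sort f
  have h2 : ∀ i, (w.letter i).2 = Side.L → f (w.letter i).1 = i := fun i hi =>
    pos_eq_iff.2 (Prod.ext rfl hi)
  have h3 := h1 hlt.le
  simp only [Function.comp_apply, leftPerm, ← hf, ← Equiv.Perm.mul_apply, mul_inv_cancel,
    Equiv.Perm.one_apply] at h3
  rw [h2 p hp, h2 q hq] at h3
  refine lt_of_le_of_ne h3 fun h => ?_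
  rw [h] at hlt
  exact lt_irrefl _ hlt

variable [NeZero n]

/-- The shift `q` is the position of the first letter `L`. That only letters `R` are skipped is what
the induction on shifts needs. -/
lemma projLP_spec (w : GaussCode n) : ∃ (π : Equiv.Perm (Fin n)) (q : Fin (2 * n)),
    w.projLP = relabel π (shift q w) ∧ (∀ i, (w.letter i).2 = Side.L → q ≤ i) ∧
      w.projLP.IsLeftPreferred := by
  set v := relabel w.leftPerm w with hv
  have hW : v.IsWeaklyLeftPreferred := isWeaklyLeftPreferred_relabel_leftPerm w
  set q := v.pos (0, Side.L) with hq
  have hmin : ∀ i, (w.letter i).2 = Side.L → q ≤ i := by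
    intro i hi
    have h1 : (v.letter i).2 = Side.L := hi
    have h2 := hW.strictMono_pos.monotone (Fin.zero_le (v.letter i).1)
    have h3 : v.pos ((v.letter i).1, Side.L) = i := pos_eq_iff.2 (Prod.ext rfl h1)
    simp only [h3] at h2
    exact h2
  -- No letter `L` wraps around, since none stands before `q`; so the shift preserves their order.
  have hval : ∀ i : Fin (2 * n), (v.letter ((finRotate (2 * n) ^ (q : ℕ)) i)).2 = Side.L →
      (((finRotate (2 * n) ^ (q : ℕ)) i : Fin (2 * n)) : ℕ) = i + q := by
    intro i hi
    have h1 : q ≤ (finRotate (2 * n) ^ (q : ℕ)) i := hmin _ hi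
    have h2 : (q : ℕ) ≤ _ := h1
    rw [finRotate_pow_val] at h2 ⊢
    rcases Nat.lt_or_ge (i + q) (2 * n) with h | h
    · exact Nat.mod_eq_of_lt h
    · rw [Nat.mod_eq_sub_mod h, Nat.mod_eq_of_lt (by omega)] at h2
      omega
  refine ⟨w.leftPerm, q, shift_relabel _ _ _, hmin, ?_, ?_⟩
  · intro i j hi hj hlt
    have h1 : (finRotate (2 * n) ^ (q : ℕ)) i < (finRotate (2 * n) ^ (q : ℕ)) j := hW _ _ hi hj hlt
    have h2 : (((finRotate (2 * n) ^ (q : ℕ)) i : Fin (2 * n)) : ℕ) <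
      ((finRotate (2 * n) ^ (q : ℕ)) j : Fin (2 * n)) := h1
    rw [hval i hi, hval j hj] at h2
    exact Fin.lt_def.2 (by omega)
  · have h1 : (finRotate (2 * n) ^ (q : ℕ)) 0 = q := Fin.ext (by
      rw [finRotate_pow_val]
      simp [Nat.mod_eq_of_lt q.2])
    change v.letter ((finRotate (2 * n) ^ (q : ℕ)) 0) = _
    rw [h1, hq, letter_pos]

lemma isLeftPreferred_projLP (w : GaussCode n) : w.projLP.IsLeftPreferred := by
  obtain ⟨-, -, -, -, h⟩ := projLP_spec w
  exact h

lemma related_projLP (w : GaussCode n) : Related w w.projLP := by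
  obtain ⟨π, q, h, -⟩ := projLP_spec w
  exact ⟨π, q, h⟩

lemma related_shiftLP (w : GaussCode n) : Related w w.shiftLP :=
  (related_shift 1 w).trans (related_projLP _)

lemma related_iterate_shiftLP (w : GaussCode n) (k : ℕ) : Related w (shiftLP^[k] w) := by
  induction k with
  | zero => exact Related.refl w
  | succ k ih => rw [Function.iterate_succ_apply']; exact ih.trans (related_shiftLP _)

lemma IsLeftPreferred.iterate_shiftLP (h : w.IsLeftPreferred) (k : ℕ) :
    (shiftLP^[k] w).IsLeftPreferred := by
  cases k with
  | zero => exact h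
  | succ k => rw [Function.iterate_succ_apply']; exact isLeftPreferred_projLP _

/-- Each `shiftLP` advances to the next letter `L`. Since a left preferred code starts with such a
letter, these steps do not jump over the shift `m`, and strong induction on `m` applies. -/
lemma IsLeftPreferred.exists_iterate_of_shift {m : ℕ} (h : w.IsLeftPreferred)
    (h' : w'.IsLeftPreferred) {π : Equiv.Perm (Fin n)} (hw : w' = relabel π (shift m w)) :
    ∃ k, w' = shiftLP^[k] w := by
  induction m using Nat.strong_induction_on generalizing w π with
  | _ m ih =>
    rcases Nat.eq_zero_or_pos m with rfl | hm
    · refine ⟨0, ?_⟩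
      rw [shift_zero] at hw
      rw [hw] at h' ⊢
      exact eq_relabel_of_isWeaklyLeftPreferred h.1 h'.1
    · obtain ⟨ρ, q, hq, hmin, hLP⟩ := projLP_spec (shift 1 w)
      -- The target begins with a letter `L`, which in `shift 1 w` stands at position `m - 1`; so
      -- the first letter `L` there is not later. If `m - 1` exceeds the length, the bound is
      -- trivial.
      have hqm : (q : ℕ) + 1 ≤ m := by
        rcases Nat.lt_or_ge (m - 1) (2 * n) with hlt | hge
        · have h1 := hmin ⟨m - 1, hlt⟩ (by
            have h2 : ((shift m w).letter 0).2 = Side.L := by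
              have := congrArg Prod.snd h'.2
              rwa [hw] at this
            rw [← h2, letter_shift, letter_shift]
            congr 2
            refine Fin.ext ?_
            rw [finRotate_pow_val, finRotate_pow_val]
            simp [Nat.sub_add_cancel hm])
          have h3 : (q : ℕ) ≤ m - 1 := h1
          omega
        · have := q.2
          omega
      obtain ⟨k, hk⟩ := ih (m - (q + 1)) (by omega) (w := shiftLP w) hLP (π := π * ρ⁻¹) (by
        have h1 : shiftLP w = relabel ρ (shift (1 + q) w) := by
          rw [← shift_shift]; exact hq
        rw [h1, shift_relabel, relabel_relabel, inv_mul_cancel_right, shift_shift, hw]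
        congr 2
        omega)
      exact ⟨k + 1, by rw [Function.iterate_succ_apply]; exact hk⟩

/-- The bound `k < n` justifies that `projLC` takes the minimum over `n` iterates only. An iterate
is determined by the letter `L` of `w` that comes first in it, and there are `n` of these, so the
first `n + 1` iterates contain a repetition. -/
lemma IsLeftPreferred.exists_iterate (h : w.IsLeftPreferred) (h' : w'.IsLeftPreferred)
    (hr : Related w w') : ∃ k < n, w' = shiftLP^[k] w := by
  have hn : 0 < n := Nat.pos_of_ne_zero (NeZero.ne n)
  have hrep : ∀ k : ℕ, ∃ (j : Fin n) (π : Equiv.Perm (Fin n)),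
      shiftLP^[k] w = relabel π (shift (w.pos (j, Side.L)) w) := by
    intro k
    obtain ⟨π, m, hm⟩ := related_iterate_shiftLP w k
    obtain ⟨m', hm', he⟩ := exists_shift_eq m hn w
    rw [he] at hm
    have h1 : w.letter ⟨m', hm'⟩ = (π⁻¹ 0, Side.L) := by
      have h2 := (h.iterate_shiftLP k).2
      rw [hm, letter_relabel, letter_shift] at h2
      have h3 : (finRotate (2 * n) ^ m') 0 = ⟨m', hm'⟩ := Fin.ext (by
        rw [finRotate_pow_val]
        simp [Nat.mod_eq_of_lt hm'])
      rw [h3] at h2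
      refine Prod.ext ?_ (congrArg Prod.snd h2 :)
      rw [Equiv.Perm.eq_inv_iff_eq]
      exact congrArg Prod.fst h2
    refine ⟨π⁻¹ 0, π, ?_⟩
    rw [pos_eq_iff.2 h1, hm]
  choose j π hj using hrep
  obtain ⟨a, b, hab, hje⟩ : ∃ a b : Fin (n + 1), a < b ∧ j a = j b := by
    obtain ⟨a, b, hne, he⟩ := Fintype.exists_ne_map_eq_of_card_lt (fun a : Fin (n + 1) => j a)
      (by simp)
    rcases lt_or_gt_of_ne hne with hlt | hlt
    · exact ⟨a, b, hlt, he⟩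
    · exact ⟨b, a, hlt, he.symm⟩
  have hper : shiftLP^[b] w = shiftLP^[a] w := by
    have h1 : shiftLP^[b] w = relabel (π b * (π a)⁻¹) (shiftLP^[a] w) := by
      rw [hj a, hj b, relabel_relabel, inv_mul_cancel_right, hje]
    rw [h1]
    refine eq_relabel_of_isWeaklyLeftPreferred (h.iterate_shiftLP a).1 ?_
    rw [← h1]
    exact (h.iterate_shiftLP b).1
  have hab' : (a : ℕ) < b := hab
  have hbn : (b : ℕ) ≤ n := Nat.lt_succ_iff.1 b.2
  have hred : ∀ k : ℕ, ∃ l < n, shiftLP^[k] w = shiftLP^[l] w := by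
    intro k
    induction k using Nat.strong_induction_on with
    | _ k ih =>
      rcases Nat.lt_or_ge k n with hk | hk
      · exact ⟨k, hk, rfl⟩
      · obtain ⟨l, hl, he⟩ := ih (k - b + a) (by omega)
        refine ⟨l, hl, ?_⟩
        rw [← he, Function.iterate_add_apply, ← hper, ← Function.iterate_add_apply,
          Nat.sub_add_cancel (by omega)]
  obtain ⟨ρ, m, hm⟩ := hr
  obtain ⟨k, hk⟩ := h.exists_iterate_of_shift h' hm
  obtain ⟨l, hl, he⟩ := hred k
  exact ⟨l, hl, hk.trans he⟩

lemma exists_projLC_eq (w : GaussCode n) : ∃ k, w.projLC = shiftLP^[k] w.projLP := by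
  have := Finset.min'_mem ((Finset.range n).image fun k => shiftLP^[k] (projLP w))
    ((Finset.nonempty_range_iff.mpr (NeZero.ne n)).image _)
  obtain ⟨k, -, hk⟩ := Finset.mem_image.1 this
  exact ⟨k, hk.symm⟩

lemma isLeftPreferred_projLC (w : GaussCode n) : w.projLC.IsLeftPreferred := by
  obtain ⟨k, hk⟩ := exists_projLC_eq w
  rw [hk]
  exact (isLeftPreferred_projLP w).iterate_shiftLP k

lemma related_projLC (w : GaussCode n) : Related w w.projLC := by
  obtain ⟨k, hk⟩ := exists_projLC_eq w
  rw [hk]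
  exact (related_projLP w).trans (related_iterate_shiftLP _ k)

/-- All related left preferred codes occur among the iterates, so the minimum depends only on the
class. -/
lemma projLC_le (h : w'.IsLeftPreferred) (hr : Related w w') : w.projLC ≤ w' := by
  obtain ⟨k, hk, he⟩ := (isLeftPreferred_projLP w).exists_iterate h ((related_projLP w).symm.trans hr)
  exact Finset.min'_le _ _ (Finset.mem_image.2 ⟨k, Finset.mem_range.2 hk, he.symm⟩)

lemma isLeftCanonical_projLC (w : GaussCode n) : w.projLC.IsLeftCanonical :=
  ⟨isLeftPreferred_projLC w, fun k => projLC_le ((isLeftPreferred_projLC w).iterate_shiftLP k)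
    ((related_projLC w).trans (related_iterate_shiftLP _ k))⟩

lemma projLC_eq_iff : w.projLC = w'.projLC ↔ Related w w' := by
  refine ⟨fun h => (related_projLC w).trans (h ▸ (related_projLC w').symm), fun h => ?_⟩
  exact le_antisymm (projLC_le (isLeftPreferred_projLC w') (h.trans (related_projLC w')))
    (projLC_le (isLeftPreferred_projLC w) (h.symm.trans (related_projLC w)))

lemma IsLeftCanonical.projLC_eq (h : w.IsLeftCanonical) : w.projLC = w := by
  refine le_antisymm (projLC_le h.1 (Related.refl w)) ?_
  obtain ⟨k, -, hk⟩ := h.1.exists_iterate (isLeftPreferred_projLC w) (related_projLC w)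
  rw [hk]
  exact h.2 k

end GaussCode

/-! ### The Gauss codes of a diagram -/

namespace VirtualDiagram

open GaussCode

variable {n : ℕ} {D : VirtualDiagram} {w w' : GaussCode n} {t₀ t₁ : ℝ} {τ τ' : Fin (2 * n) → ℝ}
  {c c' : Fin n → Plane}

lemma HasCodeAt.add_int (h : D.HasCodeAt w t₀ τ c) (k : ℤ) :
    D.HasCodeAt w (t₀ + k) (fun i => τ i + k) c := by
  obtain ⟨h1, h2, h3, h4, h5, h6⟩ := h
  refine ⟨by rwa [D.curve_add_int], h2, h3, fun i j hij => by simpa using h4 hij, ?_, fun i => ?_⟩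
  · ext t
    constructor
    · rintro ⟨i, rfl⟩
      have : τ i ∈ Set.range τ := Set.mem_range_self i
      rw [h5] at this
      exact ⟨⟨by linarith [this.1.1], by linarith [this.1.2]⟩, by rw [D.curve_add_int]; exact this.2⟩
    · rintro ⟨⟨ht1, ht2⟩, ht3⟩
      have : t - k ∈ Set.range τ := by
        rw [h5]
        refine ⟨⟨by linarith, by linarith⟩, ?_⟩
        rw [← D.curve_add_int _ k, sub_add_cancel]
        exact ht3
      obtain ⟨i, hi⟩ := this
      exact ⟨i, by simp [hi]⟩
  · simp only [D.curve_add_int, D.deriv_curve_add_int]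
    refine ⟨(h6 i).1, fun s hs hne => (h6 i).2 s hs fun hsp => hne ?_⟩
    obtain ⟨l, hl⟩ := hsp
    exact ⟨l - k, by push_cast; linarith⟩

lemma HasCodeAt.relabel (h : D.HasCodeAt w t₀ τ c) (π : Equiv.Perm (Fin n)) :
    D.HasCodeAt (relabel π w) t₀ τ (c ∘ π.symm) := by
  obtain ⟨h1, h2, h3, h4, h5, h6⟩ := h
  refine ⟨h1, h2.comp π.symm.injective, by rw [π.symm.surjective.range_comp, h3], h4, h5,
    fun i => ⟨?_, fun s hs hne => (h6 i).2 s hs hne⟩⟩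
  rw [(h6 i).1, letter_relabel]
  simp

/-- Moving the base point past `m` passages puts them at the end of the list, with parameters
increased by 1. -/
lemma HasCodeAt.exists_shift (h : D.HasCodeAt w t₀ τ c) (h01 : t₁ ∈ Set.Ico t₀ (t₀ + 1))
    (hr : D.curve t₁ ∉ D.real) {m : ℕ} (hm : m ≤ 2 * n) (hlt : ∀ i, τ i < t₁ ↔ (i : ℕ) < m) :
    ∃ τ', D.HasCodeAt (shift m w) t₁ τ' c := by
  have hmem := h.mem_Ioo
  have hmono := h.strictMono
  have hreal := h.curve_mem
  have hex := fun t => h.exists_eq (t := t)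
  obtain ⟨h1, h2, h3, h4, h5, h6⟩ := h
  have hne : ∀ i, τ i ≠ t₁ := fun i hi => hr (hi ▸ hreal i)
  let f : Fin (2 * n) → Fin (2 * n) := ⇑(finRotate (2 * n) ^ m)
  let τ' : Fin (2 * n) → ℝ := fun i => τ (f i) + if (i : ℕ) + m < 2 * n then 0 else 1
  have hf1 : ∀ i : Fin (2 * n), (i : ℕ) + m < 2 * n → (f i : ℕ) = i + m := fun i hi => by
    rw [finRotate_pow_val, Nat.mod_eq_of_lt hi]
  have hf2 : ∀ i : Fin (2 * n), ¬ (i : ℕ) + m < 2 * n → (f i : ℕ) = i + m - 2 * n := fun i hi => by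
    have := i.2
    rw [finRotate_pow_val, Nat.mod_eq_sub_mod (by omega), Nat.mod_eq_of_lt (by omega)]
  have hsp : ∀ i, ∃ k : ℤ, τ' i = τ (f i) + k := fun i => by
    simp only [τ']
    split_ifs
    · exact ⟨0, by simp⟩
    · exact ⟨1, by simp⟩
  refine ⟨τ', hr, h2, h3, ?_, ?_, fun i => ?_⟩
  · intro i j hij
    have hij' : (i : ℕ) < j := hij
    by_cases hi : (i : ℕ) + m < 2 * n <;> by_cases hj : (j : ℕ) + m < 2 * n
    · have : f i < f j := Fin.lt_def.2 (by rw [hf1 i hi, hf1 j hj]; omega)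
      simp only [τ', hi, hj, if_true]
      linarith [hmono this]
    · simp only [τ', hi, hj, if_true, if_false]
      linarith [(hmem (f i)).2, (hmem (f j)).1]
    · omega
    · have : f i < f j := Fin.lt_def.2 (by rw [hf2 i hi, hf2 j hj]; omega)
      simp only [τ', hi, hj, if_false]
      linarith [hmono this]
  · ext t
    constructor
    · rintro ⟨i, rfl⟩
      have hi2 := i.2
      refine ⟨?_, ?_⟩
      · by_cases hi : (i : ℕ) + m < 2 * n
        · simp only [τ', hi, if_true, add_zero]
          have : ¬ τ (f i) < t₁ := by rw [hlt, hf1 i hi]; omega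
          exact ⟨lt_of_le_of_ne (not_lt.1 this) (hne _).symm, by linarith [(hmem (f i)).2, h01.1]⟩
        · simp only [τ', hi, if_false]
          have : τ (f i) < t₁ := by rw [hlt, hf2 i hi]; omega
          exact ⟨by linarith [(hmem (f i)).1, h01.2], by linarith⟩
      · obtain ⟨k, hk⟩ := hsp i
        rw [hk, D.curve_add_int]
        exact hreal _
    · rintro ⟨⟨ht1, ht2⟩, ht3⟩
      rcases lt_trichotomy t (t₀ + 1) with hlt1 | heq | hgt
      · obtain ⟨j, rfl⟩ := hex t ⟨h01.1.trans_lt ht1, hlt1⟩ ht3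
        have hj : m ≤ j := not_lt.1 fun h => (lt_asymm ht1 ((hlt j).2 h))
        have hj2 := j.2
        have hjm : ((⟨j - m, by omega⟩ : Fin (2 * n)) : ℕ) + m < 2 * n := by simp; omega
        refine ⟨⟨j - m, by omega⟩, ?_⟩
        have : f ⟨j - m, by omega⟩ = j := Fin.ext (by rw [hf1 _ hjm]; simp; omega)
        simp only [τ', this]
        rw [if_pos hjm, add_zero]
      · exfalso
        refine h1 ?_
        rw [← D.periodic, ← heq]
        exact ht3
      · have ht4 : D.curve (t - 1) ∈ D.real := by
          rw [← D.periodic, sub_add_cancel]; exact ht3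
        obtain ⟨j, hj⟩ := hex (t - 1) ⟨by linarith, by linarith [h01.2]⟩ ht4
        have hjm : (j : ℕ) < m := (hlt j).1 (by rw [hj]; linarith)
        have hj2 := j.2
        have hjm' : ¬ ((⟨j + 2 * n - m, by omega⟩ : Fin (2 * n)) : ℕ) + m < 2 * n := by simp; omega
        refine ⟨⟨j + 2 * n - m, by omega⟩, ?_⟩
        have : f ⟨j + 2 * n - m, by omega⟩ = j := Fin.ext (by rw [hf2 _ hjm']; simp; omega)
        simp only [τ', this]
        rw [if_neg hjm', hj]
        ring
  · obtain ⟨k, hk⟩ := hsp i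
    rw [hk, D.curve_add_int, D.deriv_curve_add_int]
    refine ⟨(h6 (f i)).1, fun s hs hne => (h6 (f i)).2 s hs fun hs' => hne ?_⟩
    obtain ⟨l, hl⟩ := hs'
    exact ⟨l - k, by push_cast; linarith⟩

lemma HasCodeAt.exists_shift_of_notMem (h : D.HasCodeAt w t₀ τ c)
    (h01 : t₁ ∈ Set.Ico t₀ (t₀ + 1)) (hr : D.curve t₁ ∉ D.real) :
    ∃ m τ', D.HasCodeAt (shift m w) t₁ τ' c := by
  classical
  by_cases hex : ∃ i, ¬ τ i < t₁
  · have hne : (Finset.univ.filter fun i => ¬ τ i < t₁).Nonempty := by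
      obtain ⟨i, hi⟩ := hex
      exact ⟨i, by simpa using hi⟩
    set j := (Finset.univ.filter fun i => ¬ τ i < t₁).min' hne with hj
    have hj1 : ¬ τ j < t₁ := by
      have := Finset.min'_mem _ hne
      rw [← hj] at this
      simpa using this
    have hlt : ∀ i, τ i < t₁ ↔ (i : ℕ) < j := by
      refine fun i => ⟨fun hi => ?_, fun hi => ?_⟩
      · by_contra hc
        have hle : j ≤ i := not_lt.1 hc
        exact hj1 ((h.strictMono.monotone hle).trans_lt hi)
      · by_contra hc
        have := Finset.min'_le (Finset.univ.filter fun i => ¬ τ i < t₁) i (by simpa using hc)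
        rw [← hj] at this
        exact absurd hi (not_lt.2 this)
    obtain ⟨τ', h'⟩ := h.exists_shift h01 hr j.2.le hlt
    exact ⟨j, τ', h'⟩
  · push Not at hex
    obtain ⟨τ', h'⟩ := h.exists_shift h01 hr (m := 2 * n) le_rfl fun i => ⟨fun _ => i.2, fun _ => hex i⟩
    exact ⟨_, τ', h'⟩

/-- The new base point is the midpoint between two neighbouring passages. -/
lemma HasGaussCode.shift (h : D.HasGaussCode w) (m : ℕ) : D.HasGaussCode (shift m w) := by
  rcases Nat.eq_zero_or_pos n with rfl | hn
  · rwa [show GaussCode.shift m w = w from ext_letter fun i => absurd i.2 (by simp)]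
  obtain ⟨k, hk, he⟩ := exists_shift_eq m hn w
  rw [he]
  obtain ⟨t₀, τ, c, h⟩ := h
  change D.HasCodeAt w t₀ τ c at h
  rcases Nat.eq_zero_or_pos k with rfl | hk0
  · rw [shift_zero]
    exact h.hasGaussCode
  have hlt : (⟨k - 1, by omega⟩ : Fin (2 * n)) < ⟨k, hk⟩ := Fin.mk_lt_mk.2 (by omega)
  set i₀ : Fin (2 * n) := ⟨k - 1, by omega⟩
  set i₁ : Fin (2 * n) := ⟨k, hk⟩
  have hnp : nextParam τ i₀ = τ i₁ := by
    have : (i₀ : ℕ) + 1 < 2 * n := by simp [i₀]; omega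
    rw [nextParam, dif_pos this]
    congr 1
    exact Fin.ext (by simp [i₀, i₁]; omega)
  have hτ := h.strictMono hlt
  obtain ⟨τ', h'⟩ := h.exists_shift (t₁ := (τ i₀ + τ i₁) / 2) (m := k)
    ⟨by linarith [(h.mem_Ioo i₀).1, (h.mem_Ioo i₁).1],
      by linarith [(h.mem_Ioo i₀).2, (h.mem_Ioo i₁).2]⟩
    (h.notMem_real i₀ (by rw [hnp]; exact ⟨by linarith, by linarith⟩)) hk.le (fun i => by
      constructor
      · intro hi
        by_contra hc
        have : i₁ ≤ i := not_lt.1 hc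
        linarith [h.strictMono.monotone this]
      · intro hi
        have : i ≤ i₀ := Fin.le_def.2 (by simp only [i₀]; omega)
        linarith [h.strictMono.monotone this])
  exact h'.hasGaussCode

lemma HasGaussCode.related (h : D.HasGaussCode w) (hr : Related w w') : D.HasGaussCode w' := by
  obtain ⟨π, m, rfl⟩ := hr
  obtain ⟨t₀, τ, c, h'⟩ := h.shift m
  exact HasCodeAt.hasGaussCode (HasCodeAt.relabel h' π)

lemma HasCodeAt.exists_ne (h : D.HasCodeAt w t₀ τ c) (i : Fin (2 * n)) :
    ∃ s, D.curve s = D.curve (τ i) ∧ ¬ SameParam s (τ i) := by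
  refine ⟨τ (w.pos ((w.letter i).1, !(w.letter i).2)), ?_, h.not_sameParam fun he => ?_⟩
  · rw [h.curve_eq, h.curve_eq, letter_pos]
  · rw [pos_eq_iff] at he
    have := congrArg Prod.snd he
    simp at this

/-- Base point and labels leave no freedom: `τ` is the increasing enumeration of a fixed set, and
the sides are read off the tangents. -/
lemma HasCodeAt.eq (h : D.HasCodeAt w t₀ τ c) (h' : D.HasCodeAt w' t₀ τ' c) : w = w' := by
  have hτ : τ = τ' := by
    have := h.2.2.2.2.1.trans h'.2.2.2.2.1.symm
    exact (h.strictMono.range_inj h'.strictMono).1 this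
  subst hτ
  refine ext_letter fun i => Prod.ext ?_ ?_
  · exact h.2.1 (by rw [← h.curve_eq, ← h'.curve_eq])
  · obtain ⟨s, hs, hne⟩ := h.exists_ne i
    have h1 := (h.2.2.2.2.2 i).2 s hs hne
    have h2 := (h'.2.2.2.2.2 i).2 s hs hne
    rw [← h2] at h1
    revert h1
    generalize (w.letter i).2 = a
    generalize (w'.letter i).2 = b
    revert a b
    decide

theorem HasGaussCode.related_of (h : D.HasGaussCode w) (h' : D.HasGaussCode w') :
    Related w w' := by
  obtain ⟨t₀, τ, c, h⟩ := h
  obtain ⟨t₁, τ', c', h'⟩ := h'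
  change D.HasCodeAt w t₀ τ c at h
  change D.HasCodeAt w' t₁ τ' c' at h'
  obtain ⟨k, hk⟩ := exists_int_add_mem_Ico t₀ t₁
  obtain ⟨m, τ'', h''⟩ := h.exists_shift_of_notMem hk (h'.add_int k).1
  have hrange : Set.range c = Set.range c' := h.2.2.1.trans h'.2.2.1.symm
  let π : Equiv.Perm (Fin n) := (Equiv.ofInjective c h.2.1).trans
    ((Equiv.setCongr hrange).trans (Equiv.ofInjective c' h'.2.1).symm)
  have hπ : c' ∘ π = c := by
    funext j
    simp only [π, Function.comp_apply, Equiv.trans_apply]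
    exact (Equiv.apply_ofInjective_symm h'.2.1 _)
  have h3 := h''.relabel π
  have hc : c ∘ π.symm = c' := by
    rw [← hπ]; funext j; simp
  rw [hc] at h3
  exact ⟨π, m, (h'.add_int k).eq h3⟩

theorem HasGaussCode.strictEquiv_of_related (hn : 0 < n) {D' : VirtualDiagram}
    (h : D.HasGaussCode w) (h' : D'.HasGaussCode w') (hr : Related w w') : StrictEquiv D D' :=
  (h.related hr).strictEquiv hn h'

lemma deriv_rev (D : VirtualDiagram) (t : ℝ) : deriv D.rev.curve t = -deriv D.curve (-t) :=
  deriv_comp_neg _ _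

/-- Reversal negates both tangents at a crossing, so the determinant and the side of each passage
are unchanged; only the order is reversed. -/
theorem HasGaussCode.rev (h : D.HasGaussCode w) : D.rev.HasGaussCode w.rev := by
  obtain ⟨t₀, τ, c, h⟩ := h
  change D.HasCodeAt w t₀ τ c at h
  have hmem := h.mem_Ioo
  have hmono := h.strictMono
  have hreal := h.curve_mem
  have hex := fun t => h.exists_eq (t := t)
  obtain ⟨h1, h2, h3, h4, h5, h6⟩ := h
  have hrc : ∀ t, D.rev.curve t = D.curve (-t) := fun _ => rfl
  have hrr : D.rev.real = D.real := rfl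
  refine ⟨-t₀ - 1, fun i => -τ i.rev, c, ?_, h2, h3, fun i j hij => ?_, ?_, fun i => ?_⟩
  · have : D.curve (-(-t₀ - 1)) = D.curve t₀ := by
      rw [← D.periodic t₀]; congr 1; ring
    rw [hrc, hrr, this]
    exact h1
  · simpa using hmono (Fin.rev_lt_rev.2 hij)
  · ext t
    rw [hrr]
    constructor
    · rintro ⟨i, rfl⟩
      exact ⟨⟨by linarith [(hmem i.rev).2], by linarith [(hmem i.rev).1]⟩, by
        rw [hrc, neg_neg]; exact hreal _⟩
    · rintro ⟨ht, hr⟩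
      obtain ⟨i, hi⟩ := hex (-t) ⟨by linarith [ht.2], by linarith [ht.1]⟩ hr
      exact ⟨i.rev, by simp [hi]⟩
  · rw [hrc, neg_neg, letter_rev]
    refine ⟨(h6 i.rev).1, fun s hs hne => ?_⟩
    rw [(h6 i.rev).2 (-s) hs fun hs' => hne ?_, deriv_rev, deriv_rev, neg_neg]
    · simp [planeDet]
    · obtain ⟨k, hk⟩ := hs'
      exact ⟨-k, by push_cast; linarith⟩

end VirtualDiagram

/-! ### Reidemeister moves give reducible Gauss codes -/

lemma mul_pos_of_isPreconnected {X : Type*} [TopologicalSpace X] {s : Set X} (hs : IsPreconnected s)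
    {f : X → ℝ} (hf : ContinuousOn f s) (h0 : ∀ x ∈ s, f x ≠ 0) {x y : X} (hx : x ∈ s)
    (hy : y ∈ s) : 0 < f x * f y := by
  have key : ∀ x ∈ s, ∀ y ∈ s, f x ≤ 0 → 0 ≤ f y → False := fun x hx y hy h1 h2 => by
    obtain ⟨z, hz, hfz⟩ := hs.intermediate_value₂ hx hy hf continuousOn_const h1 h2
    exact h0 z hz hfz
  rcases lt_or_gt_of_ne (h0 x hx) with h1 | h1 <;> rcases lt_or_gt_of_ne (h0 y hy) with h2 | h2
  · exact mul_pos_of_neg_of_neg h1 h2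
  · exact (key x hx y hy h1.le h2.le).elim
  · exact (key y hy x hx h2.le h1.le).elim
  · exact mul_pos h1 h2

/-- If both derivatives were positive, `f` would be positive just after `a` and negative just before
`b`, although it has constant sign in between. The case of two negative derivatives is the same for
`-f`. -/
lemma deriv_mul_deriv_nonpos {f : ℝ → ℝ} {a b : ℝ} (hab : a < b) (hf : ContinuousOn f (Set.Ioo a b))
    (ha : f a = 0) (hb : f b = 0) (h0 : ∀ x ∈ Set.Ioo a b, f x ≠ 0) : deriv f a * deriv f b ≤ 0 := by
  have key : ∀ g : ℝ → ℝ, ContinuousOn g (Set.Ioo a b) → g a = 0 → g b = 0 →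
      (∀ x ∈ Set.Ioo a b, g x ≠ 0) → 0 < deriv g a → 0 < deriv g b → False := by
    intro g hg ha hb h0 h1 h2
    have e1 := (eventually_nhdsWithin_sign_eq_of_deriv_pos h1 ha).filter_mono
      (nhdsWithin_le_nhds (s := Set.Ioi a))
    have e2 := (eventually_nhdsWithin_sign_eq_of_deriv_pos h2 hb).filter_mono
      (nhdsWithin_le_nhds (s := Set.Iio b))
    obtain ⟨x, hx, hx'⟩ := (e1.and (Ioo_mem_nhdsGT hab)).exists
    obtain ⟨y, hy, hy'⟩ := (e2.and (Ioo_mem_nhdsLT hab)).exists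
    rw [sign_pos (sub_pos.2 hx'.1), sign_eq_one_iff] at hx
    rw [sign_neg (sub_neg.2 hy'.2), sign_eq_neg_one_iff] at hy
    have := mul_pos_of_isPreconnected isPreconnected_Ioo hg h0 hx' hy'
    linarith [mul_neg_of_pos_of_neg hx hy]
  by_contra! h
  rcases pos_and_pos_or_neg_and_neg_of_mul_pos h with ⟨h1, h2⟩ | ⟨h1, h2⟩
  · exact key f hf ha hb h0 h1 h2
  · refine key (fun x => -f x) hf.neg (by simp [ha]) (by simp [hb]) (fun x hx => by
      simpa using h0 x hx) ?_ ?_ <;> rw [deriv.fun_neg] <;> linarith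

lemma IsPlaneDiffeo.jac_mul_jac_pos {F : Plane ≃ Plane} (hF : IsPlaneDiffeo F) (p q : Plane) :
    0 < jac (fderiv ℝ F p) * jac (fderiv ℝ F q) := by
  refine mul_pos_of_isPreconnected isPreconnected_univ (f := fun p => jac (fderiv ℝ F p)) ?_
    (fun x _ => hF.jac_ne_zero x) (Set.mem_univ p) (Set.mem_univ q)
  have h : Continuous (fderiv ℝ F) := hF.1.continuous_fderiv (by simp)
  have h' : Continuous fun p => jac (fderiv ℝ F p) := by
    unfold jac planeDet
    fun_prop
  exact h'.continuousOn

namespace VirtualDiagram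

open GaussCode

variable {n : ℕ} {D D' : VirtualDiagram} {w : GaussCode n} {t₀ : ℝ} {τ : Fin (2 * n) → ℝ}
  {c : Fin n → Plane}

lemma HasCodeAt.exists_next (h : D.HasCodeAt w t₀ τ c) {s t : ℝ} (hst : s < t)
    (hs : D.curve s ∈ D.real) (ht : D.curve t ∈ D.real)
    (hno : ∀ x ∈ Set.Ioo s t, D.curve x ∉ D.real) :
    ∃ i, SameParam s (τ i) ∧ SameParam t (τ (next i)) := by
  obtain ⟨k, hk⟩ := exists_int_add_mem_Ico t₀ s
  have hs' : D.curve (s + k) ∈ D.real := by rwa [D.curve_add_int]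
  have hne : s + k ≠ t₀ := fun he => h.1 (he ▸ hs')
  obtain ⟨i, hi⟩ := h.exists_eq ⟨lt_of_le_of_ne hk.1 hne.symm, hk.2⟩ hs'
  refine ⟨i, ⟨-k, by rw [hi]; push_cast; ring⟩, ?_⟩
  have hlt := lt_nextParam h.strictMono h.mem_Ioo i
  obtain ⟨l, hl⟩ := nextParam_eq τ i
  have h1 : nextParam τ i ≤ t + k := by
    by_contra! hc
    refine h.notMem_real i ⟨?_, hc⟩ (by rwa [D.curve_add_int])
    linarith
  rcases h1.eq_or_lt with h2 | h2
  · exact ⟨l - k, by rw [next]; push_cast; linarith⟩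
  · exfalso
    refine hno (nextParam τ i - k) ⟨by linarith, by linarith⟩ ?_
    have : nextParam τ i - k = τ (finRotate (2 * n) i) + (l - k : ℤ) := by
      rw [hl]; push_cast; ring
    rw [this, D.curve_add_int]
    exact h.curve_mem _

lemma HasCodeAt.letter_of_sameParam (h : D.HasCodeAt w t₀ τ c) {i j : Fin (2 * n)} {s t : ℝ}
    (hs : SameParam s (τ i)) (ht : SameParam t (τ j)) (hst : D.curve s = D.curve t)
    (hne : ¬ SameParam s t) :
    w.letter j = ((w.letter i).1, !(w.letter i).2) ∧
      ((w.letter i).2 = Side.L ↔ planeDet (deriv D.curve s) (deriv D.curve t) < 0) := by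
  obtain ⟨k, rfl⟩ := hs
  obtain ⟨l, rfl⟩ := ht
  rw [D.curve_add_int, D.curve_add_int] at hst
  rw [D.deriv_curve_add_int, D.deriv_curve_add_int]
  have hij : ¬ SameParam (τ j) (τ i) := by
    rintro ⟨m, hm⟩
    exact hne ⟨k - l - m, by push_cast; linarith⟩
  refine ⟨?_, (h.2.2.2.2.2 i).2 _ hst.symm hij⟩
  have h1 : (w.letter j).1 = (w.letter i).1 := h.2.1 (by rw [← h.curve_eq, ← h.curve_eq, hst])
  refine Prod.ext h1 ?_
  have h2 : (w.letter j).2 ≠ (w.letter i).2 := fun h2 => by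
    have : j = i := w.letter_injective (Prod.ext h1 h2)
    exact hij (by rw [this]; exact ⟨0, by simp⟩)
  change (w.letter j).2 = !(w.letter i).2
  exact Bool.eq_not.2 h2

lemma not_sameParam_of_lt {s t : ℝ} (h1 : s < t) (h2 : t < s + 1) : ¬ SameParam s t := by
  rintro ⟨k, hk⟩
  have h3 : (k : ℝ) < 0 := by linarith
  have h4 : (-1 : ℝ) < k := by linarith
  have h5 : k < 0 := by exact_mod_cast h3
  have h6 : -1 < k := by exact_mod_cast h4
  omega

lemma sameParam_arcParams {a b x : ℝ} (h : x ∈ arcParams a b) :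
    ∃ y ∈ Set.Ioo a b, SameParam x y := by
  obtain ⟨k, hk⟩ := h
  exact ⟨x + k, hk, -k, by push_cast; ring⟩

lemma curve_eq_of_sameParam (D : VirtualDiagram) {s t : ℝ} (h : SameParam s t) :
    D.curve s = D.curve t := h.apply_eq D.periodic

lemma exists_of_mem_real {x : ℝ} (hx : D.curve x ∈ D.real) :
    ∃ y, D.curve y = D.curve x ∧ ¬ SameParam x y := by
  obtain ⟨s, t, hs, ht, hst⟩ := D.real_crossing _ hx
  by_cases h : SameParam x s
  · exact ⟨t, ht, fun h' => hst (h.symm.trans h')⟩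
  · exact ⟨s, hs, h⟩

lemma mem_arcParams_of_mem_Ioo {a b x : ℝ} (h : x ∈ Set.Ioo a b) : x ∈ arcParams a b :=
  ⟨0, by simpa using h⟩

/-- A real crossing met between `s` and `t` would lie in the disc, so its other branch would belong
to the same arc; but that arc has only one self-crossing. -/
theorem HasGaussCode.isOneReducible_of_R1Move (h : D.HasGaussCode w) (hm : R1Move D D') :
    w.IsOneReducible := by
  obtain ⟨t₀, τ, c, h⟩ := h
  change D.HasCodeAt w t₀ τ c at h
  obtain ⟨F, a, b, s, t, -, has, hst, htb, hba, hN, -, -, hcr, hreal, huniq, -, -⟩ := hm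
  have hns : ¬ SameParam s t := not_sameParam_of_lt hst (by linarith)
  obtain ⟨i, hi1, hi2⟩ := h.exists_next hst hreal (hcr ▸ hreal) (fun x hx hxr => by
    obtain ⟨y, hy, hxy⟩ := exists_of_mem_real hxr
    have hxab : x ∈ Set.Ioo a b := ⟨has.trans hx.1, hx.2.trans htb⟩
    have hy' : y ∈ arcParams a b := (hN y).1 (by
      rw [hy]; exact (hN x).2 (mem_arcParams_of_mem_Ioo hxab))
    obtain ⟨z, hz, hyz⟩ := sameParam_arcParams hy'
    have hxz : D.curve x = D.curve z := by rw [← hy, D.curve_eq_of_sameParam hyz]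
    rcases lt_trichotomy x z with hlt | rfl | hlt
    · obtain ⟨rfl, -⟩ := huniq x hxab z hz hlt hxz
      exact lt_irrefl _ hx.1
    · exact hxy hyz.symm
    · obtain ⟨-, rfl⟩ := huniq z hz x hxab hlt hxz.symm
      exact lt_irrefl _ hx.2)
  obtain ⟨h1, -⟩ := h.letter_of_sameParam hi1 hi2 hcr hns
  refine ⟨(w.letter i).1, ?_⟩
  cases hx : (w.letter i).2
  · exact Or.inl ⟨i, Prod.ext rfl hx, by rw [h1, hx]; rfl⟩
  · exact Or.inr ⟨i, Prod.ext rfl hx, by rw [h1, hx]; rfl⟩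

/-- Opposite signs at the two crossings mean opposite sides along each arc. The first kind of
`2`-reducibility arises when both arcs run through the crossings in the same order, and the other
two when the second arc runs backwards. -/
lemma HasCodeAt.isTwoReducible (h : D.HasCodeAt w t₀ τ c) {s₁ s₂ t₁ t₂ : ℝ} (hs : s₁ < s₂)
    (h1 : D.curve s₁ = D.curve t₁) (hr1 : D.curve s₁ ∈ D.real) (hn1 : ¬ SameParam s₁ t₁)
    (h2 : D.curve s₂ = D.curve t₂) (hr2 : D.curve s₂ ∈ D.real) (hn2 : ¬ SameParam s₂ t₂)
    (hne : D.curve s₁ ≠ D.curve s₂) (hnos : ∀ x ∈ Set.Ioo s₁ s₂, D.curve x ∉ D.real)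
    (hnot : ∀ x, x ∈ Set.Ioo t₁ t₂ ∨ x ∈ Set.Ioo t₂ t₁ → D.curve x ∉ D.real)
    (hdet : planeDet (deriv D.curve s₁) (deriv D.curve t₁) *
      planeDet (deriv D.curve s₂) (deriv D.curve t₂) < 0) : w.IsTwoReducible := by
  obtain ⟨i, hi1, hi2⟩ := h.exists_next hs hr1 hr2 hnos
  have hjk : (w.letter i).1 ≠ (w.letter (next i)).1 := fun he => hne (by
    rw [D.curve_eq_of_sameParam hi1, D.curve_eq_of_sameParam hi2, h.curve_eq, h.curve_eq, he])
  have hside : ∀ {p q}, SameParam t₁ (τ p) → SameParam t₂ (τ q) →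
      w.letter p = ((w.letter i).1, !(w.letter i).2) ∧
      w.letter (next i) = ((w.letter (next i)).1, !(w.letter i).2) ∧
      w.letter q = ((w.letter (next i)).1, (w.letter i).2) := by
    intro p q hp hq
    obtain ⟨e1, e2⟩ := h.letter_of_sameParam hi1 hp h1 hn1
    obtain ⟨e3, e4⟩ := h.letter_of_sameParam hi2 hq h2 hn2
    have e5 : (w.letter (next i)).2 = !(w.letter i).2 := by
      cases hx : (w.letter i).2 <;> cases hy : (w.letter (next i)).2
      · have a1 := e2.1 hx
        have a2 := e4.1 hy
        linarith [mul_pos_of_neg_of_neg a1 a2]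
      · rfl
      · rfl
      · have a1 : ¬ _ := fun hc => absurd (hx.symm.trans (e2.2 hc)) (by decide)
        have a2 : ¬ _ := fun hc => absurd (hy.symm.trans (e4.2 hc)) (by decide)
        linarith [mul_nonneg (not_lt.1 a1) (not_lt.1 a2)]
    refine ⟨e1, Prod.ext rfl e5, ?_⟩
    rw [e3, e5, Bool.not_not]
  have ht : t₁ ≠ t₂ := fun he => hne (by rw [h1, h2, he])
  refine ⟨(w.letter i).1, (w.letter (next i)).1, hjk, ?_⟩
  rcases lt_or_gt_of_ne ht with hlt | hlt
  · obtain ⟨q, hq1, hq2⟩ := h.exists_next hlt (h1 ▸ hr1) (h2 ▸ hr2) (fun x hx => hnot x (Or.inl hx))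
    obtain ⟨e1, e2, e3⟩ := hside hq1 hq2
    left
    cases hx : (w.letter i).2
    · exact ⟨⟨i, Prod.ext rfl hx, by rw [e2, hx]; rfl⟩, ⟨q, by rw [e1, hx]; rfl, by rw [e3, hx]⟩⟩
    · exact ⟨⟨q, by rw [e1, hx]; rfl, by rw [e3, hx]⟩, ⟨i, Prod.ext rfl hx, by rw [e2, hx]; rfl⟩⟩
  · obtain ⟨q, hq1, hq2⟩ := h.exists_next hlt (h2 ▸ hr2) (h1 ▸ hr1) (fun x hx => hnot x (Or.inr hx))
    obtain ⟨e1, e2, e3⟩ := hside hq2 hq1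
    right
    cases hx : (w.letter i).2
    · exact Or.inl ⟨⟨i, Prod.ext rfl hx, by rw [e2, hx]; rfl⟩,
        ⟨q, by rw [e3, hx], by rw [e1, hx]; rfl⟩⟩
    · exact Or.inr ⟨⟨i, Prod.ext rfl hx, by rw [e2, hx]; rfl⟩,
        ⟨q, by rw [e3, hx], by rw [e1, hx]; rfl⟩⟩

/-- The crossings in a disc in which the first arc is a diameter have opposite signs. -/
lemma planeDet_mul_planeDet_neg {F : Plane ≃ Plane} (hF : IsPlaneDiffeo F) {a b x y s₁ s₂ : ℝ}
    (hdiam : ∀ t ∈ Set.Ioo a b, (F.symm (D.curve t)).2 = 0)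
    (hs₁ : s₁ ∈ Set.Ioo a b) (hs₂ : s₂ ∈ Set.Ioo a b) (hxy : x < y)
    (hne : ∀ t ∈ Set.Ioo x y, (F.symm (D.curve t)).2 ≠ 0)
    (hx : D.curve s₁ = D.curve x) (hy : D.curve s₂ = D.curve y)
    (hnx : ¬ SameParam s₁ x) (hny : ¬ SameParam s₂ y) :
    planeDet (deriv D.curve s₁) (deriv D.curve x) * planeDet (deriv D.curve s₂) (deriv D.curve y)
      < 0 := by
  set G := F.symm with hG
  have hG' : IsPlaneDiffeo G := hF.symm
  set η : ℝ → Plane := fun t => G (D.curve t) with hη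
  have hηd : ∀ t, HasDerivAt η (fderiv ℝ G (D.curve t) (deriv D.curve t)) t := fun t =>
    hG'.hasDerivAt (D.differentiable t)
  have hηs : ContDiff ℝ ∞ η := hG'.1.comp D.smooth
  have hcont : Continuous (deriv η) := hηs.continuous_deriv (by simp)
  have hη0 : ∀ t, deriv η t ≠ 0 := fun t h0 => by
    rw [(hηd t).deriv] at h0
    exact D.immersed t (hG'.fderiv_injective _ (by rw [h0, map_zero]))
  have hfst : ∀ t ∈ Set.Ioo a b, (deriv η t).2 = 0 := fun t ht => by
    have h1 : (fun t => (η t).2) =ᶠ[𝓝 t] fun _ => 0 := by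
      filter_upwards [isOpen_Ioo.mem_nhds ht] with u hu using hdiam u hu
    have h2 : HasDerivAt (fun t => (η t).2) (deriv η t).2 t :=
      (hηs.differentiable (by simp) t).hasDerivAt.snd
    exact h2.unique ((hasDerivAt_const t (0 : ℝ)).congr_of_eventuallyEq h1)
  -- In the coordinates of the disc the first arc is horizontal and immersed, so its horizontal
  -- velocity keeps its sign.
  have hu : 0 < (deriv η s₁).1 * (deriv η s₂).1 :=
    mul_pos_of_isPreconnected (f := fun t => (deriv η t).1) isPreconnected_Ioo
      (hcont.fst.continuousOn) (fun t ht h0 => hη0 t (Prod.ext h0 (hfst t ht))) hs₁ hs₂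
  have hdet : ∀ s t, D.curve s = D.curve t → planeDet (deriv η s) (deriv η t) =
      jac (fderiv ℝ G (D.curve s)) * planeDet (deriv D.curve s) (deriv D.curve t) := by
    intro s t hst
    rw [(hηd s).deriv, (hηd t).deriv, ← hst, planeDet_map]
  have hdet' : ∀ s ∈ Set.Ioo a b, ∀ t, planeDet (deriv η s) (deriv η t) =
      (deriv η s).1 * (deriv η t).2 := fun s hs t => by
    rw [planeDet, hfst s hs]; ring
  -- Between the crossings the second arc stays on one side of the diameter, so it crosses in
  -- opposite directions. Transversality later makes the inequality strict.
  have hv : deriv (fun t => (η t).2) x * deriv (fun t => (η t).2) y ≤ 0 := by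
    refine deriv_mul_deriv_nonpos hxy hηs.continuous.snd.continuousOn ?_ ?_ hne
    · change (G (D.curve x)).2 = 0
      rw [← hx]; exact hdiam s₁ hs₁
    · change (G (D.curve y)).2 = 0
      rw [← hy]; exact hdiam s₂ hs₂
  have hsnd : ∀ t, deriv (fun t => (η t).2) t = (deriv η t).2 := fun t => by
    have h2 : HasDerivAt (fun t => (η t).2) (deriv η t).2 t :=
      (hηs.differentiable (by simp) t).hasDerivAt.snd
    exact h2.deriv
  rw [hsnd, hsnd] at hv
  have h1 := hdet s₁ x hx
  have h2 := hdet s₂ y hy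
  rw [hdet' s₁ hs₁] at h1
  rw [hdet' s₂ hs₂] at h2
  have hj := hG'.jac_mul_jac_pos (D.curve s₁) (D.curve s₂)
  set J₁ := jac (fderiv ℝ G (D.curve s₁))
  set J₂ := jac (fderiv ℝ G (D.curve s₂))
  set P₁ := planeDet (deriv D.curve s₁) (deriv D.curve x) with hP₁
  set P₂ := planeDet (deriv D.curve s₂) (deriv D.curve y) with hP₂
  have hP : P₁ * P₂ ≠ 0 := mul_ne_zero (D.transverse _ _ hx hnx) (D.transverse _ _ hy hny)
  have h3 : (J₁ * J₂) * (P₁ * P₂) ≤ 0 := by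
    have : (J₁ * J₂) * (P₁ * P₂) = ((deriv η s₁).1 * (deriv η s₂).1) *
        ((deriv η x).2 * (deriv η y).2) := by
      calc _ = (J₁ * P₁) * (J₂ * P₂) := by ring
        _ = _ := by rw [← h1, ← h2]; ring
    rw [this]
    exact mul_nonpos_of_nonneg_of_nonpos hu.le hv
  refine lt_of_le_of_ne ?_ hP
  by_contra! hc
  linarith [mul_pos hj hc]

theorem HasGaussCode.isTwoReducible_of_R2Move (h : D.HasGaussCode w) (hm : R2Move D D') :
    w.IsTwoReducible := by
  obtain ⟨t₀, τ, c, h⟩ := h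
  change D.HasCodeAt w t₀ τ c at h
  obtain ⟨F, a, b, x, y, s₁, s₂, t₁, t₂, hF, hab, hbx, hxy, hya, hN, -, -, hdiam, hinj1, hinj2, -,
    hs₁, hs₂, hs, ht₁, ht₂, h1, hr1, h2, hr2, huniq, -, -⟩ := hm
  have hns : ∀ s ∈ Set.Ioo a b, ∀ t ∈ Set.Ioo x y, ¬ SameParam s t := fun s hs t ht =>
    not_sameParam_of_lt (by linarith [hs.2, ht.1]) (by linarith [hs.1, ht.2])
  have hreal1 : ∀ s ∈ Set.Ioo a b, D.curve s ∈ D.real → s = s₁ ∨ s = s₂ := by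
    intro s hs hr
    obtain ⟨u, hu, hsu⟩ := exists_of_mem_real hr
    rcases (hN u).1 (by rw [hu]; exact (hN s).2 (Or.inl (mem_arcParams_of_mem_Ioo hs))) with hu' | hu'
    · obtain ⟨z, hz, huz⟩ := sameParam_arcParams hu'
      have := hinj1 hs hz (by rw [← hu, D.curve_eq_of_sameParam huz])
      exact absurd (this ▸ huz.symm) hsu
    · obtain ⟨z, hz, huz⟩ := sameParam_arcParams hu'
      exact (huniq s hs z hz (by rw [← hu, D.curve_eq_of_sameParam huz])).imp And.left And.left
  have hreal2 : ∀ t ∈ Set.Ioo x y, D.curve t ∈ D.real → t = t₁ ∨ t = t₂ := by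
    intro s hs hr
    obtain ⟨u, hu, hsu⟩ := exists_of_mem_real hr
    rcases (hN u).1 (by rw [hu]; exact (hN s).2 (Or.inr (mem_arcParams_of_mem_Ioo hs))) with hu' | hu'
    · obtain ⟨z, hz, huz⟩ := sameParam_arcParams hu'
      exact (huniq z hz s hs (by rw [← hu, D.curve_eq_of_sameParam huz])).imp And.right And.right
    · obtain ⟨z, hz, huz⟩ := sameParam_arcParams hu'
      have := hinj2 hs hz (by rw [← hu, D.curve_eq_of_sameParam huz])
      exact absurd (this ▸ huz.symm) hsu
  have hd : ∀ t ∈ Set.Ioo a b, (F.symm (D.curve t)).2 = 0 := by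
    intro t ht
    have : D.curve t ∈ F '' unitDiameter := hdiam ▸ Set.mem_image_of_mem _ ht
    obtain ⟨p, hp, he⟩ := this
    rw [← he, Equiv.symm_apply_apply]
    exact hp.2
  have hd' : ∀ t ∈ Set.Ioo x y, (F.symm (D.curve t)).2 = 0 → t = t₁ ∨ t = t₂ := by
    intro t ht h0
    obtain ⟨p, hp, he⟩ := (hN t).2 (Or.inr (mem_arcParams_of_mem_Ioo ht))
    have : D.curve t ∈ D.curve '' Set.Ioo a b := by
      rw [hdiam]
      refine ⟨p, ⟨hp, ?_⟩, he⟩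
      rw [← he, Equiv.symm_apply_apply] at h0
      exact h0
    obtain ⟨s, hs, hst⟩ := this
    exact (huniq s hs t ht hst).imp And.right And.right
  have hne : D.curve s₁ ≠ D.curve s₂ := fun he => hs (hinj1 hs₁ hs₂ he)
  have ht : t₁ ≠ t₂ := fun he => hne (by rw [h1, h2, he])
  have hdet : planeDet (deriv D.curve s₁) (deriv D.curve t₁) *
      planeDet (deriv D.curve s₂) (deriv D.curve t₂) < 0 := by
    rcases lt_or_gt_of_ne ht with hlt | hlt
    · refine planeDet_mul_planeDet_neg hF hd hs₁ hs₂ hlt (fun t ht' h0 => ?_) h1 h2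
        (hns _ hs₁ _ ht₁) (hns _ hs₂ _ ht₂)
      rcases hd' t ⟨ht₁.1.trans ht'.1, ht'.2.trans ht₂.2⟩ h0 with rfl | rfl
      · exact lt_irrefl _ ht'.1
      · exact lt_irrefl _ ht'.2
    · rw [mul_comm]
      refine planeDet_mul_planeDet_neg hF hd hs₂ hs₁ hlt (fun t ht' h0 => ?_) h2 h1
        (hns _ hs₂ _ ht₂) (hns _ hs₁ _ ht₁)
      rcases hd' t ⟨ht₂.1.trans ht'.1, ht'.2.trans ht₁.2⟩ h0 with rfl | rfl
      · exact lt_irrefl _ ht'.2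
      · exact lt_irrefl _ ht'.1
  have hnot : ∀ u, u ∈ Set.Ioo t₁ t₂ ∨ u ∈ Set.Ioo t₂ t₁ → D.curve u ∉ D.real := by
    rintro u (hu | hu) hr
    · rcases hreal2 u ⟨ht₁.1.trans hu.1, hu.2.trans ht₂.2⟩ hr with rfl | rfl
      · exact lt_irrefl _ hu.1
      · exact lt_irrefl _ hu.2
    · rcases hreal2 u ⟨ht₂.1.trans hu.1, hu.2.trans ht₁.2⟩ hr with rfl | rfl
      · exact lt_irrefl _ hu.2
      · exact lt_irrefl _ hu.1
  rcases lt_or_gt_of_ne hs with hlt | hlt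
  · refine h.isTwoReducible hlt h1 hr1 (hns _ hs₁ _ ht₁) h2 hr2 (hns _ hs₂ _ ht₂) hne
      (fun u hu hr => ?_) hnot hdet
    rcases hreal1 u ⟨hs₁.1.trans hu.1, hu.2.trans hs₂.2⟩ hr with rfl | rfl
    · exact lt_irrefl _ hu.1
    · exact lt_irrefl _ hu.2
  · refine h.isTwoReducible hlt h2 hr2 (hns _ hs₂ _ ht₂) h1 hr1 (hns _ hs₁ _ ht₁) hne.symm
      (fun u hu hr => ?_) (fun u hu => hnot u hu.symm) (by rwa [mul_comm])
    rcases hreal1 u ⟨hs₂.1.trans hu.1, hu.2.trans hs₁.2⟩ hr with rfl | rfl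
    · exact lt_irrefl _ hu.2
    · exact lt_irrefl _ hu.1

theorem HasGaussCode.isMinimal (h : D.HasGaussCode w) (hw : w.IsMinimal) : D.IsMinimal := by
  rintro ⟨D₁, D₂, he, hm⟩
  have h₁ := he.hasGaussCode_iff.1 h
  rcases hm with hm | hm
  · exact hw.1 (h₁.isOneReducible_of_R1Move hm)
  · exact hw.2 (h₁.isTwoReducible_of_R2Move hm)

end VirtualDiagram

/-! ### Existence of a Gauss code -/

namespace VirtualDiagram

open GaussCode

variable {n : ℕ}

/-- The passage `u` is the one with side `L`, by the sign of the determinant; there is no third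
passage because there are no triple points. -/
lemma exists_passages (D : VirtualDiagram) (a : ℝ) {p : Plane} (hp : p ∈ D.real) :
    ∃ u ∈ Set.Ico a (a + 1), ∃ v ∈ Set.Ico a (a + 1), D.curve u = p ∧ D.curve v = p ∧
      planeDet (deriv D.curve u) (deriv D.curve v) < 0 ∧
      ∀ t ∈ Set.Ico a (a + 1), D.curve t = p → t = u ∨ t = v := by
  obtain ⟨s, t, hs, ht, hst⟩ := D.real_crossing p hp
  obtain ⟨k, hk⟩ := exists_int_add_mem_Ico a s
  obtain ⟨l, hl⟩ := exists_int_add_mem_Ico a t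
  rw [← D.curve_add_int s k] at hs
  rw [← D.curve_add_int t l] at ht
  have hne : ¬ SameParam (s + k) (t + l) := fun h =>
    hst ((SameParam.add_int s k).symm.trans (h.trans (SameParam.add_int t l)))
  have huniq : ∀ x ∈ Set.Ico a (a + 1), ∀ y ∈ Set.Ico a (a + 1), SameParam x y → x = y := by
    rintro x hx y hy hxy
    rcases lt_trichotomy x y with h | h | h
    · exact absurd hxy (not_sameParam_of_lt h (by linarith [hx.1, hy.2]))
    · exact h
    · exact absurd hxy.symm (not_sameParam_of_lt h (by linarith [hy.1, hx.2]))
  have hall : ∀ x ∈ Set.Ico a (a + 1), D.curve x = p → x = s + k ∨ x = t + l := by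
    intro x hx hxp
    rcases D.no_triple x (s + k) (t + l) (hxp.trans hs.symm) (hs.trans ht.symm) with h | h | h
    · exact Or.inl (huniq x hx _ hk h)
    · exact absurd h hne
    · exact Or.inr (huniq x hx _ hl h)
  rcases lt_or_gt_of_ne (D.transverse _ _ (hs.trans ht.symm) hne) with h | h
  · exact ⟨_, hk, _, hl, hs, ht, h, hall⟩
  · exact ⟨_, hl, _, hk, ht, hs, by rw [planeDet_swap]; linarith, fun x hx hxp => (hall x hx hxp).symm⟩

lemma exists_notMem_real (D : VirtualDiagram) (h : D.real.Finite) : ∃ t, D.curve t ∉ D.real := by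
  by_contra! hc
  have : (Set.Ico (0 : ℝ) (0 + 1)).Finite := by
    have hfin : (⋃ p ∈ D.real, {t | t ∈ Set.Ico (0 : ℝ) (0 + 1) ∧ D.curve t = p}).Finite := by
      refine h.biUnion fun p hp => ?_
      obtain ⟨u, -, v, -, -, -, -, huv⟩ := D.exists_passages 0 hp
      exact (Set.toFinite {u, v}).subset fun t ht => by simpa using huv t ht.1 ht.2
    refine hfin.subset fun t ht => ?_
    simp only [Set.mem_iUnion]
    exact ⟨D.curve t, hc t, ht, rfl⟩
  exact Set.Ico_infinite (by norm_num) this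

/-- Each real crossing gives two parameters in the period after a base point off the real crossings,
one for each side. Sorting these `2 * n` parameters yields the code. -/
theorem exists_hasGaussCode_of_ncard [NeZero n] (D : VirtualDiagram) (hD : D.real.ncard = n) :
    ∃ w : GaussCode n, D.HasGaussCode w := by
  have hfin : D.real.Finite := Set.finite_of_ncard_ne_zero (by rw [hD]; exact NeZero.ne n)
  obtain ⟨t₀, ht₀⟩ := D.exists_notMem_real hfin
  obtain ⟨e⟩ : Nonempty (Fin n ≃ D.real) := by
    have := hfin.fintype
    exact ⟨(Fintype.equivFinOfCardEq (by rw [← Nat.card_eq_fintype_card]; exact hD)).symm⟩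
  let c : Fin n → Plane := fun j => e j
  have hc : Function.Injective c := Subtype.val_injective.comp e.injective
  choose u hu v hv hup hvp hdet hall using fun j => D.exists_passages t₀ (e j).2
  have huv : ∀ j, ¬ SameParam (u j) (v j) := fun j hs => by
    have := hdet j
    rw [hs.apply_eq (deriv_periodic D.periodic)] at this
    simp [planeDet, mul_comm] at this
  let φ : Fin n × Side → ℝ := fun x => bif x.2 then v x.1 else u x.1
  have hφ : ∀ x, D.curve (φ x) = c x.1 := by
    rintro ⟨j, _ | _⟩
    · exact hup j
    · exact hvp j
  have hφm : ∀ x, φ x ∈ Set.Ioo t₀ (t₀ + 1) := by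
    intro x
    have h1 : φ x ∈ Set.Ico t₀ (t₀ + 1) := by
      rcases x with ⟨j, _ | _⟩
      · exact hu j
      · exact hv j
    refine ⟨lt_of_le_of_ne h1.1 fun h => ht₀ ?_, h1.2⟩
    rw [h, hφ]
    exact (e x.1).2
  have hφd : ∀ j, planeDet (deriv D.curve (φ (j, Side.L))) (deriv D.curve (φ (j, Side.R))) < 0 :=
    hdet
  have hφne : ∀ j, ¬ SameParam (φ (j, Side.L)) (φ (j, Side.R)) := huv
  have hφi : Function.Injective φ := by
    intro x y hxy
    have h1 : x.1 = y.1 := hc (by rw [← hφ, ← hφ, hxy])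
    rcases x with ⟨j, _ | _⟩ <;> rcases y with ⟨k, _ | _⟩ <;> obtain rfl : j = k := h1
    · rfl
    · exact absurd (hxy ▸ SameParam.refl _) (hφne j)
    · exact absurd (hxy ▸ SameParam.refl _) (hφne j)
    · rfl
  have hcard : (Finset.univ.image φ).card = 2 * n := by
    rw [Finset.card_image_of_injective _ hφi]
    simp [mul_comm]
  let τ := (Finset.univ.image φ).orderEmbOfFin hcard
  have hτ : ∀ i, ∃ x, φ x = τ i := fun i => by
    have := Finset.orderEmbOfFin_mem (Finset.univ.image φ) hcard i
    obtain ⟨x, -, hx⟩ := Finset.mem_image.1 this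
    exact ⟨x, hx⟩
  choose x hx using hτ
  have hrange : Set.range τ = Set.range φ := by
    simp only [τ, Finset.range_orderEmbOfFin]
    simp
  let w : GaussCode n := ⟨x, fun y => by
    have : φ y ∈ Set.range τ := by rw [hrange]; exact Set.mem_range_self y
    obtain ⟨i, hi⟩ := this
    exact ⟨i, hφi ((hx i).trans hi)⟩⟩
  refine ⟨w, t₀, τ, c, ht₀, hc, ?_, τ.strictMono, ?_, fun i => ⟨?_, fun s hs hne => ?_⟩⟩
  · change Set.range (Subtype.val ∘ e) = _
    rw [e.surjective.range_comp, Subtype.range_coe]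
  · rw [hrange]
    ext t
    constructor
    · rintro ⟨y, rfl⟩
      exact ⟨hφm y, by rw [hφ]; exact (e y.1).2⟩
    · rintro ⟨ht, hr⟩
      obtain ⟨j, hj⟩ := e.surjective ⟨_, hr⟩
      rcases hall j t ⟨ht.1.le, ht.2⟩ (by rw [hj]) with h | h
      · exact ⟨(j, Side.L), h.symm⟩
      · exact ⟨(j, Side.R), h.symm⟩
  · rw [← hx, hφ]
    rfl
  · change ((x i).2 = Side.L ↔ _)
    rw [← hx] at hs hne ⊢
    have hother : ∀ y : Fin n × Side, D.curve s = c y.1 → ¬ SameParam s (φ (y.1, y.2)) →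
        SameParam s (φ (y.1, !y.2)) := by
      intro y hsy hns
      rcases D.no_triple s (φ (y.1, !y.2)) (φ (y.1, y.2)) (by rw [hsy, hφ])
        (by rw [hφ, hφ]) with h | h | h
      · exact h
      · rcases y with ⟨j, _ | _⟩
        · exact absurd h.symm (hφne j)
        · exact absurd h (hφne j)
      · exact absurd h hns
    have h1 := hother (x i) (by rw [hs, hφ]) hne
    rw [h1.apply_eq (deriv_periodic D.periodic)]
    generalize x i = y
    rcases y with ⟨j, _ | _⟩
    · exact ⟨fun _ => hφd j, fun _ => rfl⟩
    · refine ⟨fun h => Bool.noConfusion h, fun h => ?_⟩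
      have h2 := hφd j
      rw [planeDet_swap] at h2
      change planeDet (deriv D.curve (φ (j, Side.R))) (deriv D.curve (φ (j, Side.L))) < 0 at h
      linarith

end VirtualDiagram

/-! ### Replacing an arc in a disc -/

lemma periodize_eventuallyEq_zero {F : Type*} [Zero F] {f : ℝ → F} {a b : ℝ} (ha : 0 < a)
    (hb : b < 1) (h : ∀ t, f t ≠ 0 → t ∈ Set.Icc a b) {t : ℝ} (ht : t ∈ Set.Ico (0 : ℝ) 1)
    (htab : t ∉ Set.Icc a b) : periodize f =ᶠ[𝓝 t] fun _ => 0 := by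
  rcases ht.1.eq_or_lt with h0 | h0
  · subst h0
    filter_upwards [Ioo_mem_nhds (show -(1 - b) < 0 by linarith) ha,
      Ioo_mem_nhds (show (-1 : ℝ) < 0 by norm_num) (zero_lt_one)] with x hx hx'
    by_contra hne
    rcases lt_or_ge x 0 with hneg | hpos
    · rw [← periodize_add_one, periodize_of_mem f ⟨by linarith [hx'.1], by linarith⟩] at hne
      linarith [(h _ hne).2, hx.1]
    · rw [periodize_of_mem f ⟨hpos, hx'.2⟩] at hne
      linarith [(h _ hne).1, hx.2]
  · filter_upwards [periodize_eventuallyEq f ⟨h0, ht.2⟩, isClosed_Icc.isOpen_compl.mem_nhds htab]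
      with x hx hx'
    rw [hx]
    by_contra hne
    exact hx' (h x hne)

lemma mem_arcParams_iff {a b t : ℝ} (ha : 0 ≤ a) (hb : b ≤ 1) (ht : t ∈ Set.Ico (0 : ℝ) 1) :
    t ∈ arcParams a b ↔ t ∈ Set.Ioo a b := by
  refine ⟨fun ⟨k, hk⟩ => ?_, fun h => ⟨0, by simpa using h⟩⟩
  have h1 : (k : ℝ) < 1 := by linarith [hk.2, ht.1]
  have h2 : (-1 : ℝ) < k := by linarith [hk.1, ht.2]
  have h3 : k < 1 := by exact_mod_cast h1
  have h4 : -1 < k := by exact_mod_cast h2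
  have h5 : k = 0 := by omega
  simpa [h5] using hk

lemma SameParam.mem_arcParams {a b s t : ℝ} (h : SameParam s t) :
    s ∈ arcParams a b ↔ t ∈ arcParams a b := by
  have key : ∀ {s t}, SameParam s t → s ∈ arcParams a b → t ∈ arcParams a b := by
    rintro s t ⟨k, rfl⟩ ⟨l, hl⟩
    exact ⟨k + l, by push_cast; rwa [← add_assoc]⟩
  exact ⟨key h, key h.symm⟩

lemma exists_sameParam_mem_Ico (t : ℝ) : ∃ s ∈ Set.Ico (0 : ℝ) 1, SameParam t s := by
  obtain ⟨k, hk⟩ := VirtualDiagram.exists_int_add_mem_Ico 0 t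
  exact ⟨t + k, by simpa using hk, -k, by push_cast; ring⟩

namespace VirtualDiagram

/-- Replacement of an arc by an arc that is embedded in a disc `N` and meets no other arc of the
diagram in `N`. -/
theorem exists_replace (D : VirtualDiagram) {N : Set Plane} {a b a' b' : ℝ} (ha : 0 ≤ a)
    (haa' : a < a') (hbb' : b' < b) (hb : b ≤ 1) {B : Set ℝ}
    (hN : ∀ t, D.curve t ∈ N ↔ t ∈ B ∪ arcParams a b)
    {g : ℝ → Plane} (hg : ContDiff ℝ ∞ g) (hsupp : ∀ t, g t ≠ 0 → t ∈ Set.Icc a' b')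
    (hgN : ∀ t ∈ Set.Ioo a b, D.curve t + g t ∈ N)
    (hgB : ∀ t ∈ Set.Ioo a b, ∀ s ∈ B, s ∉ arcParams a b → D.curve t + g t ≠ D.curve s)
    (himm : ∀ t ∈ Set.Ioo a b, deriv D.curve t + deriv g t ≠ 0)
    (hinj : Set.InjOn (fun t => D.curve t + g t) (Set.Ioo a b))
    {R : Set Plane} (hR : R ⊆ D.real) (hRN : ∀ s, s ∈ arcParams a b → D.curve s ∉ R) :
    ∃ D' : VirtualDiagram, D'.real = R ∧
      (∀ t, D'.curve t ∈ N ↔ t ∈ B ∪ arcParams a b) ∧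
      (∀ t, t ∉ arcParams a b → D'.curve t = D.curve t) ∧
      ∀ t ∈ Set.Ioo a b, D'.curve t = D.curve t + g t := by
  have ha'0 : 0 < a' := by linarith
  have hb'1 : b' < 1 := by linarith
  set δ : ℝ → Plane := fun t => D.curve t + periodize g t with hδ
  have hδp : ∀ t, δ (t + 1) = δ t := fun t => by
    simp only [hδ, D.periodic, periodize_add_one]
  have hps := contDiff_periodize hg ha'0 hb'1 hsupp
  have hδs : ContDiff ℝ ∞ δ := D.smooth.add hps
  have hδd : ∀ t, deriv δ t = deriv D.curve t + deriv (periodize g) t := fun t =>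
    deriv_add (D.differentiable t) (hps.differentiable (by simp) t)
  have hin : ∀ t ∈ Set.Ioo a b, δ t = D.curve t + g t ∧
      deriv δ t = deriv D.curve t + deriv g t := fun t ht => by
    have h := periodize_eventuallyEq g (t := t) ⟨by linarith [ht.1], by linarith [ht.2]⟩
    exact ⟨by rw [hδ]; simp only [h.eq_of_nhds], by rw [hδd, h.deriv_eq]⟩
  have hout : ∀ t, t ∉ arcParams a b → δ t = D.curve t ∧ deriv δ t = deriv D.curve t := by
    intro t ht
    obtain ⟨s, hs, hts⟩ := exists_sameParam_mem_Ico t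
    rw [hts.mem_arcParams, mem_arcParams_iff ha hb hs] at ht
    have h := periodize_eventuallyEq_zero ha'0 hb'1 hsupp hs
      (fun h => ht ⟨by linarith [h.1], by linarith [h.2]⟩)
    rw [hts.apply_eq hδp, hts.apply_eq D.periodic, hts.apply_eq (deriv_periodic hδp),
      hts.apply_eq (deriv_periodic D.periodic), hδd, h.deriv_eq, hδ]
    simp [h.eq_of_nhds]
  have hmemN : ∀ t, δ t ∈ N ↔ t ∈ B ∪ arcParams a b := by
    intro t
    by_cases ht : t ∈ arcParams a b
    · refine ⟨fun _ => Or.inr ht, fun _ => ?_⟩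
      obtain ⟨s, hs, hts⟩ := sameParam_arcParams ht
      rw [hts.apply_eq hδp, (hin s hs).1]
      exact hgN s hs
    · rw [(hout t ht).1, hN]
  -- The new arc is embedded and disjoint from the rest of the diagram, so it takes part in no
  -- double point. Genericity is then inherited from `D`.
  have hsame : ∀ s t, s ∈ arcParams a b → δ s = δ t → SameParam s t := by
    intro s t hs hst
    obtain ⟨x, hx, hsx⟩ := sameParam_arcParams hs
    rw [hsx.apply_eq hδp] at hst
    refine hsx.trans ?_
    by_cases ht : t ∈ arcParams a b
    · obtain ⟨y, hy, hty⟩ := sameParam_arcParams ht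
      rw [hty.apply_eq hδp] at hst
      have : x = y := hinj hx hy (by simpa only [(hin x hx).1, (hin y hy).1] using hst)
      exact this ▸ hty.symm
    · have h1 : δ t ∈ N := by rw [← hst, (hin x hx).1]; exact hgN x hx
      rw [hmemN] at h1
      rw [(hin x hx).1, (hout t ht).1] at hst
      exact absurd hst (hgB x hx t (h1.resolve_right ht) ht)
  have hgen : GenericOn δ Set.univ := by
    refine ⟨fun t _ => ?_, fun s _ t _ hst hne => ?_, fun s _ t _ u _ hst htu => ?_⟩
    · by_cases ht : t ∈ arcParams a b
      · obtain ⟨s, hs, hts⟩ := sameParam_arcParams ht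
        rw [hts.apply_eq (deriv_periodic hδp), (hin s hs).2]
        exact himm s hs
      · rw [(hout t ht).2]
        exact D.immersed t
    · by_cases hs : s ∈ arcParams a b
      · exact absurd (hsame s t hs hst) hne
      · by_cases ht : t ∈ arcParams a b
        · exact absurd (hsame t s ht hst.symm).symm hne
        · rw [(hout s hs).1, (hout t ht).1] at hst
          rw [(hout s hs).2, (hout t ht).2]
          exact D.transverse s t hst hne
    · by_cases hs : s ∈ arcParams a b
      · exact Or.inl (hsame s t hs hst)
      · by_cases ht : t ∈ arcParams a b
        · exact Or.inr (Or.inl (hsame t u ht htu))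
        · by_cases hu : u ∈ arcParams a b
          · exact Or.inr (Or.inl (hsame u t hu htu.symm).symm)
          · rw [(hout s hs).1, (hout t ht).1] at hst
            rw [(hout t ht).1, (hout u hu).1] at htu
            exact D.no_triple s t u hst htu
  refine ⟨ofGeneric δ hδs hδp hgen R fun p hp => ?_, rfl, hmemN, fun t ht => (hout t ht).1,
    fun t ht => (hin t ht).1⟩
  obtain ⟨s, t, hs, ht, hst⟩ := D.real_crossing p (hR hp)
  refine ⟨s, t, ?_, ?_, hst⟩
  · rw [(hout s fun h => hRN s h (by rwa [hs])).1, hs]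
  · rw [(hout t fun h => hRN t h (by rwa [ht])).1, ht]

end VirtualDiagram

/-! ### Removing a kink -/

lemma mem_Ioo_div_iff {M σ r t : ℝ} (hM : 0 < M) :
    t ∈ Set.Ioo ((σ - r) / M) ((σ + r) / M) ↔ |M * t - σ| < r := by
  rw [Set.mem_Ioo, div_lt_iff₀ hM, lt_div_iff₀ hM, abs_lt]
  constructor <;> rintro ⟨h1, h2⟩ <;> constructor <;> linarith

/-- A smooth function that is `1` near `[-1, 1]` and has its support in `[-3 / 2, 3 / 2]`. -/
lemma exists_cutoff : ∃ ζ : ℝ → ℝ, ContDiff ℝ ∞ ζ ∧ (∀ T, 0 ≤ ζ T) ∧ (∀ T, ζ T ≤ 1) ∧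
    (∀ T, |T| ≤ 6 / 5 → ζ T = 1) ∧ ∀ T, ζ T ≠ 0 → |T| ≤ 3 / 2 := by
  let β : ContDiffBump (0 : ℝ) := ⟨6 / 5, 3 / 2, by norm_num, by norm_num⟩
  refine ⟨β, β.contDiff, fun _ => β.nonneg, fun _ => β.le_one, fun T hT => ?_, fun T hT => ?_⟩
  · exact β.one_of_mem_closedBall (by simpa using hT)
  · by_contra! h
    exact hT (β.zero_of_le_dist (by simpa using h.le))

namespace VirtualDiagram

/-- Replacement of an arc `A` in a disc by an arc `A'`, in a local parameter. -/
theorem exists_replace_local (D : VirtualDiagram) {N : Set Plane} {M σ r r' : ℝ} (hM : 0 < M)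
    (hrr : r' < r) (hr3 : r < 3) (hσ0 : 3 ≤ σ) (hσM : σ + 3 ≤ M) {A A' : ℝ → Plane}
    (hA : ContDiff ℝ ∞ A) (hA' : ContDiff ℝ ∞ A')
    (hDA : ∀ t, |M * t - σ| ≤ 3 → D.curve t = A (M * t - σ)) {B : Set ℝ}
    (hN : ∀ t, D.curve t ∈ N ↔ t ∈ B ∪ arcParams ((σ - r) / M) ((σ + r) / M))
    (hsupp : ∀ T, A' T ≠ A T → |T| ≤ r') (hAN : ∀ T, |T| < r → A' T ∈ N)
    (hAB : ∀ T, |T| < r → ∀ s ∈ B, s ∉ arcParams ((σ - r) / M) ((σ + r) / M) →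
      A' T ≠ D.curve s)
    (himm : ∀ T, |T| < r → deriv A' T ≠ 0)
    (hinj : ∀ S T, |S| < r → |T| < r → A' S = A' T → S = T)
    {R : Set Plane} (hR : R ⊆ D.real)
    (hRN : ∀ s, s ∈ arcParams ((σ - r) / M) ((σ + r) / M) → D.curve s ∉ R) :
    ∃ D' : VirtualDiagram, D'.real = R ∧
      (∀ t, D'.curve t ∈ N ↔ t ∈ B ∪ arcParams ((σ - r) / M) ((σ + r) / M)) ∧
      (∀ t, t ∉ arcParams ((σ - r) / M) ((σ + r) / M) → D'.curve t = D.curve t) ∧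
      (∀ t, |M * t - σ| < r → D'.curve t = A' (M * t - σ)) ∧
      Set.InjOn D'.curve (Set.Ioo ((σ - r) / M) ((σ + r) / M)) := by
  have hTd : ∀ t, HasDerivAt (fun t => M * t - σ) M t := fun t => by
    have h := ((hasDerivAt_id t).const_mul M).sub_const σ
    rw [mul_one] at h
    exact h
  have hmem : ∀ t, t ∈ Set.Ioo ((σ - r) / M) ((σ + r) / M) ↔ |M * t - σ| < r :=
    fun t => mem_Ioo_div_iff hM
  set g : ℝ → Plane := fun t => A' (M * t - σ) - A (M * t - σ) with hg
  have hgs : ContDiff ℝ ∞ g :=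
    (hA'.sub hA).comp ((contDiff_const.mul contDiff_id).sub contDiff_const)
  have hsum : ∀ t, |M * t - σ| < 3 → D.curve t + g t = A' (M * t - σ) := fun t ht => by
    rw [hDA t ht.le]; simp only [hg, add_sub_cancel]
  have hderiv : ∀ t, |M * t - σ| < 3 →
      deriv D.curve t + deriv g t = M • deriv A' (M * t - σ) := by
    intro t ht
    have h1 : (fun t => D.curve t + g t) =ᶠ[𝓝 t] A' ∘ fun t => M * t - σ := by
      have : Continuous fun t => |M * t - σ| := by fun_prop
      filter_upwards [this.continuousAt.eventually_lt continuousAt_const ht] with s hs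
      exact hsum s hs
    have h2 := ((hA'.differentiable (by simp) (M * t - σ)).hasDerivAt.scomp t (hTd t))
    rw [← h2.deriv, ← h1.deriv_eq]
    exact (deriv_add (D.differentiable t) (hgs.differentiable (by simp) t)).symm
  have hinj' : ∀ s ∈ Set.Ioo ((σ - r) / M) ((σ + r) / M),
      ∀ t ∈ Set.Ioo ((σ - r) / M) ((σ + r) / M), A' (M * s - σ) = A' (M * t - σ) → s = t :=
    fun s hs t ht hst => by
      have := hinj _ _ ((hmem s).1 hs) ((hmem t).1 ht) hst
      exact mul_left_cancel₀ hM.ne' (by linarith)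
  obtain ⟨D', h1, h2, h3, h4⟩ := D.exists_replace (N := N) (a := (σ - r) / M) (b := (σ + r) / M)
    (a' := (σ - r') / M) (b' := (σ + r') / M) (div_nonneg (by linarith) hM.le)
    ((div_lt_div_iff_of_pos_right hM).2 (by linarith))
    ((div_lt_div_iff_of_pos_right hM).2 (by linarith)) ((div_le_one hM).2 (by linarith)) hN
    (g := g) hgs
    (fun t ht => by
      have := abs_le.1 (hsupp (M * t - σ) fun h => ht (sub_eq_zero.2 h))
      rw [Set.mem_Icc, div_le_iff₀ hM, le_div_iff₀ hM]
      constructor <;> linarith)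
    (fun t ht => by
      rw [hmem] at ht
      rw [hsum t (ht.trans hr3)]
      exact hAN _ ht)
    (fun t ht s hs hs' => by
      rw [hmem] at ht
      rw [hsum t (ht.trans hr3)]
      exact hAB _ ht s hs hs')
    (fun t ht => by
      rw [hmem] at ht
      rw [hderiv t (ht.trans hr3)]
      exact smul_ne_zero hM.ne' (himm _ ht))
    (fun s hs t ht hst => by
      refine hinj' s hs t ht ?_
      rw [← hsum s (((hmem s).1 hs).trans hr3), ← hsum t (((hmem t).1 ht).trans hr3)]
      exact hst)
    hR hRN
  have h5 : ∀ t, |M * t - σ| < r → D'.curve t = A' (M * t - σ) := fun t ht => by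
    rw [h4 t ((hmem t).2 ht), hsum t (ht.trans hr3)]
  refine ⟨D', h1, h2, h3, h5, fun s hs t ht hst => hinj' s hs t ht ?_⟩
  rw [← h5 s ((hmem s).1 hs), ← h5 t ((hmem t).1 ht), hst]

end VirtualDiagram

/-- The kink. -/
noncomputable def kink (α T : ℝ) : Plane := (α * (T ^ 3 - T), T ^ 2)

lemma kink_contDiff (α : ℝ) : ContDiff ℝ ∞ (kink α) := by
  unfold kink; fun_prop

lemma deriv_kink (α T : ℝ) : deriv (kink α) T = (α * (3 * T ^ 2 - 1), 2 * T) := by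
  have h1 : HasDerivAt (fun T : ℝ => α * (T ^ 3 - T)) (α * (3 * T ^ 2 - 1)) T := by
    have := ((hasDerivAt_pow 3 T).sub (hasDerivAt_id T)).const_mul α
    simpa using this
  have h2 : HasDerivAt (fun T : ℝ => T ^ 2) (2 * T) T := by simpa using hasDerivAt_pow 2 T
  exact (h1.prodMk h2).deriv

lemma eq_or_of_kink_eq {α S T : ℝ} (hα : α ≠ 0) (h : kink α S = kink α T) :
    S = T ∨ T = -S ∧ S ^ 2 = 1 := by
  have h1 : S ^ 2 = T ^ 2 := congrArg Prod.snd h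
  have h2 : S ^ 3 - S = T ^ 3 - T := mul_left_cancel₀ hα (congrArg Prod.fst h)
  rcases sq_eq_sq_iff_eq_or_eq_neg.1 h1 with h3 | h3
  · exact Or.inl h3
  · have h4 : T * (T ^ 2 - 1) = 0 := by rw [h3] at h2; linarith
    rcases mul_eq_zero.1 h4 with h5 | h5
    · left; rw [h3, h5, neg_zero]
    · right; exact ⟨by linarith, by linarith⟩

/-- Scaling the plane to an ellipse. -/
noncomputable def ellipseEquiv : Plane ≃ Plane where
  toFun p := (10 * p.1, 5 * p.2)
  invFun p := (p.1 / 10, p.2 / 5)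
  left_inv p := by ext <;> simp
  right_inv p := by ext <;> simp <;> ring

lemma isPlaneDiffeo_ellipseEquiv : IsPlaneDiffeo ellipseEquiv := by
  constructor
  · change ContDiff ℝ ∞ fun p : Plane => ((10 * p.1, 5 * p.2) : Plane)
    fun_prop
  · change ContDiff ℝ ∞ fun p : Plane => ((p.1 / 10, p.2 / 5) : Plane)
    fun_prop

lemma mem_ellipse_iff {p : Plane} :
    p ∈ ellipseEquiv '' unitDisc ↔ (p.1 / 10) ^ 2 + (p.2 / 5) ^ 2 < 1 := by
  rw [Equiv.image_eq_preimage_symm]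
  rfl

/-- Existence of a diagram with a kink. -/
theorem exists_diagram_with_kink {n : ℕ} (w : GaussCode n) {i₀ i₁ : Fin (2 * n)} (h01 : (i₁ : ℕ) = i₀ + 1)
    (hl : (w.letter i₀).1 = (w.letter i₁).1) :
    ∃ (D : VirtualDiagram) (α : ℝ), D.HasGaussCode w ∧ α ^ 2 = 1 ∧
      (∀ t, |10 * (2 * n + 1) * t - 10 * ((i₀ : ℝ) + 1)| ≤ 3 →
        D.curve t = kink α (10 * (2 * n + 1) * t - 10 * ((i₀ : ℝ) + 1))) ∧
      (0, 1) ∈ D.real ∧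
      ∀ t ∈ Set.Icc (0 : ℝ) 1,
        3 < |10 * (2 * n + 1) * t - 10 * ((i₀ : ℝ) + 1)| → 8 < (D.curve t).2 := by
  have hne : i₀ ≠ i₁ := fun h => by rw [h] at h01; omega
  have hs : (w.letter i₁).2 = !(w.letter i₀).2 := Bool.eq_not.2 fun h =>
    hne (w.letter_injective (Prod.ext hl h.symm))
  -- The determinant of the tangents at `-1` and `1` is `8 * α`, so mirroring the kink realizes
  -- either side for the first passage.
  obtain ⟨α, hα0, hα1, hαL⟩ : ∃ α : ℝ, α ^ 2 = 1 ∧ |α| = 1 ∧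
      ((w.letter i₀).2 = Side.L ↔ α < 0) := by
    cases (w.letter i₀).2
    · exact ⟨-1, by norm_num, by norm_num, by norm_num⟩
    · exact ⟨1, by norm_num, by norm_num, by norm_num⟩
  have hα : α ≠ 0 := fun h => by rw [h] at hα0; norm_num at hα0
  have hreg : ∀ i : Fin (2 * n), ¬ (i ≠ i₀ ∧ i ≠ i₁) → i = i₀ ∨ i = i₁ := fun i hi => by tauto
  have hlab : ∀ i, ¬ (i ≠ i₀ ∧ i ≠ i₁) → (w.letter i).1 = (w.letter i₀).1 := fun i hi => by
    rcases hreg i hi with rfl | rfl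
    · rfl
    · exact hl.symm
  have hkink1 : kink α (-1) = (0, 1) ∧ kink α 1 = (0, 1) := by
    constructor <;> · unfold kink; norm_num
  obtain ⟨D, hD, hwin, hreal, hout⟩ := exists_diagram_of_special w (κ := Unit) (slot := fun _ => i₀)
    (fun _ _ _ => rfl) (reg := fun i => i ≠ i₀ ∧ i ≠ i₁) (fun _ h => h.1 rfl)
    (fun i j hij hi => by
      by_contra hj
      have h1 := hij.trans (hlab j hj)
      have h2 : w.letter i = w.letter i₀ ∨ w.letter i = w.letter i₁ := by
        by_cases h : (w.letter i).2 = (w.letter i₀).2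
        · exact Or.inl (Prod.ext h1 h)
        · exact Or.inr (Prod.ext (h1.trans hl) ((Bool.eq_not.2 h).trans hs.symm))
      exact h2.elim (fun h => hi.1 (w.letter_injective h)) fun h => hi.2 (w.letter_injective h))
    (A := fun _ => kink α) (fun _ => kink_contDiff α) (c₀ := 8) (c₁ := 9) (by norm_num)
    (by norm_num)
    (fun _ T h3 _ => by
      have : (9 : ℝ) ≤ |T| ^ 2 := by nlinarith
      rwa [sq_abs] at this)
    (fun _ T h3 => by
      have h1 : |α * (T ^ 3 - T)| ≤ 30 := by
        rw [abs_mul, hα1, one_mul]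
        have : |T| ^ 3 ≤ 3 ^ 3 := by gcongr
        calc |T ^ 3 - T| ≤ |T ^ 3| + |T| := abs_sub _ _
          _ ≤ 30 := by rw [abs_pow]; linarith
      have := (abs_le.1 h1).2
      change α * (T ^ 3 - T) < 50
      linarith)
    (fun _ T h => by
      rw [deriv_kink] at h
      have h1 : 2 * T = 0 := congrArg Prod.snd h
      have h2 : α * (3 * T ^ 2 - 1) = 0 := congrArg Prod.fst h
      have h3 : T = 0 := by linarith
      rw [h3] at h2
      exact hα (by linarith))
    (fun _ S _ T _ _ hST hne' => by
      rcases eq_or_of_kink_eq hα hST with h | ⟨rfl, h⟩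
      · exact absurd ⟨rfl, h⟩ hne'
      · rw [deriv_kink, deriv_kink]
        have h1 : planeDet (α * (3 * S ^ 2 - 1), 2 * S) (α * (3 * (-S) ^ 2 - 1), 2 * (-S)) =
            -8 * α * S := by
          simp only [planeDet, neg_sq, h]; ring
        rw [h1]
        have : S ≠ 0 := fun h0 => by rw [h0] at h; norm_num at h
        exact mul_ne_zero (mul_ne_zero (by norm_num) hα) this)
    (fun _ S _ T _ U _ _ _ hST hTU => by
      rcases eq_or_of_kink_eq hα hST with h | ⟨h, -⟩
      · exact Or.inl ⟨rfl, h⟩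
      · rcases eq_or_of_kink_eq hα hTU with h' | ⟨h', -⟩
        · exact Or.inr (Or.inl ⟨rfl, h'⟩)
        · exact Or.inr (Or.inr ⟨rfl, by rw [h', h, neg_neg]⟩))
    -- Both passages lie in the window of `i₀`: at `-1`, and at `10 - 9 = 1` for the next position.
    (off := fun i => if i = i₀ then -1 else if i = i₁ then -9 else 0)
    (fun i => by split_ifs <;> norm_num)
    (fun i hi => by simp [hi.1, hi.2])
    (win := fun _ _ => ()) (loc := fun i => if i = i₀ then -1 else 1)
    (fun i hi => by
      rcases hreg i hi with rfl | rfl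
      · simp
      · simp only [hne.symm, if_false, if_true, h01]
        push_cast
        ring)
    (fun i _ => by split_ifs <;> norm_num)
    (cs := fun _ => (0, 1))
    (fun i hi => by
      rcases hreg i hi with rfl | rfl
      · simpa using hkink1.1
      · simpa [hne.symm] using hkink1.2)
    (fun i j hi hj _ => (hlab i hi).trans (hlab j hj).symm)
    (fun _ T _ i _ hT => by
      have h1 : T ^ 2 = 1 := congrArg Prod.snd hT
      rcases sq_eq_one_iff.1 h1 with h2 | h2
      · exact ⟨i₁, by tauto, rfl, by simp [hne.symm, h2]⟩
      · exact ⟨i₀, by tauto, rfl, by simp [h2]⟩)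
    (fun i j hi hj hij _ => by
      have h1 : planeDet (deriv (kink α) (-1)) (deriv (kink α) 1) = 8 * α := by
        rw [deriv_kink, deriv_kink, planeDet]; ring
      have h2 : planeDet (deriv (kink α) 1) (deriv (kink α) (-1)) = -(8 * α) := by
        rw [planeDet_swap, h1]
      rcases hreg i hi with rfl | rfl <;> rcases hreg j hj with rfl | rfl
      · exact absurd rfl hij
      · simp only [if_true, hne.symm, if_false, h1, hαL]
        constructor <;> intro h <;> linarith
      · simp only [if_true, hne.symm, if_false, h2, hs]
        cases hx : (w.letter j).2
        · have := hαL.1 hx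
          simp; linarith
        · have : ¬ α < 0 := fun h => by rw [hαL.2 h] at hx; exact Bool.noConfusion hx
          have h3 : 0 < α := lt_of_le_of_ne (not_lt.1 this) hα.symm
          simp [h3]
      · exact absurd rfl hij)
  simp only [forall_const] at hwin hout
  exact ⟨D, α, hD, hα0, hwin, hreal i₀ (by tauto), hout⟩

/-- Straightening the kink. -/
lemma exists_unkink {α : ℝ} (hα0 : α ^ 2 = 1) : ∃ A : ℝ → Plane, ContDiff ℝ ∞ A ∧
    (∀ T, A T ≠ kink α T → |T| ≤ 3 / 2) ∧
    (∀ T, |T| ≤ 3 / 2 → (A T).1 ^ 2 ≤ 5 ^ 2 ∧ (A T).2 ^ 2 ≤ (9 / 4) ^ 2) ∧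
    (∀ T, deriv A T ≠ 0) ∧ ∀ S T, A S = A T → S = T := by
  have hα : α ≠ 0 := fun h => by rw [h] at hα0; norm_num at hα0
  obtain ⟨ζ, hζ, hζ0, hζ1, hζone, hζsupp⟩ := exists_cutoff
  -- The added term turns `T ^ 3 - T` into the increasing function `T ^ 3 + T` where the cutoff is
  -- 1, a region that contains the crossing parameters `± 1`.
  refine ⟨fun T => (α * (T ^ 3 - T + 2 * T * ζ T), T ^ 2), by fun_prop, fun T hT => ?_,
    fun T hT => ⟨?_, ?_⟩, fun T h0 => ?_, fun S T hST => ?_⟩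
  · refine hζsupp T fun h0 => hT ?_
    simp [h0, kink]
  · have h0 : |T| ^ 3 ≤ (3 / 2) ^ 3 := by gcongr
    have h1 : |T * (2 * ζ T - 1)| ≤ 3 / 2 * 1 := by
      rw [abs_mul]
      refine mul_le_mul hT ?_ (abs_nonneg _) (by norm_num)
      rw [abs_le]
      constructor <;> linarith [hζ0 T, hζ1 T]
    have h2 : |T ^ 3 - T + 2 * T * ζ T| ≤ 5 := by
      calc |T ^ 3 - T + 2 * T * ζ T| = |T ^ 3 + T * (2 * ζ T - 1)| := by ring_nf
        _ ≤ |T ^ 3| + |T * (2 * ζ T - 1)| := abs_add_le _ _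
        _ ≤ 5 := by rw [abs_pow]; linarith
    rw [mul_pow, hα0, one_mul]
    exact sq_le_sq.2 (by rwa [abs_of_pos (by norm_num : (0 : ℝ) < 5)])
  · have h0 : |T| ^ 2 ≤ (3 / 2) ^ 2 := by gcongr
    rw [sq_abs] at h0
    exact pow_le_pow_left₀ (sq_nonneg T) (by linarith) 2
  · have e1 : HasDerivAt (fun T : ℝ => T ^ 3 - T) (3 * T ^ 2 - 1) T := by
      have := (hasDerivAt_pow 3 T).sub (hasDerivAt_id T)
      norm_num at this
      exact this
    have e2 : HasDerivAt (fun T => 2 * T * ζ T) (2 * ζ T + 2 * T * deriv ζ T) T := by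
      have := ((hasDerivAt_id T).const_mul 2).mul (hζ.differentiable (by simp) T).hasDerivAt
      rw [mul_one] at this
      exact this
    have e3 : HasDerivAt (fun T : ℝ => T ^ 2) (2 * T) T := by simpa using hasDerivAt_pow 2 T
    have hd := ((e1.add e2).const_mul α).prodMk e3
    have h0 := hd.deriv.symm.trans h0
    have e4 : T = 0 := by
      have : 2 * T = 0 := congrArg Prod.snd h0
      linarith
    have e5 : α * (3 * T ^ 2 - 1 + (2 * ζ T + 2 * T * deriv ζ T)) = 0 := congrArg Prod.fst h0
    rw [e4, hζone 0 (by norm_num)] at e5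
    exact hα (by linarith)
  · have e1 : S ^ 2 = T ^ 2 := congrArg Prod.snd hST
    have e2 := mul_left_cancel₀ hα (congrArg Prod.fst hST :
      α * (S ^ 3 - S + 2 * S * ζ S) = α * (T ^ 3 - T + 2 * T * ζ T))
    rcases sq_eq_sq_iff_eq_or_eq_neg.1 e1 with e3 | e3
    · exact e3
    -- For `|T| ≤ 6 / 5` the second factor is `T ^ 2 + 1`; beyond that it is positive because `T ^ 2
    -- > 1` and `ζ ≥ 0`.
    · have e4 : T * (T ^ 2 - 1 + (ζ S + ζ T)) = 0 := by
        have e0 : S * (S ^ 2 - 1 + 2 * ζ S) = T * (T ^ 2 - 1 + 2 * ζ T) := by linarith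
        rw [e1] at e0
        have e6 : S = -T := e3
        generalize ζ S = z at e0 ⊢
        rw [e6] at e0
        linarith
      rcases mul_eq_zero.1 e4 with e5 | e5
      · rw [e3, e5, neg_zero]
      · exfalso
        by_cases e6 : |T| ≤ 6 / 5
        · rw [hζone T e6, hζone S (by rwa [e3, abs_neg])] at e5
          linarith [sq_nonneg T]
        · have e7 : (6 / 5 : ℝ) ^ 2 < |T| ^ 2 := by
            have := not_le.1 e6
            gcongr
          rw [sq_abs] at e7
          linarith [hζ0 S, hζ0 T]

/-- The semi-axes 10 and 5 are chosen so that the kink leaves the ellipse exactly at `T = ± 2`,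
through `(± 6, 4)`: with `u = T ^ 2` the defining polynomial has the factor `u - 4` and a positive
cofactor. -/
lemma kink_mem_ellipse_iff {α : ℝ} (hα0 : α ^ 2 = 1) (T : ℝ) :
    kink α T ∈ ellipseEquiv '' unitDisc ↔ |T| < 2 := by
  have h5 : |T| < 2 ↔ T ^ 2 < 4 := by
    rw [← sq_abs]
    constructor <;> intro h <;> nlinarith [abs_nonneg T]
  have h4 : (kink α T).1 ^ 2 = (T ^ 2) * (T ^ 2 - 1) ^ 2 := by
    simp only [kink, mul_pow, hα0]; ring
  have h6 : (kink α T).2 = T ^ 2 := rfl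
  rw [mem_ellipse_iff, h5, div_pow, div_pow, h4, h6]
  have hu : 0 ≤ T ^ 2 := sq_nonneg T
  generalize T ^ 2 = u at hu
  have h7 : u * (u - 1) ^ 2 / 10 ^ 2 + u ^ 2 / 5 ^ 2 - 1 = (u - 4) * (u ^ 2 + 6 * u + 25) / 100 := by
    ring
  have h8 : 0 < u ^ 2 + 6 * u + 25 := by positivity
  rw [← sub_neg, h7, ← sub_neg (a := u)]
  constructor
  · intro h
    by_contra! hc
    have := mul_nonneg hc h8.le
    linarith
  · intro h
    have := mul_neg_of_neg_of_pos h h8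
    linarith

/-- The rest of the diagram runs above height 8 and hence misses the ellipse, whose height is below
5. So the kink can be exchanged for the embedded arc of `exists_unkink` inside the ellipse. -/
theorem exists_R1Move {n : ℕ} (w : GaussCode n) {i₀ i₁ : Fin (2 * n)} (h01 : (i₁ : ℕ) = i₀ + 1)
    (hl : (w.letter i₀).1 = (w.letter i₁).1) :
    ∃ D D' : VirtualDiagram, D.HasGaussCode w ∧ VirtualDiagram.R1Move D D' := by
  obtain ⟨D, α, hD, hα0, hwin, hreal, hout⟩ := exists_diagram_with_kink w h01 hl
  have hα : α ≠ 0 := fun h => by rw [h] at hα0; norm_num at hα0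
  set M : ℝ := 10 * (2 * n + 1) with hMdef
  set σ : ℝ := 10 * ((i₀ : ℝ) + 1) with hσdef
  have hi₀ : (0 : ℝ) ≤ (i₀ : ℕ) := Nat.cast_nonneg _
  have hi₀' : ((i₀ : ℕ) : ℝ) + 1 ≤ 2 * n := by exact_mod_cast i₀.2
  have hM : 0 < M := by positivity
  have hσ : 10 ≤ σ := by rw [hσdef]; linarith
  have hσM : σ + 10 ≤ M := by rw [hσdef, hMdef]; linarith
  have hN : ∀ t, D.curve t ∈ ellipseEquiv '' unitDisc ↔
      t ∈ (∅ : Set ℝ) ∪ arcParams ((σ - 2) / M) ((σ + 2) / M) := by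
    intro t
    obtain ⟨s, hs, hts⟩ := exists_sameParam_mem_Ico t
    rw [Set.empty_union, D.curve_eq_of_sameParam hts, hts.mem_arcParams,
      mem_arcParams_iff (div_nonneg (by linarith) hM.le) ((div_le_one hM).2 (by linarith)) hs,
      mem_Ioo_div_iff hM]
    by_cases h3 : |M * s - σ| ≤ 3
    · rw [hwin s h3, kink_mem_ellipse_iff hα0]
    · have h4 := hout s ⟨hs.1, hs.2.le⟩ (not_le.1 h3)
      rw [mem_ellipse_iff]
      constructor
      · intro h
        nlinarith [sq_nonneg ((D.curve s).1 / 10)]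
      · intro h
        linarith
  have hs1 : M * ((σ - 1) / M) - σ = -1 := by field_simp; ring
  have ht1 : M * ((σ + 1) / M) - σ = 1 := by field_simp; ring
  have hDs : D.curve ((σ - 1) / M) = (0, 1) := by
    rw [hwin _ (by rw [hs1]; norm_num), hs1]
    norm_num [kink]
  have hDt : D.curve ((σ + 1) / M) = (0, 1) := by
    rw [hwin _ (by rw [ht1]; norm_num), ht1]
    simp [kink]
  have hself : ∀ x ∈ Set.Ioo ((σ - 2) / M) ((σ + 2) / M), ∀ y ∈ Set.Ioo ((σ - 2) / M) ((σ + 2) / M),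
      x < y → D.curve x = D.curve y → x = (σ - 1) / M ∧ y = (σ + 1) / M := by
    intro x hx y hy hxy he
    rw [mem_Ioo_div_iff hM] at hx hy
    rw [hwin x (by linarith), hwin y (by linarith)] at he
    have hlt : M * x < M * y := mul_lt_mul_of_pos_left hxy hM
    rcases eq_or_of_kink_eq hα he with h | ⟨h, h'⟩
    · linarith
    · rw [eq_div_iff hM.ne', eq_div_iff hM.ne']
      rcases sq_eq_one_iff.1 h' with h2 | h2
      · linarith
      · constructor <;> linarith
  obtain ⟨A, hA, hA1, hA2, hA3, hA4⟩ := exists_unkink hα0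
  obtain ⟨D', h1, h2, h3, h4, h5⟩ := D.exists_replace_local (N := ellipseEquiv '' unitDisc)
    (r := 2) (r' := 3 / 2) hM (by norm_num) (by norm_num) (by linarith) (by linarith)
    (kink_contDiff α) hA hwin hN hA1
    (fun T hT => by
      by_cases h0 : |T| ≤ 3 / 2
      · rw [mem_ellipse_iff, div_pow, div_pow]
        obtain ⟨h5, h6⟩ := hA2 T h0
        linarith
      · rw [show A T = kink α T by by_contra h; exact h0 (hA1 T h), kink_mem_ellipse_iff hα0]
        exact hT)
    (fun _ _ _ h => absurd h (Set.notMem_empty _)) (fun T _ => hA3 T) (fun S T _ _ => hA4 S T)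
    (R := D.real \ {D.curve ((σ - 1) / M)}) Set.sdiff_subset
    (fun s hs hsR => by
      obtain ⟨y, hy, hsy⟩ := VirtualDiagram.exists_of_mem_real hsR.1
      have hy' : y ∈ arcParams ((σ - 2) / M) ((σ + 2) / M) := by
        have := (hN y).1 (by rw [hy]; exact (hN s).2 (Or.inr hs))
        rwa [Set.empty_union] at this
      obtain ⟨x, hx, hsx⟩ := VirtualDiagram.sameParam_arcParams hs
      obtain ⟨z, hz, hyz⟩ := VirtualDiagram.sameParam_arcParams hy'
      rw [D.curve_eq_of_sameParam hsx, D.curve_eq_of_sameParam hyz] at hy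
      refine hsR.2 ?_
      rw [D.curve_eq_of_sameParam hsx, Set.mem_singleton_iff]
      rcases lt_trichotomy x z with hlt | rfl | hlt
      · rw [(hself x hx z hz hlt hy.symm).1]
      · exact absurd (hsx.trans hyz.symm) hsy
      · rw [← hy, (hself z hz x hx hlt hy).1])
  simp only [Set.empty_union] at hN h2
  refine ⟨D, D', hD, ellipseEquiv, (σ - 2) / M, (σ + 2) / M, (σ - 1) / M, (σ + 1) / M,
    isPlaneDiffeo_ellipseEquiv, ?_, ?_, ?_, ?_, hN, h2, h3, by rw [hDs, hDt], by rwa [hDs], hself,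
    h5, h1⟩
  · rw [div_lt_div_iff_of_pos_right hM]; linarith
  · rw [div_lt_div_iff_of_pos_right hM]; linarith
  · rw [div_lt_div_iff_of_pos_right hM]; linarith
  · rw [div_add_one hM.ne', div_lt_div_iff_of_pos_right hM]; linarith

/-! ### Removing a bigon -/

/-- The two arcs of a bigon with crossings `(± 1, 6)`. -/
noncomputable def bigonArc (α β : ℝ) (k : Bool) (T : ℝ) : Plane :=
  if k then (β * T, 1 + 5 * T ^ 2) else (α * T, 6 * T ^ 2)

section bigonArc

variable {α β : ℝ}

lemma bigonArc_contDiff (k : Bool) : ContDiff ℝ ∞ (bigonArc α β k) := by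
  unfold bigonArc
  cases k <;> simp only [if_true, if_false, Bool.false_eq_true] <;> fun_prop

lemma deriv_bigonArc (k : Bool) (T : ℝ) :
    deriv (bigonArc α β k) T = if k then (β, 10 * T) else (α, 12 * T) := by
  have h1 : ∀ c : ℝ, HasDerivAt (fun T : ℝ => c * T) c T := fun c => by
    simpa using (hasDerivAt_id T).const_mul c
  have h2 : ∀ c : ℝ, HasDerivAt (fun T : ℝ => c * T ^ 2) (2 * c * T) T := fun c => by
    have := (hasDerivAt_pow 2 T).const_mul c
    refine this.congr_deriv ?_
    norm_num
    ring
  unfold bigonArc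
  cases k
  · simp only [if_false, Bool.false_eq_true]
    have := ((h1 α).prodMk (h2 6)).deriv
    rw [this]
    norm_num
  · simp only [if_true]
    have := ((h1 β).prodMk ((h2 5).const_add 1)).deriv
    rw [this]
    norm_num

lemma bigonArc_injective (hα : α ≠ 0) (hβ : β ≠ 0) (k : Bool) :
    Function.Injective (bigonArc α β k) := by
  intro S T h
  have h1 := congrArg Prod.fst h
  cases k
  · exact mul_left_cancel₀ hα (by simpa [bigonArc] using h1)
  · exact mul_left_cancel₀ hβ (by simpa [bigonArc] using h1)

lemma bigonArc_eq (hα : α ^ 2 = 1) (hβ : β ^ 2 = 1) {S T : ℝ}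
    (h : bigonArc α β false S = bigonArc α β true T) : S ^ 2 = 1 ∧ T ^ 2 = 1 ∧ α * S = β * T := by
  have h1 : α * S = β * T := by simpa [bigonArc] using congrArg Prod.fst h
  have h2 : 6 * S ^ 2 = 1 + 5 * T ^ 2 := by simpa [bigonArc] using congrArg Prod.snd h
  have h3 : S ^ 2 = T ^ 2 := by
    have := congrArg (· ^ 2) h1
    simpa [mul_pow, hα, hβ] using this
  exact ⟨by linarith, by linarith, h1⟩

/-- A disc in which the first arc of the bigon is a diameter. -/
noncomputable def bigonEquiv : Plane ≃ Plane where
  toFun p := (5 / 2 * p.1, 5 * p.2 + 6 * (5 / 2 * p.1) ^ 2)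
  invFun p := (2 / 5 * p.1, (p.2 - 6 * p.1 ^ 2) / 5)
  left_inv p := by
    ext
    · simp; ring
    · simp
  right_inv p := by ext <;> simp <;> ring

lemma isPlaneDiffeo_bigonEquiv : IsPlaneDiffeo bigonEquiv := by
  constructor
  · change ContDiff ℝ ∞ fun p : Plane => ((5 / 2 * p.1, 5 * p.2 + 6 * (5 / 2 * p.1) ^ 2) : Plane)
    fun_prop
  · change ContDiff ℝ ∞ fun p : Plane => ((2 / 5 * p.1, (p.2 - 6 * p.1 ^ 2) / 5) : Plane)
    fun_prop

lemma mem_bigonDisc_iff {p : Plane} : p ∈ bigonEquiv '' unitDisc ↔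
    4 * p.1 ^ 2 + (p.2 - 6 * p.1 ^ 2) ^ 2 < 25 := by
  rw [Equiv.image_eq_preimage_symm]
  change (2 / 5 * p.1) ^ 2 + ((p.2 - 6 * p.1 ^ 2) / 5) ^ 2 < 1 ↔ _
  rw [show (2 / 5 * p.1) ^ 2 + ((p.2 - 6 * p.1 ^ 2) / 5) ^ 2 =
    (4 * p.1 ^ 2 + (p.2 - 6 * p.1 ^ 2) ^ 2) / 25 by ring, div_lt_one (by norm_num)]

/-- In the disc `p.1 ^ 2 < 25 / 4` and `p.2 < 6 * p.1 ^ 2 + 5`, so `p.2 < 42.5`. -/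
lemma notMem_bigonDisc {p : Plane} (hp : 43 ≤ p.2) : p ∉ bigonEquiv '' unitDisc := by
  rw [mem_bigonDisc_iff]
  intro h
  have h1 : p.1 ^ 2 < 25 / 4 := by nlinarith [sq_nonneg (p.2 - 6 * p.1 ^ 2)]
  nlinarith [sq_nonneg p.1]

lemma bigonArc_false_mem_iff (hα : α ^ 2 = 1) (T : ℝ) :
    bigonArc α β false T ∈ bigonEquiv '' unitDisc ↔ |T| < 5 / 2 := by
  rw [mem_bigonDisc_iff, ← abs_of_pos (by norm_num : (0 : ℝ) < 5 / 2), ← sq_lt_sq]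
  simp only [bigonArc, if_false, Bool.false_eq_true, mul_pow, hα]
  norm_num
  constructor <;> intro h <;> linarith

/-- With `u = T ^ 2` the condition becomes `(u - 4) * (u + 6) < 0`, so the second arc meets the disc
in a single interval. -/
lemma bigonArc_true_mem_iff (hβ : β ^ 2 = 1) (T : ℝ) :
    bigonArc α β true T ∈ bigonEquiv '' unitDisc ↔ |T| < 2 := by
  rw [mem_bigonDisc_iff, ← abs_of_pos (by norm_num : (0 : ℝ) < 2), ← sq_lt_sq]
  simp only [bigonArc, if_true, mul_pow, hβ, one_mul]
  have h0 : 0 ≤ T ^ 2 := sq_nonneg T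
  generalize T ^ 2 = u at h0
  rw [← sub_neg, ← sub_neg (a := u),
    show 4 * u + (1 + 5 * u - 6 * u) ^ 2 - 25 = (u - 2 ^ 2) * (u + 6) by ring]
  constructor
  · intro h
    by_contra! hc
    have := mul_nonneg hc (by linarith : 0 ≤ u + 6)
    linarith
  · intro h
    exact mul_neg_of_neg_of_pos h (by linarith)

lemma bigonDiameter (hα : α ^ 2 = 1) {p : Plane} : p ∈ bigonEquiv '' unitDiameter ↔
    ∃ T, |T| < 5 / 2 ∧ bigonArc α β false T = p := by
  have key : p ∈ bigonEquiv '' unitDiameter ↔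
      p ∈ bigonEquiv '' unitDisc ∧ (p.2 - 6 * p.1 ^ 2) / 5 = 0 := by
    rw [Equiv.image_eq_preimage_symm, Equiv.image_eq_preimage_symm]
    rfl
  rw [key]
  constructor
  · rintro ⟨h1, h2⟩
    have h3 : bigonArc α β false (α * p.1) = p := by
      simp only [bigonArc, if_false, Bool.false_eq_true, mul_pow, hα, ← mul_assoc, ← pow_two]
      exact Prod.ext (by simp) (by simp; linarith)
    refine ⟨α * p.1, ?_, h3⟩
    rw [← bigonArc_false_mem_iff (β := β) hα, h3]
    exact h1
  · rintro ⟨T, hT, rfl⟩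
    refine ⟨(bigonArc_false_mem_iff hα T).2 hT, ?_⟩
    simp only [bigonArc, if_false, Bool.false_eq_true, mul_pow, hα]
    ring

/-- Moving the second arc off the first. -/
lemma exists_unbigon (hβ : β ^ 2 = 1) : ∃ A : ℝ → Plane, ContDiff ℝ ∞ A ∧
    (∀ T, A T ≠ bigonArc α β true T → |T| ≤ 3 / 2) ∧
    (∀ T, |T| < 2 → A T ∈ bigonEquiv '' unitDisc) ∧
    (∀ T, (A T).2 ≠ 6 * (A T).1 ^ 2) ∧
    (∀ T, deriv A T ≠ 0) ∧ ∀ S T, A S = A T → S = T := by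
  have hβ' : β ≠ 0 := fun h => by rw [h] at hβ; norm_num at hβ
  obtain ⟨ζ, hζ, hζ0, hζ1, hζone, hζsupp⟩ := exists_cutoff
  have hsupp : ∀ T, ((β * T, 1 + 5 * T ^ 2 + ζ T * (T ^ 2 - 2)) : Plane) ≠ bigonArc α β true T →
      |T| ≤ 3 / 2 := fun T hT => hζsupp T fun h0 => hT (by simp [bigonArc, h0])
  -- Where the cutoff is 1 the height is `6 * T ^ 2 - 1`, strictly below the first arc.
  refine ⟨fun T => (β * T, 1 + 5 * T ^ 2 + ζ T * (T ^ 2 - 2)), by fun_prop, hsupp,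
    fun T hT => ?_, fun T h => ?_, fun T h0 => ?_, fun S T hST => ?_⟩
  · by_cases h0 : |T| ≤ 3 / 2
    · rw [mem_bigonDisc_iff]
      simp only [mul_pow, hβ, one_mul]
      have h1 : |T| ^ 2 ≤ (3 / 2) ^ 2 := by gcongr
      rw [sq_abs] at h1
      have h2 := sq_nonneg T
      have h3 : |1 - T ^ 2 + ζ T * (T ^ 2 - 2)| ≤ 2 := by
        rw [abs_le]
        constructor <;> nlinarith [hζ0 T, hζ1 T, mul_nonneg (hζ0 T) h2,
          mul_nonneg (sub_nonneg.2 (hζ1 T)) h2]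
      have h4 : (1 - T ^ 2 + ζ T * (T ^ 2 - 2)) ^ 2 ≤ 2 ^ 2 :=
        sq_le_sq.2 (by rwa [abs_of_pos (by norm_num : (0 : ℝ) < 2)])
      have h5 : 1 + 5 * T ^ 2 + ζ T * (T ^ 2 - 2) - 6 * T ^ 2 = 1 - T ^ 2 + ζ T * (T ^ 2 - 2) := by
        ring
      rw [h5]
      linarith
    · have h1 := (bigonArc_true_mem_iff (α := α) hβ T).2 hT
      have h2 : _ = bigonArc α β true T := not_not.1 fun h => h0 (hsupp T h)
      rw [← h2] at h1
      exact h1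
  · simp only [mul_pow, hβ, one_mul] at h
    by_cases h0 : |T| ≤ 6 / 5
    · rw [hζone T h0] at h
      linarith
    · have h1 : (6 / 5 : ℝ) ^ 2 < |T| ^ 2 := by
        have := not_le.1 h0
        gcongr
      rw [sq_abs] at h1
      -- The height relative to the parabola is `(1 - ζ T) * (1 - T ^ 2) - ζ T`, which is negative
      -- for `T ^ 2 > 1`.
      nlinarith [hζ0 T, hζ1 T, mul_nonneg (sub_nonneg.2 (hζ1 T)) (by linarith : 0 ≤ T ^ 2 - 1)]
  · have h1 : HasDerivAt (fun T : ℝ => β * T) β T := by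
      simpa using (hasDerivAt_id T).const_mul β
    have h2 : DifferentiableAt ℝ (fun T => 1 + 5 * T ^ 2 + ζ T * (T ^ 2 - 2)) T := by
      have := hζ.differentiable (by simp) T
      fun_prop
    have h0 := (h1.prodMk h2.hasDerivAt).deriv.symm.trans h0
    exact hβ' (congrArg Prod.fst h0)
  · exact mul_left_cancel₀ hβ' (congrArg Prod.fst hST)

end bigonArc

/-- Existence of a diagram with a bigon. -/
theorem exists_diagram_with_bigon {n : ℕ} (w : GaussCode n) {i₀ i₁ p₀ p₁ : Fin (2 * n)}
    (hi : (i₁ : ℕ) = i₀ + 1) (hip : (i₁ : ℕ) < p₀) (hp : (p₁ : ℕ) = p₀ + 1) {α β : ℝ}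
    (hα : α ^ 2 = 1) (hβ : β ^ 2 = 1) (hne : (w.letter i₀).1 ≠ (w.letter i₁).1)
    (hlab : α = β ∧ (w.letter p₀).1 = (w.letter i₀).1 ∧ (w.letter p₁).1 = (w.letter i₁).1 ∨
      α = -β ∧ (w.letter p₀).1 = (w.letter i₁).1 ∧ (w.letter p₁).1 = (w.letter i₀).1)
    (hs₀ : (w.letter i₀).2 = Side.L ↔ β < 0) (hs₁ : (w.letter i₁).2 = Side.L ↔ 0 < β)
    (ht₀ : (w.letter p₀).2 = Side.L ↔ 0 < α) (ht₁ : (w.letter p₁).2 = Side.L ↔ α < 0) :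
    ∃ D : VirtualDiagram, D.HasGaussCode w ∧
      (∀ (k : Bool) t, |10 * (2 * n + 1) * t - 10 * (((if k then p₀ else i₀ : Fin (2 * n)) : ℝ) + 1)|
        ≤ 3 → D.curve t = bigonArc α β k
          (10 * (2 * n + 1) * t - 10 * (((if k then p₀ else i₀ : Fin (2 * n)) : ℝ) + 1))) ∧
      (∀ x : ℝ, x ^ 2 = 1 → (x, 6) ∈ D.real) ∧
      ∀ t ∈ Set.Icc (0 : ℝ) 1,
        (∀ k : Bool, 3 < |10 * (2 * n + 1) * t -
          10 * (((if k then p₀ else i₀ : Fin (2 * n)) : ℝ) + 1)|) → 43 < (D.curve t).2 := by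
  have hα' : α ≠ 0 := fun h => by rw [h] at hα; norm_num at hα
  have hβ' : β ≠ 0 := fun h => by rw [h] at hβ; norm_num at hβ
  have e01 : i₀ ≠ i₁ := fun h => by rw [h] at hi; omega
  have e02 : i₀ ≠ p₀ := fun h => by rw [← h] at hip; omega
  have e03 : i₀ ≠ p₁ := fun h => by rw [← h] at hp; omega
  have e12 : i₁ ≠ p₀ := fun h => by rw [h] at hip; omega
  have e13 : i₁ ≠ p₁ := fun h => by rw [← h] at hp; omega
  have e23 : p₀ ≠ p₁ := fun h => by rw [h] at hp; omega
  have hreg : ∀ i : Fin (2 * n), ¬ (i ≠ i₀ ∧ i ≠ i₁ ∧ i ≠ p₀ ∧ i ≠ p₁) →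
      i = i₀ ∨ i = i₁ ∨ i = p₀ ∨ i = p₁ := fun i hi => by
    by_contra! hc
    exact hi hc
  let wn : Fin (2 * n) → Bool := fun i => if i = i₀ ∨ i = i₁ then false else true
  let loc : Fin (2 * n) → ℝ := fun i => if i = i₀ ∨ i = p₀ then -1 else 1
  have w0 : wn i₀ = false := if_pos (Or.inl rfl)
  have w1 : wn i₁ = false := if_pos (Or.inr rfl)
  have w2 : wn p₀ = true := if_neg (not_or.2 ⟨e02.symm, e12.symm⟩)
  have w3 : wn p₁ = true := if_neg (not_or.2 ⟨e03.symm, e13.symm⟩)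
  have l0 : loc i₀ = -1 := if_pos (Or.inl rfl)
  have l1 : loc i₁ = 1 := if_neg (not_or.2 ⟨e01.symm, e12⟩)
  have l2 : loc p₀ = -1 := if_pos (Or.inr rfl)
  have l3 : loc p₁ = 1 := if_neg (not_or.2 ⟨e03.symm, e23.symm⟩)
  -- The first arc meets the crossing of `i₀` at `-1` and that of `i₁` at `1`. The second arc meets
  -- them in the same order if `α = β` and in the opposite order if `α = -β`.
  let cs : Fin n → Plane := fun j => if j = (w.letter i₀).1 then (-α, 6) else (α, 6)
  have c0 : cs (w.letter i₀).1 = (-α, 6) := if_pos rfl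
  have c1 : cs (w.letter i₁).1 = (α, 6) := if_neg hne.symm
  have a0 : bigonArc α β false (-1) = (-α, 6) := by norm_num [bigonArc]
  have a1 : bigonArc α β false 1 = (α, 6) := by norm_num [bigonArc]
  have b0 : bigonArc α β true (-1) = (-β, 6) := by norm_num [bigonArc]
  have b1 : bigonArc α β true 1 = (β, 6) := by norm_num [bigonArc]
  have hcs : ∀ i, ¬ (i ≠ i₀ ∧ i ≠ i₁ ∧ i ≠ p₀ ∧ i ≠ p₁) →
      bigonArc α β (wn i) (loc i) = cs (w.letter i).1 := by
    intro i hi'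
    rcases hreg i hi' with rfl | rfl | rfl | rfl
    · rw [w0, l0, a0, c0]
    · rw [w1, l1, a1, c1]
    · rw [w2, l2, b0]
      rcases hlab with ⟨h1, h2, h3⟩ | ⟨h1, h2, h3⟩
      · rw [h2, c0, h1]
      · rw [h2, c1, h1]
    · rw [w3, l3, b1]
      rcases hlab with ⟨h1, h2, h3⟩ | ⟨h1, h2, h3⟩
      · rw [h3, c1, h1]
      · rw [h3, c0, h1, neg_neg]
  have hlab' : ∀ i, ¬ (i ≠ i₀ ∧ i ≠ i₁ ∧ i ≠ p₀ ∧ i ≠ p₁) →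
      (w.letter i).1 = (w.letter i₀).1 ∨ (w.letter i).1 = (w.letter i₁).1 := by
    intro i hi'
    rcases hreg i hi' with rfl | rfl | rfl | rfl
    · exact Or.inl rfl
    · exact Or.inr rfl
    · exact hlab.imp (fun h => h.2.1) fun h => h.2.1
    · exact hlab.symm.imp (fun h => h.2.2) fun h => h.2.2
  have hloc1 : ∀ i, loc i ^ 2 = 1 := fun i => by
    simp only [loc]; split_ifs <;> norm_num
  -- At a crossing `T = α * β * S`, and the determinant becomes `-2 * β * S`. Its signs at `S = ± 1`
  -- are the conditions on the sides of `i₀` and `i₁`; exchanging the arcs gives those for `p₀` and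
  -- `p₁`.
  have hdet : ∀ S T : ℝ, planeDet (deriv (bigonArc α β false) S) (deriv (bigonArc α β true) T) =
      α * (10 * T) - 12 * S * β := fun S T => by
    rw [deriv_bigonArc, deriv_bigonArc]
    simp [planeDet]
  have hdet' : ∀ S T : ℝ, planeDet (deriv (bigonArc α β true) S) (deriv (bigonArc α β false) T) =
      -(α * (10 * S) - 12 * T * β) := fun S T => by
    rw [planeDet_swap, hdet]
  have hside : ∀ i j, ¬ (i ≠ i₀ ∧ i ≠ i₁ ∧ i ≠ p₀ ∧ i ≠ p₁) →
      ¬ (j ≠ i₀ ∧ j ≠ i₁ ∧ j ≠ p₀ ∧ j ≠ p₁) → i ≠ j → (w.letter i).1 = (w.letter j).1 →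
      ((w.letter i).2 = Side.L ↔ planeDet (deriv (bigonArc α β (wn i)) (loc i))
        (deriv (bigonArc α β (wn j)) (loc j)) < 0) := by
    intro i j hi' hj' hij he
    rcases hreg i hi' with h | h | h | h <;> rcases hreg j hj' with h' | h' | h' | h' <;>
      rw [h, h'] at he hij ⊢ <;> rcases hlab with ⟨k1, k2, k3⟩ | ⟨k1, k2, k3⟩ <;>
      first
      | exact absurd rfl hij
      | exact absurd (by rw [k2, k3] at he; exact he) hne
      | exact absurd (by rw [k2, k3] at he; exact he.symm) hne
      | exact absurd (by rw [k2] at he; exact he) hne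
      | exact absurd (by rw [k2] at he; exact he.symm) hne
      | exact absurd (by rw [k3] at he; exact he) hne
      | exact absurd (by rw [k3] at he; exact he.symm) hne
      | exact absurd he hne
      | exact absurd he.symm hne
      | (simp only [w0, w1, w2, w3, l0, l1, l2, l3, hdet, hdet', hs₀, hs₁, ht₀, ht₁]
         constructor <;> intro _ <;> linarith [k1])
  obtain ⟨D, hD, hwin, hreal, hout⟩ := exists_diagram_of_special w (κ := Bool)
    (slot := fun k => if k then p₀ else i₀)
    (by
      intro k l h
      cases k <;> cases l
      · rfl
      · exact absurd h e02
      · exact absurd h.symm e02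
      · rfl)
    (reg := fun i => i ≠ i₀ ∧ i ≠ i₁ ∧ i ≠ p₀ ∧ i ≠ p₁)
    (by
      intro k hk
      cases k
      · exact hk.1 rfl
      · exact hk.2.2.1 rfl)
    (fun i j hij hi' => by
      by_contra hj
      have hpos : ∀ q q', q ≠ q' → (w.letter q).1 = (w.letter q').1 → (w.letter i).1 = (w.letter q).1 →
          i = q ∨ i = q' := by
        intro q q' hqq h1 h2
        by_cases h3 : (w.letter i).2 = (w.letter q).2
        · exact Or.inl (w.letter_injective (Prod.ext h2 h3))
        · refine Or.inr (w.letter_injective (Prod.ext (h2.trans h1) ?_))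
          have h4 : (w.letter q').2 ≠ (w.letter q).2 := fun h5 =>
            hqq (w.letter_injective (Prod.ext h1 h5.symm))
          rw [Bool.eq_not.2 h3, Bool.eq_not.2 h4]
      rcases hlab with ⟨-, h1, h2⟩ | ⟨-, h1, h2⟩ <;> rcases hlab' j hj with h3 | h3
      · exact (hpos i₀ p₀ e02 h1.symm (hij.trans h3)).elim hi'.1 hi'.2.2.1
      · exact (hpos i₁ p₁ e13 h2.symm (hij.trans h3)).elim hi'.2.1 hi'.2.2.2
      · exact (hpos i₀ p₁ e03 h2.symm (hij.trans h3)).elim hi'.1 hi'.2.2.2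
      · exact (hpos i₁ p₀ e12 h1.symm (hij.trans h3)).elim hi'.2.1 hi'.2.2.1)
    (A := bigonArc α β) (fun k => bigonArc_contDiff k) (c₀ := 43) (c₁ := 46) (by norm_num)
    (by norm_num)
    (fun k T h3 _ => by
      have : (9 : ℝ) ≤ |T| ^ 2 := by nlinarith
      rw [sq_abs] at this
      cases k <;> simp [bigonArc] <;> linarith)
    (fun k T h3 => by
      have habs : ∀ c : ℝ, c ^ 2 = 1 → c * T < 50 := fun c hc => by
        have h1 : (c * T) ^ 2 ≤ 3 ^ 2 := by
          rw [mul_pow, hc, one_mul]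
          exact sq_le_sq.2 (by rwa [abs_of_pos (by norm_num : (0 : ℝ) < 3)])
        have := abs_le_of_sq_le_sq h1 (by norm_num)
        linarith [(abs_le.1 this).2]
      cases k
      · simpa [bigonArc] using habs α hα
      · simpa [bigonArc] using habs β hβ)
    (fun k T h => by
      rw [deriv_bigonArc] at h
      cases k
      · exact hα' (congrArg Prod.fst h)
      · exact hβ' (congrArg Prod.fst h))
    (fun k S l T _ _ hST hne' => by
      have key : ∀ S T, bigonArc α β false S = bigonArc α β true T →
          α * (10 * T) - 12 * S * β ≠ 0 := by
        intro S T h h0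
        obtain ⟨h1, h2, h3⟩ := bigonArc_eq hα hβ h
        have h4 : S = α * β * T := by
          calc S = α ^ 2 * S := by rw [hα, one_mul]
            _ = α * (α * S) := by ring
            _ = α * β * T := by rw [h3]; ring
        rw [h4] at h0
        have h5 : -2 * α * T = 0 := by
          calc -2 * α * T = α * (10 * T) - 12 * (α * β ^ 2 * T) := by rw [hβ]; ring
            _ = 0 := by rw [← h0]; ring
        have h6 : T = 0 := by simpa [hα'] using h5
        rw [h6] at h2
        norm_num at h2
      cases k <;> cases l
      · exact absurd ⟨rfl, bigonArc_injective hα' hβ' _ hST⟩ hne'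
      · rw [hdet]; exact key S T hST
      · rw [hdet']; exact neg_ne_zero.2 (key T S hST.symm)
      · exact absurd ⟨rfl, bigonArc_injective hα' hβ' _ hST⟩ hne')
    (fun k S l T i U _ _ _ hST hTU => by
      by_cases hkl : k = l
      · subst hkl
        exact Or.inl ⟨rfl, bigonArc_injective hα' hβ' _ hST⟩
      · by_cases hli : l = i
        · subst hli
          exact Or.inr (Or.inl ⟨rfl, bigonArc_injective hα' hβ' _ hTU⟩)
        · have hki : k = i := by
            revert hkl hli
            cases k <;> cases l <;> cases i <;> simp
          subst hki
          exact Or.inr (Or.inr ⟨rfl, bigonArc_injective hα' hβ' _ (hST.trans hTU)⟩))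
    -- As for the kink, the two passages of each arc get the local parameters `-1` and `1` in the
    -- window of the first of them.
    (off := fun i => if i = i₀ ∨ i = p₀ then -1 else if i = i₁ ∨ i = p₁ then -9 else 0)
    (fun i => by split_ifs <;> norm_num)
    (fun i hi' => by simp [hi'.1, hi'.2.1, hi'.2.2.1, hi'.2.2.2])
    (win := fun i _ => wn i) (loc := loc)
    (fun i hi' => by
      rcases hreg i hi' with h | h | h | h <;> rw [h]
      · simp [w0, l0]
      · simp only [w1, l1, hi, e01.symm, e12, or_self, true_or, if_true, if_false]
        push_cast
        norm_num
      · simp [w2, l2]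
      · simp only [w3, l3, hp, e03.symm, e23.symm, or_self, or_true, if_true, if_false]
        push_cast
        norm_num)
    (fun i _ => by
      have h1 : |loc i| ^ 2 = 1 := by rw [sq_abs, hloc1]
      nlinarith [abs_nonneg (loc i)])
    (cs := cs) hcs
    (fun i j hi' hj' he => by
      rcases hlab' i hi' with h1 | h1 <;> rcases hlab' j hj' with h2 | h2 <;> rw [h1, h2] at he ⊢
      · rw [c0, c1] at he
        have := congrArg Prod.fst he
        exact absurd (by linarith : α = 0) hα'
      · rw [c0, c1] at he
        have := congrArg Prod.fst he
        exact absurd (by linarith : α = 0) hα')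
    (fun k T _ i hi' hT => by
      have h1 : (bigonArc α β k T).2 = 6 := by
        rw [hT]
        rcases hlab' i hi' with h1 | h1 <;> rw [h1]
        · rw [c0]
        · rw [c1]
      have h2 : (bigonArc α β k T).1 ^ 2 = 1 := by
        rw [hT]
        rcases hlab' i hi' with h1 | h1 <;> rw [h1]
        · rw [c0, neg_sq, hα]
        · rw [c1, hα]
      have h3 : T ^ 2 = 1 := by
        cases k
        · simpa [bigonArc, mul_pow, hα] using h2
        · simpa [bigonArc, mul_pow, hβ] using h2
      rcases sq_eq_one_iff.1 h3 with h4 | h4 <;> cases k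
      · exact ⟨i₁, fun h => h.2.1 rfl, w1, l1.trans h4.symm⟩
      · exact ⟨p₁, fun h => h.2.2.2 rfl, w3, l3.trans h4.symm⟩
      · exact ⟨i₀, fun h => h.1 rfl, w0, l0.trans h4.symm⟩
      · exact ⟨p₀, fun h => h.2.2.1 rfl, w2, l2.trans h4.symm⟩)
    hside
  refine ⟨D, hD, hwin, fun x hx => ?_, hout⟩
  have h0 := hreal i₀ fun h => h.1 rfl
  have h1 := hreal i₁ fun h => h.2.1 rfl
  rw [c0] at h0
  rw [c1] at h1
  rcases sq_eq_one_iff.1 hx with h2 | h2 <;> rcases sq_eq_one_iff.1 hα with h3 | h3 <;>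
    rw [h2] <;> rw [h3] at h0 h1
  · exact h1
  · simpa using h0
  · exact h0
  · exact h1

/-- Every code with a bigon is the code of a diagram to which a move `R₂` applies. -/
theorem exists_R2Move {n : ℕ} (w : GaussCode n) {i₀ i₁ p₀ p₁ : Fin (2 * n)}
    (hi : (i₁ : ℕ) = i₀ + 1) (hip : (i₁ : ℕ) < p₀) (hp : (p₁ : ℕ) = p₀ + 1) {α β : ℝ}
    (hα : α ^ 2 = 1) (hβ : β ^ 2 = 1) (hne : (w.letter i₀).1 ≠ (w.letter i₁).1)
    (hlab : α = β ∧ (w.letter p₀).1 = (w.letter i₀).1 ∧ (w.letter p₁).1 = (w.letter i₁).1 ∨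
      α = -β ∧ (w.letter p₀).1 = (w.letter i₁).1 ∧ (w.letter p₁).1 = (w.letter i₀).1)
    (hs₀ : (w.letter i₀).2 = Side.L ↔ β < 0) (hs₁ : (w.letter i₁).2 = Side.L ↔ 0 < β)
    (ht₀ : (w.letter p₀).2 = Side.L ↔ 0 < α) (ht₁ : (w.letter p₁).2 = Side.L ↔ α < 0) :
    ∃ D D' : VirtualDiagram, D.HasGaussCode w ∧ VirtualDiagram.R2Move D D' := by
  obtain ⟨D, hD, hwin, hreal, hout⟩ :=
    exists_diagram_with_bigon w hi hip hp hα hβ hne hlab hs₀ hs₁ ht₀ ht₁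
  have hα' : α ≠ 0 := fun h => by rw [h] at hα; norm_num at hα
  have hβ' : β ≠ 0 := fun h => by rw [h] at hβ; norm_num at hβ
  have hwin₁ := hwin false
  have hwin₂ := hwin true
  simp only [Bool.forall_bool, if_true, if_false, Bool.false_eq_true] at hwin₁ hwin₂ hout
  set M : ℝ := 10 * (2 * n + 1) with hMdef
  set σ : ℝ := 10 * ((i₀ : ℝ) + 1) with hσdef
  set ρ : ℝ := 10 * ((p₀ : ℝ) + 1) with hρdef
  have hi₀ : (0 : ℝ) ≤ (i₀ : ℕ) := Nat.cast_nonneg _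
  have hi₀' : ((i₀ : ℕ) : ℝ) + 1 ≤ (p₀ : ℕ) := by
    have : (i₀ : ℕ) + 1 ≤ p₀ := by omega
    exact_mod_cast this
  have hp₀' : ((p₀ : ℕ) : ℝ) + 1 ≤ 2 * n := by exact_mod_cast p₀.2
  have hM : 0 < M := by positivity
  have hσ : 10 ≤ σ := by rw [hσdef]; linarith
  have hσρ : σ + 10 ≤ ρ := by rw [hσdef, hρdef]; linarith
  have hρM : ρ + 10 ≤ M := by rw [hρdef, hMdef]; linarith
  have hmem₁ : ∀ s ∈ Set.Ico (0 : ℝ) 1,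
      (s ∈ arcParams ((σ - 5 / 2) / M) ((σ + 5 / 2) / M) ↔ |M * s - σ| < 5 / 2) := fun s hs => by
    rw [mem_arcParams_iff (div_nonneg (by linarith) hM.le) ((div_le_one hM).2 (by linarith)) hs,
      mem_Ioo_div_iff hM]
  have hmem₂ : ∀ s ∈ Set.Ico (0 : ℝ) 1,
      (s ∈ arcParams ((ρ - 2) / M) ((ρ + 2) / M) ↔ |M * s - ρ| < 2) := fun s hs => by
    rw [mem_arcParams_iff (div_nonneg (by linarith) hM.le) ((div_le_one hM).2 (by linarith)) hs,
      mem_Ioo_div_iff hM]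
  have hfar : ∀ s, |M * s - σ| ≤ 3 → |M * s - ρ| ≤ 3 → False := fun s h1 h2 => by
    linarith [(abs_le.1 h1).2, (abs_le.1 h2).1]
  have hN : ∀ t, D.curve t ∈ bigonEquiv '' unitDisc ↔
      t ∈ arcParams ((σ - 5 / 2) / M) ((σ + 5 / 2) / M) ∪
        arcParams ((ρ - 2) / M) ((ρ + 2) / M) := by
    intro t
    obtain ⟨s, hs, hts⟩ := exists_sameParam_mem_Ico t
    rw [Set.mem_union, D.curve_eq_of_sameParam hts, hts.mem_arcParams, hts.mem_arcParams,
      hmem₁ s hs, hmem₂ s hs]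
    by_cases h3 : |M * s - σ| ≤ 3
    · rw [hwin₁ s h3, bigonArc_false_mem_iff hα]
      exact ⟨Or.inl, fun h => h.resolve_right fun h' => hfar s h3 (by linarith)⟩
    by_cases h4 : |M * s - ρ| ≤ 3
    · rw [hwin₂ s h4, bigonArc_true_mem_iff hβ]
      exact ⟨Or.inr, fun h => h.resolve_left fun h' => h3 (by linarith)⟩
    · have h5 := hout s ⟨hs.1, hs.2.le⟩ ⟨not_le.1 h3, not_le.1 h4⟩
      exact ⟨fun h => absurd h (notMem_bigonDisc h5.le), fun h => h.elim
        (fun h' => absurd (by linarith) h3) fun h' => absurd (by linarith) h4⟩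
  have hcurve₁ : ∀ T, |T| ≤ 3 → D.curve ((σ + T) / M) = bigonArc α β false T := fun T hT => by
    have h1 : M * ((σ + T) / M) - σ = T := by field_simp; ring
    rw [hwin₁ _ (by rwa [h1]), h1]
  have hcurve₂ : ∀ T, |T| ≤ 3 → D.curve ((ρ + T) / M) = bigonArc α β true T := fun T hT => by
    have h1 : M * ((ρ + T) / M) - ρ = T := by field_simp; ring
    rw [hwin₂ _ (by rwa [h1]), h1]
  -- The local parameter on the second arc is `α * β` times that on the first, which handles equal
  -- and opposite directions together.
  have hmeet : ∀ x ∈ Set.Ioo ((σ - 5 / 2) / M) ((σ + 5 / 2) / M),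
      ∀ y ∈ Set.Ioo ((ρ - 2) / M) ((ρ + 2) / M), D.curve x = D.curve y →
      (x = (σ + -1) / M ∧ y = (ρ + -(α * β)) / M) ∨ (x = (σ + 1) / M ∧ y = (ρ + α * β) / M) := by
    intro x hx y hy he
    rw [mem_Ioo_div_iff hM] at hx hy
    rw [hwin₁ x (by linarith), hwin₂ y (by linarith)] at he
    obtain ⟨h1, h2, h3⟩ := bigonArc_eq hα hβ he
    have h4 : M * y - ρ = α * β * (M * x - σ) := by
      calc M * y - ρ = β * (β * (M * y - ρ)) := by rw [← mul_assoc, ← pow_two, hβ, one_mul]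
        _ = α * β * (M * x - σ) := by rw [← h3]; ring
    simp only [eq_div_iff hM.ne']
    rcases sq_eq_one_iff.1 h1 with h5 | h5 <;> rw [h5] at h4
    · right; constructor <;> linarith
    · left; constructor <;> linarith
  have hinj₁ : Set.InjOn D.curve (Set.Ioo ((σ - 5 / 2) / M) ((σ + 5 / 2) / M)) := by
    intro x hx y hy he
    rw [mem_Ioo_div_iff hM] at hx hy
    rw [hwin₁ x (by linarith), hwin₁ y (by linarith)] at he
    have := bigonArc_injective hα' hβ' _ he
    exact mul_left_cancel₀ hM.ne' (by linarith)
  have hinj₂ : Set.InjOn D.curve (Set.Ioo ((ρ - 2) / M) ((ρ + 2) / M)) := by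
    intro x hx y hy he
    rw [mem_Ioo_div_iff hM] at hx hy
    rw [hwin₂ x (by linarith), hwin₂ y (by linarith)] at he
    have := bigonArc_injective hα' hβ' _ he
    exact mul_left_cancel₀ hM.ne' (by linarith)
  have hαβ : (α * β) ^ 2 = 1 := by rw [mul_pow, hα, hβ, one_mul]
  have hαβ' : |α * β| = 1 := by
    rcases sq_eq_one_iff.1 hαβ with h | h <;> rw [h] <;> norm_num
  have hs1 : D.curve ((σ + -1) / M) = (-α, 6) := by
    rw [hcurve₁ _ (by norm_num)]; norm_num [bigonArc]
  have hs2 : D.curve ((σ + 1) / M) = (α, 6) := by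
    rw [hcurve₁ _ (by norm_num)]; norm_num [bigonArc]
  have ht1 : D.curve ((ρ + -(α * β)) / M) = (-α, 6) := by
    rw [hcurve₂ _ (by rw [abs_neg, hαβ']; norm_num)]
    simp only [bigonArc, if_true, neg_sq, hαβ]
    refine Prod.ext ?_ (by norm_num)
    calc β * -(α * β) = -α * β ^ 2 := by ring
      _ = -α := by rw [hβ, mul_one]
  have ht2 : D.curve ((ρ + α * β) / M) = (α, 6) := by
    rw [hcurve₂ _ (by rw [hαβ']; norm_num)]
    simp only [bigonArc, if_true, hαβ]
    refine Prod.ext ?_ (by norm_num)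
    calc β * (α * β) = α * β ^ 2 := by ring
      _ = α := by rw [hβ, mul_one]
  obtain ⟨A, hA, hA1, hA2, hA3, hA4, hA5⟩ := exists_unbigon (α := α) hβ
  obtain ⟨D', h1, h2, h3, h4, h5⟩ := D.exists_replace_local (N := bigonEquiv '' unitDisc)
    (r := 2) (r' := 3 / 2) hM (by norm_num) (by norm_num) (by linarith) (by linarith)
    (bigonArc_contDiff true) hA hwin₂ hN hA1 hA2
    (fun T hT s hs _ he => by
      obtain ⟨x, hx, hsx⟩ := VirtualDiagram.sameParam_arcParams hs
      rw [mem_Ioo_div_iff hM] at hx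
      rw [D.curve_eq_of_sameParam hsx, hwin₁ x (by linarith)] at he
      refine hA3 T ?_
      rw [he]
      simp [bigonArc, mul_pow, hα])
    (fun T _ => hA4 T) (fun S T _ _ => hA5 S T)
    (R := D.real \ {D.curve ((σ + -1) / M), D.curve ((σ + 1) / M)}) Set.sdiff_subset
    (fun s hs hsR => by
      obtain ⟨y, hy, hsy⟩ := VirtualDiagram.exists_of_mem_real hsR.1
      obtain ⟨x, hx, hsx⟩ := VirtualDiagram.sameParam_arcParams hs
      rw [D.curve_eq_of_sameParam hsx] at hy
      refine hsR.2 ?_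
      rw [D.curve_eq_of_sameParam hsx, Set.mem_insert_iff, Set.mem_singleton_iff]
      rcases (hN y).1 (by
        rw [hy, ← D.curve_eq_of_sameParam hsx]; exact (hN s).2 (Or.inr hs)) with hy' | hy'
      · obtain ⟨z, hz, hyz⟩ := VirtualDiagram.sameParam_arcParams hy'
        rw [D.curve_eq_of_sameParam hyz] at hy
        rw [← hy]
        rcases hmeet z hz x hx hy with h | h
        · exact Or.inl (by rw [h.1])
        · exact Or.inr (by rw [h.1])
      · obtain ⟨z, hz, hyz⟩ := VirtualDiagram.sameParam_arcParams hy'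
        rw [D.curve_eq_of_sameParam hyz] at hy
        have := hinj₂ hz hx hy
        rw [this] at hyz
        exact absurd (hsx.trans hyz.symm) hsy)
  have hlt : ∀ {x y : ℝ}, x < y → x / M < y / M := fun h =>
    (div_lt_div_iff_of_pos_right hM).2 h
  have hreal₁ : ((-α, 6) : Plane) ∈ D.real := hreal _ (by rw [neg_sq, hα])
  have hreal₂ : ((α, 6) : Plane) ∈ D.real := hreal _ hα
  refine ⟨D, D', hD, bigonEquiv, (σ - 5 / 2) / M, (σ + 5 / 2) / M, (ρ - 2) / M, (ρ + 2) / M,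
    (σ + -1) / M, (σ + 1) / M, (ρ + -(α * β)) / M, (ρ + α * β) / M,
    isPlaneDiffeo_bigonEquiv, hlt (by linarith), hlt (by linarith), hlt (by linarith), ?_, hN, h2,
    h3, ?_, hinj₁, hinj₂, h5, ⟨hlt (by linarith), hlt (by linarith)⟩,
    ⟨hlt (by linarith), hlt (by linarith)⟩, (hlt (by linarith)).ne,
    ⟨hlt ?_, hlt ?_⟩, ⟨hlt ?_, hlt ?_⟩, by rw [hs1, ht1], by rwa [hs1], by rw [hs2, ht2],
    by rwa [hs2], hmeet, ?_, h1⟩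
  · rw [div_add_one hM.ne']
    exact hlt (by linarith)
  · ext p
    rw [bigonDiameter (β := β) hα]
    constructor
    · rintro ⟨x, hx, rfl⟩
      rw [mem_Ioo_div_iff hM] at hx
      exact ⟨_, hx, (hwin₁ x (by linarith)).symm⟩
    · rintro ⟨T, hT, rfl⟩
      refine ⟨(σ + T) / M, ⟨hlt ?_, hlt ?_⟩, hcurve₁ T (by linarith)⟩ <;>
        linarith [(abs_lt.1 hT).1, (abs_lt.1 hT).2]
  · linarith [(abs_le.1 hαβ'.le).2]
  · linarith [(abs_le.1 hαβ'.le).1]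
  · linarith [(abs_le.1 hαβ'.le).1]
  · linarith [(abs_le.1 hαβ'.le).2]
  · intro x hx y hy he
    have hx' : x ∉ arcParams ((ρ - 2) / M) ((ρ + 2) / M) := by
      have hx0 : x ∈ Set.Ico (0 : ℝ) 1 :=
        ⟨(div_nonneg (by linarith) hM.le).trans hx.1.le,
          hx.2.trans_le ((div_le_one hM).2 (by linarith))⟩
      rw [hmem₂ x hx0]
      rw [mem_Ioo_div_iff hM] at hx
      exact fun h => hfar x (by linarith) (by linarith)
    rw [mem_Ioo_div_iff hM] at hx hy
    rw [h3 x hx', h4 y hy, hwin₁ x (by linarith)] at he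
    refine hA3 (M * y - ρ) ?_
    rw [← he]
    simp [bigonArc, mul_pow, hα]


/-! ### Codes of minimal diagrams are irreducible -/

namespace GaussCode

variable {n : ℕ} {w : GaussCode n} {x y : Fin n × Side}

/-- A cyclic shift moves the pair to the positions 0 and 1, so that it no longer straddles the base
point. -/
lemma Consecutive.exists_shift (h : w.Consecutive x y) (hn : 0 < n) : ∃ (m : ℕ)
    (i₀ i₁ : Fin (2 * n)), (i₀ : ℕ) = 0 ∧ (i₁ : ℕ) = i₀ + 1 ∧ (GaussCode.shift m w).letter i₀ = x ∧
      (GaussCode.shift m w).letter i₁ = y := by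
  obtain ⟨i, rfl, rfl⟩ := h
  have h0 : (finRotate (2 * n) ^ (i : ℕ)) ⟨0, by omega⟩ = i := Fin.ext (by
    rw [finRotate_pow_val, Nat.zero_add, Nat.mod_eq_of_lt i.2])
  have h1 : finRotate (2 * n) ⟨0, by omega⟩ = ⟨1, by omega⟩ := Fin.ext (by
    have := finRotate_pow_val (N := 2 * n) 1 ⟨0, by omega⟩
    rw [pow_one] at this
    rw [this]
    exact Nat.mod_eq_of_lt (show 0 + 1 < 2 * n by omega))
  refine ⟨i, ⟨0, by omega⟩, ⟨1, by omega⟩, rfl, rfl, ?_, ?_⟩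
  · rw [letter_shift, h0]
  · rw [letter_shift, ← h1, ← Equiv.Perm.mul_apply, ← pow_succ, pow_succ', Equiv.Perm.mul_apply, h0]
    rfl

/-- A pair that straddles the base point has its second letter at position 0, which is excluded
here. So once the first pair of a bigon is at the front, the second one is an honest pair of
positions. -/
lemma Consecutive.exists_pos (h : w.Consecutive x y) {i : Fin (2 * n)} (hi : (i : ℕ) = 0)
    (hy : w.letter i ≠ y) : ∃ p₀ p₁ : Fin (2 * n), (p₁ : ℕ) = p₀ + 1 ∧ w.letter p₀ = x ∧
      w.letter p₁ = y := by
  obtain ⟨q, rfl, rfl⟩ := h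
  refine ⟨q, next q, ?_, rfl, rfl⟩
  have h1 := finRotate_pow_val 1 q
  rw [pow_one] at h1
  rcases lt_or_ge ((q : ℕ) + 1) (2 * n) with h2 | h2
  · exact h1.trans (Nat.mod_eq_of_lt h2)
  · have h3 : (q : ℕ) + 1 = 2 * n := by omega
    rw [h3, Nat.mod_self] at h1
    exact absurd (congrArg w.letter (Fin.ext (hi.trans h1.symm))) hy

/-- The three kinds of `2`-reducible codes, unified. -/
lemma IsTwoReducible.exists_consecutive (h : w.IsTwoReducible) : ∃ (j k : Fin n) (s : Side),
    j ≠ k ∧ w.Consecutive (j, s) (k, !s) ∧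
      (w.Consecutive (j, !s) (k, s) ∨ w.Consecutive (k, s) (j, !s)) := by
  obtain ⟨j, k, hjk, ⟨h1, h2⟩ | ⟨h1, h2⟩ | ⟨h1, h2⟩⟩ := h
  · exact ⟨j, k, Side.L, hjk, h1, Or.inl h2⟩
  · exact ⟨j, k, Side.L, hjk, h1, Or.inr h2⟩
  · exact ⟨j, k, Side.R, hjk, h1, Or.inr h2⟩

end GaussCode

namespace VirtualDiagram

open GaussCode

variable {n : ℕ} {w : GaussCode n} {D : VirtualDiagram}

/-- The diagram with a kink has a shift of the code of `D`, so completeness makes it strictly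
equivalent to `D`. -/
lemma HasGaussCode.not_isOneReducible (h : D.HasGaussCode w) (hD : D.IsMinimal) :
    ¬ w.IsOneReducible := by
  rintro ⟨j, hj⟩
  obtain ⟨x, y, hxy, hc⟩ : ∃ x y : Fin n × Side, x.1 = y.1 ∧ w.Consecutive x y :=
    hj.elim (fun h => ⟨(j, Side.L), (j, Side.R), rfl, h⟩) fun h => ⟨(j, Side.R), (j, Side.L), rfl, h⟩
  obtain ⟨m, i₀, i₁, -, hi, rfl, rfl⟩ := hc.exists_shift (Fin.pos j)
  obtain ⟨D₁, D₂, h1, h2⟩ := exists_R1Move _ hi hxy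
  exact hD ⟨D₁, D₂, h.strictEquiv_of_related (Fin.pos j) h1 (related_shift m w), Or.inl h2⟩

lemma HasGaussCode.not_isTwoReducible (h : D.HasGaussCode w) (hD : D.IsMinimal) :
    ¬ w.IsTwoReducible := by
  intro hw
  obtain ⟨j, k, s, hjk, hc, hc'⟩ := hw.exists_consecutive
  obtain ⟨m, i₀, i₁, hi₀, hi, hl₀, hl₁⟩ := hc.exists_shift (Fin.pos j)
  have key : ∃ D₁ D₂ : VirtualDiagram, D₁.HasGaussCode (GaussCode.shift m w) ∧ R2Move D₁ D₂ := by
    have hge : ∀ {p : Fin (2 * n)}, (GaussCode.shift m w).letter p ≠ (j, s) →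
        (GaussCode.shift m w).letter p ≠ (k, !s) → (i₁ : ℕ) < p := by
      intro p h1 h2
      have h3 : (p : ℕ) ≠ i₀ := fun h => h1 (by rw [Fin.ext h, hl₀])
      have h4 : (p : ℕ) ≠ i₁ := fun h => h2 (by rw [Fin.ext h, hl₁])
      omega
    -- The side `s` fixes the direction `β` of the second arc; `α` is `β` or `-β` according to the
    -- order in which the second pair meets the crossings.
    obtain ⟨β, hβ, hβs, hβs'⟩ : ∃ β : ℝ, β ^ 2 = 1 ∧ (s = Side.L ↔ β < 0) ∧
        ((!s) = Side.L ↔ 0 < β) := by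
      cases s
      · exact ⟨-1, by norm_num, by norm_num, by norm_num⟩
      · exact ⟨1, by norm_num, by norm_num, by norm_num⟩
    rcases hc' with hc' | hc'
    · obtain ⟨p₀, p₁, hp, hm₀, hm₁⟩ := (hc'.shift m).exists_pos hi₀ (by
        rw [hl₀]; exact fun h => hjk (congrArg Prod.fst h))
      refine exists_R2Move (GaussCode.shift m w) hi (hge ?_ ?_) hp hβ hβ ?_ (Or.inl ⟨rfl, ?_, ?_⟩) ?_ ?_ ?_ ?_
        <;> simp only [hl₀, hl₁, hm₀, hm₁]
      · simp
      · simp [hjk]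
      · exact hjk
      · exact hβs
      · exact hβs'
      · exact hβs'
      · exact hβs
    · obtain ⟨p₀, p₁, hp, hm₀, hm₁⟩ := (hc'.shift m).exists_pos hi₀ (by
        rw [hl₀]; simp)
      refine exists_R2Move (GaussCode.shift m w) hi (hge ?_ ?_) hp (α := -β) (by rwa [neg_sq]) hβ ?_
        (Or.inr ⟨rfl, ?_, ?_⟩) ?_ ?_ ?_ ?_ <;> simp only [hl₀, hl₁, hm₀, hm₁]
      · simp [hjk.symm]
      · simp
      · exact hjk
      · exact hβs
      · exact hβs'
      · rw [neg_pos]; exact hβs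
      · rw [neg_lt_zero]; exact hβs'
  obtain ⟨D₁, D₂, h1, h2⟩ := key
  exact hD ⟨D₁, D₂, h.strictEquiv_of_related (Fin.pos j) h1 (related_shift m w), Or.inr h2⟩

theorem HasGaussCode.isMinimal_code (h : D.HasGaussCode w) (hD : D.IsMinimal) : w.IsMinimal :=
  ⟨h.not_isOneReducible hD, h.not_isTwoReducible hD⟩

end VirtualDiagram

/-! ### The correspondence -/

open GaussCode

lemma VirtualDiagram.HasGaussCode.isMinimal_iff {n : ℕ} {D : VirtualDiagram} {w : GaussCode n}
    (h : D.HasGaussCode w) : D.IsMinimal ↔ w.IsMinimal :=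
  ⟨h.isMinimal_code, h.isMinimal⟩

lemma VirtualDiagram.HasGaussCode.ncard_real {n : ℕ} {D : VirtualDiagram} {w : GaussCode n}
    (h : D.HasGaussCode w) : D.real.ncard = n := by
  obtain ⟨t₀, τ, c, -, hc, hr, -⟩ := h
  rw [← hr, ← Set.image_univ, Set.ncard_image_of_injective _ hc, Set.ncard_univ]
  simp

/-- Proved through diagrams: both reversed codes are codes of the reverse of one diagram that
realizes `w`. -/
lemma GaussCode.Related.rev {n : ℕ} {w w' : GaussCode n} (h : Related w w') :
    Related w.rev w'.rev := by
  obtain ⟨D, hD⟩ := exists_hasGaussCode w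
  exact hD.rev.related_of (hD.related h).rev

lemma GaussCode.rev_rev {n : ℕ} (w : GaussCode n) : w.rev.rev = w :=
  ext_letter fun i => by rw [letter_rev, letter_rev, Fin.rev_rev]

section Correspondence

variable {n : ℕ} [NeZero n]

lemma GaussCode.IsLeftCanonical.revLC_revLC {w : GaussCode n} (h : w.IsLeftCanonical) :
    w.revLC.revLC = w := by
  have h1 : Related (projLC (GaussCode.rev w)).rev w := by
    have := (related_projLC w.rev).symm.rev
    rwa [rev_rev] at this
  exact (projLC_eq_iff.2 h1).trans h.projLC_eq

/-- On canonical codes `revLC` is an involution, so the generated equivalence relation has classes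
of at most two elements. -/
lemma GaussMinLC.revClass_eq_iff {w w' : GaussMinLC n} :
    w.revClass = w'.revClass ↔ w'.1 = w.1 ∨ w'.1 = revLC w.1 := by
  constructor
  · intro h
    have h' := Quot.eqvGen_exact h
    clear h
    induction h' with
    | rel x y hxy => exact Or.inr hxy
    | refl x => exact Or.inl rfl
    | symm x y _ ih =>
      rcases ih with ih | ih
      · exact Or.inl ih.symm
      · exact Or.inr (by rw [ih, x.2.2.revLC_revLC])
    | trans x y z _ _ ih₁ ih₂ =>
      rcases ih₁ with ih₁ | ih₁ <;> rcases ih₂ with ih₂ | ih₂ <;> rw [ih₂, ih₁]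
      · exact Or.inl rfl
      · exact Or.inr rfl
      · exact Or.inr rfl
      · exact Or.inl x.2.2.revLC_revLC
  · rintro (h | h)
    · rw [Subtype.ext h]
    · exact Quot.sound h

namespace MinDiagram

/-- A Gauss code of a minimal diagram. -/
noncomputable def code (D : MinDiagram n) : GaussCode n :=
  (D.1.exists_hasGaussCode_of_ncard D.2.1).choose

lemma hasGaussCode_code (D : MinDiagram n) : D.1.HasGaussCode D.code :=
  (D.1.exists_hasGaussCode_of_ncard D.2.1).choose_spec

/-- The left canonical Gauss code of a minimal diagram. -/
noncomputable def codeLC (D : MinDiagram n) : GaussMinLC n :=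
  ⟨D.code.projLC, (D.hasGaussCode_code.isMinimal_code D.2.2).related (related_projLC _),
    isLeftCanonical_projLC _⟩

lemma codeLC_eq (D : MinDiagram n) {w : GaussCode n} (h : D.1.HasGaussCode w) :
    D.codeLC.1 = w.projLC :=
  projLC_eq_iff.2 (D.hasGaussCode_code.related_of h)

/-- Invariance and completeness together; this makes the map on classes both well defined and
injective. -/
lemma codeLC_eq_codeLC_iff {D D' : MinDiagram n} :
    D.codeLC = D'.codeLC ↔ VirtualDiagram.StrictEquiv D.1 D'.1 := by
  refine ⟨fun h => ?_, fun h => Subtype.ext ?_⟩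
  · have h1 : D.code.projLC = D'.code.projLC := congrArg Subtype.val h
    exact D.hasGaussCode_code.strictEquiv_of_related (Nat.pos_of_ne_zero (NeZero.ne n))
      D'.hasGaussCode_code (projLC_eq_iff.1 h1)
  · exact D.codeLC_eq (h.hasGaussCode_iff.2 D'.hasGaussCode_code)

/-- `revLC` of the canonical code of `D'` is the canonical code of the reversed diagram, because
reversal respects `Related`. -/
lemma codeLC_eq_revLC_iff {D D' : MinDiagram n} :
    D.codeLC.1 = D'.codeLC.1.revLC ↔ VirtualDiagram.StrictEquiv D.1 D'.1.rev := by
  have h1 : D'.codeLC.1.revLC = D'.code.rev.projLC :=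
    projLC_eq_iff.2 (related_projLC D'.code).symm.rev
  rw [h1]
  refine ⟨fun h => ?_, fun h => ?_⟩
  · exact D.hasGaussCode_code.strictEquiv_of_related (Nat.pos_of_ne_zero (NeZero.ne n))
      D'.hasGaussCode_code.rev (projLC_eq_iff.1 h)
  · exact D.codeLC_eq (h.hasGaussCode_iff.2 D'.hasGaussCode_code.rev)

lemma exists_codeLC_eq (w : GaussMinLC n) : ∃ D : MinDiagram n, D.codeLC = w := by
  obtain ⟨D, hD⟩ := exists_hasGaussCode w.1
  exact ⟨⟨D, hD.ncard_real, hD.isMinimal w.2.1⟩,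
    Subtype.ext ((codeLC_eq _ hD).trans w.2.2.projLC_eq)⟩

end MinDiagram

/-- The correspondence between strict classes and left canonical codes. -/
noncomputable def strictEquivGauss : DiagramMinStrict n ≃ GaussMinLC n :=
  Equiv.ofBijective (Quot.lift MinDiagram.codeLC fun _ _ => MinDiagram.codeLC_eq_codeLC_iff.2) <| by
    refine ⟨?_, fun w => ?_⟩
    · rintro ⟨D⟩ ⟨D'⟩ h
      exact Quot.sound (MinDiagram.codeLC_eq_codeLC_iff.1 h)
    · obtain ⟨D, hD⟩ := MinDiagram.exists_codeLC_eq w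
      exact ⟨D.strictClass, hD⟩

/-- The correspondence between strict classes and left canonical codes, modulo reversal. -/
noncomputable def strictRevEquivGauss : DiagramMinStrictRev n ≃ GaussMinLCRev n :=
  Equiv.ofBijective (Quot.lift (fun D => D.codeLC.revClass) (by
    rintro D D' (h | h)
    · rw [MinDiagram.codeLC_eq_codeLC_iff.2 h]
    · exact (GaussMinLC.revClass_eq_iff.2 (Or.inr (MinDiagram.codeLC_eq_revLC_iff.2 h))).symm)) <| by
    refine ⟨?_, fun w => ?_⟩
    · rintro ⟨D⟩ ⟨D'⟩ h
      rcases GaussMinLC.revClass_eq_iff.1 h with h | h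
      · exact Quot.sound (Or.inl (MinDiagram.codeLC_eq_codeLC_iff.1 (Subtype.ext h.symm)))
      · have h' : D'.strictRevClass = D.strictRevClass :=
          Quot.sound (Or.inr (MinDiagram.codeLC_eq_revLC_iff.1 h))
        exact h'.symm
    · obtain ⟨w, rfl⟩ := Quot.exists_rep w
      obtain ⟨D, hD⟩ := MinDiagram.exists_codeLC_eq w
      exact ⟨D.strictRevClass, congrArg GaussMinLC.revClass hD⟩

end Correspondence

theorem theorem1p3 (n : ℕ) [NeZero n] :
    (∀ D : VirtualDiagram, D.real.ncard = n → ∃ w : GaussCode n, D.HasGaussCode w) ∧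
    (∀ (D : VirtualDiagram) (w : GaussCode n), D.HasGaussCode w → (D.IsMinimal ↔ w.IsMinimal)) ∧
    ∃ (f : DiagramMinStrict n ≃ GaussMinLC n) (g : DiagramMinStrictRev n ≃ GaussMinLCRev n),
      (∀ (D : MinDiagram n) (w : GaussCode n), D.1.HasGaussCode w →
        (f D.strictClass).1 = w.projLC) ∧
      ∀ D : MinDiagram n, g D.strictRevClass = (f D.strictClass).revClass :=
  ⟨fun D h => D.exists_hasGaussCode_of_ncard h, fun _ _ h => h.isMinimal_iff,
    strictEquivGauss, strictRevEquivGauss, fun D _ h => D.codeLC_eq h, fun _ => rfl⟩
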